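/- **Data.** Let $\alpha,\gamma\in\mathbb R$ and let $\{r,\{(z_k,c_k)\}_{k=1}^N\}$ be scattering data: $r\in H^1(\mathbb R)$ (continuous representative), $N\ge 0$, $z_1,\dots,z_N$ distinct points of the open upper half plane, $c_k\in\mathbb C\setminus\{0\}$. Put $\mathcal Z=\{z_k\}$, $\mathcal Z^*=\{z_k^*\}$ ($^*$ is complex conjugation), $\rho=\frac12\min\{|\lambda-\zeta|:\lambda\ne\zeta\in\mathcal Z\cup\mathcal Z^*\}$, and let $\chi\in C^\infty(\mathbb C,[0,1])$ with $\chi=1$ where $\mathrm{dist}(z,\mathcal Z\cup\mathcal Z^*)<\rho/3$ and $\chi=0$ where this distance exceeds $2\rho/3$ ($\chi=0$ if $N=0$). For $t>0$, $x\in\mathbb R$ let $$z_0=-\tfrac14\left(\tfrac xt+\alpha\right),\quad \theta(z)=\tfrac xt z+2z^2+\alpha z-\tfrac12\gamma,\quad \nu(s)=-\tfrac1{2\pi}\log(1+|r(s)|^2),$$ $$T(z)=\prod_{\mathrm{Re}\,z_k<z_0}\frac{z-z_k^*}{z-z_k}\,\exp\left(i\int_{-\infty}^{z_0}\frac{\nu(s)}{s-z}ds\right),\quad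 T_0=\prod_{\mathrm{Re}\,z_k<z_0}\frac{z_0-z_k^*}{z_0-z_k}\,\exp\left(i\int_{-\infty}^{z_0}\frac{\nu(s)-1_{(z_0-1,z_0)}(s)\nu(z_0)}{s-z_0}ds\right).$$ **Extensions.** Write $z-z_0=|z-z_0|e^{i\varphi}$, $\varphi\in(-\pi,\pi]$. Let $\Omega_1,\Omega_2,\Omega_3$ be the open sectors $0<\varphi<\frac\pi4$, $\frac\pi4<\varphi<\frac{3\pi}4$, $\frac{3\pi}4<\varphi<\pi$, let $\Omega_6,\Omega_5,\Omega_4$ be their reflections in the real axis, let $\Sigma_j=z_0+e^{i(2j-1)\pi/4}\mathbb R_+$ $(1\le j\le4)$, and $\Sigma=\{z_0\}\cup\bigcup_j\Sigma_j$, oriented from left to right. With $r_0=r(z_0)$, $\nu_0=\nu(z_0)$ and principal powers let $$f_1=r_0T_0^{-2}(z-z_0)^{-2i\nu_0},\ f_3=\frac{r_0^*T_0^2}{1+|r_0|^2}(z-z_0)^{2i\nu_0},\ f_4=\frac{r_0T_0^{-2}}{1+|r_0|^2}(z-z_0)^{-2i\nu_0},\ f_6=r_0^*T_0^2(z-z_0)^{2i\nu_0},$$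 and, with $r=r(\mathrm{Re}\,z)$ in the next line, $$g_1=rT(z)^{-2},\quad g_3=\frac{r^*}{1+|r|^2}T(z)^2,\quad g_4=\frac{r}{1+|r|^2}T(z)^{-2},\quad g_6=r^*T(z)^2.$$ On $\Omega_j$ $(j=1,3,4,6)$ put $R_j=(1-\chi)\bigl(f_j+(g_j-f_j)\cos2\varphi\bigr)$, and let $R^{(2)}$ be $$\begin{pmatrix}1&0\\-R_1e^{2it\theta}&1\end{pmatrix},\ \begin{pmatrix}1&-R_3e^{-2it\theta}\\0&1\end{pmatrix},\ \begin{pmatrix}1&0\\R_4e^{2it\theta}&1\end{pmatrix},\ \begin{pmatrix}1&R_6e^{-2it\theta}\\0&1\end{pmatrix}$$ on $\Omega_1,\Omega_3,\Omega_4,\Omega_6$ respectively, and $R^{(2)}=I$ elsewhere. **Model problem.** $M_{RHP}$ is a $2\times2$ matrix function, analytic off $\Sigma\cup\mathcal Z\cup\mathcal Z^*$, bounded near $z_0$, $M_{RHP}=I+O(z^{-1})$ as $z\to\infty$, with boundary values satisfying $M_{RHP,+}=M_{RHP,-}V$ on $\Sigma\setminus(\{z_0\}\cup\mathcal Z\cup\mathcal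 Z^*)$, where $V-I$ has a single nonzero entry: the $(2,1)$ entry $(1-\chi)f_1e^{2it\theta}$ on $\Sigma_1$, the $(1,2)$ entry $(1-\chi)f_3e^{-2it\theta}$ on $\Sigma_2$, the $(2,1)$ entry $(1-\chi)f_4e^{2it\theta}$ on $\Sigma_3$, the $(1,2)$ entry $(1-\chi)f_6e^{-2it\theta}$ on $\Sigma_4$. At $w\in\mathcal Z\cup\mathcal Z^*$ it has at most a simple pole, with $\mathrm{Res}_{w}M_{RHP}=\lim_{z\to w}M_{RHP}n_w$, where $n_w$ has a single nonzero entry. If $\mathrm{Re}\,z_k<z_0$: for $w=z_k$ the $(1,2)$ entry $c_k^{-1}\bigl((1/T)'(z_k)\bigr)^{-2}e^{-2it\theta(z_k)}$, for $w=z_k^*$ the $(2,1)$ entry $-(c_k^*)^{-1}T'(z_k^*)^{-2}e^{2it\theta(z_k^*)}$. If $\mathrm{Re}\,z_k\ge z_0$: for $w=z_k$ the $(2,1)$ entry $c_kT(z_k)^{-2}e^{2it\theta(z_k)}$, for $w=z_k^*$ the $(1,2)$ entry $-c_k^*T(z_k^*)^2e^{-2it\theta(z_k^*)}$. **Pure $\bar\partial$-problem.**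 With $\bar\partial=\frac12(\partial_x+i\partial_y)$ (for $z=x+iy$), let $W^{(3)}=M_{RHP}\,(\bar\partial R^{(2)})\,M_{RHP}^{-1}$, where $\bar\partial R^{(2)}$ is the almost everywhere defined pointwise derivative. A solution $M^{(3)}$ is a continuous $2\times 2$ matrix function on $\mathbb C$ with $M^{(3)}(z)\to I$ as $z\to\infty$, $M^{(3)}W^{(3)}\in L^1_{loc}$ and $\bar\partial M^{(3)}=M^{(3)}W^{(3)}$ in the sense of distributions. **Lemma.** For given $\alpha,\gamma$, scattering data and $\chi$ there are constants $c$ and $t_0>0$ such that for all $t\ge t_0$, all $x\in\mathbb R$ and every solution $M_{RHP}$ of the model problem, the pure $\bar\partial$-problem has exactly one solution $M^{(3)}$; the function $M^{(3)}W^{(3)}$ is integrable on $\mathbb C$; the coefficient of $z^{-1}$ of $M^{(3)}$ at infinity is $$M^{(3)}_1=\frac1\pi\iint_{\mathbb C}M^{(3)}W^{(3)}\,dA,$$ in the sense that $z\,(M^{(3)}(z)-I)\to M^{(3)}_1$ as $z=iy$, $y\to\pm\infty$; and every entry satisfies $|(M^{(3)}_1)_{ij}|\le c\,t^{-3/4}$.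 -/

import Mathlib

noncomputable section

namespace CGNLS

/-- Membership in the Sobolev space `H¹(ℝ)`, for the (absolutely) continuous representative:
`r ∈ L²` and `r` is a primitive of a function in `L²`. -/
def MemH1 (r : ℝ → ℂ) : Prop :=
  MeasureTheory.MemLp r 2 MeasureTheory.volume ∧
    ∃ g : ℝ → ℂ, MeasureTheory.MemLp g 2 MeasureTheory.volume ∧
      ∀ a b : ℝ, r b - r a = ∫ s in a..b, g s

/-- Scattering data `{r, {(z_k, c_k)}}`: a reflection coefficient in `H¹(ℝ)`, finitely many simple
discrete eigenvalues `z_k` in the open upper half plane, and their norming constants `c_k`. -/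
structure ScatteringData where
  N : ℕ
  pole : Fin N → ℂ
  norming : Fin N → ℂ
  r : ℝ → ℂ
  pole_im_pos : ∀ k, 0 < (pole k).im
  pole_injective : Function.Injective pole
  norming_ne_zero : ∀ k, norming k ≠ 0
  r_memH1 : MemH1 r

/-- The discrete spectrum `𝒵 ∪ 𝒵*`. -/
def ScatteringData.discrete (D : ScatteringData) : Set ℂ :=
  {w | ∃ k, w = D.pole k ∨ w = starRingEnd ℂ (D.pole k)}

/-- `ρ`, half of the minimal distance between distinct points of `𝒵 ∪ 𝒵*`. -/
def ScatteringData.rho (D : ScatteringData) : ℝ :=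
  (1 / 2) * sInf {d : ℝ | ∃ a ∈ D.discrete, ∃ b ∈ D.discrete, a ≠ b ∧ d = dist a b}

/-- `χ` is a smooth cutoff to a neighbourhood of the discrete spectrum. (If there is no discrete
spectrum, then `χ = 0`.) -/
structure IsCutoff (D : ScatteringData) (χ : ℂ → ℝ) : Prop where
  smooth : ContDiff ℝ (⊤ : ℕ∞) χ
  mem_Icc : ∀ z, χ z ∈ Set.Icc (0 : ℝ) 1
  eq_one : ∀ z, (∃ w ∈ D.discrete, dist z w < D.rho / 3) → χ z = 1
  eq_zero : ∀ z, (∀ w ∈ D.discrete, 2 * D.rho / 3 < dist z w) → χ z = 0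

/-- The stationary phase point `z₀ = -(x/t + α)/4`. -/
def phasePoint (α x t : ℝ) : ℝ := -(1 / 4) * (x / t + α)

/-- The phase `θ(z) = z x/t + 2z² + αz - γ/2`. -/
def theta (α γ x t : ℝ) (z : ℂ) : ℂ := z * (x / t) + 2 * z ^ 2 + α * z - γ / 2

/-- The oscillatory factor `exp(2itθ(z))`. -/
def osc (α γ x t : ℝ) (z : ℂ) : ℂ := Complex.exp (2 * Complex.I * t * theta α γ x t z)

/-- `ν(s) = -(1/2π) log(1 + |r(s)|²)`. -/
def nu (r : ℝ → ℂ) (s : ℝ) : ℝ := -(1 / (2 * Real.pi)) * Real.log (1 + ‖r s‖ ^ 2)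

/-- The product of `(z - z_k*)/(z - z_k)` over all `k` with `Re z_k < z₀`. -/
def blaschke (D : ScatteringData) (z₀ : ℝ) (z : ℂ) : ℂ :=
  ∏ k ∈ Finset.univ.filter (fun k => (D.pole k).re < z₀),
    (z - starRingEnd ℂ (D.pole k)) / (z - D.pole k)

/-- `δ(z) = exp(i ∫_{-∞}^{z₀} ν(s)/(s - z) ds)`. -/
def delta (D : ScatteringData) (z₀ : ℝ) (z : ℂ) : ℂ :=
  Complex.exp (Complex.I * ∫ s in Set.Iic z₀, (nu D.r s : ℂ) / ((s : ℂ) - z))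

/-- `T(z)`, the product of the two previous functions. -/
def T (D : ScatteringData) (z₀ : ℝ) (z : ℂ) : ℂ := blaschke D z₀ z * delta D z₀ z

/-- `β(z, z₀) = -ν(z₀) log(z - z₀ + 1) + ∫_{-∞}^{z₀} (ν(s) - 1_{(z₀-1,z₀)}(s) ν(z₀))/(s - z) ds`. -/
def beta (D : ScatteringData) (z₀ : ℝ) (z : ℂ) : ℂ :=
  -(nu D.r z₀ : ℂ) * Complex.log (z - z₀ + 1) +
    ∫ s in Set.Iic z₀,
      ((nu D.r s - (Set.Ioo (z₀ - 1) z₀).indicator (fun _ => nu D.r z₀) s : ℝ) : ℂ) / ((s : ℂ) - z)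

/-- The complex unit `T₀(z₀)`. -/
def T0 (D : ScatteringData) (z₀ : ℝ) : ℂ :=
  blaschke D z₀ z₀ * Complex.exp (Complex.I * beta D z₀ z₀)

/-! The six open sectors with vertex `z₀` cut out by the real axis and by the rays
`Σ_j = z₀ + e^{i(2j-1)π/4} ℝ₊`, and these rays. -/

def Omega1 (z₀ : ℝ) : Set ℂ := {z | 0 < z.im ∧ z.im < z.re - z₀}
def Omega2 (z₀ : ℝ) : Set ℂ := {z | |z.re - z₀| < z.im}
def Omega3 (z₀ : ℝ) : Set ℂ := {z | 0 < z.im ∧ z.im < z₀ - z.re}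
def Omega4 (z₀ : ℝ) : Set ℂ := {z | z.im < 0 ∧ -z.im < z₀ - z.re}
def Omega5 (z₀ : ℝ) : Set ℂ := {z | |z.re - z₀| < -z.im}
def Omega6 (z₀ : ℝ) : Set ℂ := {z | z.im < 0 ∧ -z.im < z.re - z₀}

def Sigma1 (z₀ : ℝ) : Set ℂ := {z | 0 < z.im ∧ z.im = z.re - z₀}
def Sigma2 (z₀ : ℝ) : Set ℂ := {z | 0 < z.im ∧ z.im = z₀ - z.re}
def Sigma3 (z₀ : ℝ) : Set ℂ := {z | z.im < 0 ∧ -z.im = z₀ - z.re}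
def Sigma4 (z₀ : ℝ) : Set ℂ := {z | z.im < 0 ∧ -z.im = z.re - z₀}

/-- The contour `Σ⁽²⁾`, including the vertex `z₀`: the points with `|Im z| = |Re z - z₀|`. -/
def contour (z₀ : ℝ) : Set ℂ := {z | |z.im| = |z.re - z₀|}

/-! The boundary values on the rays `Σ₁, …, Σ₄` of the extensions `R₁, R₃, R₄, R₆`, without the
factor `1 - χ`. -/

def f1 (D : ScatteringData) (z₀ : ℝ) (z : ℂ) : ℂ :=
  D.r z₀ * (T0 D z₀ ^ 2)⁻¹ * (z - z₀) ^ (-2 * Complex.I * (nu D.r z₀ : ℂ))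

def f3 (D : ScatteringData) (z₀ : ℝ) (z : ℂ) : ℂ :=
  starRingEnd ℂ (D.r z₀) / (1 + (‖D.r z₀‖ : ℂ) ^ 2) * T0 D z₀ ^ 2 *
    (z - z₀) ^ (2 * Complex.I * (nu D.r z₀ : ℂ))

def f4 (D : ScatteringData) (z₀ : ℝ) (z : ℂ) : ℂ :=
  D.r z₀ / (1 + (‖D.r z₀‖ : ℂ) ^ 2) * (T0 D z₀ ^ 2)⁻¹ *
    (z - z₀) ^ (-2 * Complex.I * (nu D.r z₀ : ℂ))

def f6 (D : ScatteringData) (z₀ : ℝ) (z : ℂ) : ℂ :=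
  starRingEnd ℂ (D.r z₀) * T0 D z₀ ^ 2 * (z - z₀) ^ (2 * Complex.I * (nu D.r z₀ : ℂ))

/-- The interpolation `(1 - χ)(f + (g - f) cos 2φ)`, `φ = arg(z - z₀)`: for `χ = 0` on the real
axis it equals `g` there (`φ ∈ {0, π}`), and it equals `(1 - χ) f` on the rays, where
`φ ∈ {±π/4, ±3π/4}`. -/
def blend (χ : ℂ → ℝ) (z₀ : ℝ) (f g : ℂ → ℂ) (z : ℂ) : ℂ :=
  (1 - (χ z : ℂ)) * (f z + (g z - f z) * (Real.cos (2 * Complex.arg (z - z₀)) : ℂ))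

/-! The continuous extensions `R_j : Ω_j → ℂ`. The boundary values at real `z` are
`r T⁻²`, `r* T₊²/(1+|r|²)`, `r T₋⁻²/(1+|r|²)`, `r* T²` for `j = 1, 3, 4, 6`. -/

def R1 (D : ScatteringData) (χ : ℂ → ℝ) (z₀ : ℝ) : ℂ → ℂ :=
  blend χ z₀ (f1 D z₀) (fun z => D.r z.re * (T D z₀ z ^ 2)⁻¹)

def R3 (D : ScatteringData) (χ : ℂ → ℝ) (z₀ : ℝ) : ℂ → ℂ :=
  blend χ z₀ (f3 D z₀)
    (fun z => starRingEnd ℂ (D.r z.re) / (1 + (‖D.r z.re‖ : ℂ) ^ 2) * T D z₀ z ^ 2)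

def R4 (D : ScatteringData) (χ : ℂ → ℝ) (z₀ : ℝ) : ℂ → ℂ :=
  blend χ z₀ (f4 D z₀)
    (fun z => D.r z.re / (1 + (‖D.r z.re‖ : ℂ) ^ 2) * (T D z₀ z ^ 2)⁻¹)

def R6 (D : ScatteringData) (χ : ℂ → ℝ) (z₀ : ℝ) : ℂ → ℂ :=
  blend χ z₀ (f6 D z₀) (fun z => starRingEnd ℂ (D.r z.re) * T D z₀ z ^ 2)

open Classical in
/-- The matrix `R⁽²⁾`. -/
def Rtwo (D : ScatteringData) (χ : ℂ → ℝ) (α γ x t : ℝ) (z : ℂ) : Matrix (Fin 2) (Fin 2) ℂ :=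
  if z ∈ Omega1 (phasePoint α x t) then
    !![1, 0; -(R1 D χ (phasePoint α x t) z * osc α γ x t z), 1]
  else if z ∈ Omega3 (phasePoint α x t) then
    !![1, -(R3 D χ (phasePoint α x t) z * (osc α γ x t z)⁻¹); 0, 1]
  else if z ∈ Omega4 (phasePoint α x t) then
    !![1, 0; R4 D χ (phasePoint α x t) z * osc α γ x t z, 1]
  else if z ∈ Omega6 (phasePoint α x t) then
    !![1, R6 D χ (phasePoint α x t) z * (osc α γ x t z)⁻¹; 0, 1]
  else 1

/-- `∂̄f = (∂_x f + i ∂_y f)/2`. -/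
def dbar (f : ℂ → ℂ) (z : ℂ) : ℂ :=
  (1 / 2) * (fderiv ℝ f z 1 + Complex.I * fderiv ℝ f z Complex.I)

/-- `∂̄R⁽²⁾`, entrywise. It is a classical derivative at almost every point of the plane. -/
def dbarRtwo (D : ScatteringData) (χ : ℂ → ℝ) (α γ x t : ℝ) (z : ℂ) :
    Matrix (Fin 2) (Fin 2) ℂ :=
  Matrix.of fun i j => dbar (fun w => Rtwo D χ α γ x t w i j) z

/-- The jump relation `M₊ = M₋ V` at a point `z`, where `M₊`, `M₋` are the limits at `z` of `M`
from inside the regions `P`, `Q`. -/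
def HasJump (M : ℂ → Matrix (Fin 2) (Fin 2) ℂ) (P Q : Set ℂ) (z : ℂ)
    (V : Matrix (Fin 2) (Fin 2) ℂ) : Prop :=
  ∃ A B : Matrix (Fin 2) (Fin 2) ℂ,
    Filter.Tendsto M (nhdsWithin z P) (nhds A) ∧
    Filter.Tendsto M (nhdsWithin z Q) (nhds B) ∧ A = B * V

/-- `M` has (at most) a simple pole at `w` and `Res_{z = w} M = lim_{z → w} M n`, the limits being
taken inside the region `P`. -/
def HasResidue (M : ℂ → Matrix (Fin 2) (Fin 2) ℂ) (P : Set ℂ) (w : ℂ)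
    (n : Matrix (Fin 2) (Fin 2) ℂ) : Prop :=
  ∃ A : Matrix (Fin 2) (Fin 2) ℂ,
    Filter.Tendsto (fun z => (z - w) • M z) (nhdsWithin w P) (nhds A) ∧
    Filter.Tendsto (fun z => M z * n) (nhdsWithin w P) (nhds A)

open Classical in
/-- The residue matrix at `z_k`. -/
def resUpper (D : ScatteringData) (α γ x t : ℝ) (k : Fin D.N) : Matrix (Fin 2) (Fin 2) ℂ :=
  if (D.pole k).re < phasePoint α x t then
    !![0, (D.norming k)⁻¹ *
        ((deriv (fun z => (T D (phasePoint α x t) z)⁻¹) (D.pole k)) ^ 2)⁻¹ *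
        (osc α γ x t (D.pole k))⁻¹; 0, 0]
  else
    !![0, 0; D.norming k * (T D (phasePoint α x t) (D.pole k) ^ 2)⁻¹ * osc α γ x t (D.pole k), 0]

open Classical in
/-- The residue matrix at `z_k*`. -/
def resLower (D : ScatteringData) (α γ x t : ℝ) (k : Fin D.N) : Matrix (Fin 2) (Fin 2) ℂ :=
  if (D.pole k).re < phasePoint α x t then
    !![0, 0; -((starRingEnd ℂ (D.norming k))⁻¹ *
        ((deriv (T D (phasePoint α x t)) (starRingEnd ℂ (D.pole k))) ^ 2)⁻¹ *
        osc α γ x t (starRingEnd ℂ (D.pole k))), 0]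
  else
    !![0, -(starRingEnd ℂ (D.norming k) *
        T D (phasePoint α x t) (starRingEnd ℂ (D.pole k)) ^ 2 *
        (osc α γ x t (starRingEnd ℂ (D.pole k)))⁻¹); 0, 0]

/-- `M` solves the model Riemann-Hilbert problem for `M_RHP`: the jump contour `Σ⁽²⁾` is oriented
from left to right, so that the `+` side of each ray is its upper side. -/
structure IsModelSolution (D : ScatteringData) (χ : ℂ → ℝ) (α γ x t : ℝ)
    (M : ℂ → Matrix (Fin 2) (Fin 2) ℂ) : Prop where
  analytic : ∀ i j, DifferentiableOn ℂ (fun z => M z i j)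
    (contour (phasePoint α x t) ∪ D.discrete)ᶜ
  jump1 : ∀ z ∈ Sigma1 (phasePoint α x t), z ∉ D.discrete →
    HasJump M (Omega2 (phasePoint α x t)) (Omega1 (phasePoint α x t)) z
      !![1, 0; (1 - (χ z : ℂ)) * f1 D (phasePoint α x t) z * osc α γ x t z, 1]
  jump2 : ∀ z ∈ Sigma2 (phasePoint α x t), z ∉ D.discrete →
    HasJump M (Omega2 (phasePoint α x t)) (Omega3 (phasePoint α x t)) z
      !![1, (1 - (χ z : ℂ)) * f3 D (phasePoint α x t) z * (osc α γ x t z)⁻¹; 0, 1]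
  jump3 : ∀ z ∈ Sigma3 (phasePoint α x t), z ∉ D.discrete →
    HasJump M (Omega4 (phasePoint α x t)) (Omega5 (phasePoint α x t)) z
      !![1, 0; (1 - (χ z : ℂ)) * f4 D (phasePoint α x t) z * osc α γ x t z, 1]
  jump4 : ∀ z ∈ Sigma4 (phasePoint α x t), z ∉ D.discrete →
    HasJump M (Omega6 (phasePoint α x t)) (Omega5 (phasePoint α x t)) z
      !![1, (1 - (χ z : ℂ)) * f6 D (phasePoint α x t) z * (osc α γ x t z)⁻¹; 0, 1]
  bounded_near_vertex : ∃ C ε : ℝ, 0 < ε ∧ ∀ z ∉ contour (phasePoint α x t),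
    dist z (phasePoint α x t : ℂ) < ε → ∀ i j, ‖M z i j‖ ≤ C
  normalized : ∃ C K : ℝ, ∀ z ∉ contour (phasePoint α x t),
    K < ‖z‖ → ∀ i j, ‖(M z - 1) i j‖ ≤ C / ‖z‖
  residue_upper : ∀ k, HasResidue M (contour (phasePoint α x t) ∪ D.discrete)ᶜ (D.pole k)
    (resUpper D α γ x t k)
  residue_lower : ∀ k, HasResidue M (contour (phasePoint α x t) ∪ D.discrete)ᶜ
    (starRingEnd ℂ (D.pole k)) (resLower D α γ x t k)

/-- `W⁽³⁾ = M_RHP (∂̄R⁽²⁾) M_RHP⁻¹`. -/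
def Wthree (D : ScatteringData) (χ : ℂ → ℝ) (α γ x t : ℝ)
    (Mrhp : ℂ → Matrix (Fin 2) (Fin 2) ℂ) (z : ℂ) : Matrix (Fin 2) (Fin 2) ℂ :=
  Mrhp z * dbarRtwo D χ α γ x t z * (Mrhp z)⁻¹

/-- `M` solves the pure `∂̄`-problem with coefficient `W`: it is continuous on the plane, tends to
the identity at infinity, and `∂̄M = M W` in the sense of distributions. -/
structure IsPureDbarSolution (W M : ℂ → Matrix (Fin 2) (Fin 2) ℂ) : Prop where
  continuous : Continuous M
  tendsto_one : Filter.Tendsto M (Filter.cocompact ℂ) (nhds 1)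
  locallyIntegrable : ∀ i j,
    MeasureTheory.LocallyIntegrable (fun z => (M z * W z) i j) MeasureTheory.volume
  weak_dbar : ∀ φ : ℂ → ℂ, ContDiff ℝ (⊤ : ℕ∞) φ → HasCompactSupport φ →
    ∀ i j, ∫ z : ℂ, M z i j * dbar φ z = -∫ z : ℂ, (M z * W z) i j * φ z

/-- `M₁ = (1/π) ∬ M W dA`. -/
def coeffOne (W M : ℂ → Matrix (Fin 2) (Fin 2) ℂ) : Matrix (Fin 2) (Fin 2) ℂ :=
  Matrix.of fun i j => (1 / (Real.pi : ℂ)) * ∫ z : ℂ, (M z * W z) i j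

end CGNLS

end

namespace CGNLS

open MeasureTheory Set Filter Topology

/-! Inverting ∂̄ by the solid Cauchy transform S (`solidCauchy`) turns the pure ∂̄-problem into the
fixed point equation M = 1 + S(MW). The linear part is bounded, up to a constant, by sup_z ∬ |W(ζ)|
/ |z - ζ|; once this is small, there is exactly one bounded solution. Weyl's lemma and Liouville's
theorem show that every distributional solution is a fixed point. Since W vanishes for |Re z - z₀| ≤
|Im z|, dominated convergence along the imaginary axis identifies the coefficient of 1/z as (1/π) ∬
MW, which is at most a multiple of ∬ |W|. This is `IsSmallCoefficient.exists_solution`. What has to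
be shown is that, uniformly in x and in the model solution, ∬ |W| = O(t^(-3/4)) and ∬ |W(ζ)| / |z -
ζ| = O(t^(-1/4)).

The first ingredient is |W| ≤ C |∂̄R⁽²⁾|. As R⁽²⁾ is constant near the discrete spectrum, it
suffices to bound M_RHP and its inverse away from the poles, uniformly for large t
(`exists_uniform_bound`); no existence theory for the model problem is used. Triangular factors 1 +
(1 - χ)N with N² = 0 (`jumpNil`) remove the jumps on Σ; let U be the product of M_RHP with them. By
the symmetry N(z*) = -N(z)†, these factors cancel in U(z) U(z*)† (`gram`) up to the difference χ(z*)
- χ(z), and the poles cancel by the same symmetry of the residue matrices. So the Gram function is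
the identity plus the Cauchy transform of a density that lives away from the real axis, where N is
O(exp(-8td²)). If |M_RHP| ≤ m off the poles, then the Gram function is 1 + O(exp(-8td²) m²). On the
real axis it is M M†, hence |M| ≤ 1 + ηm there, with η exponentially small. A Blaschke product and
the Phragmén–Lindelöf principle carry this bound into both half-planes. For large t any bound m may
thus be replaced by C₀ + m/2; since some bound always exists, one of size 2C₀ + 1 holds. A Gram
function close to 1 also yields the bound for the inverse.

The second ingredient is a pointwise bound (`CutoffGeometry.exists_dbarRtwo_bound`). The
interpolation between f and g costs |g - f| / |z - z₀|. A function in H¹ is Hölder continuous of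
order 1/2, and T² differs from T₀² (z - z₀)^(2iν₀) by O(|z - z₀|^(1/2)), by a Privalov estimate for
`beta`. With u = Re z - z₀ and v = Im z this gives |∂̄R⁽²⁾| ≤ exp(-8t|uv|) (k(Re z) + C |u|^(-1/2))
for |v| < |u|, where k ∈ L². On each horizontal line the Cauchy–Schwarz inequality applies, and
because |v| < |u| a Gaussian exp(-4tv²) remains for the integration in v. The powers t^(-3/4) and
t^(-1/4) come out of `exists_integral_majorant_le` and `exists_integral_majorant_kernel_le`. -/

/-! ### The operator ∂̄ and the Cauchy–Pompeiu formula. -/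

lemma norm_dbar_le (φ : ℂ → ℂ) (z : ℂ) : ‖dbar φ z‖ ≤ ‖fderiv ℝ φ z‖ := by
  have h1 := (fderiv ℝ φ z).le_opNorm 1
  have h2 := (fderiv ℝ φ z).le_opNorm Complex.I
  unfold dbar
  calc _ ≤ ‖(1/2 : ℂ)‖ * (‖fderiv ℝ φ z 1‖ + ‖Complex.I * fderiv ℝ φ z Complex.I‖) := by
        rw [norm_mul]; gcongr; exact norm_add_le _ _
    _ ≤ _ := by
        simp only [norm_mul, Complex.norm_I, norm_one, mul_one, one_mul] at *
        norm_num
        linarith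

lemma continuous_dbar {φ : ℂ → ℂ} (hφ : ContDiff ℝ 1 φ) : Continuous (dbar φ) := by
  have h := hφ.continuous_fderiv one_ne_zero
  unfold dbar
  fun_prop

lemma hasCompactSupport_dbar {φ : ℂ → ℂ} (hc : HasCompactSupport φ) :
    HasCompactSupport (dbar φ) := by
  have h := hc.fderiv (𝕜 := ℝ)
  refine h.mono' ?_
  intro z hz
  apply subset_tsupport
  intro h0
  apply hz
  simp [dbar, h0]

lemma dbar_comp_add (φ : ℂ → ℂ) (a z : ℂ) : dbar (fun w => φ (w + a)) z = dbar φ (z + a) := by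
  simp only [dbar, fderiv_comp_add_right]

/-- Since ∂̄ = (e^(is)/2)(∂_r + (i/r)∂_s), the Jacobian `r` cancels the pole of `1/z`. What remains
is a radial derivative plus `I/r` times an angular one, and each can be integrated outright. -/
lemma polar_dbar (φ : ℂ → ℂ) {r s : ℝ} (hr : 0 < r) :
    (r : ℂ) * (dbar φ (r * (Real.cos s + Real.sin s * Complex.I)) /
      (r * (Real.cos s + Real.sin s * Complex.I))) =
    (1 / 2) * (fderiv ℝ φ (r * (Real.cos s + Real.sin s * Complex.I))
        (Real.cos s + Real.sin s * Complex.I) +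
      Complex.I * fderiv ℝ φ (r * (Real.cos s + Real.sin s * Complex.I))
        (Complex.I * (Real.cos s + Real.sin s * Complex.I))) := by
  set z : ℂ := r * (Real.cos s + Real.sin s * Complex.I)
  have h1 : (Real.cos s + Real.sin s * Complex.I : ℂ) = Real.cos s • 1 + Real.sin s • Complex.I := by
    simp [Complex.real_smul]
  have h2 : Complex.I * (Real.cos s + Real.sin s * Complex.I : ℂ) =
      (-Real.sin s) • 1 + Real.cos s • Complex.I := by
    simp only [Complex.real_smul, Complex.ofReal_neg]
    linear_combination (Real.sin s : ℂ) * Complex.I_sq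
  rw [h2, h1]
  simp only [map_add, map_smul]
  have hne : (Real.cos s + Real.sin s * Complex.I : ℂ) ≠ 0 := by
    intro h
    have := congrArg Complex.re h
    have h' := congrArg Complex.im h
    simp [Complex.cos_ofReal_re, Complex.sin_ofReal_re, Complex.cos_ofReal_im, Complex.sin_ofReal_im] at this h'
    have := Real.sin_sq_add_cos_sq s
    simp_all
  have hr' : (r : ℂ) ≠ 0 := by exact_mod_cast hr.ne'
  have hsq : (Real.sin s : ℂ)^2 + (Real.cos s : ℂ)^2 = 1 := by
    exact_mod_cast Real.sin_sq_add_cos_sq s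
  rw [show (r : ℂ) * (dbar φ z / z) = dbar φ z / (Real.cos s + Real.sin s * Complex.I) by
    simp only [z]; field_simp]
  rw [div_eq_iff hne]
  simp only [dbar, Complex.real_smul]
  push_cast
  generalize fderiv ℝ φ z 1 = a
  generalize fderiv ℝ φ z Complex.I = b
  push_cast at hsq
  generalize Complex.sin (s : ℂ) = σ at *
  generalize Complex.cos (s : ℂ) = κ at *
  have hI := Complex.I_sq
  linear_combination (-(1/2) * (a + Complex.I * b)) * hsq + (1/2) * (a * σ^2 - b * σ * κ) * hI

/-- **Cauchy–Pompeiu formula** at the origin. -/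
lemma integral_dbar_div_self {φ : ℂ → ℂ} (hφ : ContDiff ℝ 1 φ) (hc : HasCompactSupport φ) :
    ∫ z, dbar φ z / z = -Real.pi * φ 0 := by
  rw [← Complex.integral_comp_polarCoord_symm]
  obtain ⟨R, hR0, hR⟩ : ∃ R : ℝ, 0 < R ∧ ∀ z, R ≤ ‖z‖ → fderiv ℝ φ z = 0 ∧ φ z = 0 := by
    obtain ⟨R, hR⟩ := hc.isCompact.isBounded.subset_closedBall 0
    refine ⟨max R 0 + 1, by positivity, fun z hz => ?_⟩
    have hz' : z ∉ tsupport φ := fun h => by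
      have := hR h
      rw [mem_closedBall_zero_iff] at this
      have := le_max_left R 0
      linarith
    exact ⟨image_eq_zero_of_notMem_tsupport (fun h => hz' (tsupport_fderiv_subset ℝ h)),
      image_eq_zero_of_notMem_tsupport hz'⟩
  set e : ℝ → ℂ := fun s => Real.cos s + Real.sin s * Complex.I with he
  have hen : ∀ s, ‖e s‖ = 1 := fun s => by
    simp only [he, Complex.ofReal_cos, Complex.ofReal_sin, ← Complex.exp_mul_I]
    exact Complex.norm_exp_ofReal_mul_I s
  have hec : Continuous e := by fun_prop
  have hD := hφ.continuous_fderiv one_ne_zero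
  -- `A` is the derivative along the ray, and `r * B` is the derivative along the circle (`hdA`,
  -- `hdB`).
  set A : ℝ × ℝ → ℂ := fun p => fderiv ℝ φ (p.1 * e p.2) (e p.2) with hA
  set B : ℝ × ℝ → ℂ := fun p => fderiv ℝ φ (p.1 * e p.2) (Complex.I * e p.2) with hB
  have hAc : Continuous A := by fun_prop
  have hBc : Continuous B := by fun_prop
  have hnorm : ∀ p : ℝ × ℝ, ‖(p.1 : ℂ) * e p.2‖ = |p.1| := fun p => by
    rw [norm_mul, hen]; simp
  have hdA : ∀ s r, HasDerivAt (fun r : ℝ => φ (r * e s)) (A (r, s)) r := by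
    intro s r
    have h1 : HasDerivAt (fun r : ℝ => (r : ℂ) * e s) (e s) r := by
      simpa using (Complex.ofRealCLM.hasDerivAt (x := r)).mul_const (e s)
    exact ((hφ.differentiable one_ne_zero _).hasFDerivAt).comp_hasDerivAt r h1
  have hde : ∀ s, HasDerivAt e (Complex.I * e s) s := by
    intro s
    have h1 := (Real.hasDerivAt_cos s).ofReal_comp
    have h2 := ((Real.hasDerivAt_sin s).ofReal_comp).mul_const Complex.I
    refine (h1.add h2).congr_deriv ?_
    simp only [he]
    push_cast
    linear_combination -Complex.sin s * Complex.I_sq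
  have hdB : ∀ r s : ℝ, HasDerivAt (fun s : ℝ => φ (r * e s)) (r * B (r, s)) s := by
    intro r s
    have h1 : HasDerivAt (fun s : ℝ => (r : ℂ) * e s) (r * (Complex.I * e s)) s :=
      (hde s).const_mul _
    have := ((hφ.differentiable one_ne_zero _).hasFDerivAt).comp_hasDerivAt s h1
    refine this.congr_deriv ?_
    rw [show (r : ℂ) * (Complex.I * e s) = r • (Complex.I * e s) by simp, map_smul]
    simp [hB]
  have hint : ∀ G : ℝ × ℝ → ℂ, Continuous G → (∀ p : ℝ × ℝ, R ≤ p.1 → G p = 0) →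
      IntegrableOn G (Ioi 0 ×ˢ Ioo (-Real.pi) Real.pi) := by
    intro G hG hz
    have h1 : IntegrableOn G (Icc 0 R ×ˢ Icc (-Real.pi) Real.pi) :=
      hG.continuousOn.integrableOn_compact (isCompact_Icc.prod isCompact_Icc)
    refine h1.of_forall_sdiff_eq_zero (measurableSet_Ioi.prod measurableSet_Ioo) ?_
    rintro ⟨r, s⟩ ⟨⟨h2, h3⟩, h4⟩
    refine hz _ ?_
    by_contra! h
    exact h4 ⟨⟨(mem_Ioi.1 h2).le, h.le⟩, Ioo_subset_Icc_self h3⟩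
  have hAz : ∀ p : ℝ × ℝ, R ≤ p.1 → A p = 0 := fun p hp => by
    simp only [hA]; rw [(hR _ _).1]; · simp
    rw [hnorm]; exact hp.trans (le_abs_self _)
  have hBz : ∀ p : ℝ × ℝ, R ≤ p.1 → B p = 0 := fun p hp => by
    simp only [hB]; rw [(hR _ _).1]; · simp
    rw [hnorm]; exact hp.trans (le_abs_self _)
  have h1 : ∫ p in polarCoord.target, p.1 • (dbar φ (Complex.polarCoord.symm p) /
      Complex.polarCoord.symm p) =
      ∫ p in Ioi 0 ×ˢ Ioo (-Real.pi) Real.pi, ((1/2) * (A p + Complex.I * B p)) := by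
    rw [polarCoord_target]
    refine setIntegral_congr_fun (measurableSet_Ioi.prod measurableSet_Ioo) ?_
    rintro ⟨r, s⟩ ⟨hr, -⟩
    have := polar_dbar φ (s := s) (mem_Ioi.1 hr)
    simp only [Complex.polarCoord_symm_apply, Complex.real_smul]
    exact this
  have hIA := hint A hAc hAz
  have hIB := hint B hBc hBz
  -- On every ray the radial derivative integrates to `-φ 0`; the angles have total length 2π.
  have h2 : ∫ p in Ioi 0 ×ˢ Ioo (-Real.pi) Real.pi, A p = -(2 * Real.pi) * φ 0 := by
    rw [Measure.volume_eq_prod, ← Measure.prod_restrict, integral_prod_symm _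
      (by rw [Measure.prod_restrict]; exact hIA)]
    have : ∀ s : ℝ, ∫ r in Ioi (0:ℝ), A (r, s) = - φ 0 := by
      intro s
      have := integral_Ioi_of_hasDerivAt_of_tendsto' (f := fun r : ℝ => φ (r * e s)) (a := 0)
        (m := 0) (fun r _ => hdA s r) ?_ ?_
      · simpa using this
      · have h1 : IntegrableOn (fun r => A (r, s)) (Icc 0 R) :=
          (Continuous.continuousOn (by fun_prop)).integrableOn_compact isCompact_Icc
        refine h1.of_forall_sdiff_eq_zero measurableSet_Ioi ?_
        rintro r ⟨h2, h4⟩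
        refine hAz _ ?_
        by_contra! h
        exact h4 ⟨(mem_Ioi.1 h2).le, h.le⟩
      · refine tendsto_const_nhds.congr' ?_
        filter_upwards [eventually_ge_atTop R] with r hr
        refine (hR _ ?_).2.symm
        have := hnorm (r, s)
        simp only at this
        rw [this]; exact hr.trans (le_abs_self _)
    simp only [this]
    simp
    left
    rw [max_eq_left (by positivity)]
    push_cast; ring
  -- For fixed `r`, the integrand is `1/r` times the derivative of a 2π-periodic function.
  have h3 : ∫ p in Ioi 0 ×ˢ Ioo (-Real.pi) Real.pi, B p = 0 := by
    rw [Measure.volume_eq_prod, setIntegral_prod _ (by rwa [← Measure.volume_eq_prod])]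
    refine setIntegral_eq_zero_of_forall_eq_zero ?_
    intro r hr
    rw [← integral_Ioc_eq_integral_Ioo, ← intervalIntegral.integral_of_le (by linarith [Real.pi_pos])]
    have h := intervalIntegral.integral_eq_sub_of_hasDerivAt (a := -Real.pi) (b := Real.pi)
      (fun s _ => hdB r s) (Continuous.intervalIntegrable (by fun_prop) _ _)
    rw [intervalIntegral.integral_const_mul] at h
    have h0 : e Real.pi = e (-Real.pi) := by simp [he]
    rw [h0, sub_self] at h
    have hr' : (r : ℂ) ≠ 0 := by exact_mod_cast (mem_Ioi.1 hr).ne'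
    exact (mul_eq_zero.1 h).resolve_left hr'
  rw [h1, integral_const_mul, integral_add hIA (hIB.const_mul _), integral_const_mul, h2, h3]
  ring

/-- **Cauchy–Pompeiu formula** for compactly supported functions. -/
lemma integral_dbar_div_sub {φ : ℂ → ℂ} (hφ : ContDiff ℝ 1 φ) (hc : HasCompactSupport φ) (ζ : ℂ) :
    ∫ z, dbar φ z / (z - ζ) = -Real.pi * φ ζ := by
  have h := integral_dbar_div_self (φ := fun w => φ (w + ζ)) (by fun_prop)
    (hc.comp_homeomorph (Homeomorph.addRight ζ))
  simp only [dbar_comp_add, zero_add] at h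
  rw [← h, ← integral_add_right_eq_self _ ζ]
  simp

/-! ### Weyl's lemma. -/

section

open scoped Convolution

/-- The reflection `w ↦ z - w` changes the sign of the derivative, so pairing a function with this
expression gives minus the ∂̄-derivative of its convolution with `ψ`. -/
lemma dbar_ofReal_comp_sub {ψ : ℂ → ℝ} (hψ : ContDiff ℝ 1 ψ) (z t : ℂ) :
    dbar (fun w => (ψ (z - w) : ℂ)) t =
      -((1 / 2) * ((fderiv ℝ ψ (z - t) 1 : ℂ) + Complex.I * (fderiv ℝ ψ (z - t) Complex.I : ℂ))) := by
  have h1 : HasFDerivAt (fun w => (ψ (z - w) : ℂ))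
      (Complex.ofRealCLM.comp ((fderiv ℝ ψ (z - t)).comp (-(ContinuousLinearMap.id ℝ ℂ)))) t := by
    have h0 : HasFDerivAt (fun w : ℂ => z - w) (-(ContinuousLinearMap.id ℝ ℂ)) t := by
      simpa using (hasFDerivAt_id t).const_sub z
    exact Complex.ofRealCLM.hasFDerivAt.comp t
      (((hψ.differentiable one_ne_zero (z - t)).hasFDerivAt).comp t h0)
  rw [dbar, h1.fderiv]
  simp
  ring

/-- **Weyl's lemma** for the `∂̄` operator on continuous functions. -/
lemma differentiableOn_of_weak_dbar_eq_zero {O : Set ℂ} (hO : IsOpen O) {f : ℂ → ℂ}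
    (hf : ContinuousOn f O)
    (h : ∀ φ : ℂ → ℂ, ContDiff ℝ (⊤ : ℕ∞) φ → HasCompactSupport φ → tsupport φ ⊆ O →
      ∫ z, f z * dbar φ z = 0) : DifferentiableOn ℂ f O := by
  intro p hp
  obtain ⟨ρ, hρ, hρO⟩ := Metric.isOpen_iff.1 hO p hp
  -- Mollifiers of radius at most `r`, evaluated on the ball of radius `r`, see only the ball of
  -- radius `2 * r`, which stays inside `O`.
  set r : ℝ := ρ / 3 with hr
  have hr0 : 0 < r := by positivity
  have hKO : Metric.closedBall p (2 * r) ⊆ O := by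
    refine (Metric.closedBall_subset_ball ?_).trans hρO
    rw [hr]; linarith
  set K := Metric.closedBall p (2 * r) with hK
  have hKc : IsCompact K := isCompact_closedBall _ _
  set f₁ : ℂ → ℂ := K.indicator f with hf₁
  have hfK : ContinuousOn f K := hf.mono hKO
  have hint : Integrable f₁ :=
    (hfK.integrableOn_compact hKc).integrable_indicator hKc.measurableSet
  have hloc : LocallyIntegrable f₁ := hint.locallyIntegrable
  let b : ℕ → ContDiffBump (0 : ℂ) := fun n =>
    ⟨r / (2 * (n + 1)), r / (n + 1), by positivity, by
      apply div_lt_div_of_pos_left hr0 <;> [positivity; linarith [Nat.cast_nonneg (α := ℝ) n]]⟩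
  have hb : ∀ n, (b n).rOut = r / (n + 1) := fun n => rfl
  have hbr : ∀ n, (b n).rOut ≤ r := fun n => by
    rw [hb]; apply div_le_self hr0.le; linarith [Nat.cast_nonneg (α := ℝ) n]
  set F : ℕ → ℂ → ℂ := fun n =>
    MeasureTheory.convolution ((b n).normed volume) f₁ (ContinuousLinearMap.lsmul ℝ ℝ) volume with hF
  have hlim : TendstoUniformlyOn F f atTop (Metric.ball p r) := by
    rw [Metric.tendstoUniformlyOn_iff]
    intro ε hε
    obtain ⟨δ, hδ, hδε⟩ := Metric.uniformContinuousOn_iff.1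
      (hKc.uniformContinuousOn_of_continuous hfK) (ε / 2) (by positivity)
    have hev : ∀ᶠ n : ℕ in atTop, r / (n + 1) < δ := by
      have : Tendsto (fun n : ℕ => r / ((n : ℝ) + 1)) atTop (𝓝 0) :=
        tendsto_const_nhds.div_atTop (tendsto_atTop_add_const_right _ _ tendsto_natCast_atTop_atTop)
      exact this.eventually_lt_const hδ
    filter_upwards [hev] with n hn z hz
    have hzK : z ∈ K := Metric.ball_subset_closedBall
      (Metric.ball_subset_ball (by linarith) hz)
    have hsub : ∀ x ∈ Metric.ball z (b n).rOut, x ∈ K := fun x hx => by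
      have h1 := hbr n
      rw [Metric.mem_ball] at hx hz
      rw [hK, Metric.mem_closedBall]
      linarith [dist_triangle x z p]
    have := ContDiffBump.dist_normed_convolution_le (φ := b n) (g := f₁) (μ := volume) (x₀ := z)
      (ε := ε / 2) hint.aestronglyMeasurable (fun x hx => by
        rw [hf₁, indicator_of_mem (hsub x hx), indicator_of_mem hzK]
        refine (hδε x (hsub x hx) z hzK ?_).le
        rw [Metric.mem_ball, hb] at hx
        linarith)
    rw [hf₁, indicator_of_mem hzK] at this
    rw [dist_comm]
    exact lt_of_le_of_lt this (by linarith)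
  have hdiff : ∀ n, DifferentiableOn ℂ (F n) (Metric.ball p r) := by
    intro n z hz
    set ψ : ℂ → ℝ := (b n).normed volume with hψ
    have hψs : ContDiff ℝ (⊤ : ℕ∞) ψ := (b n).contDiff_normed
    have hψ1 : ContDiff ℝ 1 ψ := hψs.of_le (by exact_mod_cast le_top)
    have hψc : HasCompactSupport ψ := (b n).hasCompactSupport_normed
    refine DifferentiableAt.differentiableWithinAt ?_
    set L : ℂ →L[ℝ] ℝ →L[ℝ] ℂ := (ContinuousLinearMap.lsmul ℝ ℝ).flip with hL
    have hFn : F n = MeasureTheory.convolution f₁ ψ L volume := by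
      rw [hF, hL, convolution_flip]
    have hd := hψc.hasFDerivAt_convolution_right L hloc hψ1 z
    rw [hFn]
    rw [differentiableAt_complex_iff_differentiableAt_real]
    -- What is left is the Cauchy–Riemann equation for the convolution. It is the hypothesis, tested
    -- on the reflected mollifier `w ↦ ψ (z - w)`.
    refine ⟨hd.differentiableAt, ?_⟩
    have hfc : Continuous (fderiv ℝ ψ) := hψ1.continuous_fderiv one_ne_zero
    have hfs : HasCompactSupport (fderiv ℝ ψ) := hψc.fderiv (𝕜 := ℝ)
    rw [hd.fderiv, convolution_precompR_apply L hloc hfs hfc,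
      convolution_precompR_apply L hloc hfs hfc]
    set φ : ℂ → ℂ := fun w => (ψ (z - w) : ℂ) with hφ
    have hφs : ContDiff ℝ (⊤ : ℕ∞) φ :=
      Complex.ofRealCLM.contDiff.comp (hψs.comp (contDiff_const.sub contDiff_id))
    have hts : ∀ w, w ∉ Metric.closedBall z (b n).rOut → φ w = 0 := by
      intro w hw
      have : z - w ∉ Function.support ψ := by
        rw [hψ, (b n).support_normed_eq, mem_ball_zero_iff]
        rw [Metric.mem_closedBall, dist_comm, dist_eq_norm] at hw
        exact fun h => hw h.le
      simp only [hφ, Function.notMem_support.1 this, Complex.ofReal_zero]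
    have hsub : Metric.closedBall z (b n).rOut ⊆ K := fun x hx => by
      have h1 := hbr n
      rw [Metric.mem_ball] at hz
      rw [Metric.mem_closedBall] at hx
      rw [hK, Metric.mem_closedBall]
      linarith [dist_triangle x z p]
    have htsub : tsupport φ ⊆ Metric.closedBall z (b n).rOut :=
      closure_minimal (fun w hw => by
        by_contra hh; exact hw (hts w hh)) Metric.isClosed_closedBall
    have hφc : HasCompactSupport φ :=
      HasCompactSupport.intro (isCompact_closedBall z (b n).rOut) hts
    have h0 := h φ hφs hφc (htsub.trans (hsub.trans hKO))
    have e1 : ∀ v : ℂ, MeasureTheory.convolution f₁ (fun a => fderiv ℝ ψ a v) L volume z =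
        ∫ t, f₁ t * (fderiv ℝ ψ (z - t) v : ℂ) := by
      intro v
      rw [convolution_def]
      congr 1 with t
      simp [hL, mul_comm]
    have e2 : ∀ v : ℂ, Integrable (fun t => f₁ t * (fderiv ℝ ψ (z - t) v : ℂ)) := by
      intro v
      have : HasCompactSupport (fun a => fderiv ℝ ψ a v) := by
        refine hfs.comp_left (g := fun (l : ℂ →L[ℝ] ℝ) => l v) (by simp)
      have := this.convolutionExists_right L hloc (by fun_prop) z
      rw [ConvolutionExistsAt] at this
      refine this.congr (Eventually.of_forall fun t => ?_)
      simp [hL, mul_comm]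
    rw [e1, e1]
    have e3 : ∫ t, f₁ t * dbar φ t = 0 := by
      rw [← h0]
      congr 1 with t
      by_cases ht : t ∈ K
      · rw [hf₁, indicator_of_mem ht]
      · have : dbar φ t = 0 := by
          have : fderiv ℝ φ t = 0 := image_eq_zero_of_notMem_tsupport (fun h =>
            ht (hsub (htsub (tsupport_fderiv_subset ℝ h))))
          simp [dbar, this]
        rw [this, mul_zero, mul_zero]
    simp only [hφ, dbar_ofReal_comp_sub hψ1] at e3
    have e4 : ∀ t, f₁ t * -((1 / 2) * ((fderiv ℝ ψ (z - t) 1 : ℂ) +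
        Complex.I * (fderiv ℝ ψ (z - t) Complex.I : ℂ))) =
        (-(1/2)) * (f₁ t * (fderiv ℝ ψ (z - t) 1 : ℂ)) +
        (-(1/2) * Complex.I) * (f₁ t * (fderiv ℝ ψ (z - t) Complex.I : ℂ)) := fun t => by ring
    simp only [e4] at e3
    rw [integral_add ((e2 1).const_mul _) ((e2 Complex.I).const_mul _), integral_const_mul,
      integral_const_mul] at e3
    rw [smul_eq_mul]
    linear_combination (2 * Complex.I) * e3 + (∫ t, f₁ t * (fderiv ℝ ψ (z - t) Complex.I : ℂ)) * Complex.I_sq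
  -- A locally uniform limit of holomorphic functions is holomorphic.
  have := (hlim.tendstoLocallyUniformlyOn).differentiableOn (Eventually.of_forall hdiff) Metric.isOpen_ball
  exact (this.differentiableAt (Metric.isOpen_ball.mem_nhds (Metric.mem_ball_self hr0))).differentiableWithinAt

end

/-! ### The solid Cauchy transform. -/

/-- The solid Cauchy transform `(1/π) ∬ F(ζ)/(z - ζ) dA(ζ)`. -/
noncomputable def solidCauchy (F : ℂ → ℂ) (z : ℂ) : ℂ := (1 / (Real.pi : ℂ)) * ∫ ζ, F ζ / (z - ζ)

/-- An integrable density whose potential with kernel `|z|^(-9/8)` is bounded by `C`. -/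
structure HasKatoBound (F : ℂ → ℂ) (C : ℝ) : Prop where
  integrable : Integrable F
  integrable_kernel : ∀ z, Integrable fun ζ => ‖F ζ‖ * ‖z - ζ‖ ^ (-(9 / 8) : ℝ)
  integral_le : ∀ z, ∫ ζ, ‖F ζ‖ * ‖z - ζ‖ ^ (-(9 / 8) : ℝ) ≤ C

/-- The power dominates for `s ≤ 1`, the constant for `s ≥ 1`. So integrability of a density,
together with its potential for the stronger kernel, controls the Cauchy kernel. -/
lemma inv_le_one_add_rpow {s : ℝ} (hs : 0 ≤ s) : s⁻¹ ≤ 1 + s ^ (-(9 / 8) : ℝ) := by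
  rcases hs.eq_or_lt with rfl | hs
  · simp only [inv_zero]; positivity
  rcases le_total 1 s with h | h
  · have := inv_le_one_of_one_le₀ h
    have := Real.rpow_nonneg hs.le (-(9 / 8))
    linarith
  · have : s⁻¹ ≤ s ^ (-(9 / 8) : ℝ) := by
      rw [← Real.rpow_neg_one]
      exact Real.rpow_le_rpow_of_exponent_ge hs h (by norm_num)
    linarith

/-- A continuous truncation of the kernel `1/w`. -/
noncomputable def truncKernel (δ : ℝ) (w : ℂ) : ℂ := starRingEnd ℂ w / ((max ‖w‖ δ : ℝ) : ℂ) ^ 2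

lemma truncKernel_of_le {δ : ℝ} (hδ : 0 < δ) {w : ℂ} (h : δ ≤ ‖w‖) : truncKernel δ w = 1 / w := by
  have hw : w ≠ 0 := norm_pos_iff.1 (hδ.trans_le h)
  have hc : starRingEnd ℂ w ≠ 0 := by simpa using hw
  rw [truncKernel, max_eq_left h, ← Complex.mul_conj']
  field_simp

lemma continuous_truncKernel {δ : ℝ} (hδ : 0 < δ) : Continuous (truncKernel δ) := by
  unfold truncKernel
  refine Continuous.div (by fun_prop) (by fun_prop) fun w => ?_
  have : 0 < max ‖w‖ δ := lt_max_of_lt_right hδ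
  exact pow_ne_zero _ (by exact_mod_cast this.ne')

lemma norm_truncKernel_le {δ : ℝ} (hδ : 0 < δ) (w : ℂ) : ‖truncKernel δ w‖ ≤ 1 / max ‖w‖ δ := by
  have h : 0 < max ‖w‖ δ := lt_max_of_lt_right hδ
  rw [truncKernel, norm_div, norm_pow, Complex.norm_real, RCLike.norm_conj,
    Real.norm_of_nonneg h.le, div_le_div_iff₀ (by positivity) h]
  nlinarith [le_max_left ‖w‖ δ]

/-- The error lives in `‖w‖ < δ`, where it is at most `‖w‖⁻¹ = ‖w‖^(1/8) * ‖w‖^(-9/8)`. The spare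
power makes the truncation good uniformly in the centre of the kernel; this is why the exponent
`9/8` exceeds `1`. -/
lemma norm_inv_sub_truncKernel_le {δ : ℝ} (hδ : 0 < δ) (w : ℂ) :
    ‖1 / w - truncKernel δ w‖ ≤ δ ^ (1 / 8 : ℝ) * ‖w‖ ^ (-(9 / 8) : ℝ) := by
  rcases le_or_gt δ ‖w‖ with h | h
  · rw [truncKernel_of_le hδ h, sub_self, norm_zero]; positivity
  rcases eq_or_ne w 0 with rfl | hw
  · simp [truncKernel]
  have hw0 : 0 < ‖w‖ := norm_pos_iff.2 hw
  have hc : starRingEnd ℂ w ≠ 0 := by simpa using hw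
  have e : 1 / w - truncKernel δ w = starRingEnd ℂ w * (((‖w‖ ^ 2)⁻¹ - (δ ^ 2)⁻¹ : ℝ) : ℂ) := by
    rw [truncKernel, max_eq_right h.le]
    push_cast
    rw [← Complex.mul_conj']
    field_simp
  have h2 : (δ ^ 2)⁻¹ ≤ (‖w‖ ^ 2)⁻¹ := inv_anti₀ (by positivity) (by gcongr)
  rw [e, norm_mul, RCLike.norm_conj, Complex.norm_real, Real.norm_of_nonneg (by linarith)]
  calc ‖w‖ * ((‖w‖ ^ 2)⁻¹ - (δ ^ 2)⁻¹) ≤ ‖w‖ * (‖w‖ ^ 2)⁻¹ := by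
        gcongr; have : 0 ≤ (δ ^ 2)⁻¹ := by positivity
        linarith
    _ = ‖w‖ ^ (1 / 8 : ℝ) * ‖w‖ ^ (-(9 / 8) : ℝ) := by
        rw [← Real.rpow_add hw0]; norm_num
        rw [Real.rpow_neg_one]; field_simp
    _ ≤ _ := by gcongr

namespace HasKatoBound

variable {F : ℂ → ℂ} {C : ℝ}

lemma integrable_inv (h : HasKatoBound F C) (z : ℂ) : Integrable fun ζ => ‖F ζ‖ * ‖z - ζ‖⁻¹ := by
  refine (h.integrable.norm.add (h.integrable_kernel z)).mono'
    (h.integrable.norm.aestronglyMeasurable.mul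
      (by fun_prop : Measurable fun ζ => ‖z - ζ‖⁻¹).aestronglyMeasurable) ?_
  refine Eventually.of_forall fun ζ => ?_
  rw [Real.norm_of_nonneg (by positivity)]
  have := mul_le_mul_of_nonneg_left (inv_le_one_add_rpow (norm_nonneg (z - ζ))) (norm_nonneg (F ζ))
  simpa [mul_add] using this

lemma integral_inv_le (h : HasKatoBound F C) (z : ℂ) :
    ∫ ζ, ‖F ζ‖ * ‖z - ζ‖⁻¹ ≤ (∫ ζ, ‖F ζ‖) + C := by
  calc _ ≤ ∫ ζ, (‖F ζ‖ + ‖F ζ‖ * ‖z - ζ‖ ^ (-(9 / 8) : ℝ)) := by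
        refine integral_mono (h.integrable_inv z)
          (h.integrable.norm.add (h.integrable_kernel z)) fun ζ => ?_
        have := mul_le_mul_of_nonneg_left (inv_le_one_add_rpow (norm_nonneg (z - ζ)))
          (norm_nonneg (F ζ))
        simpa [mul_add] using this
    _ ≤ _ := by
        rw [integral_add h.integrable.norm (h.integrable_kernel z)]
        linarith [h.integral_le z]

lemma integrable_div (h : HasKatoBound F C) (z : ℂ) : Integrable fun ζ => F ζ / (z - ζ) := by
  refine (h.integrable_inv z).mono' ?_ (Eventually.of_forall fun ζ => by
    rw [norm_div, div_eq_mul_inv])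
  simp only [div_eq_mul_inv]
  exact h.integrable.aestronglyMeasurable.mul
      (by fun_prop : Measurable fun ζ => (z - ζ)⁻¹).aestronglyMeasurable

lemma _root_.CGNLS.norm_solidCauchy_le (F : ℂ → ℂ) (z : ℂ) {B : ℝ}
    (hB : ∫ ζ, ‖F ζ‖ * ‖z - ζ‖⁻¹ ≤ B) : ‖solidCauchy F z‖ ≤ B := by
  have h0 : 0 ≤ ∫ ζ, ‖F ζ‖ * ‖z - ζ‖⁻¹ := integral_nonneg fun ζ => by positivity
  have h1 : ‖∫ ζ, F ζ / (z - ζ)‖ ≤ ∫ ζ, ‖F ζ‖ * ‖z - ζ‖⁻¹ := by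
    refine (norm_integral_le_integral_norm _).trans (le_of_eq ?_)
    congr 1 with ζ
    rw [norm_div, div_eq_mul_inv]
  rw [solidCauchy, norm_mul, norm_div, norm_one, Complex.norm_real, Real.norm_of_nonneg Real.pi_pos.le]
  have h2 : 1 / Real.pi ≤ 1 := by
    rw [div_le_one Real.pi_pos]; linarith [Real.pi_gt_three]
  calc _ ≤ 1 * ∫ ζ, ‖F ζ‖ * ‖z - ζ‖⁻¹ := by gcongr
    _ ≤ B := by linarith

lemma integrable_truncKernel (h : HasKatoBound F C) {δ : ℝ} (hδ : 0 < δ) (z : ℂ) :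
    Integrable fun ζ => F ζ * truncKernel δ (z - ζ) := by
  refine (h.integrable.norm.mul_const (1 / δ)).mono'
    (h.integrable.aestronglyMeasurable.mul
      ((continuous_truncKernel hδ).comp (by fun_prop)).aestronglyMeasurable)
    (Eventually.of_forall fun ζ => ?_)
  rw [norm_mul]
  gcongr
  exact (norm_truncKernel_le hδ _).trans (by gcongr; exact le_max_right _ _)

lemma norm_sub_trunc_le (h : HasKatoBound F C) {δ : ℝ} (hδ : 0 < δ) (z : ℂ) :
    ‖(∫ ζ, F ζ / (z - ζ)) - ∫ ζ, F ζ * truncKernel δ (z - ζ)‖ ≤ δ ^ (1 / 8 : ℝ) * C := by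
  rw [← integral_sub (h.integrable_div z) (h.integrable_truncKernel hδ z)]
  calc _ ≤ ∫ ζ, ‖F ζ / (z - ζ) - F ζ * truncKernel δ (z - ζ)‖ := norm_integral_le_integral_norm _
    _ ≤ ∫ ζ, δ ^ (1 / 8 : ℝ) * (‖F ζ‖ * ‖z - ζ‖ ^ (-(9 / 8) : ℝ)) := by
        refine integral_mono ((h.integrable_div z).sub (h.integrable_truncKernel hδ z)).norm
          ((h.integrable_kernel z).const_mul _) fun ζ => ?_
        have e : F ζ / (z - ζ) - F ζ * truncKernel δ (z - ζ) =
          F ζ * (1 / (z - ζ) - truncKernel δ (z - ζ)) := by ring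
        simp only
        rw [e, norm_mul, mul_left_comm]
        gcongr
        exact norm_inv_sub_truncKernel_le hδ _
    _ ≤ _ := by
        rw [integral_const_mul]
        gcongr
        exact h.integral_le z

lemma exists_delta (C : ℝ) {ε : ℝ} (hε : 0 < ε) : ∃ δ : ℝ, 0 < δ ∧ δ ^ (1 / 8 : ℝ) * C < ε := by
  have : Tendsto (fun δ : ℝ => δ ^ (1 / 8 : ℝ) * C) (𝓝[>] 0) (𝓝 (0 ^ (1 / 8 : ℝ) * C)) :=
    (((Real.continuous_rpow_const (by norm_num)).tendsto 0).mono_left nhdsWithin_le_nhds).mul_const _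
  rw [Real.zero_rpow (by norm_num), zero_mul] at this
  obtain ⟨δ, h1, h2⟩ := ((this.eventually_lt_const hε).and self_mem_nhdsWithin).exists
  exact ⟨δ, h2, h1⟩

/-- A uniform limit of continuous functions: the truncated kernels are bounded and continuous, and
the error in `norm_sub_trunc_le` does not depend on `z`. -/
lemma continuous_integral (h : HasKatoBound F C) : Continuous fun z => ∫ ζ, F ζ / (z - ζ) := by
  refine continuous_of_uniform_approx_of_continuous fun u hu => ?_
  obtain ⟨ε, hε, hεu⟩ := Metric.mem_uniformity_dist.1 hu
  obtain ⟨δ, hδ, hδε⟩ := exists_delta C hε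
  refine ⟨fun z => ∫ ζ, F ζ * truncKernel δ (z - ζ), ?_, fun z => hεu ?_⟩
  · refine continuous_of_dominated (bound := fun ζ => ‖F ζ‖ * (1 / δ))
      (fun z => (h.integrable_truncKernel hδ z).aestronglyMeasurable)
      (fun z => Eventually.of_forall fun ζ => ?_) (h.integrable.norm.mul_const _)
      (Eventually.of_forall fun ζ => ?_)
    · rw [norm_mul]
      gcongr
      exact (norm_truncKernel_le hδ _).trans (by gcongr; exact le_max_right _ _)
    · exact continuous_const.mul ((continuous_truncKernel hδ).comp (by fun_prop))
  · rw [dist_eq_norm]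
    exact (h.norm_sub_trunc_le hδ z).trans_lt hδε

lemma continuous_solidCauchy (h : HasKatoBound F C) : Continuous (solidCauchy F) :=
  continuous_const.mul h.continuous_integral

lemma tendsto_trunc (h : HasKatoBound F C) {δ : ℝ} (hδ : 0 < δ) :
    Tendsto (fun z => ∫ ζ, F ζ * truncKernel δ (z - ζ)) (cocompact ℂ) (𝓝 0) := by
  have : (cocompact ℂ).IsCountablyGenerated := by
    rw [← Metric.cobounded_eq_cocompact, ← comap_norm_atTop]; infer_instance
  have := tendsto_integral_filter_of_dominated_convergence (l := cocompact ℂ) (μ := volume)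
    (F := fun z ζ => F ζ * truncKernel δ (z - ζ)) (f := fun _ => (0 : ℂ)) (fun ζ => ‖F ζ‖ * (1 / δ))
    (Eventually.of_forall fun z => (h.integrable_truncKernel hδ z).aestronglyMeasurable)
    (Eventually.of_forall fun z => Eventually.of_forall fun ζ => ?_) (h.integrable.norm.mul_const _)
    (Eventually.of_forall fun ζ => ?_)
  · simpa using this
  · rw [norm_mul]
    gcongr
    exact (norm_truncKernel_le hδ _).trans (by gcongr; exact le_max_right _ _)
  · have h1 : Tendsto (fun z : ℂ => ‖z - ζ‖) (cocompact ℂ) atTop := by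
      have h2 := tendsto_atTop_add_const_right _ (-‖ζ‖) (tendsto_norm_cocompact_atTop (E := ℂ))
      refine tendsto_atTop_mono (fun z => ?_) h2
      linarith [norm_sub_norm_le z ζ]
    have h2 : Tendsto (fun z => truncKernel δ (z - ζ)) (cocompact ℂ) (𝓝 0) := by
      refine squeeze_zero_norm (fun z => (norm_truncKernel_le hδ _)) ?_
      exact tendsto_const_nhds.div_atTop (tendsto_atTop_mono (fun z => le_max_left _ _) h1)
    simpa using h2.const_mul (F ζ)

lemma tendsto_solidCauchy (h : HasKatoBound F C) :
    Tendsto (solidCauchy F) (cocompact ℂ) (𝓝 0) := by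
  have : Tendsto (fun z => ∫ ζ, F ζ / (z - ζ)) (cocompact ℂ) (𝓝 0) := by
    rw [Metric.tendsto_nhds]
    intro ε hε
    obtain ⟨δ, hδ, hδε⟩ := exists_delta C (half_pos hε)
    filter_upwards [Metric.tendsto_nhds.1 (h.tendsto_trunc hδ) (ε / 2) (half_pos hε)] with z hz
    have h2 := h.norm_sub_trunc_le hδ z
    rw [dist_zero_right] at hz ⊢
    have h3 := norm_sub_norm_le (∫ ζ, F ζ / (z - ζ)) (∫ ζ, F ζ * truncKernel δ (z - ζ))
    linarith
  have h2 := this.const_mul (1 / (Real.pi : ℂ))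
  rwa [mul_zero] at h2

/-- The solid Cauchy transform inverts `∂̄` in the sense of distributions. -/
lemma weak_dbar (h : HasKatoBound F C) {φ : ℂ → ℂ} (hφ : ContDiff ℝ 1 φ)
    (hc : HasCompactSupport φ) :
    ∫ z, solidCauchy F z * dbar φ z = -∫ z, F z * φ z := by
  set ψ := dbar φ with hψ
  have hψc : Continuous ψ := continuous_dbar hφ
  have hψs : HasCompactSupport ψ := hasCompactSupport_dbar hc
  have hm : AEStronglyMeasurable (Function.uncurry fun z ζ => F ζ / (z - ζ) * ψ z)
      (volume.prod volume) := by
    have h1 : AEStronglyMeasurable (fun p : ℂ × ℂ => F p.2) (volume.prod volume) :=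
      h.integrable.aestronglyMeasurable.comp_snd
    have h2 : Measurable fun p : ℂ × ℂ => (p.1 - p.2)⁻¹ := by fun_prop
    have h3 : Continuous fun p : ℂ × ℂ => ψ p.1 := by fun_prop
    refine ((h1.mul h2.aestronglyMeasurable).mul h3.aestronglyMeasurable).congr
      (Eventually.of_forall fun p => ?_)
    simp [Function.uncurry, div_eq_mul_inv]
  have hI : Integrable (Function.uncurry fun z ζ => F ζ / (z - ζ) * ψ z) (volume.prod volume) := by
    rw [integrable_prod_iff hm]
    refine ⟨Eventually.of_forall fun z => (h.integrable_div z).mul_const (ψ z), ?_⟩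
    refine ((hψc.norm.integrable_of_hasCompactSupport hψs.norm).const_mul
      ((∫ ζ, ‖F ζ‖) + C)).mono' hm.norm.integral_prod_right' (Eventually.of_forall fun z => ?_)
    simp only [Function.uncurry, norm_mul, norm_div]
    rw [integral_mul_const, Real.norm_of_nonneg (by positivity)]
    gcongr
    simpa [div_eq_mul_inv] using h.integral_inv_le z
  have e1 : ∀ z, solidCauchy F z * ψ z =
      (1 / (Real.pi : ℂ)) * ∫ ζ, F ζ / (z - ζ) * ψ z := fun z => by
    rw [integral_mul_const, solidCauchy]; ring
  simp only [e1]
  -- After Fubini the inner integral is the Cauchy–Pompeiu integral of `φ` at `ζ`, which equals `-π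
  -- * φ ζ`.
  rw [integral_const_mul, integral_integral_swap hI, ← integral_const_mul, ← integral_neg]
  congr 1 with ζ
  have e2 : ∀ z, F ζ / (z - ζ) * ψ z = F ζ * (ψ z / (z - ζ)) := fun z => by ring
  simp only [e2]
  rw [integral_const_mul, integral_dbar_div_sub hφ hc]
  have : (Real.pi : ℂ) ≠ 0 := by exact_mod_cast Real.pi_ne_zero
  field_simp

end HasKatoBound

/-! ### Green's theorem with an exceptional contour. -/

lemma intervalIntegral_rect {g : ℝ × ℝ → ℂ} (hg : Integrable g) {a b c d : ℝ} (hab : a ≤ b)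
    (hcd : c ≤ d) :
    ∫ x in a..b, ∫ y in c..d, g (x, y) = ∫ p in Ioc a b ×ˢ Ioc c d, g p := by
  rw [Measure.volume_eq_prod, setIntegral_prod _ (by
    rw [← Measure.volume_eq_prod]; exact hg.integrableOn), intervalIntegral.integral_of_le hab]
  simp only [intervalIntegral.integral_of_le hcd]

lemma setIntegral_four_rects {g : ℝ × ℝ → ℂ} (hg : Integrable g) {R : ℝ} (hR : 0 ≤ R) :
    (∫ p in Ioc 0 R ×ˢ Ioc 0 R, g p) + (∫ p in Ioc (-R) 0 ×ˢ Ioc 0 R, g p) +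
      ((∫ p in Ioc 0 R ×ˢ Ioc (-R) 0, g p) + (∫ p in Ioc (-R) 0 ×ˢ Ioc (-R) 0, g p)) =
      ∫ p in Ioc (-R) R ×ˢ Ioc (-R) R, g p := by
  have hdisj : Disjoint (Ioc 0 R) (Ioc (-R) 0) := by
    rw [Set.disjoint_left]; intro x h1 h2; exact absurd h1.1 (not_lt.2 h2.2)
  have hun : Ioc 0 R ∪ Ioc (-R) 0 = Ioc (-R) R := by
    rw [union_comm, Ioc_union_Ioc_eq_Ioc (by linarith) hR]
  have h1 : ∀ t : Set ℝ, MeasurableSet t → (∫ p in Ioc 0 R ×ˢ t, g p) +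
      (∫ p in Ioc (-R) 0 ×ˢ t, g p) = ∫ p in Ioc (-R) R ×ˢ t, g p := by
    intro t ht
    rw [← hun, union_prod, setIntegral_union (hdisj.set_prod_left _ _)
      (measurableSet_Ioc.prod ht) hg.integrableOn hg.integrableOn]
  rw [h1 _ measurableSet_Ioc, h1 _ measurableSet_Ioc]
  conv_rhs => rw [← hun]
  rw [hun, ← hun, prod_union, setIntegral_union (hdisj.set_prod_right _ _)
      (measurableSet_Ioc.union measurableSet_Ioc |>.prod measurableSet_Ioc) hg.integrableOn hg.integrableOn]

/-- **Green's theorem**: the integral of `∂̄F` vanishes for a continuous compactly supported `F`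
that is differentiable off the coordinate axes. -/
lemma integral_dbar_eq_zero_of_axes {F : ℂ → ℂ} (hc : Continuous F) (hs : HasCompactSupport F)
    (hd : ∀ z : ℂ, z.re ≠ 0 → z.im ≠ 0 → DifferentiableAt ℝ F z) (hi : Integrable (dbar F)) :
    ∫ z, dbar F z = 0 := by
  obtain ⟨R, hR0, hR⟩ : ∃ R : ℝ, 0 < R ∧ ∀ z, R ≤ ‖z‖ → F z = 0 ∧ dbar F z = 0 := by
    obtain ⟨R, hR⟩ := hs.isCompact.isBounded.subset_closedBall 0
    refine ⟨max R 0 + 1, by positivity, fun z hz => ?_⟩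
    have hz' : z ∉ tsupport F := fun h => by
      have := hR h
      rw [mem_closedBall_zero_iff] at this
      have := le_max_left R 0
      linarith
    refine ⟨image_eq_zero_of_notMem_tsupport hz', ?_⟩
    have : fderiv ℝ F z = 0 :=
      image_eq_zero_of_notMem_tsupport (fun h => hz' (tsupport_fderiv_subset ℝ h))
    simp [dbar, this]
  set g : ℝ × ℝ → ℂ := fun p => dbar F (p.1 + p.2 * Complex.I) with hg
  have hmp := (Complex.volume_preserving_equiv_real_prod.symm)
  have hgi : Integrable g := by
    have := (hmp.integrable_comp_emb Complex.measurableEquivRealProd.symm.measurableEmbedding).2 hi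
    refine this.congr (Eventually.of_forall fun p => ?_)
    simp [hg, Complex.measurableEquivRealProd_symm_apply, Complex.mk_eq_add_mul_I]
  have hge : ∫ z, dbar F z = ∫ p, g p := by
    rw [← hmp.integral_comp Complex.measurableEquivRealProd.symm.measurableEmbedding]
    congr 1 with p
    simp [hg, Complex.measurableEquivRealProd_symm_apply, Complex.mk_eq_add_mul_I]
  have hset : ∫ p, g p = ∫ p in Ioc (-R) R ×ˢ Ioc (-R) R, g p := by
    refine (setIntegral_eq_integral_of_forall_compl_eq_zero fun p hp => ?_).symm
    refine (hR _ ?_).2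
    by_contra! h
    apply hp
    have h1 := (Complex.abs_re_le_norm _).trans_lt h
    have h2 := (Complex.abs_im_le_norm _).trans_lt h
    simp only [Complex.add_re, Complex.ofReal_re, Complex.mul_re, Complex.I_re, Complex.add_im,
      Complex.ofReal_im, Complex.mul_im, Complex.I_im, mul_zero, mul_one, sub_zero, add_zero,
      zero_add, abs_lt] at h1 h2
    exact ⟨⟨h1.1, h1.2.le⟩, ⟨h2.1, h2.2.le⟩⟩
  -- The boundary formula for rectangles asks for differentiability in the open interior only; the
  -- last two conditions put that interior inside one quadrant, away from the axes.
  have key : ∀ z w : ℂ, z.re ≤ w.re → z.im ≤ w.im → (0 ≤ z.re ∨ w.re ≤ 0) →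
      (0 ≤ z.im ∨ w.im ≤ 0) →
      (∫ x : ℝ in z.re..w.re, F (x + z.im * Complex.I)) -
      (∫ x : ℝ in z.re..w.re, F (x + w.im * Complex.I)) +
      Complex.I • (∫ y : ℝ in z.im..w.im, F (w.re + y * Complex.I)) -
      Complex.I • (∫ y : ℝ in z.im..w.im, F (z.re + y * Complex.I)) =
      2 * Complex.I * ∫ p in Ioc z.re w.re ×ˢ Ioc z.im w.im, g p := by
    intro z w h1 h2 h3 h4
    rw [Complex.integral_boundary_rect_of_hasFDerivAt_real_off_countable F (fderiv ℝ F) z w ∅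
      countable_empty hc.continuousOn]
    · rw [← intervalIntegral_rect hgi h1 h2, ← intervalIntegral.integral_const_mul]
      simp only [← intervalIntegral.integral_const_mul]
      refine intervalIntegral.integral_congr fun x _ => ?_
      refine intervalIntegral.integral_congr fun y _ => ?_
      simp only [hg, dbar, smul_eq_mul]
      linear_combination (-(fderiv ℝ F (x + y * Complex.I) Complex.I)) * Complex.I_sq
    · intro x hx
      rw [min_eq_left h1, max_eq_right h1, min_eq_left h2, max_eq_right h2] at hx
      obtain ⟨⟨⟨a1, a2⟩, ⟨a3, a4⟩⟩, -⟩ := hx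
      refine (hd x ?_ ?_).hasFDerivAt
      · rcases h3 with h3 | h3 <;> intro h <;> linarith
      · rcases h4 with h4 | h4 <;> intro h <;> linarith
    · refine Integrable.integrableOn ?_
      refine (hi.const_mul (2 * Complex.I)).congr (Eventually.of_forall fun z => ?_)
      simp only [dbar, smul_eq_mul]
      linear_combination (fderiv ℝ F z Complex.I) * Complex.I_sq
  have z1 : ∀ x : ℝ, F (x + R * Complex.I) = 0 := fun x => (hR _ (by
    have := Complex.abs_im_le_norm (x + R * Complex.I)
    simp at this; exact (le_abs_self R).trans this)).1
  have z2 : ∀ x : ℝ, F (x - R * Complex.I) = 0 := fun x => (hR _ (by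
    have := Complex.abs_im_le_norm (x - R * Complex.I)
    simp at this; exact (le_abs_self R).trans this)).1
  have z3 : ∀ x : ℝ, F (R + x * Complex.I) = 0 := fun x => (hR _ (by
    have := Complex.abs_re_le_norm (R + x * Complex.I)
    simp at this; exact (le_abs_self R).trans this)).1
  have z4 : ∀ x : ℝ, F (-R + x * Complex.I) = 0 := fun x => (hR _ (by
    have := Complex.abs_re_le_norm (-R + x * Complex.I)
    simp at this; exact (le_abs_self R).trans this)).1
  have k1 := key 0 ⟨R, R⟩ hR0.le hR0.le (Or.inl le_rfl) (Or.inl le_rfl)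
  have k2 := key ⟨-R, 0⟩ ⟨0, R⟩ (by simpa using hR0.le) hR0.le (Or.inr le_rfl) (Or.inl le_rfl)
  have k3 := key ⟨0, -R⟩ ⟨R, 0⟩ hR0.le (by simpa using hR0.le) (Or.inl le_rfl) (Or.inr le_rfl)
  have k4 := key ⟨-R, -R⟩ 0 (by simpa using hR0.le) (by simpa using hR0.le) (Or.inr le_rfl)
    (Or.inr le_rfl)
  simp only [Complex.zero_re, Complex.zero_im, Complex.ofReal_zero, Complex.ofReal_neg, zero_mul,
    add_zero, z1, z2, z3, z4, neg_mul, ← sub_eq_add_neg, intervalIntegral.integral_zero,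
    smul_zero, sub_zero] at k1 k2 k3 k4
  rw [hge, hset, ← setIntegral_four_rects hgi hR0.le]
  have h2I : (2 * Complex.I) ≠ 0 := by simp
  refine (mul_eq_zero.1 ?_).resolve_left h2I
  -- The outer edges contribute nothing (`z1` to `z4`). Each inner edge occurs twice with opposite
  -- orientations, so the four boundary integrals cancel.
  rw [mul_add, mul_add, mul_add, ← k1, ← k2, ← k3, ← k4]
  simp only [zero_add]
  ring

lemma volume_line_eq_zero {a b : ℝ} (hab : a ≠ 0 ∨ b ≠ 0) (c : ℝ) :
    volume {z : ℂ | a * z.re + b * z.im = c} = 0 := by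
  rcases Set.eq_empty_or_nonempty {z : ℂ | a * z.re + b * z.im = c} with h | ⟨w, hw⟩
  · rw [h]; exact measure_empty
  set ℓ : ℂ →ₗ[ℝ] ℝ := a • Complex.reLm + b • Complex.imLm with hℓ
  have hker : ℓ.ker ≠ ⊤ := by
    rw [Ne, LinearMap.ker_eq_top]
    intro h0
    rcases hab with h | h
    · exact h (by simpa [hℓ] using LinearMap.congr_fun h0 1)
    · exact h (by simpa [hℓ] using LinearMap.congr_fun h0 Complex.I)
  have h := Measure.addHaar_submodule (volume : Measure ℂ) ℓ.ker hker
  have : {z : ℂ | a * z.re + b * z.im = c} = (fun z => z + (-w)) ⁻¹' (ℓ.ker : Set ℂ) := by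
    ext z
    simp only [mem_ofPred_eq, mem_preimage, SetLike.mem_coe, LinearMap.mem_ker, hℓ,
      LinearMap.add_apply, LinearMap.smul_apply, Complex.reLm_coe, Complex.imLm_coe, smul_eq_mul,
      Complex.add_re, Complex.neg_re, Complex.add_im, Complex.neg_im]
    rw [mem_ofPred_eq] at hw
    constructor <;> intro h <;> linarith
  rw [this, measure_preimage_add_right, h]

lemma isClosed_contour (z₀ : ℝ) : IsClosed (contour z₀) :=
  isClosed_eq (by fun_prop) (by fun_prop)

lemma volume_contour (z₀ : ℝ) : volume (contour z₀) = 0 := by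
  have h : contour z₀ ⊆ {z : ℂ | 1 * z.re + (-1) * z.im = z₀} ∪ {z : ℂ | 1 * z.re + 1 * z.im = z₀} := by
    intro z hz
    rcases abs_eq_abs.1 (show |z.im| = |z.re - z₀| from hz) with h | h
    · left; simp only [mem_ofPred_eq]; linarith
    · right; simp only [mem_ofPred_eq]; linarith
  refine measure_mono_null h (measure_union_null ?_ ?_) <;> exact volume_line_eq_zero (by simp) _

lemma dense_compl_contour (z₀ : ℝ) : Dense (contour z₀)ᶜ := by
  have : interior (contour z₀) = ∅ :=
    interior_eq_empty_iff_dense_compl.2 (by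
      refine Measure.dense_of_ae (μ := volume) ?_
      exact measure_eq_zero_iff_ae_notMem.1 (volume_contour z₀))
  exact interior_eq_empty_iff_dense_compl.1 this

/-- Chain rule for a holomorphic inner map: only the conjugate of its derivative enters. For a
rotation this is a nonzero constant, so the vanishing of `∫ ∂̄F` is invariant under rotations. -/
lemma dbar_comp_affine {F : ℂ → ℂ} {a e z : ℂ} (hF : DifferentiableAt ℝ F (a + e * z)) :
    dbar (fun w => F (a + e * w)) z = starRingEnd ℂ e * dbar F (a + e * z) := by
  have h0 : HasFDerivAt (fun w : ℂ => a + e * w) (e • ContinuousLinearMap.id ℝ ℂ) z := by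
    simpa using ((hasFDerivAt_id (𝕜 := ℝ) z).const_mul e).const_add a
  have h1 := hF.hasFDerivAt.comp z h0
  have h2 : ∀ v : ℂ, v = v.re • (1 : ℂ) + v.im • Complex.I := fun v => by
    apply Complex.ext <;> simp
  have h3 : fderiv ℝ (fun w => F (a + e * w)) z = _ := h1.fderiv
  rw [dbar, dbar, h3]
  generalize fderiv ℝ F (a + e * z) = L
  simp only [ContinuousLinearMap.comp_apply, smul_apply,
    ContinuousLinearMap.id_apply, smul_eq_mul, mul_one]
  have h4 : starRingEnd ℂ e = e.re - e.im * Complex.I := by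
    apply Complex.ext <;> simp
  have h5 : ∀ v : ℂ, L v = v.re * L 1 + v.im * L Complex.I := fun v => by
    conv_lhs => rw [h2 v]
    rw [map_add, map_smul, map_smul, Complex.real_smul, Complex.real_smul]
  rw [h4, h5 (e * Complex.I), h5 e]
  simp only [Complex.mul_re, Complex.mul_im, Complex.I_re, Complex.I_im, mul_zero,
    mul_one, zero_sub, add_zero, Complex.ofReal_neg]
  linear_combination ((1/2) * e.im * L Complex.I) * Complex.I_sq

lemma dbar_mul {f φ : ℂ → ℂ} {z : ℂ} (hf : DifferentiableAt ℝ f z) (hφ : DifferentiableAt ℝ φ z) :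
    dbar (fun w => f w * φ w) z = dbar f z * φ z + f z * dbar φ z := by
  have h : fderiv ℝ (fun w => f w * φ w) z = _ := fderiv_fun_mul hf hφ
  rw [dbar, h, dbar, dbar]
  simp
  ring

/-- Rotation by `π/4` about `z₀` maps the coordinate axes to the contour. -/
lemma mem_contour_rotate_iff (z₀ : ℝ) (w : ℂ) :
    (z₀ : ℂ) + (Circle.exp (Real.pi / 4) : ℂ) * w ∈ contour z₀ ↔ w.re = 0 ∨ w.im = 0 := by
  have he : (Circle.exp (Real.pi / 4) : ℂ) = (√2 / 2 : ℝ) * (1 + Complex.I) := by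
    rw [Circle.coe_exp, Complex.exp_mul_I, ← Complex.ofReal_cos, ← Complex.ofReal_sin,
      Real.cos_pi_div_four, Real.sin_pi_div_four]
    ring
  have h2 : 0 < (√2 / 2 : ℝ) := by positivity
  simp only [contour, mem_ofPred_eq, he]
  rw [mul_assoc]
  simp only [Complex.add_im, Complex.ofReal_im, Complex.add_re,
    Complex.ofReal_re, zero_add, add_sub_cancel_left, Complex.mul_im,
    Complex.mul_re, Complex.one_re, Complex.one_im, Complex.I_re, Complex.I_im, add_zero,
    one_mul, zero_mul, sub_zero]
  rw [abs_mul, abs_mul, mul_right_inj' (by positivity), abs_eq_abs]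
  constructor
  · rintro (h | h)
    · right; linarith
    · left; linarith
  · rintro (h | h)
    · right; rw [h]; ring
    · left; rw [h]; ring

/-- **Green's theorem** for a continuous compactly supported function that is differentiable off the
contour. -/
lemma integral_dbar_eq_zero_of_contour {z₀ : ℝ} {F : ℂ → ℂ} (hc : Continuous F)
    (hs : HasCompactSupport F) (hd : ∀ z, z ∉ contour z₀ → DifferentiableAt ℝ F z)
    (hi : Integrable (dbar F)) : ∫ z, dbar F z = 0 := by
  set e : Circle := Circle.exp (Real.pi / 4)
  set ρ : ℂ ≃ᵐ ℂ := ((rotation e).toMeasurableEquiv).trans (MeasurableEquiv.addLeft (z₀ : ℂ))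
  have hρ : ∀ w, ρ w = z₀ + e * w := fun w => rfl
  have hmp : MeasurePreserving ρ :=
    (measurePreserving_add_left volume (z₀ : ℂ)).comp (rotation e).measurePreserving
  have hρh : ∀ w, (fun w => F (z₀ + e * w)) w = F (ρ w) := fun w => rfl
  have hae : ∀ w : ℂ, w.re ≠ 0 → w.im ≠ 0 →
      DifferentiableAt ℝ F (z₀ + e * w) := fun w h1 h2 =>
    hd _ (by rw [mem_contour_rotate_iff]; tauto)
  have hdb : ∀ᵐ w : ℂ, dbar (fun w => F (z₀ + e * w)) w = starRingEnd ℂ e * dbar F (ρ w) := by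
    have h1 := measure_eq_zero_iff_ae_notMem.1 (volume_line_eq_zero (a := 1) (b := 0) (by simp) 0)
    have h2 := measure_eq_zero_iff_ae_notMem.1 (volume_line_eq_zero (a := 0) (b := 1) (by simp) 0)
    filter_upwards [h1, h2] with w h1 h2
    exact dbar_comp_affine (hae w (by simpa using h1) (by simpa using h2))
  have hcs : HasCompactSupport (fun w => F (z₀ + e * w)) :=
    hs.comp_homeomorph ((rotation e).toHomeomorph.trans (Homeomorph.addLeft (z₀ : ℂ)))
  have hdd : ∀ w : ℂ, w.re ≠ 0 → w.im ≠ 0 →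
      DifferentiableAt ℝ (fun w => F (z₀ + e * w)) w := fun w h1 h2 =>
    (hae w h1 h2).comp w (by fun_prop)
  have hint : Integrable (dbar (fun w => F (z₀ + e * w))) :=
    Integrable.congr (((hmp.integrable_comp_emb ρ.measurableEmbedding).2 hi).const_mul _)
      (hdb.mono fun w hw => hw.symm)
  have h0 := integral_dbar_eq_zero_of_axes (F := fun w => F (z₀ + e * w)) (by fun_prop) hcs hdd hint
  rw [integral_congr_ae hdb, integral_const_mul, hmp.integral_comp ρ.measurableEmbedding] at h0
  exact (mul_eq_zero.1 h0).resolve_left fun h => Circle.coe_ne_zero e ((map_eq_zero _).1 h)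

/-! ### Gluing, removable singularities and Liouville's theorem. -/

/-- Gluing across the contour: if `∂̄f = g` off the contour and `f` extends continuously to it, then
`f` differs from the solid Cauchy transform of `g` by a holomorphic function. -/
lemma differentiableOn_extendFrom_sub_solidCauchy {z₀ : ℝ} {O P : Set ℂ} {f g : ℂ → ℂ} {C : ℝ}
    (hO : IsOpen O) (hP : P.Finite) (hg : HasKatoBound g C)
    (hd : ∀ z ∈ O, z ∉ contour z₀ → z ∉ P → DifferentiableAt ℝ f z ∧ dbar f z = g z)
    (hl : ∀ z ∈ O, z ∈ contour z₀ → z ∉ P → ∃ y, Tendsto f (𝓝[(contour z₀)ᶜ] z) (𝓝 y)) :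
    DifferentiableOn ℂ (fun z => extendFrom (contour z₀)ᶜ f z - solidCauchy g z) (O \ P) := by
  set S := contour z₀ with hS
  set ft := extendFrom Sᶜ f with hft
  have hSo : IsOpen Sᶜ := (isClosed_contour z₀).isOpen_compl
  have hU : IsOpen (O \ P) := hO.sdiff hP.isClosed
  have hcont : ContinuousOn ft (O \ P) := by
    refine continuousOn_extendFrom (fun z _ => dense_compl_contour z₀ z) ?_
    rintro z ⟨hzO, hzP⟩
    by_cases hz : z ∈ S
    · exact hl z hzO hz hzP
    · exact ⟨f z, ((hd z hzO hz hzP).1.continuousAt).continuousWithinAt⟩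
  have heq : ∀ z ∈ O \ P, z ∉ S → ft =ᶠ[𝓝 z] f := by
    intro z hz hzS
    filter_upwards [hU.mem_nhds hz, hSo.mem_nhds hzS] with w hw hwS
    exact extendFrom_eq (dense_compl_contour z₀ w)
      ((hd w hw.1 hwS hw.2).1.continuousAt).continuousWithinAt
  -- By Weyl's lemma a weak statement suffices. It is Green's theorem for the product of the
  -- extension with a test function; the product is continuous on the whole plane because the test
  -- function vanishes near the complement of `O \ P`.
  refine differentiableOn_of_weak_dbar_eq_zero hU
    (hcont.sub hg.continuous_solidCauchy.continuousOn) fun φ hφ hφc hφU => ?_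
  have hφ1 : ContDiff ℝ 1 φ := hφ.of_le (by exact_mod_cast le_top)
  set F : ℂ → ℂ := fun z => ft z * φ z with hF
  have hoff : ∀ z, z ∉ O \ P → φ =ᶠ[𝓝 z] 0 := fun z hz =>
    notMem_tsupport_iff_eventuallyEq.1 fun h => hz (hφU h)
  have hdoff : ∀ z, z ∉ O \ P → dbar φ z = 0 := fun z hz => by
    have := (hoff z hz).fderiv_eq (𝕜 := ℝ)
    rw [dbar, this]; simp
  have hcmul : ∀ ψ : ℂ → ℂ, Continuous ψ → (∀ z, z ∉ O \ P → ψ =ᶠ[𝓝 z] 0) →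
      Continuous fun z => ft z * ψ z := by
    intro ψ hψ h0
    rw [continuous_iff_continuousAt]
    intro z
    by_cases hz : z ∈ O \ P
    · exact (hcont.continuousAt (hU.mem_nhds hz)).mul hψ.continuousAt
    · have : (fun z => ft z * ψ z) =ᶠ[𝓝 z] fun _ => 0 := by
        filter_upwards [h0 z hz] with w hw
        simp [hw]
      exact continuousAt_const.congr this.symm
  have hFc : Continuous F := hcmul φ hφ.continuous hoff
  have hdc : Continuous fun z => ft z * dbar φ z := by
    refine hcmul _ (continuous_dbar hφ1) fun z hz => ?_
    have := (hoff z hz).eventuallyEq_nhds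
    filter_upwards [this] with w hw
    have := hw.fderiv_eq (𝕜 := ℝ)
    rw [dbar, this]; simp
  have hFs : HasCompactSupport F := hφc.mul_left
  have hds : HasCompactSupport fun z => ft z * dbar φ z := (hasCompactSupport_dbar hφc).mul_left
  have hFd : ∀ z, z ∉ S → DifferentiableAt ℝ F z ∧ dbar F z = g z * φ z + ft z * dbar φ z := by
    intro z hz
    by_cases hzU : z ∈ O \ P
    · have h1 := heq z hzU hz
      obtain ⟨h2, h3⟩ := hd z hzU.1 hz hzU.2
      have h4 : DifferentiableAt ℝ ft z := h2.congr_of_eventuallyEq h1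
      have h5 : dbar ft z = g z := by rw [← h3, dbar, h1.fderiv_eq, dbar]
      have h6 := hφ1.differentiable one_ne_zero z
      exact ⟨h4.mul h6, by rw [hF, dbar_mul h4 h6, h5]⟩
    · have h1 : F =ᶠ[𝓝 z] fun _ => 0 := by
        filter_upwards [hoff z hzU] with w hw
        simp [hF, hw]
      refine ⟨(differentiableAt_const 0).congr_of_eventuallyEq h1, ?_⟩
      rw [hdoff z hzU, (hoff z hzU).eq_of_nhds, dbar, h1.fderiv_eq]
      simp
  have hgφ : Integrable fun z => g z * φ z := by
    obtain ⟨B, hB⟩ := hφ.continuous.bounded_above_of_compact_support hφc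
    exact hg.integrable.mul_bdd hφ.continuous.aestronglyMeasurable (Eventually.of_forall hB)
  have hae : ∀ᵐ z : ℂ, dbar F z = g z * φ z + ft z * dbar φ z := by
    filter_upwards [measure_eq_zero_iff_ae_notMem.1 (volume_contour z₀)] with z hz
    exact (hFd z hz).2
  have hI2 : Integrable fun z => ft z * dbar φ z := hdc.integrable_of_hasCompactSupport hds
  have hFi : Integrable (dbar F) := (hgφ.add hI2).congr (hae.mono fun z hz => hz.symm)
  have h0 := integral_dbar_eq_zero_of_contour hFc hFs (fun z hz => (hFd z hz).1) hFi
  rw [integral_congr_ae hae, integral_add hgφ hI2] at h0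
  have hI3 : Integrable fun z => solidCauchy g z * dbar φ z :=
    (hg.continuous_solidCauchy.mul (continuous_dbar hφ1)).integrable_of_hasCompactSupport
      ((hasCompactSupport_dbar hφc).mul_left)
  simp only [sub_mul]
  rw [integral_sub hI2 hI3, hg.weak_dbar hφ1 hφc]
  linear_combination h0

/-- Removal of finitely many isolated singularities near which the function is bounded. -/
lemma exists_differentiableOn_of_bounded {O P : Set ℂ} {h : ℂ → ℂ} (hO : IsOpen O) (hP : P.Finite)
    (hd : DifferentiableOn ℂ h (O \ P))
    (hb : ∀ p ∈ O ∩ P, ∃ C : ℝ, ∀ᶠ z in 𝓝[≠] p, ‖h z‖ ≤ C) :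
    ∃ k : ℂ → ℂ, DifferentiableOn ℂ k O ∧ EqOn k h (O \ P) := by
  classical
  refine ⟨fun z => if z ∈ P then limUnder (𝓝[≠] z) h else h z, ?_, fun z hz => if_neg hz.2⟩
  intro p hp
  refine DifferentiableAt.differentiableWithinAt ?_
  by_cases hpP : p ∈ P
  · obtain ⟨C, hC⟩ := hb p ⟨hp, hpP⟩
    have hfin : (P \ {p})ᶜ ∈ 𝓝 p :=
      (hP.subset sdiff_subset).isClosed.isOpen_compl.mem_nhds (by simp)
    have hs : {z | z ∈ O ∧ z ∈ (P \ {p})ᶜ ∧ (z ∈ ({p} : Set ℂ)ᶜ → ‖h z‖ ≤ C)} ∈ 𝓝 p := by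
      filter_upwards [hO.mem_nhds hp, hfin, eventually_nhdsWithin_iff.1 hC] with z h1 h2 h3
      exact ⟨h1, h2, h3⟩
    set s := {z | z ∈ O ∧ z ∈ (P \ {p})ᶜ ∧ (z ∈ ({p} : Set ℂ)ᶜ → ‖h z‖ ≤ C)} with hsdef
    have hsub : s \ {p} ⊆ O \ P := by
      rintro z ⟨⟨h1, h2, -⟩, h3⟩
      exact ⟨h1, fun h4 => h2 ⟨h4, h3⟩⟩
    have := Complex.differentiableOn_update_limUnder_of_bddAbove hs (hd.mono hsub) ⟨C, by
      rintro _ ⟨z, ⟨hz, hz2⟩, rfl⟩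
      exact hz.2.2 hz2⟩
    refine (this.differentiableAt hs).congr_of_eventuallyEq ?_
    filter_upwards [hs] with z hz
    by_cases hzp : z = p
    · subst hzp; simp [hpP]
    · rw [Function.update_of_ne hzp, if_neg fun h4 => hz.2.1 ⟨h4, hzp⟩]
  · have hU : O \ P ∈ 𝓝 p := (hO.sdiff hP.isClosed).mem_nhds ⟨hp, hpP⟩
    refine (hd.differentiableAt hU).congr_of_eventuallyEq ?_
    filter_upwards [hU] with z hz
    rw [if_neg hz.2]

lemma extendFrom_mem_of_isClosed {S A : Set ℂ} {f : ℂ → ℂ} {z : ℂ} (hS : Dense Sᶜ)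
    (hl : ∃ y, Tendsto f (𝓝[Sᶜ] z) (𝓝 y)) (hA : IsClosed A) (h : ∀ᶠ w in 𝓝[Sᶜ] z, f w ∈ A) :
    extendFrom Sᶜ f z ∈ A := by
  have := mem_closure_iff_nhdsWithin_neBot.mp (hS z)
  exact hA.mem_of_tendsto (tendsto_extendFrom hl) h

lemma eventually_notMem_finite {P : Set ℂ} (hP : P.Finite) (p : ℂ) : ∀ᶠ z in 𝓝[≠] p, z ∉ P := by
  have hfin : (P \ {p})ᶜ ∈ 𝓝 p :=
    (hP.subset sdiff_subset).isClosed.isOpen_compl.mem_nhds (by simp)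
  filter_upwards [mem_nhdsWithin_of_mem_nhds hfin, self_mem_nhdsWithin] with z h1 h2 h3
  exact h1 ⟨h3, h2⟩

section Glue

variable {z₀ : ℝ} {O P : Set ℂ} {f g : ℂ → ℂ} {C : ℝ}

/-- Gluing across the contour, followed by removal of the points of `P`. The bound near `P` is
needed only off the contour, since it passes to the extension by density. -/
lemma exists_holomorphic_glue (hO : IsOpen O) (hP : P.Finite) (hg : HasKatoBound g C)
    (hd : ∀ z ∈ O, z ∉ contour z₀ → z ∉ P → DifferentiableAt ℝ f z ∧ dbar f z = g z)
    (hl : ∀ z ∈ O, z ∈ contour z₀ → z ∉ P → ∃ y, Tendsto f (𝓝[(contour z₀)ᶜ] z) (𝓝 y))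
    (hb : ∀ p ∈ O ∩ P, ∃ B : ℝ, ∀ᶠ z in 𝓝 p, z ∉ contour z₀ → z ∉ P → ‖f z‖ ≤ B) :
    ∃ k : ℂ → ℂ, DifferentiableOn ℂ k O ∧
      EqOn k (fun z => extendFrom (contour z₀)ᶜ f z - solidCauchy g z) (O \ P) ∧
      ∀ z ∈ O, z ∉ contour z₀ → z ∉ P → k z = f z - solidCauchy g z := by
  have hlim : ∀ z ∈ O, z ∉ P → ∃ y, Tendsto f (𝓝[(contour z₀)ᶜ] z) (𝓝 y) := by
    intro z hz hzP
    by_cases hzS : z ∈ contour z₀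
    · exact hl z hz hzS hzP
    · exact ⟨f z, (hd z hz hzS hzP).1.continuousAt.continuousWithinAt⟩
  obtain ⟨k, hk, hke⟩ := exists_differentiableOn_of_bounded hO hP
    (differentiableOn_extendFrom_sub_solidCauchy hO hP hg hd hl) (by
      rintro p ⟨hpO, hpP⟩
      obtain ⟨B, hB⟩ := hb p ⟨hpO, hpP⟩
      have h2 : ∀ᶠ z in 𝓝 p, ‖solidCauchy g z‖ < ‖solidCauchy g p‖ + 1 :=
        (hg.continuous_solidCauchy.norm.tendsto p).eventually_lt_const (by linarith)
      refine ⟨B + (‖solidCauchy g p‖ + 1), ?_⟩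
      filter_upwards [eventually_notMem_finite hP p, mem_nhdsWithin_of_mem_nhds (hO.mem_nhds hpO),
        mem_nhdsWithin_of_mem_nhds hB.eventually_nhds, mem_nhdsWithin_of_mem_nhds h2]
        with z hzP hzO hzB hz2
      have : extendFrom (contour z₀)ᶜ f z ∈ Metric.closedBall (0 : ℂ) B := by
        refine extendFrom_mem_of_isClosed (dense_compl_contour z₀) (hlim z hzO hzP)
          Metric.isClosed_closedBall ?_
        have hPn : Pᶜ ∈ 𝓝 z := hP.isClosed.isOpen_compl.mem_nhds hzP
        filter_upwards [mem_nhdsWithin_of_mem_nhds hzB, self_mem_nhdsWithin,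
          mem_nhdsWithin_of_mem_nhds hPn] with w h3 h4 h5
        rw [mem_closedBall_zero_iff]
        exact h3 h4 h5
      rw [mem_closedBall_zero_iff] at this
      exact (norm_sub_le _ _).trans (add_le_add this (le_of_lt hz2)))
  refine ⟨k, hk, hke, fun z hz hzS hzP => ?_⟩
  rw [hke ⟨hz, hzP⟩]
  simp only
  rw [extendFrom_eq (dense_compl_contour z₀ z)
    (hd z hz hzS hzP).1.continuousAt.continuousWithinAt]

/-- **Liouville's theorem** for functions that solve `∂̄f = g` off the contour. -/
lemma eq_add_solidCauchy_of_tendsto (hP : P.Finite) (hg : HasKatoBound g C) {c : ℂ}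
    (hd : ∀ z, z ∉ contour z₀ → z ∉ P → DifferentiableAt ℝ f z ∧ dbar f z = g z)
    (hl : ∀ z, z ∈ contour z₀ → z ∉ P → ∃ y, Tendsto f (𝓝[(contour z₀)ᶜ] z) (𝓝 y))
    (hb : ∀ p ∈ P, ∃ B : ℝ, ∀ᶠ z in 𝓝 p, z ∉ contour z₀ → z ∉ P → ‖f z‖ ≤ B)
    (hinf : Tendsto f (cocompact ℂ ⊓ 𝓟 (contour z₀)ᶜ) (𝓝 c)) :
    ∀ z, z ∉ contour z₀ → z ∉ P → f z = c + solidCauchy g z := by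
  obtain ⟨k, hk, hke, hkf⟩ := exists_holomorphic_glue (O := univ) isOpen_univ hP hg
    (fun z _ => hd z) (fun z _ => hl z) (fun p hp => hb p hp.2)
  have hlim : ∀ z, z ∉ P → ∃ y, Tendsto f (𝓝[(contour z₀)ᶜ] z) (𝓝 y) := by
    intro z hzP
    by_cases hzS : z ∈ contour z₀
    · exact hl z hzS hzP
    · exact ⟨f z, (hd z hzS hzP).1.continuousAt.continuousWithinAt⟩
  have h1 : Tendsto (extendFrom (contour z₀)ᶜ f) (cocompact ℂ) (𝓝 c) := by
    rw [Metric.nhds_basis_closedBall.tendsto_right_iff]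
    intro ε hε
    have := hinf (Metric.closedBall_mem_nhds c hε)
    rw [mem_map, mem_inf_principal, mem_cocompact] at this
    obtain ⟨K, hK, hKs⟩ := this
    filter_upwards [(hK.union hP.isCompact).compl_mem_cocompact] with z hz
    have hzn : (K ∪ P)ᶜ ∈ 𝓝 z :=
      (hK.isClosed.union hP.isClosed).isOpen_compl.mem_nhds hz
    refine extendFrom_mem_of_isClosed (dense_compl_contour z₀)
      (hlim z fun h => hz (Or.inr h)) Metric.isClosed_closedBall ?_
    filter_upwards [mem_nhdsWithin_of_mem_nhds hzn, self_mem_nhdsWithin] with w h3 h4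
    exact hKs (fun h => h3 (Or.inl h)) h4
  have h2 : Tendsto k (cocompact ℂ) (𝓝 c) := by
    have h3 := h1.sub hg.tendsto_solidCauchy
    rw [sub_zero] at h3
    refine h3.congr' ?_
    filter_upwards [hP.isCompact.compl_mem_cocompact] with z hz
    exact (hke ⟨mem_univ z, hz⟩).symm
  intro z hzS hzP
  have h3 := (differentiableOn_univ.1 hk).apply_eq_of_tendsto_cocompact z h2
  rw [hkf z (mem_univ z) hzS hzP] at h3
  linear_combination h3

end Glue

/-! ### A Phragmén–Lindelöf principle. -/

/-- **Phragmén–Lindelöf** in the half-plane `σ Im z > 0`, with one exceptional boundary point. -/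
lemma norm_le_of_halfPlane {σ z₀ m C₁ : ℝ} (hσ : σ = 1 ∨ σ = -1) {k : ℂ → ℂ}
    (hk : DifferentiableOn ℂ k {z | 0 < σ * z.im}) (hm : ∀ z : ℂ, 0 < σ * z.im → ‖k z‖ ≤ m)
    (hb : ∀ s : ℝ, s ≠ z₀ → ∃ y, Tendsto k (𝓝[{z | 0 < σ * z.im}] s) (𝓝 y) ∧ ‖y‖ ≤ C₁)
    {z : ℂ} (hz : 0 < σ * z.im) : ‖k z‖ ≤ C₁ := by
  have hσ2 : σ * σ = 1 := by rcases hσ with rfl | rfl <;> norm_num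
  have hσ0 : σ ≠ 0 := by rintro rfl; norm_num at hσ2
  have hC₁ : 0 ≤ C₁ := by
    obtain ⟨y, -, hy⟩ := hb (z₀ + 1) (by simp)
    exact (norm_nonneg y).trans hy
  set A : Set ℂ := {w | 0 < w.re} with hA
  -- A rotation followed by a translation carries the right half-plane to the half-plane of `σ`,
  -- with `0 ↦ z₀`.
  set ρ : ℂ → ℂ := fun w => z₀ + σ * Complex.I * w with hρ
  have hρim : ∀ w, σ * (ρ w).im = w.re := fun w => by
    have : (ρ w).im = σ * w.re := by simp [hρ]
    rw [this, ← mul_assoc, hσ2, one_mul]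
  have hρc : Continuous ρ := by fun_prop
  have hρA : MapsTo ρ A {z | 0 < σ * z.im} := fun w hw => by
    rw [mem_ofPred_eq, hρim]; exact hw
  have hw1 : ∀ w ∈ A, w + 1 ≠ 0 := fun w hw h => by
    have := congrArg Complex.re h
    simp only [Complex.add_re, Complex.one_re, Complex.zero_re] at this
    have h2 : 0 < w.re := hw
    linarith
  have hfac : ∀ w : ℂ, 0 ≤ w.re → ‖w / (w + 1)‖ ≤ 1 := fun w hw => by
    rw [norm_div]
    refine div_le_one_of_le₀ ?_ (norm_nonneg _)
    rw [← sq_le_sq₀ (norm_nonneg _) (norm_nonneg _), ← Complex.normSq_eq_norm_sq,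
      ← Complex.normSq_eq_norm_sq, Complex.normSq_apply, Complex.normSq_apply]
    simp only [Complex.add_re, Complex.one_re, Complex.add_im, Complex.one_im]
    nlinarith
  have hcl : closure A = {w | 0 ≤ w.re} := Complex.closure_setOfPred_lt_re 0
  -- The factor `w / (w + 1)` has modulus at most one and vanishes at the exceptional point, so the
  -- product has controlled values on the whole boundary. The power `n` serves to get rid of this
  -- factor at the end.
  have key : ∀ (n : ℕ), n ≠ 0 → ∀ w ∈ A, ‖w / (w + 1)‖ * ‖k (ρ w)‖ ^ n ≤ C₁ ^ n := by
    intro n hn w hw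
    set H : ℂ → ℂ := fun w => w / (w + 1) * k (ρ w) ^ n with hH
    have hHd : DifferentiableOn ℂ H A := by
      refine DifferentiableOn.mul (DifferentiableOn.div differentiableOn_id (by fun_prop) hw1)
        (DifferentiableOn.pow (hk.comp (by fun_prop) hρA) n)
    have hHm : ∀ w ∈ A, ‖H w‖ ≤ ‖w / (w + 1)‖ * m ^ n := fun w hw => by
      rw [hH]; simp only [norm_mul, norm_pow]
      gcongr
      exact hm _ (hρA hw)
    have hlim : ∀ w : ℂ, w.re = 0 → ∃ y, Tendsto H (𝓝[A] w) (𝓝 y) ∧ ‖y‖ ≤ C₁ ^ n := by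
      intro w hw
      have hne : w + 1 ≠ 0 := fun h => by
        have := congrArg Complex.re h
        simp [hw] at this
      have hfl : Tendsto (fun w : ℂ => w / (w + 1)) (𝓝[A] w) (𝓝 (w / (w + 1))) :=
        (ContinuousAt.div (f := fun w : ℂ => w) (g := fun w : ℂ => w + 1) continuousAt_id
          (by fun_prop) hne).tendsto.mono_left nhdsWithin_le_nhds
      by_cases hw0 : w = 0
      · refine ⟨0, ?_, by simpa using pow_nonneg hC₁ n⟩
        subst hw0
        have h3 : Tendsto (fun w : ℂ => ‖w / (w + 1)‖ * m ^ n) (𝓝[A] 0) (𝓝 0) := by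
          have := (hfl.norm).mul_const (m ^ n)
          simpa using this
        refine squeeze_zero_norm' ?_ h3
        filter_upwards [self_mem_nhdsWithin] with w hw using hHm w hw
      · obtain ⟨y, hy, hyC⟩ := hb (z₀ - σ * w.im) (by
          intro h
          have h4 : σ * w.im = 0 := by linarith
          have h5 := (mul_eq_zero.1 h4).resolve_left hσ0
          exact hw0 (Complex.ext hw h5))
        have h6 : Tendsto ρ (𝓝[A] w) (𝓝[{z | 0 < σ * z.im}] ((z₀ - σ * w.im : ℝ) : ℂ)) := by
          have h7 : ρ w = ((z₀ - σ * w.im : ℝ) : ℂ) := by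
            apply Complex.ext <;> simp [hρ, hw]; ring
          rw [← h7]
          exact tendsto_nhdsWithin_iff.2 ⟨hρc.continuousAt.tendsto.mono_left nhdsWithin_le_nhds,
            eventually_nhdsWithin_of_forall hρA⟩
        refine ⟨_, hfl.mul ((hy.comp h6).pow n), ?_⟩
        rw [norm_mul, norm_pow]
        calc _ ≤ 1 * C₁ ^ n := by
              gcongr
              exact hfac w hw.ge
          _ = _ := one_mul _
    have hAo : IsOpen A := isOpen_lt continuous_const Complex.continuous_re
    have hlim' : ∀ w ∈ closure A, ∃ y, Tendsto H (𝓝[A] w) (𝓝 y) := by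
      intro w hw
      rw [hcl] at hw
      rcases (show 0 ≤ w.re from hw).eq_or_lt with h | h
      · obtain ⟨y, hy, -⟩ := hlim w h.symm
        exact ⟨y, hy⟩
      · exact ⟨H w, (hHd.continuousOn w h)⟩
    set G := extendFrom A H with hG
    have hGH : ∀ w ∈ A, G w = H w := fun w hw => extendFrom_extends hHd.continuousOn w hw
    have hGd : DiffContOnCl ℂ G A :=
      ⟨hHd.congr hGH, continuousOn_extendFrom subset_rfl hlim'⟩
    have hGA : ∀ w ∈ A, ‖G w‖ ≤ |m| ^ n := fun w hw => by
      rw [hGH w hw]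
      refine (hHm w hw).trans ?_
      calc _ ≤ 1 * |m| ^ n := by
            have hm0 : 0 ≤ m := (norm_nonneg _).trans (hm _ (hρA hw))
            rw [abs_of_nonneg hm0]
            gcongr
            exact hfac w (le_of_lt hw)
        _ = _ := one_mul _
    have := PhragmenLindelof.right_half_plane_of_bounded_on_real (f := G) (C := C₁ ^ n) (z := w) hGd
      ⟨0, by norm_num, 0, by
        refine Asymptotics.IsBigO.of_bound (|m| ^ n) ?_
        rw [eventually_inf_principal]
        refine Eventually.of_forall fun w hw => ?_
        simpa using hGA w hw⟩
      ⟨|m| ^ n, by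
        rw [eventually_map]
        filter_upwards [eventually_gt_atTop 0] with x hx
        exact hGA x (by simpa [hA] using hx)⟩
      (fun x => by
        obtain ⟨y, hy, hyC⟩ := hlim (x * Complex.I) (by simp)
        rw [hG, extendFrom_eq (by rw [hcl]; simp) hy]
        exact hyC) (le_of_lt hw)
    rw [hGH w hw, hH] at this
    simpa only [norm_mul, norm_pow] using this
  obtain ⟨w, hw, rfl⟩ : ∃ w ∈ A, ρ w = z := by
    refine ⟨-(σ * Complex.I) * (z - z₀), ?_, ?_⟩
    · simp only [hA, mem_ofPred_eq]
      simpa using hz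
    · simp only [hρ]
      have : (σ : ℂ) * σ = 1 := by exact_mod_cast hσ2
      linear_combination (-(z - z₀)) * Complex.I ^ 2 * this - (z - z₀) * Complex.I_sq
  have hw0 : w ≠ 0 := by rintro rfl; simp [hA] at hw
  have hpos : 0 < ‖w / (w + 1)‖ := norm_pos_iff.2 (div_ne_zero hw0 (hw1 w hw))
  -- If the bound failed at this point, `(‖k (ρ w)‖ / C₁) ^ n` would exceed the fixed number `1 / ‖w
  -- / (w + 1)‖` for some `n`, against `key`. For `C₁ = 0` the case `n = 1` suffices.
  by_contra! hcon
  rcases hC₁.eq_or_lt with h0 | h0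
  · have := key 1 one_ne_zero w hw
    rw [← h0] at this hcon
    rw [pow_one, pow_one] at this
    have := mul_pos hpos hcon
    linarith
  · have hq : 1 < ‖k (ρ w)‖ / C₁ := (one_lt_div h0).2 hcon
    obtain ⟨n, hn⟩ := pow_unbounded_of_one_lt (1 / ‖w / (w + 1)‖) hq
    have hn0 : n ≠ 0 := by
      rintro rfl
      rw [pow_zero, div_lt_one hpos] at hn
      linarith [hfac w (le_of_lt hw)]
    have h1 := key n hn0 w hw
    rw [div_pow, lt_div_iff₀ (by positivity), div_mul_eq_mul_div, div_lt_iff₀ hpos] at hn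
    linarith

/-! ### Functions in H¹(ℝ) and the density ν. -/

section Sobolev

variable {r : ℝ → ℂ}

lemma integrable_norm_sq_of_memLp {g : ℝ → ℂ} (hg : MemLp g 2) : Integrable fun s => ‖g s‖ ^ 2 := by
  have := hg.integrable_norm_pow (p := 2) two_ne_zero
  simpa using this

lemma locallyIntegrable_of_memLp_two {g : ℝ → ℂ} (hg : MemLp g 2) :
    LocallyIntegrable g volume :=
  hg.locallyIntegrable (by norm_num)

/-- Cauchy–Schwarz in additive form: `‖g‖ ≤ l * ‖g‖ ^ 2 + 1 / l` pointwise, with `l = √|b - a|`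
chosen so that both terms integrate to multiples of `l`. The constant is not sharp. -/
lemma norm_intervalIntegral_le_sqrt {g : ℝ → ℂ} (hg : MemLp g 2) (a b : ℝ) :
    ‖∫ s in a..b, g s‖ ≤ ((∫ s, ‖g s‖ ^ 2) + 1) * √|b - a| := by
  wlog hab : a ≤ b generalizing a b
  · have := this b a (le_of_not_ge hab)
    rwa [intervalIntegral.integral_symm, norm_neg, abs_sub_comm]
  rcases hab.eq_or_lt with rfl | hlt
  · simp
  have hsq := integrable_norm_sq_of_memLp hg
  have hl : 0 < √|b - a| := Real.sqrt_pos.2 (abs_pos.2 (by linarith))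
  have hl2 : √|b - a| * √|b - a| = b - a := by
    rw [Real.mul_self_sqrt (abs_nonneg _), abs_of_pos (by linarith)]
  set l := √|b - a| with hldef
  have hgi : IntegrableOn (fun s => ‖g s‖) (Ioc a b) :=
    (((locallyIntegrable_of_memLp_two hg).integrableOn_isCompact isCompact_Icc).mono_set
      Ioc_subset_Icc_self).norm
  calc ‖∫ s in a..b, g s‖ ≤ ∫ s in Ioc a b, ‖g s‖ := by
        rw [intervalIntegral.integral_of_le hab]; exact norm_integral_le_integral_norm _
    _ ≤ ∫ s in Ioc a b, (l * ‖g s‖ ^ 2 + 1 / l) := by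
        refine setIntegral_mono hgi ((hsq.integrableOn.const_mul l).add
          (integrableOn_const (by simp))) fun s => ?_
        have h1 : 0 ≤ (l * ‖g s‖ - 1) ^ 2 := sq_nonneg _
        have h2 : 0 ≤ ‖g s‖ := norm_nonneg _
        have h3 : l * (l * ‖g s‖ ^ 2 + 1 / l) = l ^ 2 * ‖g s‖ ^ 2 + 1 := by field_simp
        refine le_of_mul_le_mul_left ?_ hl
        rw [h3]
        nlinarith [mul_nonneg hl.le h2]
    _ = l * (∫ s in Ioc a b, ‖g s‖ ^ 2) + l := by
        rw [integral_add (hsq.integrableOn.const_mul l) (integrableOn_const (by simp)),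
          integral_const_mul, setIntegral_const]
        simp only [Measure.real, Real.volume_Ioc, smul_eq_mul]
        rw [ENNReal.toReal_ofReal (by linarith), ← hl2]
        field_simp
    _ ≤ l * (∫ s, ‖g s‖ ^ 2) + l := by
        have h1 := setIntegral_le_integral (s := Ioc a b) hsq
          (Eventually.of_forall fun s => by positivity)
        have h2 := mul_le_mul_of_nonneg_left h1 hl.le
        linarith
    _ = _ := by ring

lemma MemH1.exists_holder (h : MemH1 r) : ∃ K : ℝ, 0 ≤ K ∧ ∀ a b, ‖r b - r a‖ ≤ K * √|b - a| := by
  obtain ⟨-, g, hg, hrg⟩ := h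
  refine ⟨(∫ s, ‖g s‖ ^ 2) + 1, ?_, fun a b => ?_⟩
  · have : 0 ≤ ∫ s, ‖g s‖ ^ 2 := integral_nonneg fun s => by positivity
    linarith
  · rw [hrg]; exact norm_intervalIntegral_le_sqrt hg a b

lemma MemH1.continuous (h : MemH1 r) : Continuous r := by
  obtain ⟨-, g, hg, hrg⟩ := h
  have h1 : r = fun b => r 0 + ∫ s in (0 : ℝ)..b, g s := by
    ext b; rw [← hrg]; ring
  rw [h1]
  exact continuous_const.add (intervalIntegral.continuous_primitive
    (fun a b => (locallyIntegrable_of_memLp_two hg).integrableOn_isCompact isCompact_uIcc |>.intervalIntegrable) 0)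

/-- On `[s, s + 1]` the Hölder condition gives `‖r s‖ ≤ ‖r a‖ + K`; averaging the squares over `a`
brings in the `L²` norm. -/
lemma MemH1.exists_bound (h : MemH1 r) : ∃ R : ℝ, 0 ≤ R ∧ ∀ s, ‖r s‖ ≤ R := by
  obtain ⟨K, hK0, hK⟩ := h.exists_holder
  have hsq := integrable_norm_sq_of_memLp h.1
  refine ⟨√(2 * (∫ s, ‖r s‖ ^ 2) + 2 * K ^ 2), by positivity, fun s => ?_⟩
  refine Real.le_sqrt_of_sq_le ?_
  have hc := h.continuous
  have h1 : ∀ a ∈ Icc s (s + 1), ‖r s‖ ^ 2 ≤ 2 * ‖r a‖ ^ 2 + 2 * K ^ 2 := by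
    rintro a ⟨ha1, ha2⟩
    have h2 : ‖r s‖ ≤ ‖r a‖ + K := by
      have h3 := hK a s
      have h4 : √|s - a| ≤ 1 := by
        rw [Real.sqrt_le_one]
        rw [abs_sub_comm, abs_of_nonneg] <;> linarith
      have h5 := norm_sub_norm_le (r s) (r a)
      nlinarith
    nlinarith [sq_nonneg (‖r a‖ - K), norm_nonneg (r s), norm_nonneg (r a)]
  have h2 := intervalIntegral.integral_mono_on (μ := volume) (a := s) (b := s + 1) (by linarith)
    (f := fun _ => ‖r s‖ ^ 2) (g := fun a => 2 * ‖r a‖ ^ 2 + 2 * K ^ 2)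
    (by simp) (Continuous.intervalIntegrable (by fun_prop) _ _) h1
  rw [intervalIntegral.integral_const, intervalIntegral.integral_add
    (Continuous.intervalIntegrable (by fun_prop) _ _) (by simp), intervalIntegral.integral_const,
    intervalIntegral.integral_const_mul] at h2
  simp only [add_sub_cancel_left, smul_eq_mul, one_mul] at h2
  refine h2.trans ?_
  gcongr
  rw [intervalIntegral.integral_of_le (by linarith)]
  exact setIntegral_le_integral hsq (Eventually.of_forall fun s => by positivity)

lemma MemH1.exists_hasDerivAt (h : MemH1 r) :
    ∃ g : ℝ → ℂ, MemLp g 2 ∧ ∀ᵐ s, HasDerivAt r (g s) s := by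
  obtain ⟨-, g, hg, hrg⟩ := h
  refine ⟨g, hg, ?_⟩
  filter_upwards [LocallyIntegrable.ae_hasDerivAt_integral (locallyIntegrable_of_memLp_two hg)] with s hs
  have h1 : r = fun b => r 0 + ∫ s in (0 : ℝ)..b, g s := by
    ext b; rw [← hrg]; ring
  rw [h1]
  simpa using (hs 0).const_add (r 0)

lemma abs_nu_le (r : ℝ → ℂ) (s : ℝ) : |nu r s| ≤ ‖r s‖ ^ 2 := by
  have h1 : Real.log (1 + ‖r s‖ ^ 2) ≤ ‖r s‖ ^ 2 := by
    have := Real.log_le_sub_one_of_pos (x := 1 + ‖r s‖ ^ 2) (by positivity)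
    linarith
  have h0 : 0 ≤ Real.log (1 + ‖r s‖ ^ 2) := Real.log_nonneg (by nlinarith [sq_nonneg ‖r s‖])
  have h2 : 1 / (2 * Real.pi) ≤ 1 := by
    rw [div_le_one (by positivity)]; linarith [Real.pi_gt_three]
  have h3 : 0 < 1 / (2 * Real.pi) := by positivity
  rw [nu, abs_mul, abs_neg, abs_of_pos h3, abs_of_nonneg h0]
  nlinarith

lemma continuous_nu (hr : Continuous r) : Continuous (nu r) := by
  unfold nu
  refine continuous_const.mul (Continuous.log (by fun_prop) fun s => ?_)
  positivity

lemma MemH1.integrable_nu (h : MemH1 r) : Integrable (nu r) :=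
  (integrable_norm_sq_of_memLp h.1).mono' (continuous_nu h.continuous).aestronglyMeasurable
    (Eventually.of_forall fun s => by rw [Real.norm_eq_abs]; exact abs_nu_le r s)

/-- The function `x - log (1 + x ^ 2)` is monotone because `2 * x ≤ 1 + x ^ 2`. Through this, ν
inherits the Hölder condition of `r`. -/
lemma abs_log_one_add_sq_sub_le {a b : ℝ} (ha : 0 ≤ a) (hb : 0 ≤ b) :
    |Real.log (1 + a ^ 2) - Real.log (1 + b ^ 2)| ≤ |a - b| := by
  wlog hab : b ≤ a generalizing a b
  · rw [abs_sub_comm, abs_sub_comm a]; exact this hb ha (le_of_not_ge hab)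
  have h1 : Real.log (1 + b ^ 2) ≤ Real.log (1 + a ^ 2) :=
    Real.log_le_log (by positivity) (by gcongr)
  rw [abs_of_nonneg (by linarith), abs_of_nonneg (by linarith)]
  have hd : ∀ x : ℝ, HasDerivAt (fun x => x - Real.log (1 + x ^ 2)) (1 - (2 * x) / (1 + x ^ 2)) x := by
    intro x
    have h2 : HasDerivAt (fun x : ℝ => 1 + x ^ 2) (2 * x) x := by
      simpa using (hasDerivAt_pow 2 x).const_add 1
    exact (hasDerivAt_id x).sub (h2.log (by positivity))
  have hm : Monotone fun x : ℝ => x - Real.log (1 + x ^ 2) := by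
    refine monotone_of_deriv_nonneg (fun x => (hd x).differentiableAt) fun x => ?_
    rw [(hd x).deriv, sub_nonneg, div_le_one (by positivity)]
    nlinarith [sq_nonneg (x - 1)]
  have := hm hab
  simp only at this
  linarith

lemma abs_nu_sub_le (r : ℝ → ℂ) (a b : ℝ) : |nu r a - nu r b| ≤ ‖r a - r b‖ := by
  have h1 := abs_log_one_add_sq_sub_le (norm_nonneg (r a)) (norm_nonneg (r b))
  have h2 := abs_norm_sub_norm_le (r a) (r b)
  have h3 : 0 < 1 / (2 * Real.pi) := by positivity
  have h4 : 1 / (2 * Real.pi) ≤ 1 := by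
    rw [div_le_one (by positivity)]; linarith [Real.pi_gt_three]
  rw [nu, nu, ← mul_sub, abs_mul, abs_neg, abs_of_pos h3]
  calc _ ≤ 1 * |Real.log (1 + ‖r a‖ ^ 2) - Real.log (1 + ‖r b‖ ^ 2)| := by gcongr
    _ ≤ _ := by linarith

end Sobolev

/-! ### The discrete spectrum and its cutoff. -/

section Geometry

variable {D : ScatteringData} {χ : ℂ → ℝ}

lemma discrete_finite (D : ScatteringData) : D.discrete.Finite := by
  have : D.discrete = range D.pole ∪ range fun k => starRingEnd ℂ (D.pole k) := by
    ext w
    simp only [ScatteringData.discrete, mem_ofPred_eq, mem_union, mem_range]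
    constructor
    · rintro ⟨k, h | h⟩
      · exact Or.inl ⟨k, h.symm⟩
      · exact Or.inr ⟨k, h.symm⟩
    · rintro (⟨k, h⟩ | ⟨k, h⟩)
      · exact ⟨k, Or.inl h.symm⟩
      · exact ⟨k, Or.inr h.symm⟩
  rw [this]
  exact (finite_range _).union (finite_range _)

lemma conj_mem_discrete {w : ℂ} (hw : w ∈ D.discrete) : starRingEnd ℂ w ∈ D.discrete := by
  obtain ⟨k, rfl | rfl⟩ := hw
  · exact ⟨k, Or.inr rfl⟩
  · exact ⟨k, Or.inl (by simp)⟩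

lemma conj_mem_discrete_iff {w : ℂ} : starRingEnd ℂ w ∈ D.discrete ↔ w ∈ D.discrete :=
  ⟨fun h => by simpa using conj_mem_discrete h, conj_mem_discrete⟩

lemma im_ne_zero_of_mem_discrete {w : ℂ} (hw : w ∈ D.discrete) : w.im ≠ 0 := by
  obtain ⟨k, rfl | rfl⟩ := hw
  · exact (D.pole_im_pos k).ne'
  · simpa using (D.pole_im_pos k).ne'

/-- The separation `d` and radius `L` of a cutoff to the discrete spectrum: balls of radius `d`
around the discrete spectrum, where `χ = 1`, the strip `|Im z| < d`, where `χ = 0`, and the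
complement of the ball of radius `L`, where `χ = 0`. -/
structure CutoffGeometry (D : ScatteringData) (χ : ℂ → ℝ) (d L : ℝ) : Prop where
  pos : 0 < d
  smooth : ContDiff ℝ 1 χ
  mem_Icc : ∀ z, χ z ∈ Icc (0 : ℝ) 1
  separated : ∀ a ∈ D.discrete, ∀ b ∈ D.discrete, a ≠ b → 6 * d ≤ dist a b
  im_ge : ∀ w ∈ D.discrete, 3 * d ≤ |w.im|
  norm_le : ∀ w ∈ D.discrete, ‖w‖ + 3 * d ≤ L
  eq_one : ∀ w ∈ D.discrete, ∀ z, dist z w < d → χ z = 1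
  eq_zero_strip : ∀ z : ℂ, |z.im| < d → χ z = 0
  eq_zero_far : ∀ z : ℂ, L ≤ ‖z‖ → χ z = 0

lemma IsCutoff.exists_geometry (hχ : IsCutoff D χ) : ∃ d L : ℝ, CutoffGeometry D χ d L := by
  have hsm : ContDiff ℝ 1 χ := hχ.smooth.of_le (by exact_mod_cast le_top)
  -- Without discrete spectrum the infimum in `rho` is that of the empty set, which is `0`; but then
  -- `χ` vanishes identically and any positive `d` serves.
  rcases D.discrete.eq_empty_or_nonempty with he | ⟨w₀, hw₀⟩
  · have h0 : ∀ z, χ z = 0 := fun z => hχ.eq_zero z fun w hw => by simp [he] at hw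
    refine ⟨1, 0, one_pos, hsm, hχ.mem_Icc, ?_, ?_, ?_, ?_, fun z _ => h0 z, fun z _ => h0 z⟩ <;>
      simp [he]
  set A : Set ℝ := {d : ℝ | ∃ a ∈ D.discrete, ∃ b ∈ D.discrete, a ≠ b ∧ d = dist a b} with hA
  have hAf : A.Finite := by
    refine (((discrete_finite D).prod (discrete_finite D)).image fun p => dist p.1 p.2).subset ?_
    rintro _ ⟨a, ha, b, hb, -, rfl⟩
    exact ⟨(a, b), ⟨ha, hb⟩, rfl⟩
  -- A point and its conjugate compete in the minimum, at distance `2 * |w.im|`; hence the spectrum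
  -- has height at least `ρ`.
  have hAconj : ∀ w ∈ D.discrete, 2 * |w.im| ∈ A := by
    intro w hw
    refine ⟨w, hw, _, conj_mem_discrete hw, ?_, ?_⟩
    · intro h
      have := congrArg Complex.im h
      rw [Complex.conj_im] at this
      exact im_ne_zero_of_mem_discrete hw (by linarith)
    · rw [Complex.dist_self_conj]
  have hAne : A.Nonempty := ⟨_, hAconj w₀ hw₀⟩
  have hAmem := hAne.csInf_mem hAf
  have hAle : ∀ x ∈ A, 2 * D.rho ≤ x := fun x hx => by
    have := csInf_le hAf.bddBelow hx
    rw [ScatteringData.rho, ← hA]; linarith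
  have hpos : 0 < D.rho := by
    obtain ⟨a, ha, b, hb, hab, h⟩ := hAmem
    have := dist_pos.2 hab
    rw [ScatteringData.rho, ← hA, h]; linarith
  obtain ⟨B, hB⟩ := (discrete_finite D).isBounded.subset_closedBall 0
  have hB' : ∀ w ∈ D.discrete, ‖w‖ ≤ B := fun w hw => by simpa using hB hw
  have him : ∀ w ∈ D.discrete, D.rho ≤ |w.im| := fun w hw => by
    linarith [hAle _ (hAconj w hw)]
  -- `ρ / 3` is the radius on which `χ = 1`. A point with `|Im z| < ρ / 3` is farther than `2ρ / 3`
  -- from the spectrum, so the same number serves as the width of the strip.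
  refine ⟨D.rho / 3, B + D.rho, by positivity, hsm, hχ.mem_Icc, ?_, ?_, ?_, ?_, ?_, ?_⟩
  · intro a ha b hb hab
    have := hAle _ ⟨a, ha, b, hb, hab, rfl⟩
    linarith
  · intro w hw; linarith [him w hw]
  · intro w hw; linarith [hB' w hw]
  · exact fun w hw z hz => hχ.eq_one z ⟨w, hw, hz⟩
  · intro z hz
    refine hχ.eq_zero z fun w hw => ?_
    have h1 := him w hw
    have h2 := Complex.abs_im_le_norm (z - w)
    rw [Complex.sub_im] at h2
    have h3 := abs_sub_abs_le_abs_sub w.im z.im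
    rw [abs_sub_comm] at h3
    rw [dist_eq_norm]; linarith
  · intro z hz
    refine hχ.eq_zero z fun w hw => ?_
    have h1 := hB' w hw
    have h2 := norm_sub_norm_le z w
    rw [dist_eq_norm]; linarith

variable {d L : ℝ}

end Geometry

/-! ### Schwarz symmetry of `T` and `T₀`. -/

section Symmetry

variable (D : ScatteringData) (z₀ : ℝ)

lemma conj_blaschke (z : ℂ) :
    starRingEnd ℂ (blaschke D z₀ z) = (blaschke D z₀ (starRingEnd ℂ z))⁻¹ := by
  simp only [blaschke, map_prod, map_div₀, map_sub, Complex.conj_conj, ← Finset.prod_inv_distrib,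
    inv_div]

lemma conj_delta (z : ℂ) :
    starRingEnd ℂ (delta D z₀ z) = (delta D z₀ (starRingEnd ℂ z))⁻¹ := by
  rw [delta, delta, ← Complex.exp_conj, ← Complex.exp_neg, map_mul, Complex.conj_I, ← integral_conj]
  simp

/-- Reflection inverts the Blaschke product and `δ`. For this reason estimates of `T⁻²` follow from
estimates of `T²` at the conjugate point. -/
lemma conj_T (z : ℂ) : starRingEnd ℂ (T D z₀ z) = (T D z₀ (starRingEnd ℂ z))⁻¹ := by
  rw [T, T, map_mul, conj_blaschke, conj_delta, mul_inv]

lemma conj_T0 : starRingEnd ℂ (T0 D z₀) = (T0 D z₀)⁻¹ := by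
  rw [T0, map_mul, conj_blaschke, mul_inv, Complex.conj_ofReal, ← Complex.exp_conj, ← Complex.exp_neg,
    map_mul, Complex.conj_I, neg_mul]
  congr 4
  rw [beta, map_add, map_mul, ← integral_conj]
  simp

lemma blaschke_ne_zero {z : ℂ} (hz : z ∉ D.discrete) : blaschke D z₀ z ≠ 0 := by
  refine Finset.prod_ne_zero_iff.2 fun k _ => div_ne_zero ?_ ?_
  · exact sub_ne_zero.2 fun h => hz ⟨k, Or.inr h⟩
  · exact sub_ne_zero.2 fun h => hz ⟨k, Or.inl h⟩

lemma ofReal_notMem_discrete (s : ℝ) : (s : ℂ) ∉ D.discrete := fun h =>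
  im_ne_zero_of_mem_discrete h (Complex.ofReal_im s)

lemma T0_ne_zero : T0 D z₀ ≠ 0 :=
  mul_ne_zero (blaschke_ne_zero D z₀ (ofReal_notMem_discrete D z₀)) (Complex.exp_ne_zero _)

lemma norm_T0 : ‖T0 D z₀‖ = 1 := by
  have h := Complex.mul_conj' (T0 D z₀)
  rw [conj_T0, mul_inv_cancel₀ (T0_ne_zero D z₀)] at h
  have h2 : ‖T0 D z₀‖ ^ 2 = 1 := by exact_mod_cast h.symm
  nlinarith [norm_nonneg (T0 D z₀)]

/-- By `conj_T`, the function `1/T` is the Schwarz reflection of `T`. This links the derivatives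
that enter the residue matrices at a pole and at its conjugate. -/
lemma deriv_inv_T (w : ℂ) :
    deriv (fun z => (T D z₀ z)⁻¹) w = starRingEnd ℂ (deriv (T D z₀) (starRingEnd ℂ w)) := by
  have h : (fun z => (T D z₀ z)⁻¹) = fun z => starRingEnd ℂ (T D z₀ (starRingEnd ℂ z)) := by
    ext z; rw [conj_T, Complex.conj_conj]
  rw [h]
  exact congrFun (deriv_conj_conj (f := T D z₀)) w

end Symmetry

/-! ### The phase function. -/

section Phase

variable {α γ x t : ℝ}

/-- Completing the square at the stationary point; up to a real constant the phase depends on `z -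
z₀` only, which yields the modulus in `norm_osc`. -/
lemma theta_eq (α γ x t : ℝ) (z : ℂ) : theta α γ x t z =
    2 * (z - phasePoint α x t) ^ 2 - ((2 * (phasePoint α x t) ^ 2 + γ / 2 : ℝ) : ℂ) := by
  rw [theta, phasePoint]; push_cast; ring

lemma osc_ne_zero (z : ℂ) : osc α γ x t z ≠ 0 := Complex.exp_ne_zero _

lemma conj_osc (z : ℂ) : starRingEnd ℂ (osc α γ x t z) = (osc α γ x t (starRingEnd ℂ z))⁻¹ := by
  rw [osc, osc, ← Complex.exp_conj, ← Complex.exp_neg, theta_eq, theta_eq]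
  simp [map_ofNat]

lemma norm_osc (z : ℂ) :
    ‖osc α γ x t z‖ = Real.exp (-(8 * t * ((z.re - phasePoint α x t) * z.im))) := by
  rw [osc, Complex.norm_exp, theta_eq]
  congr 1
  simp [pow_two]
  ring

lemma differentiable_osc : Differentiable ℂ (osc α γ x t) := by
  unfold osc theta; fun_prop

end Phase

/-! ### The residue matrices. -/

section Residues

variable (D : ScatteringData) (α γ x t : ℝ)

/-- This symmetry, together with nilpotency, is what makes the Gram function regular at the poles.
-/
lemma resLower_eq (k : Fin D.N) : resLower D α γ x t k = -(resUpper D α γ x t k).conjTranspose := by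
  unfold resLower resUpper
  split_ifs
  · ext i j
    fin_cases i <;> fin_cases j <;>
      simp [Matrix.conjTranspose_apply, deriv_inv_T, conj_osc]
  · ext i j
    fin_cases i <;> fin_cases j <;>
      simp [Matrix.conjTranspose_apply, conj_T, conj_osc]

lemma resUpper_mul_self (k : Fin D.N) : resUpper D α γ x t k * resUpper D α γ x t k = 0 := by
  unfold resUpper
  split_ifs <;> ext i j <;> fin_cases i <;> fin_cases j <;> simp [Matrix.mul_apply]

end Residues

/-! ### The functions prescribed on the rays. -/

section Rays

variable (D : ScatteringData) (z₀ : ℝ)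

lemma conj_cpow_imag {w : ℂ} (hw : w.arg ≠ Real.pi) (a : ℝ) :
    starRingEnd ℂ (starRingEnd ℂ w ^ (2 * Complex.I * (a : ℂ))) = w ^ (-2 * Complex.I * (a : ℂ)) := by
  rw [Complex.conj_cpow _ _ hw, Complex.conj_conj]
  congr 1
  simp [map_ofNat]

lemma conj_f6 {z : ℂ} (hz : (z - z₀).arg ≠ Real.pi) :
    starRingEnd ℂ (f6 D z₀ (starRingEnd ℂ z)) = f1 D z₀ z := by
  have h := conj_cpow_imag hz (nu D.r z₀)
  rw [map_sub, Complex.conj_ofReal] at h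
  simp only [f6, f1, map_mul, Complex.conj_conj, map_pow, conj_T0, h, inv_pow]

lemma conj_f3 {z : ℂ} (hz : (z - z₀).arg ≠ Real.pi) :
    starRingEnd ℂ (f3 D z₀ (starRingEnd ℂ z)) = f4 D z₀ z := by
  have h := conj_cpow_imag hz (nu D.r z₀)
  rw [map_sub, Complex.conj_ofReal] at h
  simp only [f3, f4, map_mul, Complex.conj_conj, map_pow, conj_T0, h, inv_pow, map_div₀, map_add,
    map_one, Complex.conj_ofReal]

/-- The exponent is purely imaginary, so for `w ≠ 0` the modulus depends on the argument of `w`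
alone, and `|arg w| ≤ π`. -/
lemma norm_cpow_imag_le (w : ℂ) (a : ℝ) {ε : ℝ} (hε : |ε| ≤ 2) :
    ‖w ^ ((ε : ℂ) * Complex.I * (a : ℂ))‖ ≤ Real.exp (2 * Real.pi * |a|) := by
  have h1 : (1 : ℝ) ≤ Real.exp (2 * Real.pi * |a|) := Real.one_le_exp (by positivity)
  rcases eq_or_ne w 0 with rfl | hw
  · by_cases h : (ε : ℂ) * Complex.I * (a : ℂ) = 0
    · rw [h]; simpa using h1
    · rw [Complex.zero_cpow h, norm_zero]; positivity
  · rw [Complex.norm_cpow_of_ne_zero hw]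
    have hre : ((ε : ℂ) * Complex.I * (a : ℂ)).re = 0 := by simp
    have him : ((ε : ℂ) * Complex.I * (a : ℂ)).im = ε * a := by simp
    rw [hre, him, Real.rpow_zero, one_div, ← Real.exp_neg]
    refine Real.exp_le_exp.2 ?_
    refine (neg_le_abs _).trans ?_
    rw [abs_mul, abs_mul]
    have := Complex.abs_arg_le_pi w
    calc |w.arg| * (|ε| * |a|) ≤ Real.pi * (2 * |a|) := by gcongr
      _ = _ := by ring

lemma norm_div_one_add_sq_le (w : ℂ) : ‖w / (1 + (‖w‖ : ℂ) ^ 2)‖ ≤ ‖w‖ := by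
  have : (1 + (‖w‖ : ℂ) ^ 2) = ((1 + ‖w‖ ^ 2 : ℝ) : ℂ) := by push_cast; ring
  rw [this, norm_div, Complex.norm_real, Real.norm_of_nonneg (by positivity)]
  exact div_le_self (norm_nonneg _) (by nlinarith [sq_nonneg ‖w‖])

lemma exists_ray_bound : ∃ B : ℝ, 0 ≤ B ∧ ∀ z₀ z, ‖f1 D z₀ z‖ ≤ B ∧ ‖f3 D z₀ z‖ ≤ B ∧
    ‖f4 D z₀ z‖ ≤ B ∧ ‖f6 D z₀ z‖ ≤ B := by
  obtain ⟨R, hR0, hR⟩ := D.r_memH1.exists_bound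
  refine ⟨R * Real.exp (2 * Real.pi * R ^ 2), by positivity, fun z₀ z => ?_⟩
  have hE : Real.exp (2 * Real.pi * |nu D.r z₀|) ≤ Real.exp (2 * Real.pi * R ^ 2) := by
    gcongr
    exact (abs_nu_le _ _).trans (by gcongr; exact hR _)
  have hp := (norm_cpow_imag_le (z - z₀) (nu D.r z₀) (ε := 2) (by norm_num)).trans hE
  have hm := (norm_cpow_imag_le (z - z₀) (nu D.r z₀) (ε := -2) (by norm_num)).trans hE
  push_cast at hp hm
  have hq := (norm_div_one_add_sq_le (D.r z₀)).trans (hR z₀)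
  have hq' := norm_div_one_add_sq_le (starRingEnd ℂ (D.r z₀))
  rw [RCLike.norm_conj] at hq'
  have hq' := hq'.trans (hR z₀)
  have hr := hR z₀
  simp only [f1, f3, f4, f6, norm_mul, norm_inv, norm_pow, norm_T0, one_pow, inv_one, mul_one,
    RCLike.norm_conj]
  refine ⟨?_, ?_, ?_, ?_⟩ <;> gcongr

end Rays

/-! ### Sectors and nilpotent factors. -/

section Sectors

variable {D : ScatteringData} {z₀ : ℝ}

lemma differentiableAt_cpow_imag {z : ℂ} (hz : z - z₀ ∈ Complex.slitPlane) (a : ℂ) :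
    DifferentiableAt ℂ (fun z : ℂ => (z - z₀) ^ a) z :=
  DifferentiableAt.cpow (by fun_prop) (by fun_prop) hz

lemma differentiableAt_rays {z : ℂ} (hz : z - z₀ ∈ Complex.slitPlane) :
    DifferentiableAt ℂ (f1 D z₀) z ∧ DifferentiableAt ℂ (f3 D z₀) z ∧
    DifferentiableAt ℂ (f4 D z₀) z ∧ DifferentiableAt ℂ (f6 D z₀) z := by
  refine ⟨?_, ?_, ?_, ?_⟩ <;> exact (differentiableAt_cpow_imag hz _).const_mul _

lemma slitPlane_of_im_ne_zero {z : ℂ} (hz : z.im ≠ 0) : z - z₀ ∈ Complex.slitPlane :=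
  Or.inr (by simpa using hz)

lemma isOpen_Omega1 : IsOpen (Omega1 z₀) :=
  IsOpen.inter (s := {z : ℂ | 0 < z.im}) (t := {z : ℂ | z.im < z.re - z₀})
    (isOpen_lt (by fun_prop) (by fun_prop)) (isOpen_lt (by fun_prop) (by fun_prop))

lemma isOpen_Omega2 : IsOpen (Omega2 z₀) := isOpen_lt (by fun_prop) (by fun_prop)

lemma isOpen_Omega3 : IsOpen (Omega3 z₀) :=
  IsOpen.inter (s := {z : ℂ | 0 < z.im}) (t := {z : ℂ | z.im < z₀ - z.re})
    (isOpen_lt (by fun_prop) (by fun_prop)) (isOpen_lt (by fun_prop) (by fun_prop))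

lemma isOpen_Omega4 : IsOpen (Omega4 z₀) :=
  IsOpen.inter (s := {z : ℂ | z.im < 0}) (t := {z : ℂ | -z.im < z₀ - z.re})
    (isOpen_lt (by fun_prop) (by fun_prop)) (isOpen_lt (by fun_prop) (by fun_prop))

lemma isOpen_Omega5 : IsOpen (Omega5 z₀) := isOpen_lt (by fun_prop) (by fun_prop)

lemma isOpen_Omega6 : IsOpen (Omega6 z₀) :=
  IsOpen.inter (s := {z : ℂ | z.im < 0}) (t := {z : ℂ | -z.im < z.re - z₀})
    (isOpen_lt (by fun_prop) (by fun_prop)) (isOpen_lt (by fun_prop) (by fun_prop))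

/-- The six sectors and the real axis cover the complement of the contour. -/
lemma mem_sector_of_notMem_contour {z : ℂ} (hz : z ∉ contour z₀) :
    z.im = 0 ∨ z ∈ Omega1 z₀ ∨ z ∈ Omega2 z₀ ∨ z ∈ Omega3 z₀ ∨ z ∈ Omega4 z₀ ∨ z ∈ Omega5 z₀ ∨
      z ∈ Omega6 z₀ := by
  simp only [contour, Omega1, Omega2, Omega3, Omega4, Omega5, Omega6, mem_ofPred_eq] at *
  grind

variable {α γ x t : ℝ}

open Classical in
/-- The nilpotent matrices whose multiples by `1 - χ` unfold the jumps on the contour. -/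
noncomputable def jumpNil (D : ScatteringData) (α γ x t : ℝ) (z : ℂ) : Matrix (Fin 2) (Fin 2) ℂ :=
  if z ∈ Omega1 (phasePoint α x t) then !![0, 0; f1 D (phasePoint α x t) z * osc α γ x t z, 0]
  else if z ∈ Omega3 (phasePoint α x t) then
    !![0, f3 D (phasePoint α x t) z * (osc α γ x t z)⁻¹; 0, 0]
  else if z ∈ Omega4 (phasePoint α x t) then
    !![0, 0; -(f4 D (phasePoint α x t) z * osc α γ x t z), 0]
  else if z ∈ Omega6 (phasePoint α x t) then
    !![0, -(f6 D (phasePoint α x t) z * (osc α γ x t z)⁻¹); 0, 0]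
  else 0

lemma jumpNil_of_mem1 {z : ℂ} (hz : z ∈ Omega1 (phasePoint α x t)) :
    jumpNil D α γ x t z = !![0, 0; f1 D (phasePoint α x t) z * osc α γ x t z, 0] := if_pos hz

lemma jumpNil_of_mem3 {z : ℂ} (hz : z ∈ Omega3 (phasePoint α x t)) :
    jumpNil D α γ x t z = !![0, f3 D (phasePoint α x t) z * (osc α γ x t z)⁻¹; 0, 0] := by
  rw [jumpNil, if_neg, if_pos hz]
  simp only [Omega1, Omega3, mem_ofPred_eq] at *
  intro h; linarith

lemma jumpNil_of_mem4 {z : ℂ} (hz : z ∈ Omega4 (phasePoint α x t)) :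
    jumpNil D α γ x t z = !![0, 0; -(f4 D (phasePoint α x t) z * osc α γ x t z), 0] := by
  rw [jumpNil, if_neg, if_neg, if_pos hz] <;>
  · simp only [Omega1, Omega3, Omega4, mem_ofPred_eq] at *
    intro h; linarith

lemma jumpNil_of_mem6 {z : ℂ} (hz : z ∈ Omega6 (phasePoint α x t)) :
    jumpNil D α γ x t z = !![0, -(f6 D (phasePoint α x t) z * (osc α γ x t z)⁻¹); 0, 0] := by
  rw [jumpNil, if_neg, if_neg, if_neg, if_pos hz] <;>
  · simp only [Omega1, Omega3, Omega4, Omega6, mem_ofPred_eq] at *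
    intro h; linarith

lemma jumpNil_of_notMem {z : ℂ} (h1 : z ∉ Omega1 (phasePoint α x t))
    (h3 : z ∉ Omega3 (phasePoint α x t)) (h4 : z ∉ Omega4 (phasePoint α x t))
    (h6 : z ∉ Omega6 (phasePoint α x t)) : jumpNil D α γ x t z = 0 := by
  rw [jumpNil, if_neg h1, if_neg h3, if_neg h4, if_neg h6]

lemma jumpNil_of_abs_le {z : ℂ} (h : |z.re - phasePoint α x t| ≤ |z.im|) :
    jumpNil D α γ x t z = 0 := by
  refine jumpNil_of_notMem ?_ ?_ ?_ ?_ <;>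
  · simp only [Omega1, Omega3, Omega4, Omega6, mem_ofPred_eq]
    grind

lemma jumpNil_mul_self (z : ℂ) : jumpNil D α γ x t z * jumpNil D α γ x t z = 0 := by
  unfold jumpNil
  split_ifs <;> ext i j <;> fin_cases i <;> fin_cases j <;> simp [Matrix.mul_apply]

lemma arg_ne_pi_of_im_ne_zero {z : ℂ} (hz : z.im ≠ 0) : (z - z₀).arg ≠ Real.pi := fun h => by
  have := (Complex.arg_eq_pi_iff.1 h).2
  simp at this
  exact hz this

lemma conj_mem_Omega6 {z : ℂ} : starRingEnd ℂ z ∈ Omega6 z₀ ↔ z ∈ Omega1 z₀ := by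
  simp only [Omega1, Omega6, mem_ofPred_eq, Complex.conj_re, Complex.conj_im]
  constructor <;> rintro ⟨h1, h2⟩ <;> constructor <;> linarith

lemma conj_mem_Omega1 {z : ℂ} : starRingEnd ℂ z ∈ Omega1 z₀ ↔ z ∈ Omega6 z₀ := by
  simp only [Omega1, Omega6, mem_ofPred_eq, Complex.conj_re, Complex.conj_im]
  constructor <;> rintro ⟨h1, h2⟩ <;> constructor <;> linarith

lemma conj_mem_Omega3 {z : ℂ} : starRingEnd ℂ z ∈ Omega3 z₀ ↔ z ∈ Omega4 z₀ := by
  simp only [Omega3, Omega4, mem_ofPred_eq, Complex.conj_re, Complex.conj_im]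
  constructor <;> rintro ⟨h1, h2⟩ <;> constructor <;> linarith

lemma conj_mem_Omega4 {z : ℂ} : starRingEnd ℂ z ∈ Omega4 z₀ ↔ z ∈ Omega3 z₀ := by
  simp only [Omega3, Omega4, mem_ofPred_eq, Complex.conj_re, Complex.conj_im]
  constructor <;> rintro ⟨h1, h2⟩ <;> constructor <;> linarith

/-- Reflection exchanges `Ω₁` with `Ω₆` and `Ω₃` with `Ω₄`, and `conj_f6`, `conj_f3` match the
entries. Since the matrices square to zero, the reflected adjoint of `1 + N` is its inverse; this
cancels the factors in the Gram function. -/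
lemma jumpNil_conj (z : ℂ) :
    jumpNil D α γ x t (starRingEnd ℂ z) = -(jumpNil D α γ x t z).conjTranspose := by
  have key1 : ∀ z ∈ Omega1 (phasePoint α x t),
      jumpNil D α γ x t (starRingEnd ℂ z) = -(jumpNil D α γ x t z).conjTranspose := by
    intro z hz
    rw [jumpNil_of_mem1 hz, jumpNil_of_mem6 (conj_mem_Omega6.2 hz)]
    have h := conj_f6 D (phasePoint α x t) (arg_ne_pi_of_im_ne_zero (z₀ := phasePoint α x t)
      (z := z) hz.1.ne')
    rw [← h]
    ext i j
    fin_cases i <;> fin_cases j <;> simp [Matrix.conjTranspose_apply, conj_osc]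
  have key4 : ∀ z ∈ Omega4 (phasePoint α x t),
      jumpNil D α γ x t (starRingEnd ℂ z) = -(jumpNil D α γ x t z).conjTranspose := by
    intro z hz
    rw [jumpNil_of_mem4 hz, jumpNil_of_mem3 (conj_mem_Omega3.2 hz)]
    have h := conj_f3 D (phasePoint α x t) (arg_ne_pi_of_im_ne_zero (z₀ := phasePoint α x t)
      (z := z) hz.1.ne)
    rw [← h]
    ext i j
    fin_cases i <;> fin_cases j <;> simp [Matrix.conjTranspose_apply, conj_osc]
  have flip : ∀ z : ℂ, jumpNil D α γ x t z = -(jumpNil D α γ x t (starRingEnd ℂ z)).conjTranspose →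
      jumpNil D α γ x t (starRingEnd ℂ z) = -(jumpNil D α γ x t z).conjTranspose := by
    intro z h
    rw [h]
    simp
  by_cases h1 : z ∈ Omega1 (phasePoint α x t)
  · exact key1 z h1
  by_cases h4 : z ∈ Omega4 (phasePoint α x t)
  · exact key4 z h4
  by_cases h6 : z ∈ Omega6 (phasePoint α x t)
  · refine flip z ?_
    have := key1 _ (conj_mem_Omega1.2 h6)
    rwa [Complex.conj_conj] at this
  by_cases h3 : z ∈ Omega3 (phasePoint α x t)
  · refine flip z ?_
    have := key4 _ (conj_mem_Omega4.2 h3)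
    rwa [Complex.conj_conj] at this
  rw [jumpNil_of_notMem h1 h3 h4 h6, jumpNil_of_notMem (by rwa [conj_mem_Omega1])
    (by rwa [conj_mem_Omega3]) (by rwa [conj_mem_Omega4]) (by rwa [conj_mem_Omega6])]
  simp

/-- The real axis is excluded: across it the matrix changes between lower and upper triangular form.
-/
lemma differentiableAt_jumpNil {z : ℂ} (hz : z ∉ contour (phasePoint α x t)) (him : z.im ≠ 0)
    (i j : Fin 2) : DifferentiableAt ℂ (fun w => jumpNil D α γ x t w i j) z := by
  obtain ⟨d1, d3, d4, d6⟩ := differentiableAt_rays (D := D)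
    (slitPlane_of_im_ne_zero (z₀ := phasePoint α x t) him)
  have dosc : DifferentiableAt ℂ (osc α γ x t) z := differentiable_osc z
  have dinv : DifferentiableAt ℂ (fun w => (osc α γ x t w)⁻¹) z := dosc.inv (osc_ne_zero z)
  have hzero : ∀ {O : Set ℂ}, IsOpen O → z ∈ O →
      (∀ w ∈ O, |w.re - phasePoint α x t| ≤ |w.im|) →
      DifferentiableAt ℂ (fun w => jumpNil D α γ x t w i j) z := by
    intro O hO hzO h
    refine (differentiableAt_const (0 : ℂ)).congr_of_eventuallyEq ?_
    filter_upwards [hO.mem_nhds hzO] with w hw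
    rw [jumpNil_of_abs_le (h w hw)]; rfl
  rcases mem_sector_of_notMem_contour hz with h | h | h | h | h | h | h
  · exact absurd h him
  · have : (fun w => jumpNil D α γ x t w i j) =ᶠ[𝓝 z] fun w =>
        (!![0, 0; f1 D (phasePoint α x t) w * osc α γ x t w, 0] : Matrix (Fin 2) (Fin 2) ℂ) i j := by
      filter_upwards [isOpen_Omega1.mem_nhds h] with w hw
      rw [jumpNil_of_mem1 hw]
    refine DifferentiableAt.congr_of_eventuallyEq ?_ this
    fin_cases i <;> fin_cases j <;>
      first | exact differentiableAt_const (0 : ℂ) | exact d1.mul dosc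
  · exact hzero isOpen_Omega2 h fun w hw => (le_of_lt hw).trans (le_abs_self _)
  · have : (fun w => jumpNil D α γ x t w i j) =ᶠ[𝓝 z] fun w =>
        (!![0, f3 D (phasePoint α x t) w * (osc α γ x t w)⁻¹; 0, 0] : Matrix (Fin 2) (Fin 2) ℂ) i j := by
      filter_upwards [isOpen_Omega3.mem_nhds h] with w hw
      rw [jumpNil_of_mem3 hw]
    refine DifferentiableAt.congr_of_eventuallyEq ?_ this
    fin_cases i <;> fin_cases j <;>
      first | exact differentiableAt_const (0 : ℂ) | exact d3.mul dinv
  · have : (fun w => jumpNil D α γ x t w i j) =ᶠ[𝓝 z] fun w =>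
        (!![0, 0; -(f4 D (phasePoint α x t) w * osc α γ x t w), 0] : Matrix (Fin 2) (Fin 2) ℂ) i j := by
      filter_upwards [isOpen_Omega4.mem_nhds h] with w hw
      rw [jumpNil_of_mem4 hw]
    refine DifferentiableAt.congr_of_eventuallyEq ?_ this
    fin_cases i <;> fin_cases j <;>
      first | exact differentiableAt_const (0 : ℂ) | exact (d4.mul dosc).neg
  · exact hzero isOpen_Omega5 h fun w hw => (le_of_lt hw).trans (neg_le_abs _)
  · have : (fun w => jumpNil D α γ x t w i j) =ᶠ[𝓝 z] fun w =>
        (!![0, -(f6 D (phasePoint α x t) w * (osc α γ x t w)⁻¹); 0, 0] : Matrix (Fin 2) (Fin 2) ℂ) i j := by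
      filter_upwards [isOpen_Omega6.mem_nhds h] with w hw
      rw [jumpNil_of_mem6 hw]
    refine DifferentiableAt.congr_of_eventuallyEq ?_ this
    fin_cases i <;> fin_cases j <;>
      first | exact differentiableAt_const (0 : ℂ) | exact (d6.mul dinv).neg

/-- In each sector the sign of `(Re z - z₀) * Im z` fits the exponent that occurs there, so the
exponential is always the decaying one. -/
lemma norm_jumpNil_le {B : ℝ} (hB0 : 0 ≤ B) (hB : ∀ z₀ z, ‖f1 D z₀ z‖ ≤ B ∧ ‖f3 D z₀ z‖ ≤ B ∧
    ‖f4 D z₀ z‖ ≤ B ∧ ‖f6 D z₀ z‖ ≤ B) (z : ℂ) (i j : Fin 2) :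
    ‖jumpNil D α γ x t z i j‖ ≤
      B * Real.exp (-(8 * t * (|z.re - phasePoint α x t| * |z.im|))) := by
  obtain ⟨b1, b3, b4, b6⟩ := hB (phasePoint α x t) z
  have h0 : 0 ≤ B * Real.exp (-(8 * t * (|z.re - phasePoint α x t| * |z.im|))) := by positivity
  by_cases h1 : z ∈ Omega1 (phasePoint α x t)
  · rw [jumpNil_of_mem1 h1]
    have e : ‖f1 D (phasePoint α x t) z * osc α γ x t z‖ ≤
        B * Real.exp (-(8 * t * (|z.re - phasePoint α x t| * |z.im|))) := by
      rw [norm_mul, norm_osc, abs_of_pos h1.1, abs_of_pos (h1.1.trans h1.2)]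
      gcongr
    fin_cases i <;> fin_cases j <;> first | exact e | exact (norm_neg _).trans_le e | simpa using h0
  by_cases h3 : z ∈ Omega3 (phasePoint α x t)
  · rw [jumpNil_of_mem3 h3]
    have e : ‖f3 D (phasePoint α x t) z * (osc α γ x t z)⁻¹‖ ≤
        B * Real.exp (-(8 * t * (|z.re - phasePoint α x t| * |z.im|))) := by
      have h5 := h3.1.trans h3.2
      rw [norm_mul, norm_inv, norm_osc, abs_of_pos h3.1, abs_of_neg (by linarith), ← Real.exp_neg,
        show -(-(8 * t * ((z.re - phasePoint α x t) * z.im))) =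
          -(8 * t * (-(z.re - phasePoint α x t) * z.im)) by ring]
      gcongr
    fin_cases i <;> fin_cases j <;> first | exact e | exact (norm_neg _).trans_le e | simpa using h0
  by_cases h4 : z ∈ Omega4 (phasePoint α x t)
  · rw [jumpNil_of_mem4 h4]
    have e : ‖f4 D (phasePoint α x t) z * osc α γ x t z‖ ≤
        B * Real.exp (-(8 * t * (|z.re - phasePoint α x t| * |z.im|))) := by
      have h5 := h4.1
      have h6 := h4.2
      rw [norm_mul, norm_osc, abs_of_neg h4.1, abs_of_neg (by linarith), neg_mul_neg]
      gcongr
    fin_cases i <;> fin_cases j <;> first | exact e | exact (norm_neg _).trans_le e | simpa using h0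
  by_cases h6 : z ∈ Omega6 (phasePoint α x t)
  · rw [jumpNil_of_mem6 h6]
    have e : ‖f6 D (phasePoint α x t) z * (osc α γ x t z)⁻¹‖ ≤
        B * Real.exp (-(8 * t * (|z.re - phasePoint α x t| * |z.im|))) := by
      have h5 := h6.1
      have h7 := h6.2
      rw [norm_mul, norm_inv, norm_osc, abs_of_neg h6.1, abs_of_pos (by linarith), ← Real.exp_neg,
        show -(-(8 * t * ((z.re - phasePoint α x t) * z.im))) =
          -(8 * t * ((z.re - phasePoint α x t) * -z.im)) by ring]
      gcongr
    fin_cases i <;> fin_cases j <;> first | exact e | exact (norm_neg _).trans_le e | simpa using h0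
  rw [jumpNil_of_notMem h1 h3 h4 h6]
  simpa using h0

end Sectors

/-! ### Product rules for ∂̄. -/

section Dbar

variable {a b s : ℂ → ℂ} {z : ℂ}

lemma dbar_eq_zero_of_differentiableAt (ha : DifferentiableAt ℂ a z) : dbar a z = 0 := by
  obtain ⟨-, h⟩ := differentiableAt_complex_iff_differentiableAt_real.1 ha
  rw [dbar, h, smul_eq_mul]
  linear_combination (1 / 2) * (fderiv ℝ a z 1) * Complex.I_sq

lemma dbar_add {f g : ℂ → ℂ} (hf : DifferentiableAt ℝ f z) (hg : DifferentiableAt ℝ g z) :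
    dbar (fun w => f w + g w) z = dbar f z + dbar g z := by
  have h : fderiv ℝ (fun w => f w + g w) z = _ := fderiv_fun_add hf hg
  rw [dbar, h, dbar, dbar]
  simp
  ring

lemma dbar_congr {f g : ℂ → ℂ} (h : f =ᶠ[𝓝 z] g) : dbar f z = dbar g z := by
  rw [dbar, dbar, h.fderiv_eq]

/-- With `a` and `b` holomorphic, only the scalar `s` is differentiated. In the applications `s` is
built from the cutoff, so unfolding loses analyticity only where the cutoff varies. -/
lemma dbar_add_mul (ha : DifferentiableAt ℂ a z) (hs : DifferentiableAt ℝ s z)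
    (hb : DifferentiableAt ℂ b z) :
    DifferentiableAt ℝ (fun w => a w + s w * b w) z ∧
      dbar (fun w => a w + s w * b w) z = dbar s z * b z := by
  have ha' := ha.restrictScalars ℝ
  have hb' := hb.restrictScalars ℝ
  refine ⟨ha'.add (hs.mul hb'), ?_⟩
  rw [dbar_add (g := fun w => s w * b w) ha' (hs.mul hb'), dbar_mul hs hb', dbar_eq_zero_of_differentiableAt ha,
    dbar_eq_zero_of_differentiableAt hb]
  ring

end Dbar

/-! ### Entrywise bounds for 2 × 2 matrices. -/

section Entries

variable {A B : Matrix (Fin 2) (Fin 2) ℂ} {a b : ℝ}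

lemma norm_mul_entry_le (hA : ∀ i j, ‖A i j‖ ≤ a) (hB : ∀ i j, ‖B i j‖ ≤ b) (i j : Fin 2) :
    ‖(A * B) i j‖ ≤ 2 * a * b := by
  have ha : 0 ≤ a := (norm_nonneg _).trans (hA 0 0)
  rw [Matrix.mul_apply, Fin.sum_univ_two]
  refine (norm_add_le _ _).trans ?_
  rw [norm_mul, norm_mul]
  have h1 := mul_le_mul (hA i 0) (hB 0 j) (norm_nonneg _) ha
  have h2 := mul_le_mul (hA i 1) (hB 1 j) (norm_nonneg _) ha
  linarith

lemma norm_conjTranspose_entry_le (hA : ∀ i j, ‖A i j‖ ≤ a) (i j : Fin 2) :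
    ‖A.conjTranspose i j‖ ≤ a := by
  rw [Matrix.conjTranspose_apply, norm_star]; exact hA j i

lemma norm_one_add_smul_entry_le {c : ℂ} (hc : ‖c‖ ≤ 1) (hA : ∀ i j, ‖A i j‖ ≤ a) (i j : Fin 2) :
    ‖(1 + c • A) i j‖ ≤ 1 + a := by
  rw [Matrix.add_apply, Matrix.smul_apply, smul_eq_mul]
  refine (norm_add_le _ _).trans (add_le_add ?_ ?_)
  · rw [Matrix.one_apply]; split_ifs <;> simp
  · rw [norm_mul]
    calc _ ≤ 1 * a := by gcongr; exact hA i j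
      _ = a := one_mul a

lemma tendsto_matrix_iff {ι : Type*} {l : Filter ι} {F : ι → Matrix (Fin 2) (Fin 2) ℂ} :
    Tendsto F l (𝓝 A) ↔ ∀ i j, Tendsto (fun z => F z i j) l (𝓝 (A i j)) := by
  refine ⟨fun h i j => ?_, fun h => tendsto_pi_nhds.2 fun i => tendsto_pi_nhds.2 fun j => h i j⟩
  exact tendsto_pi_nhds.1 (tendsto_pi_nhds.1 h i) j

end Entries

/-! ### Unfolding the jumps on the contour. -/

section Unfold

variable {D : ScatteringData} {χ : ℂ → ℝ} {α γ x t d L : ℝ}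
  {M : ℂ → Matrix (Fin 2) (Fin 2) ℂ}

/-- The solution of the model problem, multiplied by triangular factors that remove its jumps across
the contour. -/
noncomputable def unfolded (D : ScatteringData) (χ : ℂ → ℝ) (α γ x t : ℝ)
    (M : ℂ → Matrix (Fin 2) (Fin 2) ℂ) (z : ℂ) : Matrix (Fin 2) (Fin 2) ℂ :=
  M z * (1 + (1 - (χ z : ℂ)) • jumpNil D α γ x t z)

lemma one_add_smul_mul_one_sub_smul {N : Matrix (Fin 2) (Fin 2) ℂ} (hN : N * N = 0) (a b : ℂ) :
    (1 + a • N) * (1 - b • N) = 1 + (a - b) • N := by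
  rw [mul_sub, mul_one, add_mul, one_mul, smul_mul_smul_comm, hN, smul_zero, add_zero, sub_smul]
  abel

lemma eq_unfolded_mul (z : ℂ) :
    M z = unfolded D χ α γ x t M z * (1 - (1 - (χ z : ℂ)) • jumpNil D α γ x t z) := by
  rw [unfolded, mul_assoc, one_add_smul_mul_one_sub_smul (jumpNil_mul_self z), sub_self, zero_smul,
    add_zero, mul_one]

lemma tendsto_of_two_sides {F : ℂ → Matrix (Fin 2) (Fin 2) ℂ} {Y : Matrix (Fin 2) (Fin 2) ℂ}
    {A P Q U : Set ℂ} {p : ℂ} (hU : U ∈ 𝓝 p) (hsub : U ∩ A ⊆ P ∪ Q)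
    (hP : Tendsto F (𝓝[P] p) (𝓝 Y)) (hQ : Tendsto F (𝓝[Q] p) (𝓝 Y)) :
    Tendsto F (𝓝[A] p) (𝓝 Y) := by
  have h : Tendsto F (𝓝[P ∪ Q] p) (𝓝 Y) := by
    rw [nhdsWithin_union]; exact hP.sup hQ
  refine h.mono_left ?_
  rw [nhdsWithin_le_iff]
  filter_upwards [mem_nhdsWithin_of_mem_nhds hU, self_mem_nhdsWithin] with z h1 h2
  exact hsub ⟨h1, h2⟩

lemma tendsto_unfolded_of_formula {Q : Set ℂ} {p : ℂ} (hχ : Continuous χ)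
    {B : Matrix (Fin 2) (Fin 2) ℂ} {F : ℂ → Matrix (Fin 2) (Fin 2) ℂ}
    (hM : Tendsto M (𝓝[Q] p) (𝓝 B)) (hF : Tendsto F (𝓝[Q] p) (𝓝 (F p)))
    (hN : ∀ z ∈ Q, jumpNil D α γ x t z = F z) :
    Tendsto (unfolded D χ α γ x t M) (𝓝[Q] p) (𝓝 (B * (1 + (1 - (χ p : ℂ)) • F p))) := by
  have h1 : Tendsto (fun z => (1 - (χ z : ℂ))) (𝓝[Q] p) (𝓝 (1 - (χ p : ℂ))) :=
    (Continuous.tendsto (by fun_prop) p).mono_left nhdsWithin_le_nhds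
  have h2 : Tendsto (fun z => M z * (1 + (1 - (χ z : ℂ)) • F z)) (𝓝[Q] p)
      (𝓝 (B * (1 + (1 - (χ p : ℂ)) • F p))) := hM.mul ((h1.smul hF).const_add 1)
  refine h2.congr' ?_
  filter_upwards [self_mem_nhdsWithin] with z hz
  rw [unfolded, hN z hz]

lemma upper_right_subset (z₀ : ℝ) :
    ({z : ℂ | 0 < z.im} ∩ {z | z₀ < z.re}) ∩ (contour z₀)ᶜ ⊆ Omega1 z₀ ∪ Omega2 z₀ := by
  rintro z ⟨⟨h1, h2⟩, h3⟩
  simp only [contour, Omega1, Omega2, mem_compl_iff, mem_ofPred_eq, mem_union] at *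
  grind

lemma upper_left_subset (z₀ : ℝ) :
    ({z : ℂ | 0 < z.im} ∩ {z | z.re < z₀}) ∩ (contour z₀)ᶜ ⊆ Omega3 z₀ ∪ Omega2 z₀ := by
  rintro z ⟨⟨h1, h2⟩, h3⟩
  simp only [contour, Omega3, Omega2, mem_compl_iff, mem_ofPred_eq, mem_union] at *
  grind

lemma lower_left_subset (z₀ : ℝ) :
    ({z : ℂ | z.im < 0} ∩ {z | z.re < z₀}) ∩ (contour z₀)ᶜ ⊆ Omega4 z₀ ∪ Omega5 z₀ := by
  rintro z ⟨⟨h1, h2⟩, h3⟩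
  simp only [contour, Omega4, Omega5, mem_compl_iff, mem_ofPred_eq, mem_union] at *
  grind

lemma lower_right_subset (z₀ : ℝ) :
    ({z : ℂ | z.im < 0} ∩ {z | z₀ < z.re}) ∩ (contour z₀)ᶜ ⊆ Omega6 z₀ ∪ Omega5 z₀ := by
  rintro z ⟨⟨h1, h2⟩, h3⟩
  simp only [contour, Omega6, Omega5, mem_compl_iff, mem_ofPred_eq, mem_union] at *
  grind

lemma mem_rays_of_mem_contour {z₀ : ℝ} {p : ℂ} (hp : p ∈ contour z₀) (hp0 : p ≠ z₀) :
    p ∈ Sigma1 z₀ ∨ p ∈ Sigma2 z₀ ∨ p ∈ Sigma3 z₀ ∨ p ∈ Sigma4 z₀ := by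
  have h2 : |p.im| = |p.re - z₀| := hp
  have him : p.im ≠ 0 := by
    intro h
    rw [h, abs_zero, eq_comm, abs_eq_zero] at h2
    exact hp0 (Complex.ext (by simpa using sub_eq_zero.1 h2) (by simpa using h))
  simp only [Sigma1, Sigma2, Sigma3, Sigma4, mem_ofPred_eq]
  grind

/-- The unfolded solution extends continuously to the contour. -/
lemma IsModelSolution.exists_tendsto_unfolded (hM : IsModelSolution D χ α γ x t M)
    (hχ : Continuous χ) {p : ℂ} (hp : p ∈ contour (phasePoint α x t))
    (hpD : p ∉ D.discrete) (hp0 : p ≠ phasePoint α x t) :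
    ∃ Y, Tendsto (unfolded D χ α γ x t M) (𝓝[(contour (phasePoint α x t))ᶜ] p) (𝓝 Y) := by
  have him : p.im ≠ 0 := by
    intro h
    have h2 : |p.im| = |p.re - (phasePoint α x t)| := hp
    rw [h, abs_zero, eq_comm, abs_eq_zero] at h2
    exact hp0 (Complex.ext (by simpa using sub_eq_zero.1 h2) (by simpa using h))
  obtain ⟨d1, d3, d4, d6⟩ := differentiableAt_rays (D := D) (slitPlane_of_im_ne_zero (z₀ := phasePoint α x t) him)
  have c1 := d1.continuousAt
  have c3 := d3.continuousAt
  have c4 := d4.continuousAt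
  have c6 := d6.continuousAt
  have co : ContinuousAt (osc α γ x t) p := (differentiable_osc p).continuousAt
  have ci : ContinuousAt (fun w => (osc α γ x t w)⁻¹) p := co.inv₀ (osc_ne_zero p)
  have hN2 : ∀ z ∈ Omega2 (phasePoint α x t), jumpNil D α γ x t z = (fun _ : ℂ => (0 : Matrix (Fin 2) (Fin 2) ℂ)) z :=
    fun z hz => jumpNil_of_abs_le ((le_of_lt hz).trans (le_abs_self _))
  have hN5 : ∀ z ∈ Omega5 (phasePoint α x t), jumpNil D α γ x t z = (fun _ : ℂ => (0 : Matrix (Fin 2) (Fin 2) ℂ)) z :=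
    fun z hz => jumpNil_of_abs_le ((le_of_lt hz).trans (neg_le_abs _))
  have hcases : p ∈ Sigma1 (phasePoint α x t) ∨ p ∈ Sigma2 (phasePoint α x t) ∨ p ∈ Sigma3 (phasePoint α x t) ∨ p ∈ Sigma4 (phasePoint α x t) :=
    mem_rays_of_mem_contour hp hp0
  have hUp : 0 < p.im → {z : ℂ | 0 < z.im} ∈ 𝓝 p := fun h =>
    (isOpen_lt continuous_const Complex.continuous_im).mem_nhds h
  have hUm : p.im < 0 → {z : ℂ | z.im < 0} ∈ 𝓝 p := fun h =>
    (isOpen_lt Complex.continuous_im continuous_const).mem_nhds h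
  have hUr : (phasePoint α x t) < p.re → {z : ℂ | (phasePoint α x t) < z.re} ∈ 𝓝 p := fun h =>
    (isOpen_lt continuous_const Complex.continuous_re).mem_nhds h
  have hUl : p.re < (phasePoint α x t) → {z : ℂ | z.re < (phasePoint α x t)} ∈ 𝓝 p := fun h =>
    (isOpen_lt Complex.continuous_re continuous_const).mem_nhds h
  rcases hcases with h | h | h | h
  -- Above the real axis the `+` side is `Ω₂`, where the factor is trivial. The factor on the `-`
  -- side is the jump matrix itself, so both one-sided limits are `A`.
  · obtain ⟨A, B, hA, hB, hAB⟩ := hM.jump1 p h hpD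
    have hF : ContinuousAt (fun w => (!![0, 0; f1 D (phasePoint α x t) w * osc α γ x t w, 0] :
        Matrix (Fin 2) (Fin 2) ℂ)) p := by
      refine tendsto_matrix_iff.2 fun i j => ?_
      fin_cases i <;> fin_cases j <;> first | exact tendsto_const_nhds | exact (c1.mul co).tendsto
    have t2 := tendsto_unfolded_of_formula hχ hA tendsto_const_nhds hN2
    have t1 := tendsto_unfolded_of_formula hχ hB (hF.tendsto.mono_left nhdsWithin_le_nhds)
      fun z hz => jumpNil_of_mem1 hz
    have e : B * (1 + (1 - (χ p : ℂ)) • (!![0, 0; f1 D (phasePoint α x t) p * osc α γ x t p, 0] :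
        Matrix (Fin 2) (Fin 2) ℂ)) = A := by
      rw [hAB]; congr 1
      ext i j; fin_cases i <;> fin_cases j <;> simp [mul_assoc]
    rw [smul_zero, add_zero, mul_one] at t2
    rw [e] at t1
    exact ⟨A, tendsto_of_two_sides
      (inter_mem (hUp h.1) (hUr (by have := h.1; have := h.2; linarith))) (upper_right_subset _) t1 t2⟩
  · obtain ⟨A, B, hA, hB, hAB⟩ := hM.jump2 p h hpD
    have hF : ContinuousAt (fun w => (!![0, f3 D (phasePoint α x t) w * (osc α γ x t w)⁻¹; 0, 0] :
        Matrix (Fin 2) (Fin 2) ℂ)) p := by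
      refine tendsto_matrix_iff.2 fun i j => ?_
      fin_cases i <;> fin_cases j <;> first | exact tendsto_const_nhds | exact (c3.mul ci).tendsto
    have t2 := tendsto_unfolded_of_formula hχ hA tendsto_const_nhds hN2
    have t1 := tendsto_unfolded_of_formula hχ hB (hF.tendsto.mono_left nhdsWithin_le_nhds)
      fun z hz => jumpNil_of_mem3 hz
    have e : B * (1 + (1 - (χ p : ℂ)) • (!![0, f3 D (phasePoint α x t) p * (osc α γ x t p)⁻¹; 0, 0] :
        Matrix (Fin 2) (Fin 2) ℂ)) = A := by
      rw [hAB]; congr 1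
      ext i j; fin_cases i <;> fin_cases j <;> simp [mul_assoc]
    rw [smul_zero, add_zero, mul_one] at t2
    rw [e] at t1
    exact ⟨A, tendsto_of_two_sides
      (inter_mem (hUp h.1) (hUl (by have := h.1; have := h.2; linarith))) (upper_left_subset _) t1 t2⟩
  -- Below the real axis the trivial sector `Ω₅` is the `-` side, so the factor on the `+` side has
  -- to be the inverse of the jump matrix; hence the sign of its entry.
  · obtain ⟨A, B, hA, hB, hAB⟩ := hM.jump3 p h hpD
    have hF : ContinuousAt (fun w => (!![0, 0; -(f4 D (phasePoint α x t) w * osc α γ x t w), 0] :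
        Matrix (Fin 2) (Fin 2) ℂ)) p := by
      refine tendsto_matrix_iff.2 fun i j => ?_
      fin_cases i <;> fin_cases j <;>
        first | exact tendsto_const_nhds | exact (c4.mul co).neg.tendsto
    have t2 := tendsto_unfolded_of_formula hχ hB tendsto_const_nhds hN5
    have t1 := tendsto_unfolded_of_formula hχ hA (hF.tendsto.mono_left nhdsWithin_le_nhds)
      fun z hz => jumpNil_of_mem4 hz
    have e : A * (1 + (1 - (χ p : ℂ)) • (!![0, 0; -(f4 D (phasePoint α x t) p * osc α γ x t p), 0] :
        Matrix (Fin 2) (Fin 2) ℂ)) = B := by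
      rw [hAB, mul_assoc]
      conv_rhs => rw [← mul_one B]
      congr 1
      ext i j; fin_cases i <;> fin_cases j <;> simp [Matrix.mul_apply, mul_assoc]
    rw [smul_zero, add_zero, mul_one] at t2
    rw [e] at t1
    exact ⟨B, tendsto_of_two_sides
      (inter_mem (hUm h.1) (hUl (by have := h.1; have := h.2; linarith))) (lower_left_subset _) t1 t2⟩
  · obtain ⟨A, B, hA, hB, hAB⟩ := hM.jump4 p h hpD
    have hF : ContinuousAt (fun w => (!![0, -(f6 D (phasePoint α x t) w * (osc α γ x t w)⁻¹); 0, 0] :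
        Matrix (Fin 2) (Fin 2) ℂ)) p := by
      refine tendsto_matrix_iff.2 fun i j => ?_
      fin_cases i <;> fin_cases j <;>
        first | exact tendsto_const_nhds | exact (c6.mul ci).neg.tendsto
    have t2 := tendsto_unfolded_of_formula hχ hB tendsto_const_nhds hN5
    have t1 := tendsto_unfolded_of_formula hχ hA (hF.tendsto.mono_left nhdsWithin_le_nhds)
      fun z hz => jumpNil_of_mem6 hz
    have e : A * (1 + (1 - (χ p : ℂ)) • (!![0, -(f6 D (phasePoint α x t) p * (osc α γ x t p)⁻¹); 0, 0] :
        Matrix (Fin 2) (Fin 2) ℂ)) = B := by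
      rw [hAB, mul_assoc]
      conv_rhs => rw [← mul_one B]
      congr 1
      ext i j; fin_cases i <;> fin_cases j <;> simp [Matrix.mul_apply, mul_assoc]
    rw [smul_zero, add_zero, mul_one] at t2
    rw [e] at t1
    exact ⟨B, tendsto_of_two_sides
      (inter_mem (hUm h.1) (hUr (by have := h.1; have := h.2; linarith))) (lower_right_subset _) t1 t2⟩

end Unfold

/-! ### Cauchy transforms of bounded densities on a disc. -/

section CompactSupport

lemma integrable_kernel_ball :
    Integrable ((Metric.ball (0 : ℂ) 1).indicator fun w => ‖w‖ ^ (-(9 / 8) : ℝ)) := by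
  rw [integrable_indicator_iff Metric.isOpen_ball.measurableSet]
  refine integrableOn_ball_of_norm_le_rpow (C := 1) (α := 9 / 8) ?_ ?_ ?_ ?_
  · rw [Complex.finrank_real_complex]; norm_num
  · rw [Complex.finrank_real_complex]; norm_num
  · refine Eventually.of_forall fun w => ?_
    rw [Real.norm_of_nonneg (by positivity), one_mul]
  · exact (by fun_prop : Measurable fun w : ℂ => ‖w‖ ^ (-(9 / 8) : ℝ)).aestronglyMeasurable

/-- The kernel is integrable on the unit disc, as `9/8 < 2`, and at most one outside it. The bounds
are linear in the size `a` of the density, and `K` depends on the radius alone. The factor `3`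
leaves room for `∫ ‖g‖` next to the kernel integral. -/
lemma exists_katoBound_of_bounded (L : ℝ) : ∃ K : ℝ, 0 ≤ K ∧ ∀ (g : ℂ → ℂ) (a : ℝ), 0 ≤ a →
    AEStronglyMeasurable g → (∀ z, ‖g z‖ ≤ a) → (∀ z, L < ‖z‖ → g z = 0) →
    HasKatoBound g (a * K) ∧ ∀ z, ‖solidCauchy g z‖ ≤ a * K := by
  set B : ℂ → ℝ := (Metric.ball (0 : ℂ) 1).indicator fun w => ‖w‖ ^ (-(9 / 8) : ℝ) with hB
  set χ : ℂ → ℝ := (Metric.closedBall (0 : ℂ) L).indicator fun _ => 1 with hχ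
  have hBi : Integrable B := integrable_kernel_ball
  have hχi : Integrable χ := by
    rw [hχ, integrable_indicator_iff Metric.isClosed_closedBall.measurableSet]
    exact integrableOn_const (isCompact_closedBall _ _).measure_lt_top.ne
  have hB0 : ∀ w, 0 ≤ B w := fun w => indicator_nonneg (fun _ _ => by positivity) w
  have hχ0 : ∀ w, 0 ≤ χ w := fun w => indicator_nonneg (fun _ _ => by positivity) w
  have hk : ∀ w : ℂ, ‖w‖ ^ (-(9 / 8) : ℝ) ≤ 1 + B w := by
    intro w
    rcases lt_or_ge ‖w‖ 1 with h | h
    · rw [hB, indicator_of_mem (by simpa using h)]; linarith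
    · have := Real.rpow_le_one_of_one_le_of_nonpos h (by norm_num : (-(9 / 8) : ℝ) ≤ 0)
      linarith [hB0 w]
  refine ⟨3 * ((∫ z, χ z) + ∫ z, B z), by
    have := integral_nonneg (μ := volume) (f := B) hB0
    have := integral_nonneg (μ := volume) (f := χ) hχ0
    positivity, fun g a ha hgm hga hg0 => ?_⟩
  have hgχ : ∀ z, ‖g z‖ ≤ a * χ z := by
    intro z
    rcases le_or_gt ‖z‖ L with h | h
    · rw [hχ, indicator_of_mem (by simpa using h), mul_one]; exact hga z
    · rw [hg0 z h, norm_zero]; exact mul_nonneg ha (hχ0 z)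
  have hgi : Integrable g := (hχi.const_mul a).mono' hgm (Eventually.of_forall hgχ)
  have hBz : ∀ z : ℂ, Integrable fun ζ => B (z - ζ) := fun z => hBi.comp_sub_left z
  have hbd : ∀ z ζ : ℂ, ‖g ζ‖ * ‖z - ζ‖ ^ (-(9 / 8) : ℝ) ≤ a * χ ζ + a * B (z - ζ) := by
    intro z ζ
    calc ‖g ζ‖ * ‖z - ζ‖ ^ (-(9 / 8) : ℝ) ≤ ‖g ζ‖ * (1 + B (z - ζ)) := by gcongr; exact hk _
      _ ≤ _ := by
        have := mul_le_mul_of_nonneg_right (hga ζ) (hB0 (z - ζ))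
        have := hgχ ζ
        linarith
  have hbi : ∀ z : ℂ, Integrable fun ζ => a * χ ζ + a * B (z - ζ) := fun z =>
    (hχi.const_mul a).add ((hBz z).const_mul a)
  have hint : ∀ z : ℂ, ∫ ζ, (a * χ ζ + a * B (z - ζ)) = a * ((∫ z, χ z) + ∫ z, B z) := by
    intro z
    rw [integral_add (hχi.const_mul a) ((hBz z).const_mul a), integral_const_mul,
      integral_const_mul, integral_sub_left_eq_self, mul_add]
  have hker : ∀ z : ℂ, Integrable fun ζ => ‖g ζ‖ * ‖z - ζ‖ ^ (-(9 / 8) : ℝ) := fun z =>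
    (hbi z).mono' (hgm.norm.mul
      (by fun_prop : Measurable fun ζ => ‖z - ζ‖ ^ (-(9 / 8) : ℝ)).aestronglyMeasurable)
      (Eventually.of_forall fun ζ => by
        rw [Real.norm_of_nonneg (by positivity)]; exact hbd z ζ)
  have hle : ∀ z : ℂ, ∫ ζ, ‖g ζ‖ * ‖z - ζ‖ ^ (-(9 / 8) : ℝ) ≤ a * ((∫ z, χ z) + ∫ z, B z) := fun z =>
    (integral_mono (hker z) (hbi z) (hbd z)).trans (hint z).le
  have hK : HasKatoBound g (a * ((∫ z, χ z) + ∫ z, B z)) := ⟨hgi, hker, hle⟩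
  have hB1 := integral_nonneg (μ := volume) (f := B) hB0
  have hχ1 := integral_nonneg (μ := volume) (f := χ) hχ0
  have hg1 : ∫ z, ‖g z‖ ≤ a * ∫ z, χ z := by
    rw [← integral_const_mul]
    exact integral_mono hgi.norm (hχi.const_mul a) hgχ
  have h3 : 0 ≤ a * ((∫ z, χ z) + ∫ z, B z) := by positivity
  have h4 : 0 ≤ a * ∫ z, B z := by positivity
  refine ⟨⟨hgi, hker, fun z => (hle z).trans (by linarith)⟩, fun z => norm_solidCauchy_le g z ?_⟩
  have := hK.integral_inv_le z
  linarith

/-- The density is restricted to an open set because `b` is continuous only there; the bounded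
support comes from `s`. -/
lemma exists_katoBound_cutoff (L : ℝ) : ∃ K : ℝ, 0 ≤ K ∧ ∀ (O : Set ℂ) (s b : ℂ → ℂ) (a : ℝ),
    IsOpen O → ContDiff ℝ 1 s → ContinuousOn b O → 0 ≤ a → (∀ z ∈ O, ‖dbar s z * b z‖ ≤ a) →
    (∀ z, L < ‖z‖ → dbar s z = 0) →
    HasKatoBound (O.indicator fun z => dbar s z * b z) (a * K) ∧
      ∀ z, ‖solidCauchy (O.indicator fun z => dbar s z * b z) z‖ ≤ a * K := by
  obtain ⟨K, hK0, hK⟩ := exists_katoBound_of_bounded L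
  refine ⟨K, hK0, fun O s b a hO hs hb ha hba hfar => hK _ a ha ?_ ?_ ?_⟩
  · rw [aestronglyMeasurable_indicator_iff hO.measurableSet]
    exact (((continuous_dbar hs).continuousOn.mul hb)).aestronglyMeasurable hO.measurableSet
  · intro z
    by_cases hz : z ∈ O
    · rw [indicator_of_mem hz]; exact hba z hz
    · rw [indicator_of_notMem hz, norm_zero]; exact ha
  · intro z hz
    by_cases h : z ∈ O
    · rw [indicator_of_mem h, hfar z hz, zero_mul]
    · rw [indicator_of_notMem h]

end CompactSupport

/-! ### The model solution near its poles. -/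

section Poles

variable {D : ScatteringData} {χ : ℂ → ℝ} {α γ x t d L : ℝ}
  {M : ℂ → Matrix (Fin 2) (Fin 2) ℂ}

lemma unfolded_of_eq_one {z : ℂ} (h : χ z = 1) : unfolded D χ α γ x t M z = M z := by
  simp [unfolded, h]

lemma solidCauchy_zero (z : ℂ) : solidCauchy (fun _ => 0) z = 0 := by simp [solidCauchy]

lemma hasKatoBound_zero : HasKatoBound (fun _ => 0) 0 :=
  ⟨integrable_zero _ _ _, fun z => by simp, fun z => by simp⟩

lemma dense_compl_contour_union (D : ScatteringData) (z₀ : ℝ) :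
    Dense (contour z₀ ∪ D.discrete)ᶜ := by
  refine Measure.dense_of_ae (μ := volume) ?_
  refine measure_eq_zero_iff_ae_notMem.1 (measure_union_null (volume_contour z₀) ?_)
  exact (discrete_finite D).measure_zero _

lemma isOpen_compl_contour_union (D : ScatteringData) (z₀ : ℝ) :
    IsOpen (contour z₀ ∪ D.discrete)ᶜ :=
  ((isClosed_contour z₀).union (discrete_finite D).isClosed).isOpen_compl

lemma IsModelSolution.differentiableAt (hM : IsModelSolution D χ α γ x t M) {z : ℂ}
    (h1 : z ∉ contour (phasePoint α x t)) (h2 : z ∉ D.discrete) (i j : Fin 2) :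
    DifferentiableAt ℂ (fun z => M z i j) z :=
  (hM.analytic i j).differentiableAt
    ((isOpen_compl_contour_union D _).mem_nhds (by simp [h1, h2]))

/-- The triangular factor that removes the pole at `w` from `M` leaves a bounded function. -/
lemma IsModelSolution.bounded_mul_of_residue (hM : IsModelSolution D χ α γ x t M)
    (hG : CutoffGeometry D χ d L) {w : ℂ} (hw : w ∈ D.discrete) {n : Matrix (Fin 2) (Fin 2) ℂ}
    (hn : HasResidue M (contour (phasePoint α x t) ∪ D.discrete)ᶜ w n) (i j : Fin 2) :
    ∃ B : ℝ, ∀ᶠ z in 𝓝 w, z ∉ contour (phasePoint α x t) → z ∉ D.discrete →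
      ‖(M z * (1 - (z - w)⁻¹ • n)) i j‖ ≤ B := by
  set S := contour (phasePoint α x t) with hS
  obtain ⟨A, h1, h2⟩ := hn
  -- The residue condition says that `F` tends to zero at `w`. Since `F` extends holomorphically to
  -- a disc, it is `O(z - w)`, and division by `z - w` gives the claim.
  set F : ℂ → Matrix (Fin 2) (Fin 2) ℂ := fun z => (z - w) • M z - M z * n with hF
  have hF0 : Tendsto (fun z => F z i j) (𝓝[(S ∪ D.discrete)ᶜ] w) (𝓝 0) := by
    have := tendsto_matrix_iff.1 (h1.sub h2) i j
    rwa [sub_self] at this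
  have hFM : ∀ z, F z i j = (z - w) * M z i j - (M z i 0 * n 0 j + M z i 1 * n 1 j) := by
    intro z; simp [hF, Matrix.mul_apply, Fin.sum_univ_two]
  have hball : ∀ z ∈ Metric.ball w d, z ∉ ({w} : Set ℂ) → z ∉ D.discrete := by
    intro z hz hzw hzD
    have h := hG.separated z hzD w hw hzw
    rw [Metric.mem_ball] at hz
    linarith [hG.pos]
  obtain ⟨k, hk, -, hkf⟩ : ∃ k : ℂ → ℂ, DifferentiableOn ℂ k (Metric.ball w d) ∧
      EqOn k (fun z => extendFrom Sᶜ (fun z => F z i j) z - solidCauchy (fun _ => 0) z)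
        (Metric.ball w d \ {w}) ∧
      ∀ z ∈ Metric.ball w d, z ∉ S → z ∉ ({w} : Set ℂ) →
        k z = F z i j - solidCauchy (fun _ => 0) z := by
    refine exists_holomorphic_glue Metric.isOpen_ball (finite_singleton w) hasKatoBound_zero
      ?_ ?_ ?_
    · intro z hz hzS hzw
      have hd : DifferentiableAt ℂ (fun z => F z i j) z := by
        have hMd := fun i j => hM.differentiableAt hzS (hball z hz hzw) i j
        have := hMd i j
        have := hMd i 0
        have := hMd i 1
        simp only [hFM]
        fun_prop
      exact ⟨hd.restrictScalars ℝ, dbar_eq_zero_of_differentiableAt hd⟩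
    · intro z hz hzS hzw
      have hz0 : z ≠ phasePoint α x t := by
        rintro rfl
        have h3 := hG.im_ge w hw
        have h4 := Complex.abs_im_le_norm (w - phasePoint α x t)
        rw [Metric.mem_ball, dist_comm, dist_eq_norm] at hz
        simp at h4
        linarith [hG.pos]
      -- A ray may cross the disc, but `χ = 1` there: the unfolded function is `M` itself, so `M`
      -- extends continuously across the ray.
      obtain ⟨Y, hY⟩ := hM.exists_tendsto_unfolded hG.smooth.continuous hzS (hball z hz hzw) hz0
      have hY' : Tendsto M (𝓝[Sᶜ] z) (𝓝 Y) := by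
        refine hY.congr' ?_
        filter_upwards [mem_nhdsWithin_of_mem_nhds (Metric.isOpen_ball.mem_nhds hz)] with y hy
        exact unfolded_of_eq_one (hG.eq_one w hw y hy)
      have hid : Tendsto (fun y : ℂ => y - w) (𝓝[Sᶜ] z) (𝓝 (z - w)) :=
        (Continuous.tendsto (by fun_prop) z).mono_left nhdsWithin_le_nhds
      exact ⟨_, tendsto_matrix_iff.1 ((hid.smul hY').sub (hY'.mul_const n)) i j⟩
    · rintro p ⟨-, rfl⟩
      refine ⟨1, ?_⟩
      have h3 := (hF0.norm.eventually_le_const (by simp : ‖(0 : ℂ)‖ < 1))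
      rw [eventually_nhdsWithin_iff] at h3
      filter_upwards [h3, Metric.ball_mem_nhds p hG.pos] with z hz hz2 hzS hzp
      exact hz fun h => h.elim hzS (hball z hz2 hzp)
  have hwO : w ∈ Metric.ball w d := Metric.mem_ball_self hG.pos
  have hkw := hk.differentiableAt (Metric.isOpen_ball.mem_nhds hwO)
  have hkF : ∀ z ∈ Metric.ball w d, z ∉ S → z ∉ D.discrete → k z = F z i j := by
    intro z hz hzS hzD
    rw [hkf z hz hzS (by rintro rfl; exact hzD hw), solidCauchy_zero, sub_zero]
  have hk0 : k w = 0 := by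
    have hne := mem_closure_iff_nhdsWithin_neBot.mp (dense_compl_contour_union D (phasePoint α x t) w)
    refine tendsto_nhds_unique (hkw.continuousAt.continuousWithinAt.tendsto) (hF0.congr' ?_)
    filter_upwards [self_mem_nhdsWithin, mem_nhdsWithin_of_mem_nhds (Metric.isOpen_ball.mem_nhds hwO)]
      with z hz hz2
    rw [mem_compl_iff, mem_union, not_or] at hz
    exact (hkF z hz2 hz.1 hz.2).symm
  obtain ⟨B, hB⟩ := hkw.isBigO_sub.bound
  refine ⟨B, ?_⟩
  filter_upwards [hB, Metric.ball_mem_nhds w hG.pos] with z h3 hz hzS hzD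
  have hzw : z - w ≠ 0 := sub_ne_zero.2 (by rintro rfl; exact hzD hw)
  rw [hk0, sub_zero, hkF z hz hzS hzD] at h3
  have e : (M z * (1 - (z - w)⁻¹ • n)) i j = (z - w)⁻¹ * F z i j := by
    have : M z * (1 - (z - w)⁻¹ • n) = (z - w)⁻¹ • F z := by
      rw [hF, smul_sub, smul_smul, inv_mul_cancel₀ hzw, one_smul, mul_sub, mul_one,
        Matrix.mul_smul]
    rw [this, Matrix.smul_apply, smul_eq_mul]
  rw [e, norm_mul, norm_inv, inv_mul_le_iff₀ (norm_pos_iff.2 hzw), mul_comm]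
  exact h3

/-- At each point of the discrete spectrum, the residue matrix and the one at the conjugate
point. -/
lemma IsModelSolution.exists_residues (hM : IsModelSolution D χ α γ x t M) {w : ℂ}
    (hw : w ∈ D.discrete) : ∃ n : Matrix (Fin 2) (Fin 2) ℂ, n * n = 0 ∧
      HasResidue M (contour (phasePoint α x t) ∪ D.discrete)ᶜ w n ∧
      HasResidue M (contour (phasePoint α x t) ∪ D.discrete)ᶜ (starRingEnd ℂ w)
        (-n.conjTranspose) := by
  obtain ⟨k, rfl | rfl⟩ := hw
  · refine ⟨resUpper D α γ x t k, resUpper_mul_self D α γ x t k, hM.residue_upper k, ?_⟩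
    rw [← resLower_eq]; exact hM.residue_lower k
  · refine ⟨resLower D α γ x t k, ?_, hM.residue_lower k, ?_⟩
    · rw [resLower_eq, neg_mul_neg, ← Matrix.conjTranspose_mul, resUpper_mul_self D,
        Matrix.conjTranspose_zero]
    · rw [resLower_eq, Matrix.conjTranspose_neg, neg_neg, Matrix.conjTranspose_conjTranspose,
        Complex.conj_conj]
      exact hM.residue_upper k

end Poles

/-! ### The Gram function. -/

section Gram

variable {D : ScatteringData} {χ : ℂ → ℝ} {α γ x t d L m B K Bχ : ℝ}
  {M : ℂ → Matrix (Fin 2) (Fin 2) ℂ}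

lemma conj_mem_contour_iff {z₀ : ℝ} {z : ℂ} : starRingEnd ℂ z ∈ contour z₀ ↔ z ∈ contour z₀ := by
  simp [contour]

/-- The points off the contour at distance at least `d` from the discrete spectrum. -/
def offPoles (D : ScatteringData) (z₀ d : ℝ) : Set ℂ :=
  {z | z ∉ contour z₀ ∧ ∀ w ∈ D.discrete, d ≤ dist z w}

lemma conj_mem_offPoles {z₀ : ℝ} {z : ℂ} (hz : z ∈ offPoles D z₀ d) :
    starRingEnd ℂ z ∈ offPoles D z₀ d := by
  refine ⟨fun h => hz.1 (conj_mem_contour_iff.1 h), fun w hw => ?_⟩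
  have h1 := hz.2 _ (conj_mem_discrete hw)
  have h2 : dist (starRingEnd ℂ z) w = dist z (starRingEnd ℂ w) := by
    rw [← Complex.dist_conj_conj, Complex.conj_conj]
  rwa [h2]

lemma notMem_discrete_of_mem_offPoles {z₀ : ℝ} (hd : 0 < d) {z : ℂ} (hz : z ∈ offPoles D z₀ d) :
    z ∉ D.discrete := fun h => by
  have := hz.2 z h
  rw [dist_self] at this
  linarith

/-- The product of the unfolded solution and its Schwarz reflection. -/
noncomputable def gram (D : ScatteringData) (χ : ℂ → ℝ) (α γ x t : ℝ)
    (M : ℂ → Matrix (Fin 2) (Fin 2) ℂ) (z : ℂ) : Matrix (Fin 2) (Fin 2) ℂ :=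
  unfolded D χ α γ x t M z * (unfolded D χ α γ x t M (starRingEnd ℂ z)).conjTranspose

/-- By `jumpNil_conj` the reflected adjoint of the triangular factor is `1 - (1 - χ(z*)) N(z)`. As
`N² = 0`, both factors multiply to `1 + (χ(z*) - χ(z)) N(z)`, which is trivial wherever the cutoff
agrees with its reflection. -/
lemma gram_eq (z : ℂ) : gram D χ α γ x t M z =
    M z * (M (starRingEnd ℂ z)).conjTranspose +
      ((χ (starRingEnd ℂ z) - χ z : ℝ) : ℂ) •
        (M z * jumpNil D α γ x t z * (M (starRingEnd ℂ z)).conjTranspose) := by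
  have hU : (1 + (1 - (χ (starRingEnd ℂ z) : ℂ)) • jumpNil D α γ x t (starRingEnd ℂ z)).conjTranspose
      = 1 - (1 - (χ (starRingEnd ℂ z) : ℂ)) • jumpNil D α γ x t z := by
    rw [jumpNil_conj, Matrix.conjTranspose_add, Matrix.conjTranspose_one, Matrix.conjTranspose_smul,
      Matrix.conjTranspose_neg, Matrix.conjTranspose_conjTranspose, sub_eq_add_neg, smul_neg]
    simp [sub_eq_add_neg]
  rw [gram, unfolded, unfolded, Matrix.conjTranspose_mul, hU, mul_assoc, ← mul_assoc (1 + _) (1 - _),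
    one_add_smul_mul_one_sub_smul (jumpNil_mul_self z), add_mul, one_mul, mul_add, ← mul_assoc]
  congr 1
  rw [Matrix.mul_smul, Matrix.smul_mul]
  congr 1
  push_cast
  ring

lemma gram_eq_of_eq {z : ℂ} (h : χ (starRingEnd ℂ z) = χ z) : gram D χ α γ x t M z =
    M z * (M (starRingEnd ℂ z)).conjTranspose := by
  rw [gram_eq, h, sub_self, Complex.ofReal_zero, zero_smul, add_zero]

lemma IsModelSolution.differentiableAt_reflect (hM : IsModelSolution D χ α γ x t M) {z : ℂ}
    (h1 : z ∉ contour (phasePoint α x t)) (h2 : z ∉ D.discrete) (i j : Fin 2) :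
    DifferentiableAt ℂ (fun z => (M (starRingEnd ℂ z)).conjTranspose i j) z := by
  have h := (hM.differentiableAt (z := starRingEnd ℂ z) (fun h => h1 (conj_mem_contour_iff.1 h))
    (fun h => h2 (conj_mem_discrete_iff.1 h)) j i).conj_conj
  rw [Complex.conj_conj] at h
  exact h

lemma differentiableAt_mul_entry {A A' : ℂ → Matrix (Fin 2) (Fin 2) ℂ} {z : ℂ}
    (hA : ∀ i j, DifferentiableAt ℂ (fun z => A z i j) z)
    (hA' : ∀ i j, DifferentiableAt ℂ (fun z => A' z i j) z) (i j : Fin 2) :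
    DifferentiableAt ℂ (fun z => (A z * A' z) i j) z := by
  have e : (fun z => (A z * A' z) i j) = fun z => A z i 0 * A' z 0 j + A z i 1 * A' z 1 j := by
    ext z; rw [Matrix.mul_apply, Fin.sum_univ_two]
  rw [e]
  exact ((hA i 0).mul (hA' 0 j)).add ((hA i 1).mul (hA' 1 j))

lemma CutoffGeometry.conj_eq_of_near (hG : CutoffGeometry D χ d L) {w z : ℂ}
    (hw : w ∈ D.discrete) (hz : dist z w < d) : χ (starRingEnd ℂ z) = χ z := by
  rw [hG.eq_one w hw z hz, hG.eq_one _ (conj_mem_discrete hw)]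
  rwa [Complex.dist_conj_conj]

/-- The difference of the cutoff and its reflection. -/
noncomputable def cutoffDefect (χ : ℂ → ℝ) (z : ℂ) : ℂ :=
  ((χ (starRingEnd ℂ z) - χ z : ℝ) : ℂ)

lemma CutoffGeometry.contDiff_cutoffDefect (hG : CutoffGeometry D χ d L) :
    ContDiff ℝ 1 (cutoffDefect χ) := by
  have h1 : ContDiff ℝ 1 fun z : ℂ => χ (starRingEnd ℂ z) :=
    hG.smooth.comp Complex.conjCLE.contDiff
  exact Complex.ofRealCLM.contDiff.comp (h1.sub hG.smooth)

lemma dbar_eq_zero_of_eventually_const {s : ℂ → ℂ} {z c : ℂ} (h : s =ᶠ[𝓝 z] fun _ => c) :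
    dbar s z = 0 := by
  rw [dbar_congr h, dbar_eq_zero_of_differentiableAt (differentiableAt_const c)]

lemma CutoffGeometry.dbar_cutoffDefect_eq_zero (hG : CutoffGeometry D χ d L) {z : ℂ}
    (hz : |z.im| < d ∨ L < ‖z‖ ∨ ∃ w ∈ D.discrete, dist z w < d) : dbar (cutoffDefect χ) z = 0 := by
  refine dbar_eq_zero_of_eventually_const (c := 0) ?_
  rcases hz with h | h | ⟨w, hw, h⟩
  · filter_upwards [(isOpen_lt (by fun_prop) continuous_const :
      IsOpen {z : ℂ | |z.im| < d}).mem_nhds h] with y hy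
    rw [cutoffDefect, hG.eq_zero_strip y hy, hG.eq_zero_strip _ (by simpa using hy)]
    simp
  · filter_upwards [(isOpen_lt continuous_const (by fun_prop) :
      IsOpen {z : ℂ | L < ‖z‖}).mem_nhds h] with y hy
    rw [cutoffDefect, hG.eq_zero_far y hy.le, hG.eq_zero_far _ (by simpa using hy.le)]
    simp
  · filter_upwards [Metric.isOpen_ball.mem_nhds (Metric.mem_ball.2 h)] with y hy
    rw [cutoffDefect, hG.conj_eq_of_near hw (Metric.mem_ball.1 hy)]
    simp

lemma CutoffGeometry.dbar_cutoff_eq_zero (hG : CutoffGeometry D χ d L) {z : ℂ}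
    (hz : |z.im| < d ∨ L < ‖z‖ ∨ ∃ w ∈ D.discrete, dist z w < d) :
    dbar (fun z => 1 - (χ z : ℂ)) z = 0 := by
  rcases hz with h | h | ⟨w, hw, h⟩
  · refine dbar_eq_zero_of_eventually_const (c := 1) ?_
    filter_upwards [(isOpen_lt (by fun_prop) continuous_const :
      IsOpen {z : ℂ | |z.im| < d}).mem_nhds h] with y hy
    simp [hG.eq_zero_strip y hy]
  · refine dbar_eq_zero_of_eventually_const (c := 1) ?_
    filter_upwards [(isOpen_lt continuous_const (by fun_prop) :
      IsOpen {z : ℂ | L < ‖z‖}).mem_nhds h] with y hy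
    simp [hG.eq_zero_far y hy.le]
  · refine dbar_eq_zero_of_eventually_const (c := 0) ?_
    filter_upwards [Metric.isOpen_ball.mem_nhds (Metric.mem_ball.2 h)] with y hy
    simp [hG.eq_one w hw y (Metric.mem_ball.1 hy)]

lemma CutoffGeometry.contDiff_one_sub (hG : CutoffGeometry D χ d L) :
    ContDiff ℝ 1 fun z => 1 - (χ z : ℂ) :=
  contDiff_const.sub (Complex.ofRealCLM.contDiff.comp hG.smooth)

/-- The triangular factors are exponentially small away from the real axis. -/
lemma norm_jumpNil_le_of_im (hB0 : 0 ≤ B) (hB : ∀ z₀ z, ‖f1 D z₀ z‖ ≤ B ∧ ‖f3 D z₀ z‖ ≤ B ∧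
    ‖f4 D z₀ z‖ ≤ B ∧ ‖f6 D z₀ z‖ ≤ B) (hd : 0 < d) (ht : 0 < t) {z : ℂ} (hz : d ≤ |z.im|)
    (i j : Fin 2) : ‖jumpNil D α γ x t z i j‖ ≤ B * Real.exp (-(8 * t * d ^ 2)) := by
  rcases le_or_gt |z.re - phasePoint α x t| |z.im| with h | h
  · rw [jumpNil_of_abs_le h, Matrix.zero_apply, norm_zero]; positivity
  · refine (norm_jumpNil_le hB0 hB z i j).trans ?_
    gcongr
    nlinarith

lemma norm_jumpNil_le_const (hB0 : 0 ≤ B) (hB : ∀ z₀ z, ‖f1 D z₀ z‖ ≤ B ∧ ‖f3 D z₀ z‖ ≤ B ∧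
    ‖f4 D z₀ z‖ ≤ B ∧ ‖f6 D z₀ z‖ ≤ B) (ht : 0 < t) (z : ℂ)
    (i j : Fin 2) : ‖jumpNil D α γ x t z i j‖ ≤ B := by
  refine (norm_jumpNil_le hB0 hB z i j).trans (mul_le_of_le_one_right hB0 ?_)
  rw [Real.exp_le_one_iff]
  have : 0 ≤ 8 * t * (|z.re - phasePoint α x t| * |z.im|) := by positivity
  linarith

/-- The matrix `N` jumps on the real axis, but in a strip around it the cutoffs vanish and the Gram
function is the holomorphic product `M(z) M(z*)†`. Off the strip `dbar_add_mul` applies. -/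
lemma IsModelSolution.hasDbar_gram (hM : IsModelSolution D χ α γ x t M)
    (hG : CutoffGeometry D χ d L) {z : ℂ}
    (hz : z ∉ contour (phasePoint α x t)) (hzD : z ∉ D.discrete) (i j : Fin 2) :
    DifferentiableAt ℝ (fun z => gram D χ α γ x t M z i j) z ∧
      dbar (fun z => gram D χ α γ x t M z i j) z = dbar (cutoffDefect χ) z *
        (M z * jumpNil D α γ x t z * (M (starRingEnd ℂ z)).conjTranspose) i j := by
  have h1 := hM.differentiableAt hz hzD
  have h2 := hM.differentiableAt_reflect hz hzD
  have ha := differentiableAt_mul_entry h1 h2 i j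
  rcases lt_or_ge |z.im| d with h | h
  · have hloc : (fun z => gram D χ α γ x t M z i j) =ᶠ[𝓝 z]
        fun z => (M z * (M (starRingEnd ℂ z)).conjTranspose) i j := by
      filter_upwards [(isOpen_lt (by fun_prop) continuous_const :
        IsOpen {z : ℂ | |z.im| < d}).mem_nhds h] with y hy
      rw [gram_eq_of_eq]
      rw [hG.eq_zero_strip y hy, hG.eq_zero_strip _ (by simpa using hy)]
    rw [hloc.differentiableAt_iff, dbar_congr hloc, dbar_eq_zero_of_differentiableAt ha,
      hG.dbar_cutoffDefect_eq_zero (Or.inl h), zero_mul]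
    exact ⟨ha.restrictScalars ℝ, rfl⟩
  · have him : z.im ≠ 0 := abs_pos.1 (hG.pos.trans_le h)
    have hb := differentiableAt_mul_entry
      (differentiableAt_mul_entry h1 (differentiableAt_jumpNil (D := D) (γ := γ) hz him)) h2 i j
    have e : (fun z => gram D χ α γ x t M z i j) = fun z =>
        (M z * (M (starRingEnd ℂ z)).conjTranspose) i j + cutoffDefect χ z *
          (M z * jumpNil D α γ x t z * (M (starRingEnd ℂ z)).conjTranspose) i j := by
      ext z
      rw [gram_eq, Matrix.add_apply, Matrix.smul_apply, smul_eq_mul, cutoffDefect]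
    rw [e]
    exact dbar_add_mul ha (hG.contDiff_cutoffDefect.differentiable one_ne_zero z) hb

lemma tendsto_conj_within_compl_contour {z₀ : ℝ} (p : ℂ) :
    Tendsto (starRingEnd ℂ) (𝓝[(contour z₀)ᶜ] p) (𝓝[(contour z₀)ᶜ] (starRingEnd ℂ p)) :=
  tendsto_nhdsWithin_of_tendsto_nhds_of_eventually_within _
    ((Complex.continuous_conj.tendsto p).mono_left nhdsWithin_le_nhds)
    (by filter_upwards [self_mem_nhdsWithin] with z hz h using hz (conj_mem_contour_iff.1 h))

lemma IsModelSolution.exists_tendsto_gram (hM : IsModelSolution D χ α γ x t M)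
    (hχ : Continuous χ) {p : ℂ} (hp : p ∈ contour (phasePoint α x t))
    (hpD : p ∉ D.discrete) (hp0 : p ≠ phasePoint α x t) (i j : Fin 2) :
    ∃ y, Tendsto (fun z => gram D χ α γ x t M z i j) (𝓝[(contour (phasePoint α x t))ᶜ] p) (𝓝 y) := by
  obtain ⟨Y, hY⟩ := hM.exists_tendsto_unfolded hχ hp hpD hp0
  obtain ⟨Y', hY'⟩ := hM.exists_tendsto_unfolded hχ (conj_mem_contour_iff.2 hp)
    (fun h => hpD (conj_mem_discrete_iff.1 h)) (fun h => hp0 (by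
      rw [← Complex.conj_conj p, h, Complex.conj_ofReal]))
  have h2 := hY'.comp (tendsto_conj_within_compl_contour p)
  have h3 : Tendsto (fun z => (unfolded D χ α γ x t M (starRingEnd ℂ z)).conjTranspose)
      (𝓝[(contour (phasePoint α x t))ᶜ] p) (𝓝 Y'.conjTranspose) :=
    ((continuous_id.matrix_conjTranspose).tendsto Y').comp h2
  exact ⟨_, tendsto_matrix_iff.1 (hY.mul h3) i j⟩

/-- As `n * n = 0`, the factor that removes the pole at `w` and the adjoint of the one for the
conjugate point are inverse to each other. Inserting them changes nothing, and each half of the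
product becomes bounded. -/
lemma conj_mul_factor {n : Matrix (Fin 2) (Fin 2) ℂ} (hn : n * n = 0) (z w : ℂ)
    (A A' : Matrix (Fin 2) (Fin 2) ℂ) :
    A * A'.conjTranspose = (A * (1 - (z - w)⁻¹ • n)) *
      (A' * (1 - (starRingEnd ℂ z - starRingEnd ℂ w)⁻¹ • (-n.conjTranspose))).conjTranspose := by
  have h : (1 - (starRingEnd ℂ z - starRingEnd ℂ w)⁻¹ • (-n.conjTranspose)).conjTranspose =
      1 + (z - w)⁻¹ • n := by
    rw [smul_neg, sub_neg_eq_add, Matrix.conjTranspose_add, Matrix.conjTranspose_one,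
      Matrix.conjTranspose_smul, Matrix.conjTranspose_conjTranspose]
    congr 2
    simp
  have h2 : (1 - (z - w)⁻¹ • n) * (1 + (z - w)⁻¹ • n) = 1 := by
    have := one_add_smul_mul_one_sub_smul hn (-(z - w)⁻¹) (-(z - w)⁻¹)
    rw [sub_self, zero_smul, add_zero] at this
    rwa [neg_smul, ← sub_eq_add_neg, sub_neg_eq_add] at this
  rw [Matrix.conjTranspose_mul, h, mul_assoc, ← mul_assoc (1 - _), h2, one_mul]

/-- At the vertex `M` itself is bounded. At the spectrum the cutoff agrees with its reflection, and
`conj_mul_factor` writes the Gram function as a product of two bounded functions. -/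
lemma IsModelSolution.bounded_gram (hM : IsModelSolution D χ α γ x t M)
    (hG : CutoffGeometry D χ d L) (hB0 : 0 ≤ B) (hB : ∀ z₀ z, ‖f1 D z₀ z‖ ≤ B ∧ ‖f3 D z₀ z‖ ≤ B ∧
    ‖f4 D z₀ z‖ ≤ B ∧ ‖f6 D z₀ z‖ ≤ B) (ht : 0 < t) {p : ℂ}
    (hp : p ∈ insert (phasePoint α x t : ℂ) D.discrete) (i j : Fin 2) :
    ∃ b : ℝ, ∀ᶠ z in 𝓝 p, z ∉ contour (phasePoint α x t) →
      z ∉ insert (phasePoint α x t : ℂ) D.discrete → ‖gram D χ α γ x t M z i j‖ ≤ b := by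
  rcases hp with rfl | hp
  · obtain ⟨C, ε, hε, hC⟩ := hM.bounded_near_vertex
    refine ⟨2 * (2 * C * (1 + B)) * (2 * C * (1 + B)), ?_⟩
    filter_upwards [Metric.ball_mem_nhds _ hε] with z hz hzS _
    have hun : ∀ z ∉ contour (phasePoint α x t), dist z (phasePoint α x t : ℂ) < ε →
        ∀ i j, ‖unfolded D χ α γ x t M z i j‖ ≤ 2 * C * (1 + B) := fun z h1 h2 =>
      norm_mul_entry_le (hC z h1 h2) (norm_one_add_smul_entry_le (by
        have := hG.mem_Icc z
        rw [← Complex.ofReal_one, ← Complex.ofReal_sub, Complex.norm_real, Real.norm_eq_abs, abs_le]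
        constructor <;> linarith [this.1, this.2]) (norm_jumpNil_le_const hB0 hB ht z))
    refine norm_mul_entry_le (hun z hzS hz) (norm_conjTranspose_entry_le (hun _ ?_ ?_)) i j
    · exact fun h => hzS (conj_mem_contour_iff.1 h)
    · rw [← Complex.dist_conj_conj, Complex.conj_conj, Complex.conj_ofReal]; exact hz
  · obtain ⟨n, hn, hr1, hr2⟩ := hM.exists_residues hp
    choose b hb using hM.bounded_mul_of_residue hG hp hr1
    choose b' hb' using hM.bounded_mul_of_residue hG (conj_mem_discrete hp) hr2
    set c : ℝ := ∑ i, ∑ j, (|b i j| + |b' i j|) with hc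
    have hle : ∀ i j, b i j ≤ c ∧ b' i j ≤ c := by
      intro i j
      have h1 : |b i j| + |b' i j| ≤ ∑ j, (|b i j| + |b' i j|) :=
        Finset.single_le_sum (f := fun j => |b i j| + |b' i j|) (fun _ _ => by positivity)
          (Finset.mem_univ j)
      have h2 : ∑ j, (|b i j| + |b' i j|) ≤ c :=
        Finset.single_le_sum (f := fun i => ∑ j, (|b i j| + |b' i j|)) (fun _ _ => by positivity)
          (Finset.mem_univ i)
      constructor
      · linarith [le_abs_self (b i j), abs_nonneg (b' i j)]
      · linarith [le_abs_self (b' i j), abs_nonneg (b i j)]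
    refine ⟨2 * c * c, ?_⟩
    have hb1 : ∀ᶠ z in 𝓝 p, ∀ i j, z ∉ contour (phasePoint α x t) → z ∉ D.discrete →
        ‖(M z * (1 - (z - p)⁻¹ • n)) i j‖ ≤ b i j :=
      eventually_all.2 fun i => eventually_all.2 fun j => hb i j
    have hb2 : ∀ᶠ z in 𝓝 (starRingEnd ℂ p), ∀ i j, z ∉ contour (phasePoint α x t) →
        z ∉ D.discrete → ‖(M z * (1 - (z - starRingEnd ℂ p)⁻¹ • (-n.conjTranspose))) i j‖ ≤ b' i j :=
      eventually_all.2 fun i => eventually_all.2 fun j => hb' i j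
    filter_upwards [hb1, (Complex.continuous_conj.tendsto p).eventually hb2,
      Metric.ball_mem_nhds p hG.pos] with z h1 h2 h3 hzS hzP
    have hzD : z ∉ D.discrete := fun h => hzP (Or.inr h)
    rw [gram_eq_of_eq (hG.conj_eq_of_near hp h3), conj_mul_factor hn z p]
    refine norm_mul_entry_le (fun i j => (h1 i j hzS hzD).trans (hle i j).1)
      (norm_conjTranspose_entry_le fun i j => (h2 i j ?_ ?_).trans (hle i j).2) i j
    · exact fun h => hzS (conj_mem_contour_iff.1 h)
    · exact fun h => hzD (conj_mem_discrete_iff.1 h)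

lemma IsModelSolution.tendsto_one (hM : IsModelSolution D χ α γ x t M) :
    Tendsto M (cocompact ℂ ⊓ 𝓟 (contour (phasePoint α x t))ᶜ) (𝓝 1) := by
  obtain ⟨C, K, hC⟩ := hM.normalized
  refine tendsto_matrix_iff.2 fun i j => ?_
  rw [tendsto_iff_norm_sub_tendsto_zero]
  have h0 : Tendsto (fun z : ℂ => C / ‖z‖) (cocompact ℂ ⊓ 𝓟 (contour (phasePoint α x t))ᶜ) (𝓝 0) :=
    (tendsto_norm_cocompact_atTop.const_div_atTop C).mono_left inf_le_left
  refine squeeze_zero' (Eventually.of_forall fun _ => norm_nonneg _) ?_ h0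
  have h1 : ∀ᶠ z : ℂ in cocompact ℂ ⊓ 𝓟 (contour (phasePoint α x t))ᶜ, K < ‖z‖ :=
    (tendsto_norm_cocompact_atTop.eventually_gt_atTop K).filter_mono inf_le_left
  have h2 : ∀ᶠ z : ℂ in cocompact ℂ ⊓ 𝓟 (contour (phasePoint α x t))ᶜ,
      z ∈ (contour (phasePoint α x t))ᶜ := mem_inf_of_right (mem_principal_self _)
  filter_upwards [h1, h2] with z hz1 hz2
  exact hC z hz2 hz1 i j

lemma tendsto_conj_cocompact_compl_contour (z₀ : ℝ) : Tendsto (starRingEnd ℂ)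
    (cocompact ℂ ⊓ 𝓟 (contour z₀)ᶜ) (cocompact ℂ ⊓ 𝓟 (contour z₀)ᶜ) := by
  refine tendsto_inf.2 ⟨?_, tendsto_principal.2 ?_⟩
  · exact (Complex.conjCLE.toHomeomorph.isClosedEmbedding.tendsto_cocompact).mono_left inf_le_left
  · have h2 : ∀ᶠ z : ℂ in cocompact ℂ ⊓ 𝓟 (contour z₀)ᶜ, z ∈ (contour z₀)ᶜ :=
      mem_inf_of_right (mem_principal_self _)
    filter_upwards [h2] with z hz h using hz (conj_mem_contour_iff.1 h)

lemma IsModelSolution.tendsto_gram (hM : IsModelSolution D χ α γ x t M)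
    (hG : CutoffGeometry D χ d L) : Tendsto (gram D χ α γ x t M)
      (cocompact ℂ ⊓ 𝓟 (contour (phasePoint α x t))ᶜ) (𝓝 1) := by
  have h1 := hM.tendsto_one
  have h2 : Tendsto (fun z => (M (starRingEnd ℂ z)).conjTranspose)
      (cocompact ℂ ⊓ 𝓟 (contour (phasePoint α x t))ᶜ) (𝓝 (1 : Matrix (Fin 2) (Fin 2) ℂ).conjTranspose) :=
    ((continuous_id.matrix_conjTranspose).tendsto _).comp
      (h1.comp (tendsto_conj_cocompact_compl_contour _))
  have h3 := h1.mul h2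
  rw [Matrix.conjTranspose_one, mul_one] at h3
  refine h3.congr' ?_
  have h4 : ∀ᶠ z : ℂ in cocompact ℂ ⊓ 𝓟 (contour (phasePoint α x t))ᶜ, L < ‖z‖ :=
    (tendsto_norm_cocompact_atTop.eventually_gt_atTop L).filter_mono inf_le_left
  filter_upwards [h4] with z hz
  rw [gram_eq_of_eq]
  rw [hG.eq_zero_far z hz.le, hG.eq_zero_far _ (by simpa using hz.le)]

/-- The Gram function differs from the identity by an exponentially small amount. -/
lemma IsModelSolution.norm_gram_sub_one_le (hM : IsModelSolution D χ α γ x t M)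
    (hG : CutoffGeometry D χ d L) (hB0 : 0 ≤ B) (hB : ∀ z₀ z, ‖f1 D z₀ z‖ ≤ B ∧ ‖f3 D z₀ z‖ ≤ B ∧
    ‖f4 D z₀ z‖ ≤ B ∧ ‖f6 D z₀ z‖ ≤ B) (hBχ : ∀ z, ‖fderiv ℝ (cutoffDefect χ) z‖ ≤ Bχ)
    (hK : ∀ (O : Set ℂ) (s b : ℂ → ℂ) (a : ℝ),
      IsOpen O → ContDiff ℝ 1 s → ContinuousOn b O → 0 ≤ a → (∀ z ∈ O, ‖dbar s z * b z‖ ≤ a) →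
      (∀ z, L < ‖z‖ → dbar s z = 0) →
      HasKatoBound (O.indicator fun z => dbar s z * b z) (a * K) ∧
        ∀ z, ‖solidCauchy (O.indicator fun z => dbar s z * b z) z‖ ≤ a * K)
    (ht : 0 < t)
    (hm : ∀ z ∈ offPoles D (phasePoint α x t) d, ∀ i j, ‖M z i j‖ ≤ m)
    {z : ℂ} (hz : z ∉ contour (phasePoint α x t)) (hzD : z ∉ D.discrete) (i j : Fin 2) :
    ‖(gram D χ α γ x t M z - 1) i j‖ ≤ Bχ * (4 * B * K) * Real.exp (-(8 * t * d ^ 2)) * m ^ 2 := by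
  -- The real axis is removed because `b` need not be continuous there. This costs nothing, since
  -- the derivative of the cutoff vanishes in a strip around it.
  set O : Set ℂ := (contour (phasePoint α x t) ∪ D.discrete)ᶜ ∩ {z | z.im ≠ 0} with hO
  have hOo : IsOpen O := (isOpen_compl_contour_union D _).inter
    (isOpen_ne_fun Complex.continuous_im continuous_const)
  have hBχ0 : 0 ≤ Bχ := (norm_nonneg _).trans (hBχ 0)
  set b : ℂ → ℂ := fun z =>
    (M z * jumpNil D α γ x t z * (M (starRingEnd ℂ z)).conjTranspose) i j with hb
  have hbc : ContinuousOn b O := by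
    rintro z ⟨hz, him⟩
    rw [mem_compl_iff, mem_union, not_or] at hz
    exact (differentiableAt_mul_entry (differentiableAt_mul_entry (hM.differentiableAt hz.1 hz.2)
      (differentiableAt_jumpNil hz.1 him)) (hM.differentiableAt_reflect hz.1 hz.2) i
        j).continuousAt.continuousWithinAt
  -- On the support of the density `|Im z| ≥ d`, so the nilpotent factor contributes `B * exp (-8 t
  -- d²)`, the two copies of `M` contribute `m ^ 2`, and the two matrix products a factor `4`.
  set a : ℝ := Bχ * (4 * B * Real.exp (-(8 * t * d ^ 2)) * m ^ 2) with ha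
  have ha0 : 0 ≤ a := by positivity
  have hba : ∀ z ∈ O, ‖dbar (cutoffDefect χ) z * b z‖ ≤ a := by
    rintro z ⟨hz, him⟩
    rw [mem_compl_iff, mem_union, not_or] at hz
    by_cases h0 : |z.im| < d ∨ L < ‖z‖ ∨ ∃ w ∈ D.discrete, dist z w < d
    · rw [hG.dbar_cutoffDefect_eq_zero h0, zero_mul, norm_zero]; exact ha0
    push Not at h0
    have hzV : z ∈ offPoles D (phasePoint α x t) d := ⟨hz.1, h0.2.2⟩
    rw [norm_mul, ha]
    gcongr
    · exact (norm_dbar_le _ _).trans (hBχ z)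
    · refine (norm_mul_entry_le (norm_mul_entry_le (hm z hzV)
        (norm_jumpNil_le_of_im hB0 hB hG.pos ht h0.1))
          (norm_conjTranspose_entry_le (hm _ (conj_mem_offPoles hzV))) i j).trans (le_of_eq ?_)
      ring
  obtain ⟨hk1, hk2⟩ := hK O (cutoffDefect χ) b a hOo hG.contDiff_cutoffDefect hbc ha0 hba
    fun z hz => hG.dbar_cutoffDefect_eq_zero (Or.inr (Or.inl hz))
  have hz0 : z ∉ insert (phasePoint α x t : ℂ) D.discrete := by
    rintro (rfl | h)
    · exact hz (by simp [contour])
    · exact hzD h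
  -- Liouville's theorem: each entry is its limit at infinity plus the Cauchy transform of its
  -- ∂̄-derivative.
  have hrep := eq_add_solidCauchy_of_tendsto (f := fun z => gram D χ α γ x t M z i j)
    ((discrete_finite D).insert (phasePoint α x t : ℂ)) hk1
    (fun z hzS hzP => by
      obtain ⟨h1, h2⟩ := hM.hasDbar_gram hG hzS (fun h => hzP (Or.inr h)) i j
      refine ⟨h1, h2.trans ?_⟩
      by_cases him : z.im = 0
      · rw [indicator_of_notMem (fun h => h.2 him),
          hG.dbar_cutoffDefect_eq_zero (Or.inl (by simpa [him] using hG.pos)), zero_mul]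
      · rw [indicator_of_mem]
        exact ⟨fun h => h.elim hzS (fun h => hzP (Or.inr h)), him⟩)
    (fun z hzS hzP => hM.exists_tendsto_gram hG.smooth.continuous hzS (fun h => hzP (Or.inr h))
      (fun h => hzP (Or.inl h)) i j)
    (fun p hp => hM.bounded_gram hG hB0 hB ht hp i j)
    (tendsto_matrix_iff.1 (hM.tendsto_gram hG) i j) z hz hz0
  rw [Matrix.sub_apply, hrep, add_sub_cancel_left]
  refine (hk2 z).trans (le_of_eq ?_)
  rw [ha]; ring

end Gram

/-! ### Blaschke products for a half-plane. -/

section Blaschke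

variable {ι : Type*} [Fintype ι] {σ : ℝ} {q : ι → ℂ} {z : ℂ}

/-- The finite Blaschke product with zeros `q k`. -/
noncomputable def halfPlaneBlaschke (q : ι → ℂ) (z : ℂ) : ℂ :=
  ∏ k, (z - q k) / (z - starRingEnd ℂ (q k))

lemma ne_conj_of_halfPlane {w : ℂ} (hq : 0 < σ * w.im) (hz : 0 ≤ σ * z.im) :
    z - starRingEnd ℂ w ≠ 0 := fun h => by
  have h1 : z.im = -w.im := by
    have := congrArg Complex.im (sub_eq_zero.1 h); simpa using this
  rw [h1] at hz
  linarith

lemma norm_sub_le_norm_sub_conj {w : ℂ} (hσ : σ = 1 ∨ σ = -1) (hq : 0 < σ * w.im)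
    (hz : 0 ≤ σ * z.im) : ‖z - w‖ ≤ ‖z - starRingEnd ℂ w‖ := by
  rw [Complex.norm_def, Complex.norm_def]
  refine Real.sqrt_le_sqrt ?_
  rw [Complex.normSq_apply, Complex.normSq_apply]
  simp only [Complex.sub_re, Complex.sub_im, Complex.conj_re, Complex.conj_im]
  rcases hσ with rfl | rfl <;> nlinarith [mul_nonneg hq.le hz]

lemma differentiableAt_halfPlaneBlaschke (hq : ∀ k, 0 < σ * (q k).im) (hz : 0 ≤ σ * z.im) :
    DifferentiableAt ℂ (halfPlaneBlaschke q) z := by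
  have : halfPlaneBlaschke q = fun z => ∏ k, (z - q k) / (z - starRingEnd ℂ (q k)) := rfl
  rw [this]
  refine DifferentiableAt.fun_finsetProd fun k _ => ?_
  exact DifferentiableAt.div (by fun_prop) (by fun_prop) (ne_conj_of_halfPlane (hq k) hz)

lemma norm_factor_le_one (hσ : σ = 1 ∨ σ = -1) {w : ℂ} (hq : 0 < σ * w.im) (hz : 0 ≤ σ * z.im) :
    ‖(z - w) / (z - starRingEnd ℂ w)‖ ≤ 1 := by
  rw [norm_div]
  exact div_le_one_of_le₀ (norm_sub_le_norm_sub_conj hσ hq hz) (norm_nonneg _)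

lemma norm_halfPlaneBlaschke_le_one (hσ : σ = 1 ∨ σ = -1) (hq : ∀ k, 0 < σ * (q k).im)
    (hz : 0 ≤ σ * z.im) : ‖halfPlaneBlaschke q z‖ ≤ 1 := by
  rw [halfPlaneBlaschke, norm_prod]
  exact Finset.prod_le_one (fun _ _ => norm_nonneg _) fun k _ => norm_factor_le_one hσ (hq k) hz

/-- The other factors are at most one, and the denominator of the chosen factor is at least `|Im (q
k)|`. So the product absorbs a simple pole at `q k`. -/
lemma norm_halfPlaneBlaschke_le_factor (hσ : σ = 1 ∨ σ = -1) (hq : ∀ k, 0 < σ * (q k).im)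
    (hz : 0 ≤ σ * z.im) (k : ι) :
    ‖halfPlaneBlaschke q z‖ ≤ ‖z - q k‖ / (σ * (q k).im) := by
  classical
  rw [halfPlaneBlaschke, norm_prod, ← Finset.mul_prod_erase _ _ (Finset.mem_univ k)]
  have h1 : ∏ j ∈ Finset.univ.erase k, ‖(z - q j) / (z - starRingEnd ℂ (q j))‖ ≤ 1 :=
    Finset.prod_le_one (fun _ _ => norm_nonneg _) fun k _ => norm_factor_le_one hσ (hq k) hz
  refine (mul_le_of_le_one_right (norm_nonneg _) h1).trans ?_
  rw [norm_div]
  refine div_le_div_of_nonneg_left (norm_nonneg _) (hq k) ?_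
  have h2 := Complex.abs_im_le_norm (z - starRingEnd ℂ (q k))
  simp only [Complex.sub_im, Complex.conj_im, sub_neg_eq_add] at h2
  refine le_trans ?_ h2
  have hk := hq k
  rcases hσ with rfl | rfl
  · refine le_trans ?_ (le_abs_self _); linarith
  · refine le_trans ?_ (neg_le_abs _); linarith

/-- If `‖z - q k‖ ≥ d`, then `‖z - q k*‖ ≤ ‖z - q k‖ + 2 * L ≤ (1 + 2 * L / d) * ‖z - q k‖`, so
removing the product again costs a fixed constant. The second alternative only covers vanishing
denominators. -/
lemma one_le_norm_halfPlaneBlaschke_mul {d L : ℝ} (hd : 0 < d) (hL : ∀ k, ‖q k‖ ≤ L)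
    (h1 : ∀ k, d ≤ ‖z - q k‖) :
    1 ≤ (1 + 2 * L / d) ^ Fintype.card ι * ‖halfPlaneBlaschke q z‖ ∨
      ∃ k, z - starRingEnd ℂ (q k) = 0 := by
  by_cases h : ∃ k, z - starRingEnd ℂ (q k) = 0
  · exact Or.inr h
  push Not at h
  left
  rw [halfPlaneBlaschke, norm_prod, ← Finset.card_univ, ← Finset.prod_const, ← Finset.prod_mul_distrib]
  refine Finset.one_le_prod fun k _ => ?_
  have hpos : 0 < ‖z - starRingEnd ℂ (q k)‖ := norm_pos_iff.2 (h k)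
  have hL0 : 0 ≤ L := (norm_nonneg _).trans (hL k)
  rw [norm_div, ← mul_div_assoc, one_le_div hpos]
  have h2 : ‖z - starRingEnd ℂ (q k)‖ ≤ ‖z - q k‖ + 2 * L := by
    have e : z - starRingEnd ℂ (q k) = (z - q k) + (q k - starRingEnd ℂ (q k)) := by ring
    rw [e]
    refine (norm_add_le _ _).trans (add_le_add le_rfl ((norm_sub_le _ _).trans ?_))
    rw [RCLike.norm_conj]
    linarith [hL k]
  refine h2.trans ?_
  have h3 : 2 * L ≤ 2 * L / d * ‖z - q k‖ := by
    rw [div_mul_eq_mul_div, le_div_iff₀ hd]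
    exact mul_le_mul_of_nonneg_left (h1 k) (by positivity)
  linarith

end Blaschke

/-! ### One-sided limits on the real axis. -/

section Sides

variable {D : ScatteringData} {α γ x t σ : ℝ}

lemma exists_tendsto_log_side (hσ : σ = 1 ∨ σ = -1) {a : ℝ} (ha : a ≠ 0) :
    ∃ y, Tendsto Complex.log (𝓝[{z : ℂ | 0 < σ * z.im}] (a : ℂ)) (𝓝 y) := by
  rcases lt_or_gt_of_ne ha with h | h
  · rcases hσ with rfl | rfl
    · refine ⟨_, ((Complex.continuousWithinAt_log_of_re_neg_of_im_zero (z := a) (by simpa using h)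
        (by simp)).mono fun z hz => ?_).tendsto⟩
      have : 0 < 1 * z.im := hz
      simp only [mem_ofPred_eq]; linarith
    · have := Complex.tendsto_log_nhdsWithin_im_neg_of_re_neg_of_im_zero (z := a) (by simpa using h)
        (by simp)
      refine ⟨_, this.mono_left (nhdsWithin_mono _ fun z hz => ?_)⟩
      have : 0 < -1 * z.im := hz
      simp only [mem_ofPred_eq]; linarith
  · exact ⟨_, ((continuousAt_clog (Or.inl (by simpa using h))).tendsto).mono_left
      nhdsWithin_le_nhds⟩

lemma exists_tendsto_cpow_side (hσ : σ = 1 ∨ σ = -1) {s z₀ : ℝ} (hs : s ≠ z₀) (c : ℂ) :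
    ∃ y, Tendsto (fun z : ℂ => (z - z₀) ^ c) (𝓝[{z : ℂ | 0 < σ * z.im}] (s : ℂ)) (𝓝 y) := by
  obtain ⟨y, hy⟩ := exists_tendsto_log_side hσ (sub_ne_zero.2 hs)
  have h1 : Tendsto (fun z : ℂ => z - z₀) (𝓝[{z : ℂ | 0 < σ * z.im}] (s : ℂ))
      (𝓝[{z : ℂ | 0 < σ * z.im}] ((s - z₀ : ℝ) : ℂ)) := by
    refine tendsto_nhdsWithin_of_tendsto_nhds_of_eventually_within _ ?_ ?_
    · have : Tendsto (fun z : ℂ => z - z₀) (𝓝 (s : ℂ)) (𝓝 ((s : ℂ) - z₀)) :=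
        Continuous.tendsto (by fun_prop) _
      rw [Complex.ofReal_sub]
      exact this.mono_left nhdsWithin_le_nhds
    · filter_upwards [self_mem_nhdsWithin] with z hz
      have : 0 < σ * z.im := hz
      simpa using this
  refine ⟨Complex.exp (y * c), ?_⟩
  refine ((Complex.continuous_exp.tendsto _).comp ((hy.comp h1).mul_const c)).congr' ?_
  filter_upwards [self_mem_nhdsWithin] with z hz
  have hne : z - z₀ ≠ 0 := by
    intro h
    have h2 : z.im = 0 := by
      have := congrArg Complex.im h; simpa using this
    have : 0 < σ * z.im := hz
    rw [h2, mul_zero] at this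
    exact lt_irrefl _ this
  rw [Complex.cpow_def_of_ne_zero hne]
  rfl

lemma tendsto_single_entry {l : Filter ℂ} {f : ℂ → ℂ} {y : ℂ} (h : Tendsto f l (𝓝 y)) :
    Tendsto (fun z => (!![0, 0; f z, 0] : Matrix (Fin 2) (Fin 2) ℂ)) l (𝓝 !![0, 0; y, 0]) ∧
    Tendsto (fun z => (!![0, f z; 0, 0] : Matrix (Fin 2) (Fin 2) ℂ)) l (𝓝 !![0, y; 0, 0]) := by
  constructor <;>
  · refine tendsto_matrix_iff.2 fun i j => ?_
    fin_cases i <;> fin_cases j <;> first | exact tendsto_const_nhds | exact h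

/-- A half-disc of radius `|s - z₀| / 2` at `s` lies in a single sector, where one formula is valid;
the principal power has one-sided limits even on its branch cut. -/
lemma exists_tendsto_jumpNil_side (hσ : σ = 1 ∨ σ = -1) {s : ℝ} (hs : s ≠ phasePoint α x t) :
    ∃ Y, Tendsto (jumpNil D α γ x t) (𝓝[{z : ℂ | 0 < σ * z.im}] (s : ℂ)) (𝓝 Y) := by
  set z₀ := phasePoint α x t with hz₀
  set l := 𝓝[{z : ℂ | 0 < σ * z.im}] (s : ℂ) with hl
  have ho : Tendsto (osc α γ x t) l (𝓝 (osc α γ x t s)) :=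
    (differentiable_osc (s : ℂ)).continuousAt.tendsto.mono_left nhdsWithin_le_nhds
  have hi : Tendsto (fun z => (osc α γ x t z)⁻¹) l (𝓝 (osc α γ x t s)⁻¹) := ho.inv₀ (osc_ne_zero _)
  obtain ⟨y1, h1⟩ := exists_tendsto_cpow_side hσ hs (-2 * Complex.I * (nu D.r z₀ : ℂ))
  obtain ⟨y2, h2⟩ := exists_tendsto_cpow_side hσ hs (2 * Complex.I * (nu D.r z₀ : ℂ))
  have hself : ∀ᶠ z in l, 0 < σ * z.im := self_mem_nhdsWithin
  have hbox : 0 < |s - z₀| := abs_pos.2 (sub_ne_zero.2 hs)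
  have hball : ∀ᶠ z : ℂ in l, ‖z - s‖ < |s - z₀| / 2 := by
    filter_upwards [mem_nhdsWithin_of_mem_nhds (Metric.ball_mem_nhds (s : ℂ) (half_pos hbox))]
      with z hz
    rwa [← dist_eq_norm]
  have hre : ∀ z : ℂ, ‖z - s‖ < |s - z₀| / 2 → |z.re - s| < |s - z₀| / 2 ∧ |z.im| < |s - z₀| / 2 := by
    intro z hz
    have h1 := Complex.abs_re_le_norm (z - s)
    have h2 := Complex.abs_im_le_norm (z - s)
    simp only [Complex.sub_re, Complex.sub_im, Complex.ofReal_re, Complex.ofReal_im, sub_zero] at h1 h2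
    exact ⟨h1.trans_lt hz, h2.trans_lt hz⟩
  rcases hσ with rfl | rfl <;> rcases lt_or_gt_of_ne hs with h | h
  · refine ⟨_, (tendsto_single_entry ((h2.const_mul (starRingEnd ℂ (D.r z₀) /
      (1 + (‖D.r z₀‖ : ℂ) ^ 2) * T0 D z₀ ^ 2)).mul hi)).2.congr' ?_⟩
    filter_upwards [hself, hball] with z hz1 hz2
    obtain ⟨h3, h4⟩ := hre z hz2
    rw [abs_of_neg (sub_neg.2 h)] at h3 h4
    rw [jumpNil_of_mem3 ⟨by linarith, by grind⟩]
    rfl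
  · refine ⟨_, (tendsto_single_entry ((h1.const_mul (D.r z₀ * (T0 D z₀ ^ 2)⁻¹)).mul ho)).1.congr' ?_⟩
    filter_upwards [hself, hball] with z hz1 hz2
    obtain ⟨h3, h4⟩ := hre z hz2
    rw [abs_of_pos (sub_pos.2 h)] at h3 h4
    rw [jumpNil_of_mem1 ⟨by linarith, by grind⟩]
    rfl
  · refine ⟨_, (tendsto_single_entry ((h1.const_mul (D.r z₀ / (1 + (‖D.r z₀‖ : ℂ) ^ 2) *
      (T0 D z₀ ^ 2)⁻¹)).mul ho).neg).1.congr' ?_⟩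
    filter_upwards [hself, hball] with z hz1 hz2
    obtain ⟨h3, h4⟩ := hre z hz2
    rw [abs_of_neg (sub_neg.2 h)] at h3 h4
    rw [jumpNil_of_mem4 ⟨by linarith, by grind⟩]
    rfl
  · refine ⟨_, (tendsto_single_entry ((h2.const_mul (starRingEnd ℂ (D.r z₀) *
      T0 D z₀ ^ 2)).mul hi).neg).2.congr' ?_⟩
    filter_upwards [hself, hball] with z hz1 hz2
    obtain ⟨h3, h4⟩ := hre z hz2
    rw [abs_of_pos (sub_pos.2 h)] at h3 h4
    rw [jumpNil_of_mem6 ⟨by linarith, by grind⟩]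
    rfl

lemma neBot_nhdsWithin_side (hσ : σ = 1 ∨ σ = -1) (s : ℝ) :
    (𝓝[{z : ℂ | 0 < σ * z.im}] (s : ℂ)).NeBot := by
  rw [← mem_closure_iff_nhdsWithin_neBot]
  rcases hσ with rfl | rfl
  · have : {z : ℂ | 0 < 1 * z.im} = {z | 0 < z.im} := by simp
    rw [this, Complex.closure_setOfPred_lt_im]; simp
  · have : {z : ℂ | 0 < -1 * z.im} = {z | z.im < 0} := by simp
    rw [this, Complex.closure_setOfPred_im_lt]; simp

end Sides

/-! ### Estimates in a half-plane. -/

section HalfPlane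

variable {D : ScatteringData} {χ : ℂ → ℝ} {α γ x t d L m B K Bχ η σ : ℝ}
  {M : ℂ → Matrix (Fin 2) (Fin 2) ℂ}

/-- The data of uniform constants for the a priori estimates. -/
structure ModelConstants (D : ScatteringData) (χ : ℂ → ℝ) (d L B K Bχ : ℝ) : Prop where
  geometry : CutoffGeometry D χ d L
  ray_nonneg : 0 ≤ B
  ray_bound : ∀ z₀ z, ‖f1 D z₀ z‖ ≤ B ∧ ‖f3 D z₀ z‖ ≤ B ∧ ‖f4 D z₀ z‖ ≤ B ∧ ‖f6 D z₀ z‖ ≤ B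
  defect_bound : ∀ z, ‖fderiv ℝ (cutoffDefect χ) z‖ ≤ Bχ
  cutoff_bound : ∀ z, ‖fderiv ℝ (fun z => 1 - (χ z : ℂ)) z‖ ≤ Bχ
  kato_nonneg : 0 ≤ K
  kato : ∀ (O : Set ℂ) (s b : ℂ → ℂ) (a : ℝ),
      IsOpen O → ContDiff ℝ 1 s → ContinuousOn b O → 0 ≤ a → (∀ z ∈ O, ‖dbar s z * b z‖ ≤ a) →
      (∀ z, L < ‖z‖ → dbar s z = 0) →
      HasKatoBound (O.indicator fun z => dbar s z * b z) (a * K) ∧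
        ∀ z, ‖solidCauchy (O.indicator fun z => dbar s z * b z) z‖ ≤ a * K

lemma CutoffGeometry.norm_one_sub_le (hG : CutoffGeometry D χ d L) (z : ℂ) :
    ‖1 - (χ z : ℂ)‖ ≤ 1 := by
  have := hG.mem_Icc z
  rw [← Complex.ofReal_one, ← Complex.ofReal_sub, Complex.norm_real, Real.norm_eq_abs, abs_le]
  constructor <;> linarith [this.1, this.2]

lemma ofReal_notMem_contour {z₀ s : ℝ} (hs : s ≠ z₀) : (s : ℂ) ∉ contour z₀ := fun h => by
  have h2 : |(s : ℂ).im| = |(s : ℂ).re - z₀| := h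
  rw [Complex.ofReal_im, abs_zero, Complex.ofReal_re, eq_comm, abs_eq_zero, sub_eq_zero] at h2
  exact hs h2

/-- On the real axis the Gram function is `M M†`, whose diagonal entries are sums of squares. This
positivity turns control of the Gram function into control of `M`. -/
lemma norm_sq_le_gram_of_real (s : ℝ) (i j : Fin 2) :
    ‖M s i j‖ ^ 2 ≤ ‖gram D χ α γ x t M s i i‖ := by
  have e : gram D χ α γ x t M s i i = ((‖M s i 0‖ ^ 2 + ‖M s i 1‖ ^ 2 : ℝ) : ℂ) := by
    rw [gram_eq_of_eq (by rw [Complex.conj_ofReal]), Complex.conj_ofReal, Matrix.mul_apply,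
      Fin.sum_univ_two, Matrix.conjTranspose_apply, Matrix.conjTranspose_apply]
    push_cast
    rw [← Complex.mul_conj', ← Complex.mul_conj']
    rfl
  rw [e, Complex.norm_real, Real.norm_of_nonneg (by positivity)]
  fin_cases j
  · simp only [Fin.zero_eta]; nlinarith [sq_nonneg ‖M s i 1‖]
  · simp only [Fin.mk_one]; nlinarith [sq_nonneg ‖M s i 0‖]

/-- The Gram estimate gives `‖M‖² ≤ 1 + η² m² ≤ (1 + η m)²`. -/
lemma IsModelSolution.norm_real_le (hM : IsModelSolution D χ α γ x t M)
    (hC : ModelConstants D χ d L B K Bχ) (ht : 0 < t) (hm0 : 0 ≤ m)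
    (hm : ∀ z ∈ offPoles D (phasePoint α x t) d, ∀ i j, ‖M z i j‖ ≤ m) (hη : 0 ≤ η)
    (hε : Bχ * (4 * B * K) * Real.exp (-(8 * t * d ^ 2)) ≤ η ^ 2) {s : ℝ}
    (hs : s ≠ phasePoint α x t) (i j : Fin 2) : ‖M s i j‖ ≤ 1 + η * m := by
  have h1 := norm_sq_le_gram_of_real (D := D) (χ := χ) (α := α) (γ := γ) (x := x) (t := t) (M := M) s i j
  have h2 := hM.norm_gram_sub_one_le hC.geometry hC.ray_nonneg hC.ray_bound hC.defect_bound hC.kato ht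
    hm (ofReal_notMem_contour hs) (ofReal_notMem_discrete D s) i i
  rw [Matrix.sub_apply, Matrix.one_apply_eq] at h2
  have h3 := norm_sub_norm_le (gram D χ α γ x t M s i i) 1
  rw [norm_one] at h3
  have h4 := mul_le_mul_of_nonneg_right hε (sq_nonneg m)
  refine abs_le_of_sq_le_sq' ?_ (by positivity) |>.2
  nlinarith [mul_nonneg hη hm0]

/-- The Blaschke product removes the poles of the unfolded solution; subtracting one Cauchy
transform then leaves a bounded holomorphic function. Phragmén–Lindelöf bounds it by its values on
the real axis, where `norm_real_le` applies. The Cauchy transform is paid for twice, in the boundary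
values and when it is added back. -/
lemma IsModelSolution.norm_unfolded_le (hM : IsModelSolution D χ α γ x t M)
    (hC : ModelConstants D χ d L B K Bχ) (ht : 0 < t) (hm0 : 0 ≤ m)
    (hm : ∀ z ∈ offPoles D (phasePoint α x t) d, ∀ i j, ‖M z i j‖ ≤ m) (hη : 0 ≤ η)
    (hε : Bχ * (4 * B * K) * Real.exp (-(8 * t * d ^ 2)) ≤ η ^ 2)
    {ι : Type*} [Fintype ι] {q : ι → ℂ}
    (hσ : σ = 1 ∨ σ = -1) (hq : ∀ k, 0 < σ * (q k).im)
    (hDq : ∀ w ∈ D.discrete, 0 < σ * w.im → ∃ k, w = q k)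
    {z : ℂ} (hzV : z ∈ offPoles D (phasePoint α x t) d) (hz : 0 < σ * z.im) (i j : Fin 2) :
    ‖halfPlaneBlaschke q z * unfolded D χ α γ x t M z i j‖ ≤ 2 * (1 + η * m) * (1 + B) +
      2 * (Bχ * (2 * m * (B * Real.exp (-(8 * t * d ^ 2)))) * K) := by
  have hG := hC.geometry
  set S := contour (phasePoint α x t) with hS
  set H : Set ℂ := {z | 0 < σ * z.im} with hH
  have hHo : IsOpen H := isOpen_lt continuous_const (by fun_prop)
  set O : Set ℂ := (S ∪ D.discrete)ᶜ ∩ H with hO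
  have hOo : IsOpen O := (isOpen_compl_contour_union D _).inter hHo
  have hBχ0 : 0 ≤ Bχ := (norm_nonneg _).trans (hC.cutoff_bound 0)
  have hB0 := hC.ray_nonneg
  have hK0 := hC.kato_nonneg
  set Q := halfPlaneBlaschke q with hQ
  have hQd : ∀ z : ℂ, 0 ≤ σ * z.im → DifferentiableAt ℂ Q z := fun z hz =>
    differentiableAt_halfPlaneBlaschke hq hz
  have him0 : ∀ z ∈ H, z.im ≠ 0 := fun z hz h => by
    have h1 : 0 < σ * z.im := hz
    rw [h, mul_zero] at h1
    exact lt_irrefl _ h1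
  set b : ℂ → ℂ := fun z => Q z * (M z * jumpNil D α γ x t z) i j with hb
  have hMN : ∀ z ∈ H, z ∉ S → z ∉ D.discrete →
      DifferentiableAt ℂ (fun z => (M z * jumpNil D α γ x t z) i j) z := fun z hz hzS hzD =>
    differentiableAt_mul_entry (hM.differentiableAt hzS hzD)
      (differentiableAt_jumpNil hzS (him0 z hz)) i j
  have hbd : ∀ z ∈ H, z ∉ S → z ∉ D.discrete → DifferentiableAt ℂ b z := fun z hz hzS hzD =>
    (hQd z (le_of_lt hz)).mul (hMN z hz hzS hzD)
  set a : ℝ := Bχ * (2 * m * (B * Real.exp (-(8 * t * d ^ 2)))) with ha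
  have ha0 : 0 ≤ a := by positivity
  have hba : ∀ z ∈ O, ‖dbar (fun z => 1 - (χ z : ℂ)) z * b z‖ ≤ a := by
    rintro z ⟨hz, hzH⟩
    rw [mem_compl_iff, mem_union, not_or] at hz
    by_cases h0 : |z.im| < d ∨ L < ‖z‖ ∨ ∃ w ∈ D.discrete, dist z w < d
    · rw [hG.dbar_cutoff_eq_zero h0, zero_mul, norm_zero]; exact ha0
    push Not at h0
    rw [norm_mul, norm_mul, ha]
    have h1 : ‖Q z‖ ≤ 1 := norm_halfPlaneBlaschke_le_one hσ hq (le_of_lt hzH)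
    have h2 : ‖(M z * jumpNil D α γ x t z) i j‖ ≤ 2 * m * (B * Real.exp (-(8 * t * d ^ 2))) :=
      norm_mul_entry_le (hm z ⟨hz.1, h0.2.2⟩)
        (norm_jumpNil_le_of_im hB0 hC.ray_bound hG.pos ht h0.1) i j
    exact mul_le_mul ((norm_dbar_le _ _).trans (hC.cutoff_bound z))
      ((mul_le_of_le_one_left (norm_nonneg _) h1).trans h2) (by positivity) hBχ0
  obtain ⟨hk1, hk2⟩ := hC.kato O (fun z => 1 - (χ z : ℂ)) b a hOo hG.contDiff_one_sub
    (fun z hz => by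
      obtain ⟨h1, h2⟩ := hz
      rw [mem_compl_iff, mem_union, not_or] at h1
      exact (hbd z h2 h1.1 h1.2).continuousAt.continuousWithinAt) ha0 hba
    fun z hz => hG.dbar_cutoff_eq_zero (Or.inr (Or.inl hz))
  set g : ℂ → ℂ := O.indicator fun z => dbar (fun z => 1 - (χ z : ℂ)) z * b z with hg
  set f : ℂ → ℂ := fun z => Q z * unfolded D χ α γ x t M z i j with hf
  have hunf : ∀ z, unfolded D χ α γ x t M z i j =
      M z i j + (1 - (χ z : ℂ)) * (M z * jumpNil D α γ x t z) i j := fun z => by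
    rw [unfolded, mul_add, mul_one, Matrix.add_apply, Matrix.mul_smul, Matrix.smul_apply, smul_eq_mul]
  have hfe : f = fun z => Q z * M z i j + (1 - (χ z : ℂ)) * b z := by
    ext z; rw [hf, hb]; simp only [hunf]; ring
  obtain ⟨k, hkd, -, hkf⟩ : ∃ k : ℂ → ℂ, DifferentiableOn ℂ k H ∧
      EqOn k (fun z => extendFrom Sᶜ f z - solidCauchy g z) (H \ D.discrete) ∧
      ∀ z ∈ H, z ∉ S → z ∉ D.discrete → k z = f z - solidCauchy g z := by
    refine exists_holomorphic_glue hHo (discrete_finite D) hk1 ?_ ?_ ?_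
    · intro z hz hzS hzD
      have h1 := dbar_add_mul ((hQd z (le_of_lt hz)).mul (hM.differentiableAt hzS hzD i j))
        (hG.contDiff_one_sub.differentiable one_ne_zero z) (hbd z hz hzS hzD)
      rw [hfe]
      refine ⟨h1.1, h1.2.trans ?_⟩
      rw [hg, indicator_of_mem]
      exact ⟨fun h => h.elim hzS hzD, hz⟩
    · intro z hz hzS hzD
      obtain ⟨Y, hY⟩ := hM.exists_tendsto_unfolded hG.smooth.continuous hzS hzD (by
        rintro rfl
        exact him0 _ hz (Complex.ofReal_im _))
      exact ⟨_, ((hQd z (le_of_lt hz)).continuousAt.tendsto.mono_left nhdsWithin_le_nhds).mul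
        (tendsto_matrix_iff.1 hY i j)⟩
    · rintro p ⟨hpH, hpD⟩
      obtain ⟨k, rfl⟩ := hDq p hpD hpH
      obtain ⟨n, -, ⟨A, hA, -⟩, -⟩ := hM.exists_residues hpD
      refine ⟨(‖A i j‖ + 1) / (σ * (q k).im), ?_⟩
      have h1 := (tendsto_matrix_iff.1 hA i j).norm.eventually_le_const
        (by linarith : ‖A i j‖ < ‖A i j‖ + 1)
      rw [eventually_nhdsWithin_iff] at h1
      filter_upwards [h1, Metric.ball_mem_nhds _ hG.pos, hHo.mem_nhds hpH] with z h1 h2 h3 hzS hzD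
      have h4 := h1 (fun h => h.elim hzS hzD)
      rw [Matrix.smul_apply, smul_eq_mul, norm_mul] at h4
      rw [hf]
      simp only
      rw [unfolded_of_eq_one (hG.eq_one _ hpD z h2), norm_mul]
      refine (mul_le_mul_of_nonneg_right
        (norm_halfPlaneBlaschke_le_factor hσ hq (le_of_lt h3) k) (norm_nonneg _)).trans ?_
      rw [div_mul_eq_mul_div]
      exact div_le_div_of_nonneg_right h4 (hq k).le
  have hUV : ∀ z ∈ offPoles D (phasePoint α x t) d, ∀ i j,
      ‖unfolded D χ α γ x t M z i j‖ ≤ 2 * m * (1 + B) := fun z hz =>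
    norm_mul_entry_le (hm z hz) (norm_one_add_smul_entry_le (hG.norm_one_sub_le z)
      (norm_jumpNil_le_const hB0 hC.ray_bound ht z))
  -- Phragmén–Lindelöf needs only some bound, of any size: near the poles it comes from compactness,
  -- elsewhere from `hm`.
  have hkb : ∃ m' : ℝ, ∀ z ∈ H, ‖k z‖ ≤ m' := by
    set Kc : Set ℂ := ⋃ w ∈ D.discrete ∩ H, Metric.closedBall w d with hKc
    have hKcc : IsCompact Kc := ((discrete_finite D).inter_of_left H).isCompact_biUnion
      fun w _ => isCompact_closedBall w d
    have hKcH : Kc ⊆ H := by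
      intro z hz
      simp only [hKc, mem_iUnion, Metric.mem_closedBall] at hz
      obtain ⟨w, ⟨hwD, hwH⟩, hzw⟩ := hz
      have h1 := hG.im_ge w hwD
      have h2 := Complex.abs_im_le_norm (z - w)
      rw [dist_eq_norm] at hzw
      rw [Complex.sub_im] at h2
      have h3 : 0 < σ * w.im := hwH
      have h4 := abs_le.1 (h2.trans hzw)
      have h5 := hG.pos
      change 0 < σ * z.im
      rcases hσ with rfl | rfl
      · rw [abs_of_pos (by linarith)] at h1; linarith
      · rw [abs_of_neg (by linarith)] at h1; linarith
    obtain ⟨c, hc⟩ := hKcc.exists_bound_of_continuousOn (hkd.continuousOn.mono hKcH)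
    refine ⟨max c (2 * m * (1 + B) + a * K), ?_⟩
    have hoff : ∀ z ∈ H, z ∉ S → ‖k z‖ ≤ max c (2 * m * (1 + B) + a * K) := by
      intro z hz hzS
      by_cases h : ∃ w ∈ D.discrete, dist z w < d
      · obtain ⟨w, hwD, hzw⟩ := h
        refine le_max_of_le_left (hc z ?_)
        simp only [hKc, mem_iUnion, Metric.mem_closedBall]
        refine ⟨w, ⟨hwD, ?_⟩, hzw.le⟩
        have h1 := hG.im_ge w hwD
        have h2 := Complex.abs_im_le_norm (z - w)
        rw [dist_eq_norm] at hzw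
        rw [Complex.sub_im] at h2
        have h3 : 0 < σ * z.im := hz
        have h4 := abs_le.1 (h2.trans hzw.le)
        have h5 := hG.pos
        change 0 < σ * w.im
        rcases hσ with rfl | rfl
        · rcases abs_cases w.im with h6 | h6 <;> linarith
        · rcases abs_cases w.im with h6 | h6 <;> linarith
      · push Not at h
        have hzV : z ∈ offPoles D (phasePoint α x t) d := ⟨hzS, h⟩
        rw [hkf z hz hzS (notMem_discrete_of_mem_offPoles hG.pos hzV)]
        refine le_max_of_le_right ((norm_sub_le _ _).trans (add_le_add ?_ (hk2 z)))
        rw [hf, norm_mul]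
        exact (mul_le_of_le_one_left (norm_nonneg _)
          (norm_halfPlaneBlaschke_le_one hσ hq (le_of_lt hz))).trans (hUV z hzV i j)
    intro z hz
    -- Points of the contour are reached as limits from its dense complement.
    have hne := mem_closure_iff_nhdsWithin_neBot.mp (dense_compl_contour (phasePoint α x t) z)
    have hkc := (hkd.differentiableAt (hHo.mem_nhds hz)).continuousAt.tendsto.norm
    refine le_of_tendsto (hkc.mono_left (nhdsWithin_le_nhds (s := Sᶜ))) ?_
    filter_upwards [mem_nhdsWithin_of_mem_nhds (hHo.mem_nhds hz), self_mem_nhdsWithin] with y h1 h2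
    exact hoff y h1 h2
  obtain ⟨m', hm'⟩ := hkb
  have hkz : ‖k z‖ ≤ 2 * (1 + η * m) * (1 + B) + a * K := by
    refine norm_le_of_halfPlane (z₀ := phasePoint α x t) hσ hkd hm' ?_ hz
    -- `M` is analytic across the real axis away from `z₀`, whereas the triangular factor has a
    -- limit `Y` that depends on the side.
    intro s hs
    have hsS := ofReal_notMem_contour hs
    have hsD := ofReal_notMem_discrete D s
    have hne := neBot_nhdsWithin_side hσ s
    obtain ⟨Y, hY⟩ := exists_tendsto_jumpNil_side (D := D) (γ := γ) hσ hs
    have hYB : ∀ i j, ‖Y i j‖ ≤ B := fun i j => by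
      have := hne
      exact le_of_tendsto (tendsto_matrix_iff.1 hY i j).norm
        (Eventually.of_forall fun z => norm_jumpNil_le_const hB0 hC.ray_bound ht z i j)
    have hMs : Tendsto M (𝓝[H] (s : ℂ)) (𝓝 (M s)) := tendsto_matrix_iff.2 fun i j =>
      (hM.differentiableAt hsS hsD i j).continuousAt.tendsto.mono_left nhdsWithin_le_nhds
    have hχs : Tendsto (fun z => 1 - (χ z : ℂ)) (𝓝[H] (s : ℂ)) (𝓝 (1 - (χ s : ℂ))) :=
      (hG.contDiff_one_sub.continuous.tendsto _).mono_left nhdsWithin_le_nhds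
    have hU : Tendsto (unfolded D χ α γ x t M) (𝓝[H] (s : ℂ))
        (𝓝 (M s * (1 + (1 - (χ s : ℂ)) • Y))) := hMs.mul ((hχs.smul hY).const_add 1)
    have hQs : Tendsto Q (𝓝[H] (s : ℂ)) (𝓝 (Q s)) :=
      (hQd s (by simp)).continuousAt.tendsto.mono_left nhdsWithin_le_nhds
    have hCs : Tendsto (solidCauchy g) (𝓝[H] (s : ℂ)) (𝓝 (solidCauchy g s)) :=
      (hk1.continuous_solidCauchy.tendsto _).mono_left nhdsWithin_le_nhds
    refine ⟨_, ((hQs.mul (tendsto_matrix_iff.1 hU i j)).sub hCs).congr' ?_, ?_⟩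
    · have h1 := mem_nhdsWithin_of_mem_nhds (t := H)
        ((isOpen_compl_contour_union D (phasePoint α x t)).mem_nhds (fun h => h.elim hsS hsD))
      filter_upwards [h1, self_mem_nhdsWithin] with z h1 h2
      rw [mem_compl_iff, mem_union, not_or] at h1
      exact (hkf z h2 h1.1 h1.2).symm
    · refine (norm_sub_le _ _).trans (add_le_add ?_ (hk2 _))
      rw [norm_mul]
      refine (mul_le_of_le_one_left (norm_nonneg _)
        (norm_halfPlaneBlaschke_le_one hσ hq (by simp))).trans ?_
      exact norm_mul_entry_le (hM.norm_real_le hC ht hm0 hm hη hε hs)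
        (norm_one_add_smul_entry_le (hG.norm_one_sub_le _) hYB) i j
  have hzD := notMem_discrete_of_mem_offPoles hG.pos hzV
  have e : f z = k z + solidCauchy g z := by rw [hkf z hz hzV.1 hzD]; ring
  have h3 : ‖f z‖ ≤ (2 * (1 + η * m) * (1 + B) + a * K) + a * K := by
    rw [e]; exact (norm_add_le _ _).trans (add_le_add hkz (hk2 z))
  refine h3.trans (le_of_eq ?_)
  ring

end HalfPlane

/-! ### Uniform bounds for all model solutions. -/

section Uniform

variable {D : ScatteringData} {χ : ℂ → ℝ} {α γ x t d L m B K Bχ η σ : ℝ}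
  {M : ℂ → Matrix (Fin 2) (Fin 2) ℂ}

lemma exists_fderiv_bound_of_const {s : ℂ → ℂ} (hs : ContDiff ℝ 1 s) (c : ℂ)
    (hfar : ∀ z, L ≤ ‖z‖ → s z = c) : ∃ b : ℝ, 0 ≤ b ∧ ∀ z, ‖fderiv ℝ s z‖ ≤ b := by
  obtain ⟨b, hb⟩ := (isCompact_closedBall (0 : ℂ) L).exists_bound_of_continuousOn
    (hs.continuous_fderiv one_ne_zero).continuousOn
  refine ⟨max b 0, le_max_right _ _, fun z => ?_⟩
  rcases le_or_gt ‖z‖ L with h | h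
  · exact le_max_of_le_left (hb z (by simpa using h))
  · have : s =ᶠ[𝓝 z] fun _ => c := by
      filter_upwards [(isOpen_lt continuous_const (by fun_prop) :
        IsOpen {z : ℂ | L < ‖z‖}).mem_nhds h] with y hy
      exact hfar y (le_of_lt hy)
    rw [this.fderiv_eq, fderiv_fun_const]
    exact le_max_of_le_right (by simp)

lemma IsCutoff.exists_modelConstants (hχ : IsCutoff D χ) :
    ∃ d L B K Bχ, ModelConstants D χ d L B K Bχ := by
  obtain ⟨d, L, hG⟩ := hχ.exists_geometry
  obtain ⟨B, hB0, hB⟩ := exists_ray_bound D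
  obtain ⟨K, hK0, hK⟩ := exists_katoBound_cutoff L
  obtain ⟨b1, h10, h1⟩ := exists_fderiv_bound_of_const (L := L) hG.contDiff_cutoffDefect 0
    fun z hz => by
      rw [cutoffDefect, hG.eq_zero_far z hz, hG.eq_zero_far _ (by simpa using hz)]; simp
  obtain ⟨b2, h20, h2⟩ := exists_fderiv_bound_of_const (L := L) hG.contDiff_one_sub 1
    fun z hz => by rw [hG.eq_zero_far z hz]; simp
  exact ⟨d, L, B, K, max b1 b2, hG, hB0, hB, fun z => (h1 z).trans (le_max_left _ _),
    fun z => (h2 z).trans (le_max_right _ _), hK0, hK⟩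

lemma norm_one_sub_smul_entry_le {A : Matrix (Fin 2) (Fin 2) ℂ} {c : ℂ} {a : ℝ} (hc : ‖c‖ ≤ 1)
    (hA : ∀ i j, ‖A i j‖ ≤ a) (i j : Fin 2) : ‖(1 - c • A) i j‖ ≤ 1 + a := by
  have := norm_one_add_smul_entry_le (c := -c) (by rwa [norm_neg]) hA i j
  rwa [neg_smul, ← sub_eq_add_neg] at this

lemma IsModelSolution.norm_le_of_unfolded (hC : ModelConstants D χ d L B K Bχ) (ht : 0 < t) {z : ℂ}
    {u : ℝ} (hu : ∀ i j, ‖unfolded D χ α γ x t M z i j‖ ≤ u) (i j : Fin 2) :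
    ‖M z i j‖ ≤ 2 * u * (1 + B) := by
  rw [eq_unfolded_mul (D := D) (χ := χ) (α := α) (γ := γ) (x := x) (t := t) (M := M) z]
  exact norm_mul_entry_le hu (norm_one_sub_smul_entry_le (hC.geometry.norm_one_sub_le z)
    (norm_jumpNil_le_const hC.ray_nonneg hC.ray_bound ht z)) i j

/-- A bound for the model solution away from its poles improves itself. -/
lemma IsModelSolution.bound_improves (hM : IsModelSolution D χ α γ x t M)
    (hC : ModelConstants D χ d L B K Bχ) (hL : 0 ≤ L) (ht : 0 < t) (hm0 : 0 ≤ m)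
    (hm : ∀ z ∈ offPoles D (phasePoint α x t) d, ∀ i j, ‖M z i j‖ ≤ m) (hη : 0 ≤ η)
    (hε : Bχ * (4 * B * K) * Real.exp (-(8 * t * d ^ 2)) ≤ η ^ 2)
    {z : ℂ} (hz : z ∈ offPoles D (phasePoint α x t) d) (i j : Fin 2) :
    ‖M z i j‖ ≤ 4 * (1 + 2 * L / d) ^ D.N * (1 + B) ^ 2 *
      (1 + (η + Bχ * (2 * B * K) * Real.exp (-(8 * t * d ^ 2))) * m) := by
  have hd := hC.geometry.pos
  have hB0 := hC.ray_nonneg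
  have hK0 := hC.kato_nonneg
  have hBχ0 : 0 ≤ Bχ := (norm_nonneg _).trans (hC.cutoff_bound 0)
  set Qc := (1 + 2 * L / d) ^ D.N with hQc
  have hQ1 : 1 ≤ Qc := one_le_pow₀ (by linarith [show 0 ≤ 2 * L / d by positivity])
  set e := Bχ * (2 * B * K) * Real.exp (-(8 * t * d ^ 2)) with he
  have he0 : 0 ≤ e := by positivity
  -- Each open half-plane is treated with the Blaschke product whose zeros are the points of the
  -- discrete spectrum in it.
  have main : ∀ σ : ℝ, σ = 1 ∨ σ = -1 → 0 < σ * z.im → ∀ q : Fin D.N → ℂ,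
      (∀ k, 0 < σ * (q k).im) → (∀ k, q k ∈ D.discrete) →
      (∀ w ∈ D.discrete, 0 < σ * w.im → ∃ k, w = q k) →
      ‖M z i j‖ ≤ 4 * Qc * (1 + B) ^ 2 * (1 + (η + e) * m) := by
    intro σ hσ hzσ q hq hqD hDq
    have h1 := hM.norm_unfolded_le hC ht hm0 hm hη hε hσ hq hDq hz hzσ
    have h2 : 1 ≤ Qc * ‖halfPlaneBlaschke q z‖ := by
      rcases one_le_norm_halfPlaneBlaschke_mul (q := q) (z := z) hd (L := L) (fun k => by
        have := hC.geometry.norm_le _ (hqD k); linarith) (fun k => by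
        have := hz.2 _ (hqD k); rwa [dist_eq_norm] at this) with h | ⟨k, h⟩
      · rwa [Fintype.card_fin] at h
      · exact absurd h (ne_conj_of_halfPlane (hq k) hzσ.le)
    set u := 2 * (1 + η * m) * (1 + B) + 2 * (Bχ * (2 * m * (B * Real.exp (-(8 * t * d ^ 2)))) * K)
      with hu
    have h3 : ∀ i j, ‖unfolded D χ α γ x t M z i j‖ ≤ Qc * u := by
      intro i j
      have h4 := h1 i j
      rw [norm_mul] at h4
      calc ‖unfolded D χ α γ x t M z i j‖
          ≤ Qc * ‖halfPlaneBlaschke q z‖ * ‖unfolded D χ α γ x t M z i j‖ :=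
            le_mul_of_one_le_left (norm_nonneg _) h2
        _ = Qc * (‖halfPlaneBlaschke q z‖ * ‖unfolded D χ α γ x t M z i j‖) := by ring
        _ ≤ Qc * u := by gcongr
    refine (IsModelSolution.norm_le_of_unfolded hC ht h3 i j).trans ?_
    have h5 : u ≤ 2 * (1 + B) * (1 + (η + e) * m) := by
      rw [hu, he]
      have h6 : 0 ≤ B * (Bχ * (B * K) * Real.exp (-(8 * t * d ^ 2)) * m) := by positivity
      nlinarith
    calc 2 * (Qc * u) * (1 + B) ≤ 2 * (Qc * (2 * (1 + B) * (1 + (η + e) * m))) * (1 + B) := by gcongr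
      _ = _ := by ring
  rcases lt_trichotomy z.im 0 with h | h | h
  · refine main (-1) (Or.inr rfl) (by linarith) (fun k => starRingEnd ℂ (D.pole k)) (fun k => ?_)
      (fun k => ⟨k, Or.inr rfl⟩) ?_
    · simpa using D.pole_im_pos k
    · rintro w ⟨k, rfl | rfl⟩ hw
      · have := D.pole_im_pos k; linarith
      · exact ⟨k, rfl⟩
  · have hzr : z = (z.re : ℂ) := Complex.ext (by simp) (by simpa using h)
    have hs : z.re ≠ phasePoint α x t := fun h' => hz.1 (by
      rw [hzr, h']; simp [contour])
    have h1 := hM.norm_real_le hC ht hm0 hm hη hε hs i j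
    rw [← hzr] at h1
    refine h1.trans ?_
    have h2 : 1 ≤ 4 * Qc * (1 + B) ^ 2 := by
      have : 1 ≤ (1 + B) ^ 2 := one_le_pow₀ (by linarith)
      nlinarith
    have h3 : 0 ≤ (η + e) * m := by positivity
    have h4 : 0 ≤ e * m := by positivity
    nlinarith
  · refine main 1 (Or.inl rfl) (by linarith) D.pole (fun k => ?_)
      (fun k => ⟨k, Or.inl rfl⟩) ?_
    · simpa using D.pole_im_pos k
    · rintro w ⟨k, rfl | rfl⟩ hw
      · exact ⟨k, rfl⟩
      · have := D.pole_im_pos k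
        rw [Complex.conj_im] at hw; linarith

/-- A model solution is bounded away from its poles. -/
lemma IsModelSolution.exists_bound (hM : IsModelSolution D χ α γ x t M)
    (hC : ModelConstants D χ d L B K Bχ) (ht : 0 < t) :
    ∃ m : ℝ, 0 ≤ m ∧ ∀ z ∈ offPoles D (phasePoint α x t) d, ∀ i j, ‖M z i j‖ ≤ m := by
  have hB0 := hC.ray_nonneg
  have hd := hC.geometry.pos
  set V := offPoles D (phasePoint α x t) d with hV
  have hloc : ∀ p : ℂ, ∃ m : ℝ, ∀ᶠ z in 𝓝 p, z ∈ V → ∀ i j, ‖M z i j‖ ≤ m := by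
    intro p
    by_cases hpD : p ∈ D.discrete
    · refine ⟨0, ?_⟩
      filter_upwards [Metric.ball_mem_nhds p hd] with z hz hzV
      have := hzV.2 p hpD
      rw [Metric.mem_ball] at hz
      linarith
    have key : ∀ {F : ℂ → Matrix (Fin 2) (Fin 2) ℂ} {l : Filter ℂ} {Y : Matrix (Fin 2) (Fin 2) ℂ},
        Tendsto F l (𝓝 Y) → ∃ m : ℝ, 0 ≤ m ∧ ∀ᶠ z in l, ∀ i j, ‖F z i j‖ ≤ m := by
      intro F l Y hF
      refine ⟨∑ i, ∑ j, ‖Y i j‖ + 1, by positivity, ?_⟩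
      refine eventually_all.2 fun i => eventually_all.2 fun j => ?_
      refine (tendsto_matrix_iff.1 hF i j).norm.eventually_le_const (lt_of_le_of_lt ?_ (lt_add_one _))
      have h1 : ‖Y i j‖ ≤ ∑ j, ‖Y i j‖ :=
        Finset.single_le_sum (f := fun j => ‖Y i j‖) (fun _ _ => norm_nonneg _) (Finset.mem_univ j)
      exact h1.trans (Finset.single_le_sum (f := fun i => ∑ j, ‖Y i j‖) (fun _ _ => by positivity)
        (Finset.mem_univ i))
    by_cases hp0 : p = phasePoint α x t
    · obtain ⟨C, ε, hε, hb⟩ := hM.bounded_near_vertex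
      refine ⟨C, ?_⟩
      rw [hp0]
      filter_upwards [Metric.ball_mem_nhds _ hε] with z hz hzV
      exact hb z hzV.1 hz
    by_cases hpS : p ∈ contour (phasePoint α x t)
    · obtain ⟨Y, hY⟩ := hM.exists_tendsto_unfolded hC.geometry.smooth.continuous hpS hpD hp0
      obtain ⟨m, -, hm⟩ := key hY
      refine ⟨2 * m * (1 + B), ?_⟩
      rw [eventually_nhdsWithin_iff] at hm
      filter_upwards [hm] with z hz hzV
      exact IsModelSolution.norm_le_of_unfolded hC ht (hz hzV.1)
    · have hY : Tendsto M (𝓝 p) (𝓝 (M p)) := tendsto_matrix_iff.2 fun i j =>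
        (hM.differentiableAt hpS hpD i j).continuousAt.tendsto
      obtain ⟨m, -, hm⟩ := key hY
      refine ⟨m, ?_⟩
      filter_upwards [hm] with z hz _ using hz
  obtain ⟨C, R, hR⟩ := hM.normalized
  obtain ⟨m, hm⟩ : ∃ m : ℝ, ∀ z ∈ Metric.closedBall (0 : ℂ) (max R 1), z ∈ V →
      ∀ i j, ‖M z i j‖ ≤ m := by
    refine (isCompact_closedBall (0 : ℂ) (max R 1)).induction_on
      (p := fun s => ∃ m : ℝ, ∀ z ∈ s, z ∈ V → ∀ i j, ‖M z i j‖ ≤ m) ⟨0, by simp⟩ ?_ ?_ ?_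
    · rintro s t hst ⟨m, hm⟩
      exact ⟨m, fun z hz => hm z (hst hz)⟩
    · rintro s t ⟨m, hm⟩ ⟨m', hm'⟩
      refine ⟨max m m', ?_⟩
      rintro z (hz | hz) hzV i j
      · exact le_max_of_le_left (hm z hz hzV i j)
      · exact le_max_of_le_right (hm' z hz hzV i j)
    · intro p _
      obtain ⟨m, hm⟩ := hloc p
      exact ⟨_, mem_nhdsWithin_of_mem_nhds hm, m, fun z hz => hz⟩
  refine ⟨max (max m (1 + |C|)) 0, le_max_right _ _, fun z hz i j => le_max_of_le_left ?_⟩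
  rcases le_or_gt ‖z‖ (max R 1) with h | h
  · exact le_max_of_le_left (hm z (by simpa using h) hz i j)
  · refine le_max_of_le_right ?_
    have h1 := hR z hz.1 (lt_of_le_of_lt (le_max_left _ _) h) i j
    have h2 : 1 ≤ ‖z‖ := (le_max_right _ _).trans h.le
    have h3 : C / ‖z‖ ≤ |C| := by
      rw [div_le_iff₀ (by linarith)]
      nlinarith [le_abs_self C, abs_nonneg C]
    have h4 : ‖M z i j‖ ≤ ‖(M z - 1) i j‖ + ‖(1 : Matrix (Fin 2) (Fin 2) ℂ) i j‖ := by
      have : M z i j = (M z - 1) i j + (1 : Matrix (Fin 2) (Fin 2) ℂ) i j := by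
        rw [Matrix.sub_apply]; ring
      conv_lhs => rw [this]
      exact norm_add_le _ _
    have h5 : ‖(1 : Matrix (Fin 2) (Fin 2) ℂ) i j‖ ≤ 1 := by
      rw [Matrix.one_apply]; split_ifs <;> simp
    linarith

/-- If every bound `m` may be replaced by `C + m / 2`, the infimum of all bounds is at most `2 * C`;
the `+ 1` allows for an infimum that is not attained. -/
lemma exists_le_of_improves {A : Set ℝ} {C : ℝ} (hne : A.Nonempty) (h0 : ∀ m ∈ A, 0 ≤ m)
    (himp : ∀ m ∈ A, C + m / 2 ∈ A) : ∃ m ∈ A, m ≤ 2 * C + 1 := by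
  have hb : BddBelow A := ⟨0, h0⟩
  have h1 : sInf A ≤ C + sInf A / 2 := by
    have h2 : 2 * (sInf A - C) ≤ sInf A := by
      refine le_csInf hne fun m hm => ?_
      have := csInf_le hb (himp m hm)
      linarith
    linarith
  obtain ⟨m, hm, hlt⟩ := exists_lt_of_csInf_lt hne (show sInf A < 2 * C + 1 by linarith)
  exact ⟨m, hm, hlt.le⟩

/-- The determinant has modulus at least `(3/4)² - (1/4)² = 1/2`, and the entries of the adjugate
are at most `5/4`. -/
lemma exists_right_inv_of_near_one {H : Matrix (Fin 2) (Fin 2) ℂ}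
    (h : ∀ i j, ‖(H - 1) i j‖ ≤ 1 / 4) :
    ∃ G : Matrix (Fin 2) (Fin 2) ℂ, H * G = 1 ∧ ∀ i j, ‖G i j‖ ≤ 3 := by
  have h00 := h 0 0
  have h01 := h 0 1
  have h10 := h 1 0
  have h11 := h 1 1
  simp only [Matrix.sub_apply, Matrix.one_apply_eq, ne_eq, one_ne_zero, not_false_eq_true,
    Matrix.one_apply_ne, zero_ne_one, sub_zero] at h00 h01 h10 h11
  have hdet : 1 / 2 ≤ ‖H.det‖ := by
    have e : H.det = 1 - (-((H 0 0 - 1) + (H 1 1 - 1) + (H 0 0 - 1) * (H 1 1 - 1)) + H 0 1 * H 1 0) := by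
      rw [Matrix.det_fin_two]; ring
    have e' : H.det = 1 - (H 0 1 * H 1 0 - (H 0 0 - 1) * (H 1 1 - 1) - (H 0 0 - 1) - (H 1 1 - 1)) := by
      rw [e]; ring
    have a1 : ‖H 0 0‖ ≥ 3 / 4 := by
      have := norm_sub_norm_le (1 : ℂ) (1 - H 0 0)
      rw [norm_one, sub_sub_cancel, norm_sub_rev] at this
      linarith
    have a2 : ‖H 1 1‖ ≥ 3 / 4 := by
      have := norm_sub_norm_le (1 : ℂ) (1 - H 1 1)
      rw [norm_one, sub_sub_cancel, norm_sub_rev] at this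
      linarith
    have a3 := norm_sub_norm_le (H 0 0 * H 1 1) (H 0 1 * H 1 0)
    rw [Matrix.det_fin_two]
    rw [norm_mul, norm_mul] at a3
    have a4 : ‖H 0 1‖ * ‖H 1 0‖ ≤ 1 / 4 * (1 / 4) := by gcongr
    have a5 : 3 / 4 * (3 / 4) ≤ ‖H 0 0‖ * ‖H 1 1‖ := by gcongr
    linarith
  have hd0 : H.det ≠ 0 := norm_pos_iff.1 (by linarith)
  refine ⟨H.det⁻¹ • H.adjugate, ?_, fun i j => ?_⟩
  · rw [Matrix.mul_smul, Matrix.mul_adjugate, smul_smul, inv_mul_cancel₀ hd0, one_smul]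
  · have hb : ‖H.adjugate i j‖ ≤ 5 / 4 := by
      have b1 : ‖H 0 0‖ ≤ 5 / 4 := by
        have := norm_sub_norm_le (H 0 0) 1
        rw [norm_one] at this; linarith
      have b2 : ‖H 1 1‖ ≤ 5 / 4 := by
        have := norm_sub_norm_le (H 1 1) 1
        rw [norm_one] at this; linarith
      rw [Matrix.adjugate_fin_two]
      fin_cases i <;> fin_cases j <;> simp <;> linarith
    rw [Matrix.smul_apply, smul_eq_mul, norm_mul, norm_inv]
    calc ‖H.det‖⁻¹ * ‖H.adjugate i j‖ ≤ (1 / 2)⁻¹ * (5 / 4) := by gcongr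
      _ ≤ 3 := by norm_num

lemma tendsto_exp_decay (hd : 0 < d) :
    Tendsto (fun t : ℝ => Real.exp (-(8 * t * d ^ 2))) atTop (𝓝 0) := by
  refine Real.tendsto_exp_atBot.comp (tendsto_neg_atTop_atBot.comp ?_)
  have : (fun t : ℝ => 8 * t * d ^ 2) = fun t => (8 * d ^ 2) * t := by ext; ring
  rw [this]
  exact tendsto_id.const_mul_atTop (by positivity)

/-- Uniform bounds, for large `t`, for the model solutions and their inverses away from the
poles. -/
theorem exists_uniform_bound (hχ : IsCutoff D χ) :
    ∃ C t₀ d L : ℝ, CutoffGeometry D χ d L ∧ 0 ≤ C ∧ 0 < t₀ ∧ ∀ α γ t x : ℝ, t₀ ≤ t →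
      ∀ M : ℂ → Matrix (Fin 2) (Fin 2) ℂ, IsModelSolution D χ α γ x t M →
        ∀ z ∈ offPoles D (phasePoint α x t) d,
          (∀ i j, ‖M z i j‖ ≤ C) ∧ ∀ i j, ‖(M z)⁻¹ i j‖ ≤ C := by
  obtain ⟨d, L', B, K', Bχ, hC'⟩ := hχ.exists_modelConstants
  -- The radius is enlarged to be nonnegative, as `bound_improves` requires; `K` depends on the
  -- radius and is chosen anew.
  obtain ⟨L, K, hL, hC⟩ : ∃ L K, 0 ≤ L ∧ ModelConstants D χ d L B K Bχ := by
    obtain ⟨K, hK0, hK⟩ := exists_katoBound_cutoff (max L' 0)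
    refine ⟨max L' 0, K, le_max_right _ _, ⟨?_, hC'.ray_nonneg, hC'.ray_bound, hC'.defect_bound,
      hC'.cutoff_bound, hK0, hK⟩⟩
    exact { hC'.geometry with
      norm_le := fun w hw => (hC'.geometry.norm_le w hw).trans (le_max_left _ _)
      eq_zero_far := fun z hz => hC'.geometry.eq_zero_far z ((le_max_left _ _).trans hz) }
  have hd := hC.geometry.pos
  have hB0 := hC.ray_nonneg
  have hK0 := hC.kato_nonneg
  have hBχ0 : 0 ≤ Bχ := (norm_nonneg _).trans (hC.cutoff_bound 0)
  set C₀ := 4 * (1 + 2 * L / d) ^ D.N * (1 + B) ^ 2 with hC₀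
  have hC₀0 : 0 ≤ C₀ := by positivity
  clear_value C₀
  set E : ℝ → ℝ := fun t => Real.exp (-(8 * t * d ^ 2)) with hE
  have hE0 : Tendsto E atTop (𝓝 0) := tendsto_exp_decay hd
  have l1 : Tendsto (fun t => C₀ * (√(Bχ * (4 * B * K) * E t) + Bχ * (2 * B * K) * E t)) atTop (𝓝 0) := by
    have h1 : Tendsto (fun t => √(Bχ * (4 * B * K) * E t)) atTop (𝓝 0) := by
      have := (Real.continuous_sqrt.tendsto _).comp (hE0.const_mul (Bχ * (4 * B * K)))
      rwa [mul_zero, Real.sqrt_zero] at this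
    have := (h1.add (hE0.const_mul (Bχ * (2 * B * K)))).const_mul C₀
    rwa [mul_zero, add_zero, mul_zero] at this
  have l2 : Tendsto (fun t => Bχ * (4 * B * K) * E t * (2 * C₀ + 1) ^ 2) atTop (𝓝 0) := by
    have := (hE0.const_mul (Bχ * (4 * B * K))).mul_const ((2 * C₀ + 1) ^ 2)
    rwa [mul_zero, zero_mul] at this
  -- Beyond `t₁` the improved bound is at most `C₀ + m / 2`, and with the bound `2 * C₀ + 1` the
  -- Gram function is within `1/4` of the identity.
  obtain ⟨t₁, ht₁⟩ := eventually_atTop.1 ((l1.eventually_le_const (by norm_num : (0 : ℝ) < 1 / 2)).and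
    (l2.eventually_le_const (by norm_num : (0 : ℝ) < 1 / 4)))
  set m₀ := 2 * C₀ + 1 with hm₀
  refine ⟨max m₀ (2 * (2 * (1 + B) * (2 * m₀ * (1 + B))) * 3), max t₁ 1, d, L, hC.geometry,
    le_max_of_le_left (by positivity), by positivity, fun α γ t x ht M hM z hz => ?_⟩
  have ht0 : 0 < t := lt_of_lt_of_le one_pos ((le_max_right _ _).trans ht)
  obtain ⟨e1, e2⟩ := ht₁ t ((le_max_left _ _).trans ht)
  have hbound : ∀ z ∈ offPoles D (phasePoint α x t) d, ∀ i j, ‖M z i j‖ ≤ m₀ := by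
    obtain ⟨m, ⟨hm0, hm⟩, hmle⟩ := exists_le_of_improves
      (A := {m | 0 ≤ m ∧ ∀ z ∈ offPoles D (phasePoint α x t) d, ∀ i j, ‖M z i j‖ ≤ m}) (C := C₀)
      (hM.exists_bound hC ht0) (fun m hm => hm.1) (fun m hm => ⟨by linarith [hm.1], fun z hz i j => by
        refine (hM.bound_improves hC hL ht0 hm.1 hm.2 (Real.sqrt_nonneg (Bχ * (4 * B * K) * E t))
          (by rw [Real.sq_sqrt (by positivity)]) hz i j).trans ?_
        have := mul_le_mul_of_nonneg_right e1 hm.1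
        rw [← hC₀]
        simp only [hE] at this ⊢
        linarith⟩)
    exact fun z hz i j => (hm z hz i j).trans hmle
  refine ⟨fun i j => (hbound z hz i j).trans (le_max_left _ _), fun i j => ?_⟩
  have hgram : ∀ i j, ‖(gram D χ α γ x t M z - 1) i j‖ ≤ 1 / 4 := fun i j =>
    (hM.norm_gram_sub_one_le hC.geometry hB0 hC.ray_bound hC.defect_bound hC.kato ht0 hbound hz.1
      (notMem_discrete_of_mem_offPoles hd hz) i j).trans e2
  obtain ⟨G, hG, hGb⟩ := exists_right_inv_of_near_one hgram
  -- The Gram function begins with the factor `M`, so what follows `M` in it, times a right inverse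
  -- of the Gram function, inverts `M`.
  have hinv : (M z)⁻¹ = (1 + (1 - (χ z : ℂ)) • jumpNil D α γ x t z) *
      (unfolded D χ α γ x t M (starRingEnd ℂ z)).conjTranspose * G := by
    refine Matrix.inv_eq_right_inv (Eq.trans ?_ hG)
    rw [gram]
    generalize (unfolded D χ α γ x t M (starRingEnd ℂ z)).conjTranspose = X
    rw [unfolded, mul_assoc, mul_assoc, mul_assoc]
  have hJ : ∀ z i j, ‖(1 + (1 - (χ z : ℂ)) • jumpNil D α γ x t z) i j‖ ≤ 1 + B := fun z =>
    norm_one_add_smul_entry_le (hC.geometry.norm_one_sub_le z)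
      (norm_jumpNil_le_const hB0 hC.ray_bound ht0 z)
  have hU : ∀ i j, ‖unfolded D χ α γ x t M (starRingEnd ℂ z) i j‖ ≤ 2 * m₀ * (1 + B) :=
    norm_mul_entry_le (hbound _ (conj_mem_offPoles hz)) (hJ _)
  have h2 := norm_mul_entry_le (norm_mul_entry_le (hJ z) (norm_conjTranspose_entry_le hU)) hGb i j
  rw [hinv]
  exact h2.trans (le_max_right _ _)

end Uniform

/-! ### Power singularities on the line. -/

section OneDim

lemma integral_abs_rpow_neg {ρ b : ℝ} (hρ : 0 ≤ ρ) (hb : b < 1) :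
    IntervalIntegrable (fun x : ℝ => |x| ^ (-b)) volume (-ρ) ρ ∧
      ∫ x in (-ρ)..ρ, |x| ^ (-b) = 2 * ρ ^ (1 - b) / (1 - b) := by
  have h1 : IntervalIntegrable (fun x : ℝ => |x| ^ (-b)) volume 0 ρ := by
    refine (intervalIntegral.intervalIntegrable_rpow' (a := 0) (b := ρ)
      (by linarith : -1 < -b)).congr fun x hx => ?_
    rw [uIoc_of_le hρ] at hx
    rw [abs_of_pos hx.1]
  have h2 : IntervalIntegrable (fun x : ℝ => |x| ^ (-b)) volume (-ρ) 0 := by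
    have := h1.comp_sub_left 0
    simp only [zero_sub, abs_neg, sub_zero] at this
    exact this.symm
  have h3 : ∫ x in (0 : ℝ)..ρ, |x| ^ (-b) = ρ ^ (1 - b) / (1 - b) := by
    have e : ∫ x in (0 : ℝ)..ρ, |x| ^ (-b) = ∫ x in (0 : ℝ)..ρ, x ^ (-b) := by
      refine intervalIntegral.integral_congr fun x hx => ?_
      rw [uIcc_of_le hρ] at hx
      rw [abs_of_nonneg hx.1]
    rw [e, integral_rpow (Or.inl (by linarith))]
    rw [show -b + 1 = 1 - b by ring, Real.zero_rpow (by linarith), sub_zero]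
  have h4 : ∫ x in (-ρ)..0, |x| ^ (-b) = ρ ^ (1 - b) / (1 - b) := by
    rw [← h3]
    have := intervalIntegral.integral_comp_neg (a := 0) (b := ρ) (fun x : ℝ => |x| ^ (-b))
    simp only [abs_neg, neg_zero] at this
    exact this.symm
  refine ⟨h2.trans h1, ?_⟩
  rw [← intervalIntegral.integral_add_adjacent_intervals h2 h1, h3, h4]
  ring

/-- The singular part of the kernel `|x|^(-b)`. -/
noncomputable def nearKernel (ρ b : ℝ) : ℝ → ℝ := (Ioc (-ρ) ρ).indicator fun x => |x| ^ (-b)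

lemma nearKernel_nonneg (ρ b x : ℝ) : 0 ≤ nearKernel ρ b x :=
  indicator_nonneg (fun _ _ => by positivity) x

lemma integrable_nearKernel {ρ b : ℝ} (hρ : 0 ≤ ρ) (hb : b < 1) :
    Integrable (nearKernel ρ b) ∧ ∫ x, nearKernel ρ b x = 2 * ρ ^ (1 - b) / (1 - b) := by
  obtain ⟨h1, h2⟩ := integral_abs_rpow_neg hρ hb
  rw [intervalIntegrable_iff_integrableOn_Ioc_of_le (by linarith)] at h1
  rw [intervalIntegral.integral_of_le (by linarith)] at h2
  refine ⟨(integrable_indicator_iff measurableSet_Ioc).2 h1, ?_⟩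
  rw [nearKernel, integral_indicator measurableSet_Ioc, h2]

lemma abs_rpow_neg_le_nearKernel {ρ b : ℝ} (hρ : 0 < ρ) (hb : 0 ≤ b) (x : ℝ) :
    |x| ^ (-b) ≤ nearKernel ρ b x + ρ ^ (-b) := by
  by_cases hx : x ∈ Ioc (-ρ) ρ
  · rw [nearKernel, indicator_of_mem hx]
    have := Real.rpow_nonneg hρ.le (-b)
    linarith
  · rw [nearKernel, indicator_of_notMem hx, zero_add]
    refine Real.rpow_le_rpow_of_nonpos hρ ?_ (by linarith)
    by_contra h
    rw [not_le, abs_lt] at h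
    exact hx ⟨h.1, h.2.le⟩

/-- The singularity is cut off at the length of the interval: the near part contributes at most `4 *
√(q - p)`, the flat part `√(q - p)`, wherever `a` lies. -/
lemma integral_abs_sub_rpow_le {p q : ℝ} (hpq : p < q) (a : ℝ) :
    IntervalIntegrable (fun x : ℝ => |x - a| ^ (-(1 / 2) : ℝ)) volume p q ∧
      ∫ x in p..q, |x - a| ^ (-(1 / 2) : ℝ) ≤ 5 * √(q - p) := by
  have hρ : 0 < q - p := sub_pos.2 hpq
  obtain ⟨h1, h2⟩ := integrable_nearKernel (ρ := q - p) (b := 1 / 2) hρ.le (by norm_num)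
  have h1' : Integrable fun x => nearKernel (q - p) (1 / 2) (x - a) := h1.comp_sub_right a
  have hi : IntegrableOn (fun x => nearKernel (q - p) (1 / 2) (x - a) + (q - p) ^ (-(1 / 2) : ℝ))
      (Ioc p q) := h1'.integrableOn.add (integrableOn_const (by simp))
  have hle : ∀ x, |x - a| ^ (-(1 / 2) : ℝ) ≤
      nearKernel (q - p) (1 / 2) (x - a) + (q - p) ^ (-(1 / 2) : ℝ) := fun x =>
    abs_rpow_neg_le_nearKernel hρ (by norm_num) _
  have hm : IntegrableOn (fun x : ℝ => |x - a| ^ (-(1 / 2) : ℝ)) (Ioc p q) :=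
    hi.mono' (by fun_prop : Measurable fun x : ℝ => |x - a| ^ (-(1 / 2) : ℝ)).aestronglyMeasurable
      (Eventually.of_forall fun x => by
        rw [Real.norm_of_nonneg (by positivity)]; exact hle x)
  refine ⟨(intervalIntegrable_iff_integrableOn_Ioc_of_le hpq.le).2 hm, ?_⟩
  rw [intervalIntegral.integral_of_le hpq.le]
  refine (integral_mono hm hi hle).trans ?_
  rw [integral_add h1'.integrableOn (integrableOn_const (by simp))]
  have h3 : ∫ x in Ioc p q, nearKernel (q - p) (1 / 2) (x - a) ≤ 4 * √(q - p) := by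
    refine (setIntegral_le_integral h1' (Eventually.of_forall fun x => nearKernel_nonneg _ _ _)).trans ?_
    rw [integral_sub_right_eq_self, h2, Real.sqrt_eq_rpow]
    norm_num
    linarith
  have h4 : ∫ _ in Ioc p q, (q - p) ^ (-(1 / 2) : ℝ) = √(q - p) := by
    rw [setIntegral_const, smul_eq_mul, Real.volume_real_Ioc_of_le hpq.le, Real.sqrt_eq_rpow]
    nth_rewrite 1 [← Real.rpow_one (q - p)]
    rw [← Real.rpow_add hρ]
    norm_num
  linarith

end OneDim

/-! ### A Privalov estimate for Cauchy integrals. -/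

section Privalov

variable {n : ℝ → ℂ} {K : ℝ} {w : ℂ}

lemma add_ne_zero_of_im_ne_zero (hw : w.im ≠ 0) (x : ℝ) : (x : ℂ) + w ≠ 0 := fun h => hw (by
  have := congrArg Complex.im h; simpa using this)

lemma integral_inv_add (hw : w.im ≠ 0) (p q : ℝ) :
    ∫ x in p..q, ((x : ℂ) + w)⁻¹ = Complex.log (q + w) - Complex.log (p + w) := by
  refine intervalIntegral.integral_eq_sub_of_hasDerivAt (f := fun x : ℝ => Complex.log (x + w))
    (fun x _ => ?_) ?_
  · have h1 : HasDerivAt (fun x : ℝ => (x : ℂ) + w) 1 x := (Complex.ofRealCLM.hasDerivAt).add_const w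
    have h2 := h1.clog_real (Or.inr (by simpa using hw))
    rwa [one_div] at h2
  · refine Continuous.intervalIntegrable (Continuous.inv₀ (by fun_prop) fun x => ?_) _ _
    exact add_ne_zero_of_im_ne_zero hw x

/-- The real part is at most `log 3 ≤ 2`. The arguments lie in `[-π, π]`, so the imaginary part is
at most `2π ≤ 8` and the branch cut needs no attention. -/
lemma norm_log_sub_log_le {a b : ℂ} (ha : a ≠ 0) (h1 : ‖a‖ ≤ ‖b‖) (h2 : ‖b‖ ≤ 3 * ‖a‖) :
    ‖Complex.log b - Complex.log a‖ ≤ 10 := by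
  have ha' : 0 < ‖a‖ := norm_pos_iff.2 ha
  have hre : |(Complex.log b - Complex.log a).re| ≤ 2 := by
    rw [Complex.sub_re, Complex.log_re, Complex.log_re, ← Real.log_div (by linarith) ha'.ne',
      abs_of_nonneg (Real.log_nonneg ((one_le_div ha').2 h1))]
    have h3 : ‖b‖ / ‖a‖ ≤ 3 := (div_le_iff₀ ha').2 h2
    have := Real.log_le_sub_one_of_pos (div_pos (ha'.trans_le h1) ha')
    linarith
  have him : |(Complex.log b - Complex.log a).im| ≤ 8 := by
    rw [Complex.sub_im, Complex.log_im, Complex.log_im]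
    have h3 := Complex.abs_arg_le_pi a
    have h4 := Complex.abs_arg_le_pi b
    have h5 := abs_sub (Complex.arg b) (Complex.arg a)
    linarith [Real.pi_lt_d2]
  have := Complex.norm_le_abs_re_add_abs_im (Complex.log b - Complex.log a)
  linarith

lemma intervalIntegrable_div_add (hn : Continuous n) (hw : w.im ≠ 0) (p q : ℝ) :
    IntervalIntegrable (fun x : ℝ => n x / ((x : ℂ) + w)) volume p q :=
  Continuous.intervalIntegrable
    (hn.div (by fun_prop) fun x => add_ne_zero_of_im_ne_zero hw x) _ _

lemma norm_div_self_le (hK : ∀ x y, ‖n x - n y‖ ≤ K * √|x - y|) (h0 : n 0 = 0) (x : ℝ) :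
    ‖n x / (x : ℂ)‖ ≤ K * |x| ^ (-(1 / 2) : ℝ) := by
  rcases eq_or_ne x 0 with rfl | hx
  · rw [h0]; simp
  have hx' : 0 < |x| := abs_pos.2 hx
  have h1 := hK x 0
  rw [h0, sub_zero, sub_zero] at h1
  rw [norm_div, Complex.norm_real, Real.norm_eq_abs, div_le_iff₀ hx', mul_assoc]
  refine h1.trans (le_of_eq ?_)
  congr 1
  nth_rewrite 3 [← Real.rpow_one |x|]
  rw [← Real.rpow_add hx', Real.sqrt_eq_rpow]
  norm_num

lemma intervalIntegrable_div_self (hn : Continuous n) (hK : ∀ x y, ‖n x - n y‖ ≤ K * √|x - y|)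
    (h0 : n 0 = 0) {p q : ℝ} (hpq : p < q) :
    IntervalIntegrable (fun x : ℝ => n x / (x : ℂ)) volume p q := by
  have h1 := ((integral_abs_sub_rpow_le hpq 0).1).const_mul K
  refine h1.mono_fun' ?_ (Eventually.of_forall fun x => ?_)
  · exact (hn.measurable.div (by fun_prop)).aestronglyMeasurable
  · simpa using norm_div_self_le hK h0 x

/-- The Cauchy integral over `[0, 1]` of a function that vanishes at `0` and satisfies a Hölder
condition of order `1/2`, is Hölder continuous at `0`, uniformly up to the segment. -/
lemma norm_cauchy_sub_le (hn : Continuous n) (hK0 : 0 ≤ K) (hK : ∀ x y, ‖n x - n y‖ ≤ K * √|x - y|)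
    (h0 : n 0 = 0) (hw : w.im ≠ 0) (hw1 : ‖w‖ ≤ 1 / 4) :
    ‖(∫ x in (0 : ℝ)..1, n x / ((x : ℂ) + w)) - ∫ x in (0 : ℝ)..1, n x / (x : ℂ)‖ ≤
      30 * K * √‖w‖ := by
  set δ := ‖w‖ with hδ
  have hδ0 : 0 < δ := norm_pos_iff.2 (by rintro rfl; simp at hw)
  have hi1 := intervalIntegrable_div_add hn hw
  have hi2 : ∀ {p q : ℝ}, p < q → IntervalIntegrable (fun x : ℝ => n x / (x : ℂ)) volume p q :=
    fun h => intervalIntegrable_div_self hn hK h0 h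
  -- Split at `2δ`: up to there the two integrals are bounded separately, beyond it the difference
  -- of the kernels is used.
  rw [← intervalIntegral.integral_add_adjacent_intervals (hi1 0 (2 * δ)) (hi1 (2 * δ) 1),
    ← intervalIntegral.integral_add_adjacent_intervals (hi2 (by linarith : 0 < 2 * δ))
      (hi2 (by linarith : 2 * δ < 1))]
  have hs2 : √(2 * δ) ≤ 3 / 2 * √δ := by
    rw [Real.sqrt_mul (by norm_num)]
    gcongr
    rw [Real.sqrt_le_left (by norm_num)]; norm_num
  have b1 : ‖∫ x in (0 : ℝ)..(2 * δ), n x / (x : ℂ)‖ ≤ 15 / 2 * K * √δ := by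
    obtain ⟨j1, j2⟩ := integral_abs_sub_rpow_le (by linarith : 0 < 2 * δ) 0
    refine (intervalIntegral.norm_integral_le_of_norm_le (by linarith)
      (Eventually.of_forall fun x _ => by simpa using norm_div_self_le hK h0 x)
      (j1.const_mul K)).trans ?_
    rw [intervalIntegral.integral_const_mul]
    rw [sub_zero] at j2
    nlinarith
  have hu : |w.re| ≤ δ := Complex.abs_re_le_norm w
  -- `n` is recentred at `-w.re`, the real point closest to the pole `-w`. The constant that is
  -- subtracted has size `K * √δ` and multiplies a difference of two logarithms.
  have b2 : ‖∫ x in (0 : ℝ)..(2 * δ), n x / ((x : ℂ) + w)‖ ≤ 35 / 2 * K * √δ := by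
    have e : ∀ x : ℝ, n x / ((x : ℂ) + w) =
        (n x - n (-w.re)) / ((x : ℂ) + w) + n (-w.re) * ((x : ℂ) + w)⁻¹ := fun x => by
      rw [sub_div, div_eq_mul_inv (n (-w.re))]; ring
    have hi3 : IntervalIntegrable (fun x : ℝ => (n x - n (-w.re)) / ((x : ℂ) + w)) volume 0 (2 * δ) :=
      intervalIntegrable_div_add (n := fun x => n x - n (-w.re)) (by fun_prop) hw _ _
    have hi4 : IntervalIntegrable (fun x : ℝ => n (-w.re) * ((x : ℂ) + w)⁻¹) volume 0 (2 * δ) := by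
      have := intervalIntegrable_div_add (n := fun _ => n (-w.re)) continuous_const hw 0 (2 * δ)
      simpa only [div_eq_mul_inv] using this
    simp only [e]
    rw [intervalIntegral.integral_add hi3 hi4, intervalIntegral.integral_const_mul,
      integral_inv_add hw]
    obtain ⟨j1, j2⟩ := integral_abs_sub_rpow_le (by linarith : 0 < 2 * δ) (-w.re)
    have c1 : ‖∫ x in (0 : ℝ)..(2 * δ), (n x - n (-w.re)) / ((x : ℂ) + w)‖ ≤ 15 / 2 * K * √δ := by
      refine (intervalIntegral.norm_integral_le_of_norm_le (by linarith)
        (Eventually.of_forall fun x _ => ?_) (j1.const_mul K)).trans ?_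
      · have h1 : |x - -w.re| ≤ ‖(x : ℂ) + w‖ := by
          have := Complex.abs_re_le_norm ((x : ℂ) + w)
          simpa using this
        rw [norm_div]
        rcases eq_or_ne (x - -w.re) 0 with h | h
        · rw [show x = -w.re by linarith, sub_self, norm_zero, zero_div]
          positivity
        · have h2 : 0 < |x - -w.re| := abs_pos.2 h
          calc _ ≤ K * √|x - -w.re| / |x - -w.re| := by gcongr; exact hK _ _
            _ = K * |x - -w.re| ^ (-(1 / 2) : ℝ) := by
              rw [div_eq_iff h2.ne', mul_assoc]
              congr 1
              nth_rewrite 3 [← Real.rpow_one |x - -w.re|]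
              rw [← Real.rpow_add h2, Real.sqrt_eq_rpow]
              norm_num
      · rw [intervalIntegral.integral_const_mul]
        rw [sub_zero] at j2
        nlinarith
    have c2 : ‖n (-w.re)‖ ≤ K * √δ := by
      have := hK (-w.re) 0
      rw [h0, sub_zero, sub_zero, abs_neg] at this
      exact this.trans (by gcongr)
    have c3 : ‖Complex.log ((2 * δ : ℝ) + w) - Complex.log ((0 : ℝ) + w)‖ ≤ 10 := by
      have hn2 : ‖((2 * δ : ℝ) : ℂ)‖ = 2 * δ := by
        rw [Complex.norm_real, Real.norm_of_nonneg (by linarith)]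
      refine norm_log_sub_log_le ?_ ?_ ?_
      · exact add_ne_zero_of_im_ne_zero hw 0
      · have := norm_sub_le (((2 * δ : ℝ) : ℂ) + w) w
        rw [add_sub_cancel_right, hn2] at this
        rw [Complex.ofReal_zero, zero_add]
        linarith
      · have := norm_add_le (((2 * δ : ℝ) : ℂ)) w
        rw [hn2] at this
        rw [Complex.ofReal_zero, zero_add]
        linarith
    refine (norm_add_le _ _).trans ?_
    rw [norm_mul]
    have c4 : ‖n (-w.re)‖ * ‖Complex.log ((2 * δ : ℝ) + w) - Complex.log ((0 : ℝ) + w)‖ ≤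
        K * √δ * 10 := by gcongr
    linarith
  -- Here `‖x + w‖ ≥ x / 2`, so the kernels differ by at most `2δ / x²`. With `‖n x‖ ≤ K * √x`, the
  -- integral of `x^(-3/2)` from `2δ` on leaves a multiple of `√δ`.
  have b3 : ‖(∫ x in (2 * δ)..1, n x / ((x : ℂ) + w)) - ∫ x in (2 * δ)..1, n x / (x : ℂ)‖ ≤
      4 * K * √δ := by
    rw [← intervalIntegral.integral_sub (hi1 _ _) (hi2 (by linarith))]
    have hpos : (0 : ℝ) ∉ uIcc (2 * δ) 1 := by
      rw [uIcc_of_le (by linarith)]; intro h; linarith [h.1]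
    have j1 : IntervalIntegrable (fun x : ℝ => 2 * K * δ * x ^ (-(3 / 2) : ℝ)) volume (2 * δ) 1 :=
      (intervalIntegral.intervalIntegrable_rpow (Or.inr hpos)).const_mul _
    refine (intervalIntegral.norm_integral_le_of_norm_le (by linarith)
      (Eventually.of_forall fun x hx => ?_) j1).trans ?_
    · have hx0 : 0 < x := by linarith [hx.1]
      have hxc : (x : ℂ) ≠ 0 := by exact_mod_cast hx0.ne'
      have hxn : ‖(x : ℂ)‖ = x := by rw [Complex.norm_real, Real.norm_of_nonneg hx0.le]
      have hxw := add_ne_zero_of_im_ne_zero hw x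
      have h1 : x / 2 ≤ ‖(x : ℂ) + w‖ := by
        have := norm_sub_le ((x : ℂ) + w) w
        rw [add_sub_cancel_right, hxn] at this
        linarith [hx.1]
      have e : n x / ((x : ℂ) + w) - n x / (x : ℂ) = -(n x * w) / (x * ((x : ℂ) + w)) := by
        field_simp; ring
      have h2 := hK x 0
      rw [h0, sub_zero, sub_zero, abs_of_pos hx0] at h2
      rw [e, norm_div, norm_neg, norm_mul, norm_mul, hxn, ← hδ]
      calc ‖n x‖ * δ / (x * ‖(x : ℂ) + w‖) ≤ K * √x * δ / (x * (x / 2)) := by gcongr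
        _ = 2 * K * δ * (√x / (x * x)) := by field_simp
        _ = 2 * K * δ * x ^ (-(3 / 2) : ℝ) := by
          congr 1
          rw [div_eq_iff (by positivity)]
          have : x * x = x ^ (2 : ℝ) := by rw [Real.rpow_two]; ring
          rw [this, ← Real.rpow_add hx0, Real.sqrt_eq_rpow]
          norm_num
    · rw [intervalIntegral.integral_const_mul, integral_rpow (Or.inr ⟨by norm_num, hpos⟩)]
      have h3 : (2 * δ) ^ (-(1 / 2) : ℝ) ≤ (√δ)⁻¹ := by
        rw [Real.sqrt_eq_rpow, ← Real.rpow_neg hδ0.le]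
        exact Real.rpow_le_rpow_of_nonpos hδ0 (by linarith) (by norm_num)
      have h4 : δ * (√δ)⁻¹ = √δ := by
        have := Real.mul_self_sqrt hδ0.le
        field_simp
        nlinarith
      have e : (-(3 / 2) : ℝ) + 1 = -(1 / 2) := by norm_num
      rw [e, Real.one_rpow]
      have h5 : 0 ≤ (√δ)⁻¹ := by positivity
      calc 2 * K * δ * ((1 - (2 * δ) ^ (-(1 / 2) : ℝ)) / -(1 / 2))
          = 4 * K * δ * ((2 * δ) ^ (-(1 / 2) : ℝ) - 1) := by ring
        _ ≤ 4 * K * δ * (√δ)⁻¹ := by gcongr; linarith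
        _ = 4 * K * (δ * (√δ)⁻¹) := by ring
        _ = _ := by rw [h4]
  have e : ∀ a b c d : ℂ, a + b - (c + d) = a - c + (b - d) := fun a b c d => by ring
  rw [e]
  refine (norm_add_le _ _).trans ?_
  have := norm_sub_le (∫ x in (0 : ℝ)..(2 * δ), n x / ((x : ℂ) + w))
    (∫ x in (0 : ℝ)..(2 * δ), n x / (x : ℂ))
  have hKδ : 0 ≤ K * √δ := by positivity
  linarith

end Privalov

/-! ### The scalar function δ. -/

section Delta

variable {D : ScatteringData} {z₀ R : ℝ} {z : ℂ}

lemma abs_im_le_norm_ofReal_sub (s : ℝ) (z : ℂ) : |z.im| ≤ ‖(s : ℂ) - z‖ := by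
  have := Complex.abs_im_le_norm ((s : ℂ) - z)
  simpa using this

lemma ofReal_sub_ne_zero (hz : z.im ≠ 0) (s : ℝ) : (s : ℂ) - z ≠ 0 :=
  norm_pos_iff.1 ((abs_pos.2 hz).trans_le (abs_im_le_norm_ofReal_sub s z))

lemma integrable_nu_div (hz : z.im ≠ 0) :
    Integrable fun s : ℝ => (nu D.r s : ℂ) / ((s : ℂ) - z) := by
  have h := D.r_memH1.integrable_nu
  refine (h.norm.mul_const |z.im|⁻¹).mono' ?_ (Eventually.of_forall fun s => ?_)
  · exact (h.aestronglyMeasurable.aemeasurable.complex_ofReal.div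
      (by fun_prop)).aestronglyMeasurable
  · rw [norm_div, Complex.norm_real, div_eq_mul_inv]
    have := abs_pos.2 hz
    gcongr
    exact abs_im_le_norm_ofReal_sub s z

lemma integral_poisson {v : ℝ} (hv : v ≠ 0) (u : ℝ) :
    Integrable (fun s : ℝ => |v| * ((s - u) ^ 2 + v ^ 2)⁻¹) ∧
      ∫ s : ℝ, |v| * ((s - u) ^ 2 + v ^ 2)⁻¹ = Real.pi := by
  have e : (fun s : ℝ => |v| * ((s - u) ^ 2 + v ^ 2)⁻¹) =
      fun s => |v|⁻¹ * (fun x => (1 + x ^ 2)⁻¹) ((s - u) / v) := by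
    ext s
    have h0 : 0 < |v| := abs_pos.2 hv
    have h1 : v ^ 2 = |v| ^ 2 := (sq_abs v).symm
    simp only [div_pow]
    rw [h1]
    field_simp
    ring
  have h1 : Integrable fun s : ℝ => (fun x => (1 + x ^ 2)⁻¹) ((s - u) / v) :=
    (integrable_inv_one_add_sq.comp_div hv).comp_sub_right u
  rw [e]
  refine ⟨h1.const_mul _, ?_⟩
  rw [integral_const_mul, integral_sub_right_eq_self (fun s => (fun x => (1 + x ^ 2)⁻¹) (s / v)),
    Measure.integral_comp_div (fun x : ℝ => (1 + x ^ 2)⁻¹) v, integral_univ_inv_one_add_sq, smul_eq_mul, ← mul_assoc,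
    inv_mul_cancel₀ (abs_pos.2 hv).ne', one_mul]

/-- The logarithm of `‖δ‖` is minus the imaginary part of the Cauchy integral, a Poisson integral of
ν over a half-line. The Poisson kernel has mass `π`, so neither the distance to the real axis nor
`z₀` enters the bound. -/
lemma norm_delta_le (hR : ∀ s, ‖D.r s‖ ≤ R) (hz : z.im ≠ 0) :
    ‖delta D z₀ z‖ ≤ Real.exp (R ^ 2 * Real.pi) := by
  rw [delta, Complex.norm_exp]
  refine Real.exp_le_exp.2 ?_
  rw [Complex.I_mul_re]
  refine (neg_le_abs _).trans ?_
  have h1 := Complex.imCLM.integral_comp_comm (integrable_nu_div (D := D) hz).integrableOn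
    (μ := volume.restrict (Iic z₀))
  simp only [Complex.imCLM_apply] at h1
  rw [← h1]
  obtain ⟨p1, p2⟩ := integral_poisson hz z.re
  have hb : ∀ s : ℝ, ‖((nu D.r s : ℂ) / ((s : ℂ) - z)).im‖ ≤
      R ^ 2 * (|z.im| * ((s - z.re) ^ 2 + z.im ^ 2)⁻¹) := by
    intro s
    have e : ((nu D.r s : ℂ) / ((s : ℂ) - z)).im =
        nu D.r s * (z.im * ((s - z.re) ^ 2 + z.im ^ 2)⁻¹) := by
      rw [Complex.div_im, Complex.normSq_apply]
      simp
      rw [div_eq_mul_inv]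
      ring_nf
    rw [e, Real.norm_eq_abs, abs_mul, abs_mul, abs_of_nonneg (a := (_ : ℝ)⁻¹) (by positivity)]
    gcongr
    exact (abs_nu_le _ _).trans (by gcongr; exact hR s)
  have h2 := norm_integral_le_of_norm_le (μ := volume.restrict (Iic z₀))
    ((p1.const_mul (R ^ 2)).integrableOn) (Eventually.of_forall hb)
  rw [Real.norm_eq_abs] at h2
  refine h2.trans ((setIntegral_le_integral (p1.const_mul (R ^ 2))
    (Eventually.of_forall fun s => by positivity)).trans ?_)
  rw [integral_const_mul, p2]

lemma differentiableAt_delta (hz : z.im ≠ 0) : DifferentiableAt ℂ (delta D z₀) z := by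
  have hv : 0 < |z.im| / 2 := half_pos (abs_pos.2 hz)
  have him : ∀ w ∈ Metric.ball z (|z.im| / 2), |z.im| / 2 ≤ |w.im| := by
    intro w hw
    have h1 := Complex.abs_im_le_norm (w - z)
    rw [Metric.mem_ball, dist_eq_norm] at hw
    rw [Complex.sub_im] at h1
    have h2 := abs_sub_abs_le_abs_sub z.im w.im
    rw [abs_sub_comm] at h2
    linarith
  have h := D.r_memH1.integrable_nu
  have hm : ∀ w : ℂ, AEStronglyMeasurable (fun s : ℝ => (nu D.r s : ℂ) / ((s : ℂ) - w))
      (volume.restrict (Iic z₀)) := fun w =>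
    (h.aestronglyMeasurable.aemeasurable.complex_ofReal.div
      (by fun_prop)).aestronglyMeasurable.restrict
  have key := hasDerivAt_integral_of_dominated_loc_of_deriv_le (μ := volume.restrict (Iic z₀))
    (F := fun w (s : ℝ) => (nu D.r s : ℂ) / ((s : ℂ) - w))
    (F' := fun w (s : ℝ) => (nu D.r s : ℂ) / ((s : ℂ) - w) ^ 2)
    (bound := fun s => ‖nu D.r s‖ * ((|z.im| / 2) ^ 2)⁻¹) (x₀ := z)
    (Metric.ball_mem_nhds z hv) (Eventually.of_forall hm) (integrable_nu_div hz).integrableOn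
    ((h.aestronglyMeasurable.aemeasurable.complex_ofReal.div
      (by fun_prop)).aestronglyMeasurable.restrict)
    (Eventually.of_forall fun s w hw => ?_) (h.norm.mul_const _).integrableOn
    (Eventually.of_forall fun s w hw => ?_)
  · exact (key.2.differentiableAt.const_mul Complex.I).cexp
  · rw [norm_div, Complex.norm_real, div_eq_mul_inv, norm_pow]
    gcongr
    exact (him w hw).trans (abs_im_le_norm_ofReal_sub s w)
  · have hw0 : w.im ≠ 0 := abs_pos.1 (hv.trans_le (him w hw))
    have h1 : HasDerivAt (fun w : ℂ => (s : ℂ) - w) (-1) w := by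
      simpa using (hasDerivAt_id w).const_sub (s : ℂ)
    have h2 := (hasDerivAt_const w (nu D.r s : ℂ)).div h1 (ofReal_sub_ne_zero hw0 s)
    exact h2.congr_deriv (by ring)

end Delta

/-! ### Expansion of δ at the stationary phase point. -/

section Beta

variable {D : ScatteringData} {z₀ K : ℝ} {z : ℂ}

/-- The part of `ν` near the stationary phase point, recentred. -/
noncomputable def nuLocal (D : ScatteringData) (z₀ x : ℝ) : ℂ := ((nu D.r (z₀ - x) - nu D.r z₀ : ℝ) : ℂ)

lemma continuous_nuLocal : Continuous (nuLocal D z₀) := by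
  have := continuous_nu D.r_memH1.continuous
  unfold nuLocal
  fun_prop

lemma nuLocal_zero : nuLocal D z₀ 0 = 0 := by simp [nuLocal]

lemma norm_nuLocal_sub_le (hK : ∀ a b, ‖D.r b - D.r a‖ ≤ K * √|b - a|) (x y : ℝ) :
    ‖nuLocal D z₀ x - nuLocal D z₀ y‖ ≤ K * √|x - y| := by
  rw [nuLocal, nuLocal, ← Complex.ofReal_sub, Complex.norm_real, Real.norm_eq_abs,
    sub_sub_sub_cancel_right]
  refine (abs_nu_sub_le _ _ _).trans ((hK _ _).trans (le_of_eq ?_))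
  rw [sub_sub_sub_cancel_left, abs_sub_comm]

lemma integral_Ioc_eq_unit (F : ℝ → ℂ) :
    ∫ s in Ioc (z₀ - 1) z₀, F s = ∫ x in (0 : ℝ)..1, F (z₀ - x) := by
  rw [intervalIntegral.integral_comp_sub_left, sub_zero, intervalIntegral.integral_of_le (by linarith)]

lemma integrableOn_Ioc_of_unit {F : ℝ → ℂ}
    (h : IntervalIntegrable (fun x => F (z₀ - x)) volume 0 1) : IntegrableOn F (Ioc (z₀ - 1) z₀) := by
  have := h.comp_sub_left z₀
  simp only [sub_sub_cancel, sub_zero] at this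
  exact (intervalIntegrable_iff_integrableOn_Ioc_of_le (by linarith)).1 this.symm

lemma nuLocal_div_eq (x : ℝ) : nuLocal D z₀ x / ((x : ℂ) + (z - z₀)) =
    -((((nu D.r (z₀ - x) - nu D.r z₀ : ℝ) : ℂ)) / (((z₀ - x : ℝ) : ℂ) - z)) := by
  rw [nuLocal, ← div_neg]
  congr 1
  push_cast; ring

lemma intervalIntegrable_nuLocal (hz : z.im ≠ 0 ∨ z = z₀) :
    IntervalIntegrable (fun x : ℝ => nuLocal D z₀ x / ((x : ℂ) + (z - z₀))) volume 0 1 := by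
  rcases hz with hz | rfl
  · exact intervalIntegrable_div_add continuous_nuLocal (by simpa using hz) _ _
  · obtain ⟨K, -, hK⟩ := D.r_memH1.exists_holder
    simp only [sub_self, add_zero]
    exact intervalIntegrable_div_self continuous_nuLocal (norm_nuLocal_sub_le hK) nuLocal_zero
      one_pos

lemma integrableOn_nu_far (hz : z.im ≠ 0 ∨ z = z₀) :
    IntegrableOn (fun s : ℝ => (nu D.r s : ℂ) / ((s : ℂ) - z)) (Iic (z₀ - 1)) := by
  rcases hz with hz | rfl
  · exact (integrable_nu_div hz).integrableOn
  · have h := D.r_memH1.integrable_nu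
    refine Integrable.mono' (g := fun s => ‖nu D.r s‖) h.norm.integrableOn ?_ ?_
    · exact (h.aestronglyMeasurable.aemeasurable.complex_ofReal.div
        (by fun_prop)).aestronglyMeasurable.restrict
    · filter_upwards [ae_restrict_mem measurableSet_Iic] with s hs
      rw [norm_div, Complex.norm_real, ← Complex.ofReal_sub, Complex.norm_real]
      refine div_le_self (norm_nonneg _) ?_
      rw [Real.norm_eq_abs, abs_of_nonpos (by linarith [mem_Iic.1 hs])]
      linarith [mem_Iic.1 hs]

lemma Iic_eq_union : Iic z₀ = Iic (z₀ - 1) ∪ Ioc (z₀ - 1) z₀ :=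
  (Iic_union_Ioc_eq_Iic (by linarith)).symm

/-- This isolates a Cauchy integral over a unit interval whose density vanishes at the end point;
the remaining integral stays at distance one from `z₀`. The case `z = z₀` is included, where the
local integral converges by the Hölder condition. -/
lemma beta_eq (hz : z.im ≠ 0 ∨ z = z₀) : beta D z₀ z = -(nu D.r z₀ : ℂ) * Complex.log (z - z₀ + 1) +
    ((∫ s in Iic (z₀ - 1), (nu D.r s : ℂ) / ((s : ℂ) - z)) -
      ∫ x in (0 : ℝ)..1, nuLocal D z₀ x / ((x : ℂ) + (z - z₀))) := by
  set F : ℝ → ℂ := fun s =>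
    ((nu D.r s - (Ioo (z₀ - 1) z₀).indicator (fun _ => nu D.r z₀) s : ℝ) : ℂ) / ((s : ℂ) - z) with hF
  set G : ℝ → ℂ := fun s => ((nu D.r s - nu D.r z₀ : ℝ) : ℂ) / ((s : ℂ) - z) with hG
  have e1 : EqOn F (fun s => (nu D.r s : ℂ) / ((s : ℂ) - z)) (Iic (z₀ - 1)) := by
    intro s hs
    have : s ∉ Ioo (z₀ - 1) z₀ := fun h => not_lt.2 (mem_Iic.1 hs) h.1
    simp only [hF, indicator_of_notMem this, sub_zero]
  have e2 : F =ᵐ[volume.restrict (Ioc (z₀ - 1) z₀)] G := by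
    rw [← restrict_Ioo_eq_restrict_Ioc]
    filter_upwards [ae_restrict_mem measurableSet_Ioo] with s hs
    simp only [hF, hG, indicator_of_mem hs]
  have hloc := intervalIntegrable_nuLocal (D := D) hz
  have eG : ∀ x, G (z₀ - x) = -(nuLocal D z₀ x / ((x : ℂ) + (z - z₀))) := fun x => by
    rw [nuLocal_div_eq, neg_neg]
  have hGi : IntegrableOn G (Ioc (z₀ - 1) z₀) := by
    refine integrableOn_Ioc_of_unit ?_
    simp only [eG]
    exact hloc.neg
  rw [beta, Iic_eq_union, setIntegral_union (Iic_disjoint_Ioc le_rfl) measurableSet_Ioc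
    ((integrableOn_nu_far hz).congr_fun e1.symm measurableSet_Iic) (hGi.congr_fun_ae e2.symm),
    setIntegral_congr_fun measurableSet_Iic e1, integral_congr_ae e2, integral_Ioc_eq_unit]
  simp only [eG]
  rw [intervalIntegral.integral_neg, ← sub_eq_add_neg]

/-- The constant `ν(z₀)` on the last unit interval integrates to `ν(z₀)` times `log (z - z₀) - log
(z - z₀ + 1)`; the second logarithm is the one built into `beta`. -/
lemma integral_nu_eq (hz : z.im ≠ 0) : ∫ s in Iic z₀, (nu D.r s : ℂ) / ((s : ℂ) - z) =
    beta D z₀ z + nu D.r z₀ * Complex.log (z - z₀) := by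
  have hw : (z - z₀).im ≠ 0 := by simpa using hz
  have hi := integrable_nu_div (D := D) hz
  have h1 : IntervalIntegrable (fun x : ℝ => (nu D.r z₀ : ℂ) * ((x : ℂ) + (z - z₀))⁻¹) volume 0 1 := by
    have := intervalIntegrable_div_add (n := fun _ => (nu D.r z₀ : ℂ)) continuous_const hw 0 1
    simpa only [div_eq_mul_inv] using this
  have e : ∀ x : ℝ, (nu D.r (z₀ - x) : ℂ) / (((z₀ - x : ℝ) : ℂ) - z) =
      -(nuLocal D z₀ x / ((x : ℂ) + (z - z₀)) + (nu D.r z₀ : ℂ) * ((x : ℂ) + (z - z₀))⁻¹) := by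
    intro x
    have h0 : (x : ℂ) + (z - z₀) = -(((z₀ - x : ℝ) : ℂ) - z) := by push_cast; ring
    rw [nuLocal, h0, div_neg, inv_neg, mul_neg, ← div_eq_mul_inv, ← neg_add, neg_neg, ← add_div]
    congr 1
    push_cast; ring
  rw [beta_eq (Or.inl hz), Iic_eq_union, setIntegral_union (Iic_disjoint_Ioc le_rfl) measurableSet_Ioc
    hi.integrableOn hi.integrableOn, integral_Ioc_eq_unit]
  simp only [e]
  rw [intervalIntegral.integral_neg, intervalIntegral.integral_add
    (intervalIntegrable_nuLocal (Or.inl hz)) h1, intervalIntegral.integral_const_mul,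
    integral_inv_add hw]
  rw [Complex.ofReal_one, Complex.ofReal_zero, zero_add, add_comm (1 : ℂ)]
  ring

lemma delta_eq (hz : z.im ≠ 0) : delta D z₀ z =
    Complex.exp (Complex.I * beta D z₀ z) * (z - z₀) ^ (Complex.I * (nu D.r z₀ : ℂ)) := by
  have hne : z - z₀ ≠ 0 := fun h => hz (by
    have := congrArg Complex.im h; simpa using this)
  rw [delta, integral_nu_eq hz, Complex.cpow_def_of_ne_zero hne, ← Complex.exp_add]
  congr 1
  ring

/-- Three contributions: the logarithm of `1 + (z - z₀)` and the tail over `s ≤ z₀ - 1` are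
Lipschitz near `z₀`, and the local integral is Hölder continuous by `norm_cauchy_sub_le`. All
constants are uniform in `z₀`. -/
lemma exists_beta_holder (D : ScatteringData) : ∃ C : ℝ, 0 ≤ C ∧ ∀ (z₀ : ℝ) (z : ℂ), z.im ≠ 0 →
    ‖z - z₀‖ ≤ 1 / 4 → ‖beta D z₀ z - beta D z₀ z₀‖ ≤ C * √‖z - z₀‖ := by
  obtain ⟨K, hK0, hK⟩ := D.r_memH1.exists_holder
  obtain ⟨R, hR0, hR⟩ := D.r_memH1.exists_bound
  have hν := D.r_memH1.integrable_nu
  set J := ∫ s, ‖nu D.r s‖ with hJ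
  have hJ0 : 0 ≤ J := integral_nonneg fun _ => norm_nonneg _
  refine ⟨2 * R ^ 2 + 2 * J + 30 * K, by positivity, fun z₀ z hz hw => ?_⟩
  have hle : ‖z - z₀‖ ≤ √‖z - z₀‖ := by
    have h1 := Real.mul_self_sqrt (norm_nonneg (z - z₀))
    have h2 : √‖z - z₀‖ ≤ 1 := Real.sqrt_le_one.2 (by linarith)
    nlinarith [Real.sqrt_nonneg ‖z - z₀‖]
  have a1 : ‖(nu D.r z₀ : ℂ) * Complex.log (z - z₀ + 1)‖ ≤ 2 * R ^ 2 * √‖z - z₀‖ := by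
    rw [norm_mul, Complex.norm_real, add_comm]
    have h1 := Complex.norm_log_one_add_half_le_self (z := z - z₀) (by linarith)
    have h2 : ‖nu D.r z₀‖ ≤ R ^ 2 := (abs_nu_le _ _).trans (by gcongr; exact hR _)
    calc _ ≤ R ^ 2 * (3 / 2 * ‖z - z₀‖) := by gcongr
      _ ≤ R ^ 2 * (2 * √‖z - z₀‖) := by gcongr; norm_num
      _ = _ := by ring
  have a2 : ‖(∫ s in Iic (z₀ - 1), (nu D.r s : ℂ) / ((s : ℂ) - z)) -
      ∫ s in Iic (z₀ - 1), (nu D.r s : ℂ) / ((s : ℂ) - z₀)‖ ≤ 2 * J * √‖z - z₀‖ := by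
    rw [← integral_sub (integrableOn_nu_far (Or.inl hz)) (integrableOn_nu_far (Or.inr rfl))]
    have hb : ∀ᵐ s : ℝ ∂volume.restrict (Iic (z₀ - 1)),
        ‖(nu D.r s : ℂ) / ((s : ℂ) - z) - (nu D.r s : ℂ) / ((s : ℂ) - z₀)‖ ≤
          ‖nu D.r s‖ * (2 * ‖z - z₀‖) := by
      filter_upwards [ae_restrict_mem measurableSet_Iic] with s hs
      have hs' : s ≤ z₀ - 1 := hs
      have h1 : 1 ≤ ‖(s : ℂ) - z₀‖ := by
        rw [← Complex.ofReal_sub, Complex.norm_real, Real.norm_eq_abs, abs_of_nonpos (by linarith)]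
        linarith
      have h2 : 1 / 2 ≤ ‖(s : ℂ) - z‖ := by
        have := norm_sub_norm_le ((s : ℂ) - z₀) (z - z₀)
        rw [sub_sub_sub_cancel_right] at this
        linarith
      have n1 : (s : ℂ) - z₀ ≠ 0 := norm_pos_iff.1 (by linarith)
      have n2 : (s : ℂ) - z ≠ 0 := norm_pos_iff.1 (by linarith)
      have e : (nu D.r s : ℂ) / ((s : ℂ) - z) - (nu D.r s : ℂ) / ((s : ℂ) - z₀) =
          (nu D.r s : ℂ) * ((z - z₀) / (((s : ℂ) - z) * ((s : ℂ) - z₀))) := by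
        field_simp; ring
      rw [e, norm_mul, Complex.norm_real, norm_div, norm_mul]
      gcongr
      rw [div_le_iff₀ (by positivity)]
      have : 1 / 2 * 1 ≤ ‖(s : ℂ) - z‖ * ‖(s : ℂ) - z₀‖ := by gcongr
      nlinarith [norm_nonneg (z - z₀)]
    refine (norm_integral_le_of_norm_le (hν.norm.mul_const _).integrableOn hb).trans ?_
    refine (setIntegral_le_integral (hν.norm.mul_const _)
      (Eventually.of_forall fun s => by positivity)).trans ?_
    rw [integral_mul_const, ← hJ]
    nlinarith
  have a3 : ‖(∫ x in (0 : ℝ)..1, nuLocal D z₀ x / ((x : ℂ) + (z - z₀))) -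
      ∫ x in (0 : ℝ)..1, nuLocal D z₀ x / (x : ℂ)‖ ≤ 30 * K * √‖z - z₀‖ :=
    norm_cauchy_sub_le continuous_nuLocal hK0 (norm_nuLocal_sub_le hK) nuLocal_zero
      (by simpa using hz) hw
  have e : beta D z₀ z - beta D z₀ z₀ = -((nu D.r z₀ : ℂ) * Complex.log (z - z₀ + 1)) +
      ((∫ s in Iic (z₀ - 1), (nu D.r s : ℂ) / ((s : ℂ) - z)) -
        ∫ s in Iic (z₀ - 1), (nu D.r s : ℂ) / ((s : ℂ) - z₀)) -
      ((∫ x in (0 : ℝ)..1, nuLocal D z₀ x / ((x : ℂ) + (z - z₀))) -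
      ∫ x in (0 : ℝ)..1, nuLocal D z₀ x / (x : ℂ)) := by
    rw [beta_eq (Or.inl hz), beta_eq (z := (z₀ : ℂ)) (Or.inr rfl)]
    simp only [sub_self, zero_add, add_zero, Complex.log_one, mul_zero]
    ring
  rw [e]
  refine (norm_sub_le _ _).trans ?_
  have := norm_add_le (-((nu D.r z₀ : ℂ) * Complex.log (z - z₀ + 1)))
    ((∫ s in Iic (z₀ - 1), (nu D.r s : ℂ) / ((s : ℂ) - z)) -
        ∫ s in Iic (z₀ - 1), (nu D.r s : ℂ) / ((s : ℂ) - z₀))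
  rw [norm_neg] at this
  linarith

end Beta

/-! ### Uniform bounds for `T`. -/

section TBounds

variable {D : ScatteringData} {χ : ℂ → ℝ} {d L : ℝ}

lemma norm_blaschke_factor {q z : ℂ} (hd : 0 < d) (hL : 2 * ‖q‖ ≤ L) (hz : d ≤ ‖z - q‖) :
    ‖(z - starRingEnd ℂ q) / (z - q)‖ ≤ 1 + L / d := by
  have h1 : ‖z - starRingEnd ℂ q‖ ≤ ‖z - q‖ + L := by
    have e : z - starRingEnd ℂ q = (z - q) + (q - starRingEnd ℂ q) := by ring
    rw [e]
    refine (norm_add_le _ _).trans (add_le_add le_rfl ((norm_sub_le _ _).trans ?_))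
    rw [RCLike.norm_conj]; linarith
  have hL0 : 0 ≤ L := le_trans (by positivity) hL
  rw [norm_div, div_le_iff₀ (by linarith)]
  have h2 : L ≤ L / d * ‖z - q‖ := by
    rw [div_mul_eq_mul_div, le_div_iff₀ hd]; gcongr
  linarith

lemma norm_blaschke_factor_sub {q z y : ℂ} (hd : 0 < d) (hL : 2 * ‖q‖ ≤ L) (hz : d ≤ ‖z - q‖)
    (hy : d ≤ ‖y - q‖) :
    ‖(z - starRingEnd ℂ q) / (z - q) - (y - starRingEnd ℂ q) / (y - q)‖ ≤ L / d ^ 2 * ‖z - y‖ := by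
  have n1 : z - q ≠ 0 := norm_pos_iff.1 (by linarith)
  have n2 : y - q ≠ 0 := norm_pos_iff.1 (by linarith)
  have e : (z - starRingEnd ℂ q) / (z - q) - (y - starRingEnd ℂ q) / (y - q) =
      (starRingEnd ℂ q - q) * (z - y) / ((z - q) * (y - q)) := by
    field_simp; ring
  have h1 : ‖starRingEnd ℂ q - q‖ ≤ L := by
    refine (norm_sub_le _ _).trans ?_
    rw [RCLike.norm_conj]; linarith
  have hL0 : 0 ≤ L := (norm_nonneg _).trans h1
  rw [e, norm_div, norm_mul, norm_mul]
  calc _ ≤ L * ‖z - y‖ / (d * d) := by gcongr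
    _ = _ := by ring

lemma exists_prod_lipschitz {ι : Type*} (s : Finset ι) (a : ι → ℂ → ℂ) (V : Set ℂ) {b : ℝ}
    (hb0 : 0 ≤ b) (hb : ∀ k, ∀ z ∈ V, ‖a k z‖ ≤ b)
    (hl : ∀ k, ∀ z ∈ V, ∀ y ∈ V, ‖a k z - a k y‖ ≤ b * ‖z - y‖) :
    ∃ C : ℝ, 0 ≤ C ∧ (∀ z ∈ V, ‖∏ k ∈ s, a k z‖ ≤ C) ∧
      ∀ z ∈ V, ∀ y ∈ V, ‖∏ k ∈ s, a k z - ∏ k ∈ s, a k y‖ ≤ C * ‖z - y‖ := by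
  classical
  induction s using Finset.induction_on with
  | empty => exact ⟨1, by norm_num, by simp, by simp⟩
  | insert k s hk ih =>
    obtain ⟨C, hC0, h1, h2⟩ := ih
    refine ⟨2 * b * C, by positivity, fun z hz => ?_, fun z hz y hy => ?_⟩
    · rw [Finset.prod_insert hk, norm_mul]
      have := mul_le_mul (hb k z hz) (h1 z hz) (norm_nonneg _) hb0
      have : 0 ≤ b * C := by positivity
      linarith
    · rw [Finset.prod_insert hk, Finset.prod_insert hk]
      have e : a k z * ∏ k ∈ s, a k z - a k y * ∏ k ∈ s, a k y =
          a k z * (∏ k ∈ s, a k z - ∏ k ∈ s, a k y) + (a k z - a k y) * ∏ k ∈ s, a k y := by ring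
      rw [e]
      refine (norm_add_le _ _).trans ?_
      rw [norm_mul, norm_mul]
      have i1 := mul_le_mul (hb k z hz) (h2 z hz y hy) (norm_nonneg _) hb0
      have i2 := mul_le_mul (hl k z hz y hy) (h1 y hy) (norm_nonneg _) (by positivity)
      linarith

lemma CutoffGeometry.le_dist_ofReal (hG : CutoffGeometry D χ d L) (s : ℝ) {w : ℂ}
    (hw : w ∈ D.discrete) : d ≤ dist (s : ℂ) w := by
  have h1 := hG.im_ge w hw
  have h2 := Complex.abs_im_le_norm ((s : ℂ) - w)
  rw [Complex.sub_im, Complex.ofReal_im, zero_sub, abs_neg] at h2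
  rw [dist_eq_norm]
  linarith [hG.pos]

lemma CutoffGeometry.exists_blaschke_bound (hG : CutoffGeometry D χ d L) :
    ∃ C : ℝ, 0 ≤ C ∧ ∀ (z₀ : ℝ) (z : ℂ), (∀ w ∈ D.discrete, d ≤ dist z w) →
      ‖blaschke D z₀ z‖ ≤ C ∧ ‖blaschke D z₀ z - blaschke D z₀ z₀‖ ≤ C * ‖z - z₀‖ := by
  set V : Set ℂ := {z | ∀ w ∈ D.discrete, d ≤ dist z w} with hV
  have hd := hG.pos
  have hpole : ∀ k, 2 * ‖D.pole k‖ ≤ max (2 * L) 0 := fun k => by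
    have := hG.norm_le (D.pole k) ⟨k, Or.inl rfl⟩
    exact le_max_of_le_left (by linarith)
  set Λ := max (2 * L) 0 with hΛ
  have hΛ0 : 0 ≤ Λ := le_max_right _ _
  have hdist : ∀ k, ∀ z ∈ V, d ≤ ‖z - D.pole k‖ := fun k z hz => by
    rw [← dist_eq_norm]; exact hz _ ⟨k, Or.inl rfl⟩
  -- The set of poles in the product depends on `z₀`, but it has finitely many possible values;
  -- summing their constants makes the bound uniform in `z₀`.
  have key : ∀ s : Finset (Fin D.N), _ := fun s =>
    exists_prod_lipschitz s (fun k z => (z - starRingEnd ℂ (D.pole k)) / (z - D.pole k)) V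
      (b := 1 + Λ / d + Λ / d ^ 2) (by positivity)
      (fun k z hz => (norm_blaschke_factor hd (hpole k) (hdist k z hz)).trans
        (by have : 0 ≤ Λ / d ^ 2 := by positivity
            linarith))
      (fun k z hz y hy => (norm_blaschke_factor_sub hd (hpole k) (hdist k z hz)
        (hdist k y hy)).trans (by
          have : 0 ≤ 1 + Λ / d := by positivity
          gcongr; linarith))
  choose C hC0 hC1 hC2 using key
  have hle : ∀ s, C s ≤ ∑ s, C s := fun s =>
    Finset.single_le_sum (f := C) (fun s _ => hC0 s) (Finset.mem_univ s)
  refine ⟨∑ s, C s, Finset.sum_nonneg fun s _ => hC0 s, fun z₀ z hz => ⟨?_, ?_⟩⟩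
  · exact (hC1 _ z hz).trans (hle _)
  · exact (hC2 _ z hz z₀ fun w hw => hG.le_dist_ofReal z₀ hw).trans
      (mul_le_mul_of_nonneg_right (hle _) (norm_nonneg _))

lemma norm_blaschke_ofReal (z₀ s : ℝ) : ‖blaschke D z₀ s‖ = 1 := by
  have h := Complex.mul_conj' (blaschke D z₀ s)
  rw [conj_blaschke, Complex.conj_ofReal,
    mul_inv_cancel₀ (blaschke_ne_zero D z₀ (ofReal_notMem_discrete D s))] at h
  have h2 : ‖blaschke D z₀ s‖ ^ 2 = 1 := by exact_mod_cast h.symm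
  nlinarith [norm_nonneg (blaschke D z₀ s)]

lemma norm_exp_I_beta (z₀ : ℝ) : ‖Complex.exp (Complex.I * beta D z₀ z₀)‖ = 1 := by
  have h := norm_T0 D z₀
  rwa [T0, norm_mul, norm_blaschke_ofReal, one_mul] at h

/-- Near `z₀` one has `T = Y * (z - z₀)^(iν₀)` with `Y - T₀ = O(√‖z - z₀‖)`, and `Y² - T₀² = (Y -
T₀)(Y + T₀)`. For `‖z - z₀‖ > 1/4` boundedness suffices, because then `√‖z - z₀‖ ≥ 1/2`. -/
lemma CutoffGeometry.exists_T_sq_bound (hG : CutoffGeometry D χ d L) :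
    ∃ C : ℝ, 0 ≤ C ∧ ∀ (z₀ : ℝ) (z : ℂ), z.im ≠ 0 → (∀ w ∈ D.discrete, d ≤ dist z w) →
      ‖T D z₀ z ^ 2‖ ≤ C ∧ ‖T D z₀ z ^ 2 -
        T0 D z₀ ^ 2 * (z - z₀) ^ (2 * Complex.I * (nu D.r z₀ : ℂ))‖ ≤ C * √‖z - z₀‖ := by
  obtain ⟨b, hb0, hb⟩ := hG.exists_blaschke_bound
  obtain ⟨R, hR0, hR⟩ := D.r_memH1.exists_bound
  obtain ⟨c, hc0, hc⟩ := exists_beta_holder D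
  set e := Real.exp (R ^ 2 * Real.pi) with he
  set E := Real.exp (2 * Real.pi * R ^ 2) with hE
  set q := b * (c * Real.exp c) + b with hq
  have hq0 : 0 ≤ q := by positivity
  have hpow : ∀ (z₀ : ℝ) (z : ℂ), ‖(z - z₀) ^ (2 * Complex.I * (nu D.r z₀ : ℂ))‖ ≤ E := by
    intro z₀ z
    have h1 := norm_cpow_imag_le (z - z₀) (nu D.r z₀) (ε := 2) (by norm_num)
    have h2 : ((2 : ℝ) : ℂ) = 2 := by norm_num
    rw [h2] at h1
    refine h1.trans ?_
    rw [hE]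
    gcongr
    exact (abs_nu_le _ _).trans (by gcongr; exact hR _)
  refine ⟨2 * ((b * e) ^ 2 + E) + E * (q * (q + 2)), by positivity, fun z₀ z hz hV => ?_⟩
  obtain ⟨b1, b2⟩ := hb z₀ z hV
  have hT : ‖T D z₀ z‖ ≤ b * e := by
    rw [T, norm_mul]
    exact mul_le_mul b1 (norm_delta_le hR hz) (norm_nonneg _) hb0
  have hT2 : ‖T D z₀ z ^ 2‖ ≤ (b * e) ^ 2 := by rw [norm_pow]; gcongr
  have hEq : 0 ≤ E * (q * (q + 2)) := by positivity
  refine ⟨hT2.trans (by have : 0 ≤ (b * e) ^ 2 + 2 * E := by positivity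
                        linarith), ?_⟩
  rcases le_or_gt ‖z - z₀‖ (1 / 4) with h | h
  · set a := (z - z₀) ^ (Complex.I * (nu D.r z₀ : ℂ)) with ha
    have ha2 : (z - z₀) ^ (2 * Complex.I * (nu D.r z₀ : ℂ)) = a ^ 2 := by
      rw [ha, ← Complex.cpow_nat_mul]
      congr 1
      push_cast; ring
    set Y := blaschke D z₀ z * Complex.exp (Complex.I * beta D z₀ z) with hY
    have hTY : T D z₀ z = Y * a := by rw [T, delta_eq hz, hY, ha]; ring
    set s := √‖z - z₀‖ with hs
    have hs0 : 0 ≤ s := Real.sqrt_nonneg _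
    have hs1 : s ≤ 1 := Real.sqrt_le_one.2 (by linarith)
    have hsw : ‖z - z₀‖ ≤ s := by
      have h1 := Real.mul_self_sqrt (norm_nonneg (z - z₀))
      rw [← hs] at h1
      nlinarith
    have hdiff : ‖Y - T0 D z₀‖ ≤ q * s := by
      set Δ := Complex.I * (beta D z₀ z - beta D z₀ z₀) with hΔ
      have hΔn : ‖Δ‖ ≤ c * s := by
        rw [hΔ, norm_mul, Complex.norm_I, one_mul]; exact hc z₀ z hz h
      have hexp : ‖Complex.exp Δ - 1‖ ≤ c * s * Real.exp c := by
        have h1 := Complex.norm_exp_sub_sum_le_norm_mul_exp Δ 1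
        simp only [Finset.range_one, Finset.sum_singleton, pow_zero, Nat.factorial_zero,
          Nat.cast_one, div_one, pow_one] at h1
        refine h1.trans ?_
        have h3 : Real.exp ‖Δ‖ ≤ Real.exp c :=
          Real.exp_le_exp.2 (hΔn.trans (mul_le_of_le_one_right hc0 hs1))
        gcongr
      have e1 : Y - T0 D z₀ = blaschke D z₀ z * (Complex.exp (Complex.I * beta D z₀ z₀) *
          (Complex.exp Δ - 1)) + (blaschke D z₀ z - blaschke D z₀ z₀) *
            Complex.exp (Complex.I * beta D z₀ z₀) := by
        have : Complex.exp (Complex.I * beta D z₀ z) =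
            Complex.exp (Complex.I * beta D z₀ z₀) * Complex.exp Δ := by
          rw [← Complex.exp_add, hΔ]; congr 1; ring
        rw [hY, T0, this]; ring
      rw [e1]
      refine (norm_add_le _ _).trans ?_
      rw [norm_mul, norm_mul, norm_mul, norm_exp_I_beta, one_mul, mul_one]
      calc _ ≤ b * (c * s * Real.exp c) + b * s := by
            gcongr
            exact b2.trans (by gcongr)
        _ = q * s := by rw [hq]; ring
    have hYn : ‖Y + T0 D z₀‖ ≤ q + 2 := by
      have e2 : Y + T0 D z₀ = (Y - T0 D z₀) + 2 * T0 D z₀ := by ring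
      rw [e2]
      refine (norm_add_le _ _).trans ?_
      rw [norm_mul, norm_T0]
      have : q * s ≤ q := mul_le_of_le_one_right hq0 hs1
      norm_num
      linarith
    have e3 : T D z₀ z ^ 2 - T0 D z₀ ^ 2 * (z - z₀) ^ (2 * Complex.I * (nu D.r z₀ : ℂ)) =
        (z - z₀) ^ (2 * Complex.I * (nu D.r z₀ : ℂ)) * ((Y - T0 D z₀) * (Y + T0 D z₀)) := by
      rw [ha2, hTY]; ring
    rw [e3, norm_mul, norm_mul]
    calc _ ≤ E * (q * s * (q + 2)) := by
          gcongr
          exact hpow z₀ z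
      _ = E * (q * (q + 2)) * s := by ring
      _ ≤ _ := by
        gcongr
        have : 0 ≤ 2 * ((b * e) ^ 2 + E) := by positivity
        linarith
  · have h1 : 1 / 2 ≤ √‖z - z₀‖ := by
      rw [Real.le_sqrt (by norm_num) (norm_nonneg _)]; linarith
    have h2 : ‖T0 D z₀ ^ 2 * (z - z₀) ^ (2 * Complex.I * (nu D.r z₀ : ℂ))‖ ≤ E := by
      rw [norm_mul, norm_pow, norm_T0, one_pow, one_mul]; exact hpow z₀ z
    refine (norm_sub_le _ _).trans ((add_le_add hT2 h2).trans ?_)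
    have h3 : 0 ≤ (b * e) ^ 2 + E := by positivity
    nlinarith

/-- The estimates for `T⁻²` at `z` are the conjugates of those for `T²` at the conjugate point, by
`conj_T`. -/
lemma CutoffGeometry.exists_T_bounds (hG : CutoffGeometry D χ d L) :
    ∃ C : ℝ, 0 ≤ C ∧ ∀ (z₀ : ℝ) (z : ℂ), z.im ≠ 0 → (∀ w ∈ D.discrete, d ≤ dist z w) →
      (‖T D z₀ z ^ 2‖ ≤ C ∧ ‖T D z₀ z ^ 2 -
        T0 D z₀ ^ 2 * (z - z₀) ^ (2 * Complex.I * (nu D.r z₀ : ℂ))‖ ≤ C * √‖z - z₀‖) ∧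
      ‖(T D z₀ z ^ 2)⁻¹‖ ≤ C ∧ ‖(T D z₀ z ^ 2)⁻¹ -
        (T0 D z₀ ^ 2)⁻¹ * (z - z₀) ^ (-2 * Complex.I * (nu D.r z₀ : ℂ))‖ ≤ C * √‖z - z₀‖ := by
  obtain ⟨C, hC0, hC⟩ := hG.exists_T_sq_bound
  refine ⟨C, hC0, fun z₀ z hz hV => ⟨hC z₀ z hz hV, ?_⟩⟩
  have e1 : (T D z₀ z ^ 2)⁻¹ = starRingEnd ℂ (T D z₀ (starRingEnd ℂ z) ^ 2) := by
    rw [map_pow, conj_T, Complex.conj_conj, inv_pow]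
  have e2 : (T0 D z₀ ^ 2)⁻¹ * (z - z₀) ^ (-2 * Complex.I * (nu D.r z₀ : ℂ)) = starRingEnd ℂ
      (T0 D z₀ ^ 2 * (starRingEnd ℂ z - z₀) ^ (2 * Complex.I * (nu D.r z₀ : ℂ))) := by
    have h := conj_cpow_imag (arg_ne_pi_of_im_ne_zero (z₀ := z₀) hz) (nu D.r z₀)
    rw [map_sub, Complex.conj_ofReal] at h
    rw [map_mul, map_pow, conj_T0, inv_pow, h]
  have e3 : ‖z - z₀‖ = ‖starRingEnd ℂ z - z₀‖ := by
    rw [← RCLike.norm_conj, map_sub, Complex.conj_ofReal]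
  obtain ⟨h1, h2⟩ := hC z₀ (starRingEnd ℂ z) (by simpa using hz) fun w hw => by
    have := hV _ (conj_mem_discrete hw)
    rwa [← Complex.dist_conj_conj, Complex.conj_conj] at this
  rw [e1, e2, e3, ← map_sub, RCLike.norm_conj, RCLike.norm_conj]
  exact ⟨h1, h2⟩

lemma differentiableAt_T {z₀ : ℝ} {z : ℂ} (hz : z.im ≠ 0) (hzD : z ∉ D.discrete) :
    DifferentiableAt ℂ (T D z₀) z := by
  have h1 : DifferentiableAt ℂ (blaschke D z₀) z := by
    have : blaschke D z₀ = fun z => ∏ k ∈ Finset.univ.filter (fun k => (D.pole k).re < z₀),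
      (z - starRingEnd ℂ (D.pole k)) / (z - D.pole k) := rfl
    rw [this]
    refine DifferentiableAt.fun_finsetProd fun k _ => ?_
    exact DifferentiableAt.div (by fun_prop) (by fun_prop)
      (sub_ne_zero.2 fun h => hzD ⟨k, Or.inl h⟩)
  exact h1.mul (differentiableAt_delta hz)

lemma T_ne_zero {z₀ : ℝ} {z : ℂ} (hzD : z ∉ D.discrete) : T D z₀ z ≠ 0 :=
  mul_ne_zero (blaschke_ne_zero D z₀ hzD) (Complex.exp_ne_zero _)

end TBounds

/-! ### The ∂̄-derivative of the interpolation. -/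

section DbarRules

variable {z : ℂ}

lemma dbar_conj_comp {F : ℂ → ℂ} {F' : ℂ} (hF : HasDerivAt F F' z) :
    DifferentiableAt ℝ (fun w => starRingEnd ℂ (F w)) z ∧
      dbar (fun w => starRingEnd ℂ (F w)) z = starRingEnd ℂ F' := by
  have h1 : HasFDerivAt (fun w => starRingEnd ℂ (F w)) _ z :=
    Complex.conjCLE.hasFDerivAt.comp z (hF.hasFDerivAt.restrictScalars ℝ)
  refine ⟨h1.differentiableAt, ?_⟩
  rw [dbar, h1.fderiv]
  simp
  linear_combination (-(1 / 2 : ℂ) * starRingEnd ℂ F') * Complex.I_sq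

lemma dbar_re_comp {q : ℝ → ℂ} {q' : ℂ} (hq : HasDerivAt q q' z.re) :
    DifferentiableAt ℝ (fun w : ℂ => q w.re) z ∧ dbar (fun w : ℂ => q w.re) z = q' / 2 := by
  have h1 : HasFDerivAt (fun w : ℂ => q w.re) _ z :=
    hq.hasFDerivAt.comp z Complex.reCLM.hasFDerivAt
  refine ⟨h1.differentiableAt, ?_⟩
  rw [dbar, h1.fderiv]
  simp
  ring

/-- In the form `(w/w* + w*/w)/2` the cosine is visibly smooth across the branch cut of `arg`, and
∂̄ falls on the conjugates only. -/
lemma ofReal_cos_two_arg {w : ℂ} (hw : w ≠ 0) : ((Real.cos (2 * w.arg) : ℝ) : ℂ) =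
    (1 / 2) * (starRingEnd ℂ w⁻¹ * w + starRingEnd ℂ w * w⁻¹) := by
  set e := Complex.exp (w.arg * Complex.I) with he
  have hr : (‖w‖ : ℂ) ≠ 0 := by exact_mod_cast (norm_pos_iff.2 hw).ne'
  have hwe : w = ‖w‖ * e := (Complex.norm_mul_exp_arg_mul_I w).symm
  have hec : starRingEnd ℂ e = e⁻¹ := by
    rw [he, ← Complex.exp_conj, ← Complex.exp_neg]; simp
  have he0 : e ≠ 0 := Complex.exp_ne_zero _
  have hcos : ((Real.cos (2 * w.arg) : ℝ) : ℂ) = (e ^ 2 + (e⁻¹) ^ 2) / 2 := by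
    rw [Complex.ofReal_cos, Complex.cos, he, ← Complex.exp_neg, ← Complex.exp_nat_mul,
      ← Complex.exp_nat_mul]
    congr 3 <;> push_cast <;> ring
  have hwc : starRingEnd ℂ w = ‖w‖ * e⁻¹ := by
    conv_lhs => rw [hwe]
    rw [map_mul, hec, Complex.conj_ofReal]
  rw [hcos, map_inv₀, hwc]
  conv_rhs => rw [hwe]
  simp only [norm_mul, Complex.norm_real, norm_norm]
  have hne : ‖e‖ = 1 := Complex.norm_exp_ofReal_mul_I _
  rw [hne]
  push_cast
  field_simp

lemma dbar_cos_two_arg {z₀ : ℂ} (hz : z ≠ z₀) :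
    DifferentiableAt ℝ (fun z : ℂ => ((Real.cos (2 * Complex.arg (z - z₀)) : ℝ) : ℂ)) z ∧
      ‖dbar (fun z : ℂ => ((Real.cos (2 * Complex.arg (z - z₀)) : ℝ) : ℂ)) z‖ ≤ ‖z - z₀‖⁻¹ := by
  have hw : z - z₀ ≠ 0 := sub_ne_zero.2 hz
  have hev : (fun z : ℂ => ((Real.cos (2 * Complex.arg (z - z₀)) : ℝ) : ℂ)) =ᶠ[𝓝 z] fun z =>
      (1 / 2) * (starRingEnd ℂ (z - z₀)⁻¹ * (z - z₀) + starRingEnd ℂ (z - z₀) * (z - z₀)⁻¹) := by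
    filter_upwards [isOpen_ne.mem_nhds hz] with y hy
    exact ofReal_cos_two_arg (sub_ne_zero.2 hy)
  have h1 : HasDerivAt (fun z : ℂ => z - z₀) 1 z := (hasDerivAt_id z).sub_const z₀
  have h2 : HasDerivAt (fun z : ℂ => (z - z₀)⁻¹) (-1 / (z - z₀) ^ 2) z := h1.inv hw
  obtain ⟨c1, c2⟩ := dbar_conj_comp h1
  obtain ⟨c3, c4⟩ := dbar_conj_comp h2
  have r1 := h1.differentiableAt.restrictScalars ℝ
  have r2 := h2.differentiableAt.restrictScalars ℝ
  have s1 : DifferentiableAt ℝ (fun z => starRingEnd ℂ (z - z₀)⁻¹ * (z - z₀)) z := c3.mul r1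
  have s2 : DifferentiableAt ℝ (fun z => starRingEnd ℂ (z - z₀) * (z - z₀)⁻¹) z := c1.mul r2
  have s12 : DifferentiableAt ℝ (fun z => starRingEnd ℂ (z - z₀)⁻¹ * (z - z₀) +
    starRingEnd ℂ (z - z₀) * (z - z₀)⁻¹) z := s1.add s2
  have hd := s12.const_mul (1 / 2 : ℂ)
  rw [hev.differentiableAt_iff, dbar_congr hev]
  refine ⟨hd, ?_⟩
  have e : dbar (fun z => (1 / 2) * (starRingEnd ℂ (z - z₀)⁻¹ * (z - z₀) +
      starRingEnd ℂ (z - z₀) * (z - z₀)⁻¹)) z =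
      (1 / 2) * (starRingEnd ℂ (-1 / (z - z₀) ^ 2) * (z - z₀) + (z - z₀)⁻¹) := by
    rw [dbar_mul (differentiableAt_const _) s12,
      dbar_eq_zero_of_differentiableAt (differentiableAt_const _),
      dbar_add (f := fun z => starRingEnd ℂ (z - z₀)⁻¹ * (z - z₀))
        (g := fun z => starRingEnd ℂ (z - z₀) * (z - z₀)⁻¹) s1 s2, dbar_mul c3 r1, dbar_mul c1 r2,
      c2, c4, dbar_eq_zero_of_differentiableAt h1.differentiableAt,
      dbar_eq_zero_of_differentiableAt h2.differentiableAt]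
    simp
  rw [e, norm_mul]
  have hp : 0 < ‖z - z₀‖ := norm_pos_iff.2 hw
  have h3 : ‖starRingEnd ℂ (-1 / (z - z₀) ^ 2) * (z - z₀) + (z - z₀)⁻¹‖ ≤ 2 * ‖z - z₀‖⁻¹ := by
    refine (norm_add_le _ _).trans ?_
    rw [norm_mul, RCLike.norm_conj, norm_div, norm_neg, norm_one, norm_pow, norm_inv]
    apply le_of_eq
    field_simp
    norm_num
  have h4 : ‖(1 / 2 : ℂ)‖ = 1 / 2 := by norm_num
  rw [h4]
  linarith

/-- The derivative of the interpolation between a holomorphic function and a product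
`q(Re z) τ(z)` with `τ` holomorphic. -/
lemma norm_dbar_blend_le {χ : ℂ → ℝ} {z₀ : ℝ} {f τ : ℂ → ℂ} {q : ℝ → ℂ} {q' : ℂ} {b : ℝ}
    (hχ : DifferentiableAt ℝ (fun z => 1 - (χ z : ℂ)) z) (hχ1 : ‖1 - (χ z : ℂ)‖ ≤ 1)
    (hb : ‖dbar (fun z => 1 - (χ z : ℂ)) z‖ ≤ b) (hz : z ≠ z₀) (hf : DifferentiableAt ℂ f z)
    (hτ : DifferentiableAt ℂ τ z) (hq : HasDerivAt q q' z.re) :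
    DifferentiableAt ℝ (blend χ z₀ f fun z => q z.re * τ z) z ∧
    ‖dbar (blend χ z₀ f fun z => q z.re * τ z) z‖ ≤ ‖q'‖ * ‖τ z‖ +
      ‖q z.re * τ z - f z‖ * ‖z - z₀‖⁻¹ + b * (‖f z‖ + ‖q z.re * τ z - f z‖) := by
  obtain ⟨c1, c2⟩ := dbar_cos_two_arg hz
  obtain ⟨q1, q2⟩ := dbar_re_comp hq
  set c : ℂ → ℂ := fun z : ℂ => ((Real.cos (2 * Complex.arg (z - z₀)) : ℝ) : ℂ) with hc
  have hcn : ‖c z‖ ≤ 1 := by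
    rw [hc]
    simp only [Complex.norm_real, Real.norm_eq_abs]
    exact Real.abs_cos_le_one _
  have hfr := hf.restrictScalars ℝ
  have hτr := hτ.restrictScalars ℝ
  set p : ℂ → ℂ := fun z => q z.re * τ z + (-1) * f z with hp
  have p1 : DifferentiableAt ℝ p z := (q1.mul hτr).add (hfr.const_mul _)
  have p2 : dbar p z = q' / 2 * τ z := by
    rw [hp, dbar_add (f := fun z => q z.re * τ z) (g := fun z => (-1) * f z) (q1.mul hτr)
      (hfr.const_mul _), dbar_mul q1 hτr, q2, dbar_eq_zero_of_differentiableAt hτ,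
      dbar_eq_zero_of_differentiableAt (hf.const_mul _)]
    ring
  have hpz : p z = q z.re * τ z - f z := by rw [hp]; ring
  have g1 : DifferentiableAt ℝ (fun z => f z + p z * c z) z := hfr.add (p1.mul c1)
  have g2 : dbar (fun z => f z + p z * c z) z = q' / 2 * τ z * c z + p z * dbar c z := by
    rw [dbar_add (g := fun z => p z * c z) hfr (p1.mul c1), dbar_mul p1 c1, p2,
      dbar_eq_zero_of_differentiableAt hf, zero_add]
  have e : (blend χ z₀ f fun z => q z.re * τ z) =
      fun z => (1 - (χ z : ℂ)) * (f z + p z * c z) := by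
    ext z; simp only [blend, hp, hc]; ring
  rw [e]
  refine ⟨hχ.mul g1, ?_⟩
  have hn : ‖dbar (fun z => f z + p z * c z) z‖ ≤ ‖q'‖ * ‖τ z‖ + ‖p z‖ * ‖z - z₀‖⁻¹ := by
    rw [g2]
    refine (norm_add_le _ _).trans (add_le_add ?_ ?_)
    · rw [norm_mul, norm_mul, norm_div]
      have : ‖(2 : ℂ)‖ = 2 := by norm_num
      rw [this]
      have h0 : 0 ≤ ‖q'‖ * ‖τ z‖ := by positivity
      calc ‖q'‖ / 2 * ‖τ z‖ * ‖c z‖ ≤ ‖q'‖ / 2 * ‖τ z‖ * 1 := by gcongr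
        _ ≤ _ := by linarith
    · rw [norm_mul]
      exact mul_le_mul_of_nonneg_left c2 (norm_nonneg _)
  have hn2 : ‖f z + p z * c z‖ ≤ ‖f z‖ + ‖p z‖ := by
    refine (norm_add_le _ _).trans ?_
    rw [norm_mul]
    have := mul_le_of_le_one_right (norm_nonneg (p z)) hcn
    linarith
  rw [dbar_mul hχ g1, ← hpz]
  refine (norm_add_le _ _).trans ?_
  rw [norm_mul, norm_mul]
  have i1 := mul_le_mul hb hn2 (norm_nonneg _) ((norm_nonneg _).trans hb)
  have i2 := mul_le_mul hχ1 hn (norm_nonneg _) zero_le_one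
  linarith

end DbarRules

/-! ### Amplitudes built from the reflection coefficient. -/

section Amplitude

/-- A function of the reflection coefficient that inherits its bounds. -/
structure IsAmplitude (r q : ℝ → ℂ) : Prop where
  norm_le : ∀ s, ‖q s‖ ≤ ‖r s‖
  norm_sub_le : ∀ a b, ‖q a - q b‖ ≤ ‖r a - r b‖
  exists_deriv : ∀ s r', HasDerivAt r r' s → ∃ q', HasDerivAt q q' s ∧ ‖q'‖ ≤ ‖r'‖

variable {r q : ℝ → ℂ}

lemma isAmplitude_self (r : ℝ → ℂ) : IsAmplitude r r :=
  ⟨fun _ => le_rfl, fun _ _ => le_rfl, fun _ r' h => ⟨r', h, le_rfl⟩⟩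

lemma IsAmplitude.conj (h : IsAmplitude r q) : IsAmplitude r fun s => starRingEnd ℂ (q s) where
  norm_le s := by rw [RCLike.norm_conj]; exact h.norm_le s
  norm_sub_le a b := by rw [← map_sub, RCLike.norm_conj]; exact h.norm_sub_le a b
  exists_deriv s r' hr := by
    obtain ⟨q', h1, h2⟩ := h.exists_deriv s r' hr
    refine ⟨starRingEnd ℂ q', ?_, by rwa [RCLike.norm_conj]⟩
    exact Complex.conjCLE.hasFDerivAt.comp_hasDerivAt s h1

lemma one_add_norm_sq_eq (w : ℂ) : (1 + (‖w‖ : ℂ) ^ 2) = ((1 + ‖w‖ ^ 2 : ℝ) : ℂ) := by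
  push_cast; ring

lemma one_add_norm_sq_ne_zero (w : ℂ) : (1 + (‖w‖ : ℂ) ^ 2) ≠ 0 := by
  rw [one_add_norm_sq_eq]
  exact_mod_cast (by positivity : (0 : ℝ) < 1 + ‖w‖ ^ 2).ne'

lemma norm_one_add_norm_sq (w : ℂ) : ‖(1 + (‖w‖ : ℂ) ^ 2)‖ = 1 + ‖w‖ ^ 2 := by
  rw [one_add_norm_sq_eq, Complex.norm_real, Real.norm_of_nonneg (by positivity)]

/-- With `‖r‖² = r r*`, the difference of two values has numerator `(r a - r b) + r a * r b * (r b -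
r a)*`, and the derivative has numerator `r' - r² * r'*`; in both cases the denominators dominate.
-/
lemma isAmplitude_div (r : ℝ → ℂ) : IsAmplitude r fun s => r s / (1 + (‖r s‖ : ℂ) ^ 2) where
  norm_le s := norm_div_one_add_sq_le (r s)
  norm_sub_le a b := by
    have e : r a / (1 + (‖r a‖ : ℂ) ^ 2) - r b / (1 + (‖r b‖ : ℂ) ^ 2) =
        ((r a - r b) + r a * r b * starRingEnd ℂ (r b - r a)) /
          ((1 + (‖r a‖ : ℂ) ^ 2) * (1 + (‖r b‖ : ℂ) ^ 2)) := by
      rw [div_sub_div _ _ (one_add_norm_sq_ne_zero _) (one_add_norm_sq_ne_zero _)]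
      congr 1
      rw [← Complex.mul_conj', ← Complex.mul_conj', map_sub]
      ring
    rw [e, norm_div, norm_mul, norm_one_add_norm_sq, norm_one_add_norm_sq, div_le_iff₀ (by positivity)]
    refine (norm_add_le _ _).trans ?_
    rw [norm_mul, norm_mul, RCLike.norm_conj, norm_sub_rev (r b)]
    have h1 : 1 + ‖r a‖ * ‖r b‖ ≤ (1 + ‖r a‖ ^ 2) * (1 + ‖r b‖ ^ 2) := by
      nlinarith [sq_nonneg (‖r a‖ - ‖r b‖), sq_nonneg (‖r a‖ * ‖r b‖)]
    have := mul_le_mul_of_nonneg_left h1 (norm_nonneg (r a - r b))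
    linarith
  exists_deriv s r' hr := by
    have hc : HasDerivAt (fun s => starRingEnd ℂ (r s)) (starRingEnd ℂ r') s :=
      Complex.conjCLE.hasFDerivAt.comp_hasDerivAt s hr
    have hP : HasDerivAt (fun s => 1 + r s * starRingEnd ℂ (r s))
        (r' * starRingEnd ℂ (r s) + r s * starRingEnd ℂ r') s := (hr.mul hc).const_add 1
    have hne : 1 + r s * starRingEnd ℂ (r s) ≠ 0 := by
      rw [Complex.mul_conj']; exact one_add_norm_sq_ne_zero _
    have hq := hr.div hP hne
    have e : (fun s => r s / (1 + (‖r s‖ : ℂ) ^ 2)) = fun s => r s / (1 + r s * starRingEnd ℂ (r s)) := by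
      ext s; rw [Complex.mul_conj']
    rw [e]
    refine ⟨_, hq, ?_⟩
    have e2 : r' * (1 + r s * starRingEnd ℂ (r s)) -
        r s * (r' * starRingEnd ℂ (r s) + r s * starRingEnd ℂ r') =
        r' - r s * r s * starRingEnd ℂ r' := by ring
    rw [e2, Complex.mul_conj', norm_div, norm_pow, norm_one_add_norm_sq, div_le_iff₀ (by positivity)]
    refine (norm_sub_le _ _).trans ?_
    rw [norm_mul, norm_mul, RCLike.norm_conj]
    have h1 : 1 + ‖r s‖ * ‖r s‖ ≤ (1 + ‖r s‖ ^ 2) ^ 2 := by nlinarith [sq_nonneg ‖r s‖]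
    have := mul_le_mul_of_nonneg_left h1 (norm_nonneg r')
    linarith

end Amplitude

/-! ### Pointwise bound for ∂̄R⁽²⁾. -/

section DbarBound

variable {D : ScatteringData} {χ : ℂ → ℝ} {α γ x t d L : ℝ}

/-- The majorant of `∂̄R⁽²⁾`. -/
noncomputable def dbarMajorant (k : ℝ → ℝ) (C t z₀ : ℝ) : ℂ → ℝ :=
  {z : ℂ | 0 < |z.im| ∧ |z.im| < |z.re - z₀|}.indicator fun z =>
    Real.exp (-(8 * t * (|z.re - z₀| * |z.im|))) * (k z.re + C * |z.re - z₀| ^ (-(1 / 2) : ℝ))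

lemma dbarMajorant_of_mem {k : ℝ → ℝ} {C t z₀ : ℝ} {z : ℂ} (h1 : 0 < |z.im|)
    (h2 : |z.im| < |z.re - z₀|) : dbarMajorant k C t z₀ z =
    Real.exp (-(8 * t * (|z.re - z₀| * |z.im|))) * (k z.re + C * |z.re - z₀| ^ (-(1 / 2) : ℝ)) :=
  indicator_of_mem (s := {z : ℂ | 0 < |z.im| ∧ |z.im| < |z.re - z₀|}) ⟨h1, h2⟩ _

/-- The estimate of the derivative of one extension. -/
lemma norm_dbar_blend_le_majorant {K R C B b z₀ : ℝ} {f τ τ₀ : ℂ → ℂ} {q : ℝ → ℂ} {r' : ℂ} {z : ℂ}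
    (hχ : DifferentiableAt ℝ (fun z => 1 - (χ z : ℂ)) z) (hχ1 : ‖1 - (χ z : ℂ)‖ ≤ 1)
    (hb : ‖dbar (fun z => 1 - (χ z : ℂ)) z‖ ≤ b) (hb0 : 0 ≤ b)
    (hq : IsAmplitude D.r q) (hR : ∀ s, ‖D.r s‖ ≤ R)
    (hK0 : 0 ≤ K) (hK : ∀ a b, ‖D.r b - D.r a‖ ≤ K * √|b - a|)
    (hr' : HasDerivAt D.r r' z.re) (hz : z.re ≠ z₀)
    (hf : DifferentiableAt ℂ f z) (hfB : ‖f z‖ ≤ B) (hfe : f z = q z₀ * τ₀ z)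
    (hτ : DifferentiableAt ℂ τ z) (hC0 : 0 ≤ C) (hτC : ‖τ z‖ ≤ C)
    (hτ₀ : ‖τ z - τ₀ z‖ ≤ C * √‖z - z₀‖) :
    DifferentiableAt ℝ (blend χ z₀ f fun z => q z.re * τ z) z ∧
    ‖dbar (blend χ z₀ f fun z => q z.re * τ z) z‖ ≤ (C * ‖r'‖ + b * (2 * B + R * C)) +
      (K + R) * C * |z.re - z₀| ^ (-(1 / 2) : ℝ) := by
  obtain ⟨q', hq', hq'n⟩ := hq.exists_deriv _ _ hr'
  have hzz : z ≠ z₀ := by rintro rfl; exact hz (by simp)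
  obtain ⟨h1, h2⟩ := norm_dbar_blend_le hχ hχ1 hb hzz hf hτ hq'
  refine ⟨h1, h2.trans ?_⟩
  have hR0 : 0 ≤ R := (norm_nonneg _).trans (hR 0)
  have hqR : ∀ s, ‖q s‖ ≤ R := fun s => (hq.norm_le s).trans (hR s)
  set u := |z.re - z₀| with hu
  have hu0 : 0 < u := abs_pos.2 (sub_ne_zero.2 hz)
  have huw : u ≤ ‖z - z₀‖ := by
    have := Complex.abs_re_le_norm (z - z₀)
    simpa using this
  have hw0 : 0 < ‖z - z₀‖ := hu0.trans_le huw
  -- The two interpolated functions differ by `O(√‖z - z₀‖)`: the amplitude by the Hölder condition,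
  -- the factor `τ` by its expansion at `z₀`.
  have hdiff : ‖q z.re * τ z - f z‖ ≤ (K + R) * C * √‖z - z₀‖ := by
    have e : q z.re * τ z - f z = (q z.re - q z₀) * τ z + q z₀ * (τ z - τ₀ z) := by
      rw [hfe]; ring
    rw [e]
    refine (norm_add_le _ _).trans ?_
    rw [norm_mul, norm_mul]
    have i1 : ‖q z.re - q z₀‖ ≤ K * √‖z - z₀‖ :=
      (hq.norm_sub_le _ _).trans ((hK _ _).trans (by gcongr))
    calc _ ≤ K * √‖z - z₀‖ * C + R * (C * √‖z - z₀‖) := by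
          gcongr
          exact hqR _
      _ = _ := by ring
  have hpow : √‖z - z₀‖ * ‖z - z₀‖⁻¹ ≤ u ^ (-(1 / 2) : ℝ) := by
    have e : √‖z - z₀‖ * ‖z - z₀‖⁻¹ = ‖z - z₀‖ ^ (-(1 / 2) : ℝ) := by
      rw [Real.sqrt_eq_rpow, ← Real.rpow_neg_one, ← Real.rpow_add hw0]; norm_num
    rw [e]
    exact Real.rpow_le_rpow_of_nonpos hu0 huw (by norm_num)
  have t1 : ‖q'‖ * ‖τ z‖ ≤ C * ‖r'‖ := by
    rw [mul_comm]; gcongr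
  have t2 : ‖q z.re * τ z - f z‖ * ‖z - z₀‖⁻¹ ≤ (K + R) * C * u ^ (-(1 / 2) : ℝ) := by
    calc _ ≤ (K + R) * C * √‖z - z₀‖ * ‖z - z₀‖⁻¹ := by gcongr
      _ = (K + R) * C * (√‖z - z₀‖ * ‖z - z₀‖⁻¹) := by ring
      _ ≤ _ := by gcongr
  have t3 : ‖f z‖ + ‖q z.re * τ z - f z‖ ≤ 2 * B + R * C := by
    have := norm_sub_le (q z.re * τ z) (f z)
    rw [norm_mul] at this
    have : ‖q z.re‖ * ‖τ z‖ ≤ R * C := by gcongr; exact hqR _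
    linarith
  have t4 := mul_le_mul_of_nonneg_left t3 hb0
  linarith

/-- The matrix `R⁽²⁾` is trivial near the discrete spectrum. -/
lemma CutoffGeometry.Rtwo_eq_one (hG : CutoffGeometry D χ d L) {z w : ℂ} (hw : w ∈ D.discrete)
    (hz : dist z w < d) : Rtwo D χ α γ x t z = 1 := by
  have h0 : ∀ (z₀ : ℝ) (f g : ℂ → ℂ), blend χ z₀ f g z = 0 := fun z₀ f g => by
    rw [blend, hG.eq_one w hw z hz]; simp
  have hone : (1 : Matrix (Fin 2) (Fin 2) ℂ) = !![1, 0; 0, 1] := Matrix.one_fin_two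
  simp only [Rtwo, R1, R3, R4, R6, h0, zero_mul, neg_zero, hone, ite_self]

lemma CutoffGeometry.dbarRtwo_eq_zero (hG : CutoffGeometry D χ d L) {z w : ℂ} (hw : w ∈ D.discrete)
    (hz : dist z w < d) (i j : Fin 2) : dbarRtwo D χ α γ x t z i j = 0 := by
  rw [dbarRtwo, Matrix.of_apply]
  refine dbar_eq_zero_of_eventually_const (c := (1 : Matrix (Fin 2) (Fin 2) ℂ) i j) ?_
  filter_upwards [Metric.isOpen_ball.mem_nhds (Metric.mem_ball.2 hz)] with y hy
  rw [hG.Rtwo_eq_one hw hy]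

end DbarBound

section DbarBound

variable {D : ScatteringData} {χ : ℂ → ℝ} {α γ x t d L : ℝ}

lemma dbarMajorant_nonneg {k : ℝ → ℝ} {C z₀ : ℝ} (hk : ∀ s, 0 ≤ k s) (hC : 0 ≤ C) (z : ℂ) :
    0 ≤ dbarMajorant k C t z₀ z :=
  indicator_nonneg (fun _ _ => mul_nonneg (Real.exp_nonneg _)
    (add_nonneg (hk _) (mul_nonneg hC (Real.rpow_nonneg (abs_nonneg _) _)))) z

lemma Rtwo_of_mem1 {z : ℂ} (hz : z ∈ Omega1 (phasePoint α x t)) : Rtwo D χ α γ x t z =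
    !![1, 0; R1 D χ (phasePoint α x t) z * -osc α γ x t z, 1] := by
  rw [Rtwo, if_pos hz, mul_neg]

lemma Rtwo_of_mem3 {z : ℂ} (hz : z ∈ Omega3 (phasePoint α x t)) : Rtwo D χ α γ x t z =
    !![1, R3 D χ (phasePoint α x t) z * -(osc α γ x t z)⁻¹; 0, 1] := by
  rw [Rtwo, if_neg, if_pos hz, mul_neg]
  simp only [Omega1, Omega3, mem_ofPred_eq] at *
  intro h; linarith

lemma Rtwo_of_mem4 {z : ℂ} (hz : z ∈ Omega4 (phasePoint α x t)) : Rtwo D χ α γ x t z =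
    !![1, 0; R4 D χ (phasePoint α x t) z * osc α γ x t z, 1] := by
  rw [Rtwo, if_neg, if_neg, if_pos hz] <;>
  · simp only [Omega1, Omega3, Omega4, mem_ofPred_eq] at *
    intro h; linarith

lemma Rtwo_of_mem6 {z : ℂ} (hz : z ∈ Omega6 (phasePoint α x t)) : Rtwo D χ α γ x t z =
    !![1, R6 D χ (phasePoint α x t) z * (osc α γ x t z)⁻¹; 0, 1] := by
  rw [Rtwo, if_neg, if_neg, if_neg, if_pos hz] <;>
  · simp only [Omega1, Omega3, Omega4, Omega6, mem_ofPred_eq] at *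
    intro h; linarith

lemma Rtwo_of_abs_lt {z : ℂ} (hz : |z.re - phasePoint α x t| < |z.im|) : Rtwo D χ α γ x t z = 1 := by
  rw [Rtwo, if_neg, if_neg, if_neg, if_neg] <;>
  · simp only [Omega1, Omega3, Omega4, Omega6, mem_ofPred_eq]
    grind

lemma norm_dbar_mul_le {g E : ℂ → ℂ} {z : ℂ} {a m : ℝ} (hg : DifferentiableAt ℝ g z)
    (hgm : ‖dbar g z‖ ≤ m) (hE : DifferentiableAt ℂ E z) (hEa : ‖E z‖ = a) :
    ‖dbar (fun w => g w * E w) z‖ ≤ a * m := by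
  rw [dbar_mul hg (hE.restrictScalars ℝ), dbar_eq_zero_of_differentiableAt hE, mul_zero, add_zero,
    norm_mul, hEa, mul_comm]
  exact mul_le_mul_of_nonneg_left hgm (hEa ▸ norm_nonneg _)

lemma norm_dbarRtwo_le_lower {z : ℂ} {O : Set ℂ} (hO : O ∈ 𝓝 z) {g E : ℂ → ℂ} {m : ℝ} (hm : 0 ≤ m)
    (h : ∀ w ∈ O, Rtwo D χ α γ x t w = !![1, 0; g w * E w, 1])
    (hb : ‖dbar (fun w => g w * E w) z‖ ≤ m) (i j : Fin 2) : ‖dbarRtwo D χ α γ x t z i j‖ ≤ m := by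
  have key : ∀ (i j : Fin 2), (i, j) ≠ (1, 0) → ‖dbarRtwo D χ α γ x t z i j‖ ≤ m := by
    intro i j hij
    rw [dbarRtwo, Matrix.of_apply, dbar_eq_zero_of_eventually_const
      (c := (1 : Matrix (Fin 2) (Fin 2) ℂ) i j), norm_zero]
    · exact hm
    filter_upwards [hO] with w hw
    rw [h w hw]
    fin_cases i <;> fin_cases j <;> simp at hij ⊢
  by_cases hij : (i, j) = (1, 0)
  · obtain ⟨rfl, rfl⟩ := Prod.mk.inj hij
    rw [dbarRtwo, Matrix.of_apply]
    have hev : (fun w => Rtwo D χ α γ x t w 1 0) =ᶠ[𝓝 z] fun w => g w * E w := by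
      filter_upwards [hO] with w hw
      rw [h w hw]; simp
    rwa [dbar_congr hev]
  · exact key i j hij

lemma norm_dbarRtwo_le_upper {z : ℂ} {O : Set ℂ} (hO : O ∈ 𝓝 z) {g E : ℂ → ℂ} {m : ℝ} (hm : 0 ≤ m)
    (h : ∀ w ∈ O, Rtwo D χ α γ x t w = !![1, g w * E w; 0, 1])
    (hb : ‖dbar (fun w => g w * E w) z‖ ≤ m) (i j : Fin 2) : ‖dbarRtwo D χ α γ x t z i j‖ ≤ m := by
  have key : ∀ (i j : Fin 2), (i, j) ≠ (0, 1) → ‖dbarRtwo D χ α γ x t z i j‖ ≤ m := by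
    intro i j hij
    rw [dbarRtwo, Matrix.of_apply, dbar_eq_zero_of_eventually_const
      (c := (1 : Matrix (Fin 2) (Fin 2) ℂ) i j), norm_zero]
    · exact hm
    filter_upwards [hO] with w hw
    rw [h w hw]
    fin_cases i <;> fin_cases j <;> simp at hij ⊢
  by_cases hij : (i, j) = (0, 1)
  · obtain ⟨rfl, rfl⟩ := Prod.mk.inj hij
    rw [dbarRtwo, Matrix.of_apply]
    have hev : (fun w => Rtwo D χ α γ x t w 0 1) =ᶠ[𝓝 z] fun w => g w * E w := by
      filter_upwards [hO] with w hw
      rw [h w hw]; simp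
    rwa [dbar_congr hev]
  · exact key i j hij

lemma norm_osc_of_pos {z : ℂ} (h : 0 < (z.re - phasePoint α x t) * z.im) : ‖osc α γ x t z‖ =
    Real.exp (-(8 * t * (|z.re - phasePoint α x t| * |z.im|))) := by
  rw [norm_osc, ← abs_mul, abs_of_pos h]

lemma norm_osc_inv_of_neg {z : ℂ} (h : (z.re - phasePoint α x t) * z.im < 0) : ‖(osc α γ x t z)⁻¹‖ =
    Real.exp (-(8 * t * (|z.re - phasePoint α x t| * |z.im|))) := by
  rw [norm_inv, norm_osc, ← abs_mul, abs_of_neg h, ← Real.exp_neg]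
  congr 1; ring

lemma ae_re_of_ae {p : ℝ → Prop} (h : ∀ᵐ s, p s) : ∀ᵐ z : ℂ, p z.re :=
  (Measure.quasiMeasurePreserving_fst.comp
    Complex.volume_preserving_equiv_real_prod.quasiMeasurePreserving).ae h

set_option maxHeartbeats 400000 in
/-- The derivative `∂̄R⁽²⁾` is bounded by its majorant. -/
theorem CutoffGeometry.exists_dbarRtwo_bound (hG : CutoffGeometry D χ d L) :
    ∃ (k : ℝ → ℝ) (C : ℝ), 0 ≤ C ∧ (∀ s, 0 ≤ k s) ∧ MemLp k 2 ∧ ∀ α γ x t : ℝ, ∀ᵐ z, ∀ i j,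
      ‖dbarRtwo D χ α γ x t z i j‖ ≤ dbarMajorant k C t (phasePoint α x t) z := by
  obtain ⟨C, hC0, hC⟩ := hG.exists_T_bounds
  obtain ⟨B, hB0, hB⟩ := exists_ray_bound D
  obtain ⟨K, hK0, hK⟩ := D.r_memH1.exists_holder
  obtain ⟨R, hR0, hR⟩ := D.r_memH1.exists_bound
  obtain ⟨g, hg, hgr⟩ := D.r_memH1.exists_hasDerivAt
  obtain ⟨b, hb0, hb⟩ := exists_fderiv_bound_of_const (L := L) hG.contDiff_one_sub 1
    fun z hz => by rw [hG.eq_zero_far z hz]; simp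
  -- `k` collects the derivative of `r` and that of the cutoff. The latter is bounded by a constant,
  -- restricted to `|Re z| ≤ L` so that it is square integrable.
  refine ⟨fun s => C * ‖g s‖ + (Icc (-L) L).indicator (fun _ => b * (2 * B + R * C)) s,
    (K + R) * C, by positivity, fun s => ?_, ?_, fun α γ x t => ?_⟩
  · exact add_nonneg (by positivity) (indicator_nonneg (fun _ _ => by positivity) _)
  · exact (hg.norm.const_mul C).add (memLp_indicator_const 2 measurableSet_Icc _ (Or.inr (by simp)))
  set k : ℝ → ℝ := fun s => C * ‖g s‖ + (Icc (-L) L).indicator (fun _ => b * (2 * B + R * C)) s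
    with hk
  have hk0 : ∀ s, 0 ≤ k s := fun s =>
    add_nonneg (by positivity) (indicator_nonneg (fun _ _ => by positivity) _)
  have hC1 : 0 ≤ (K + R) * C := by positivity
  set z₀ := phasePoint α x t with hz₀
  -- The null sets removed are the contour, the real axis and the vertical lines over the points
  -- where `r` does not have derivative `g`.
  filter_upwards [measure_eq_zero_iff_ae_notMem.1 (volume_contour z₀), measure_eq_zero_iff_ae_notMem.1
    (volume_line_eq_zero (a := 0) (b := 1) (by simp) 0), ae_re_of_ae hgr] with z hS him hr
  have him : z.im ≠ 0 := fun h => him (by simpa using h)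
  have hm0 : 0 ≤ dbarMajorant k ((K + R) * C) t z₀ z := dbarMajorant_nonneg hk0 hC1 z
  intro i j
  -- Near the spectrum, where the bounds for `T` are not available, `R⁽²⁾` is constant.
  by_cases hnear : ∃ w ∈ D.discrete, dist z w < d
  · obtain ⟨w, hw, hzw⟩ := hnear
    rw [hG.dbarRtwo_eq_zero hw hzw, norm_zero]
    exact hm0
  push Not at hnear
  have hzD : z ∉ D.discrete := fun h => by
    have := hnear z h
    rw [dist_self] at this
    exact absurd hG.pos this.not_gt
  obtain ⟨⟨p1, p2⟩, p3, p4⟩ := hC z₀ z him hnear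
  have dT : DifferentiableAt ℂ (fun z => T D z₀ z ^ 2) z := (differentiableAt_T him hzD).pow 2
  have dTi : DifferentiableAt ℂ (fun z => (T D z₀ z ^ 2)⁻¹) z := dT.inv (pow_ne_zero 2 (T_ne_zero hzD))
  have dO : DifferentiableAt ℂ (osc α γ x t) z := differentiable_osc z
  have dOi : DifferentiableAt ℂ (fun z => (osc α γ x t z)⁻¹) z := dO.inv (osc_ne_zero z)
  have hχd : DifferentiableAt ℝ (fun z => 1 - (χ z : ℂ)) z :=
    hG.contDiff_one_sub.differentiable (by norm_num) z
  obtain ⟨df1, df3, df4, df6⟩ := differentiableAt_rays (D := D) (z₀ := z₀) (z := z)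
    (Complex.mem_slitPlane_iff.2 (Or.inr (by simpa using him)))
  obtain ⟨B1, B3, B4, B6⟩ := hB z₀ z
  -- One estimate serves all four sectors. They differ in the amplitude `q`, in `τ` (which is `T²`
  -- or `T⁻²`, with model `τ₀` at the vertex), and in the exponential `E`, whose modulus is always
  -- the decaying one.
  have main : ∀ {f τ τ₀ E : ℂ → ℂ} {q : ℝ → ℂ}, IsAmplitude D.r q → z.re ≠ z₀ → |z.im| < |z.re - z₀| →
      DifferentiableAt ℂ f z → ‖f z‖ ≤ B → f z = q z₀ * τ₀ z → DifferentiableAt ℂ τ z → ‖τ z‖ ≤ C →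
      ‖τ z - τ₀ z‖ ≤ C * √‖z - z₀‖ → DifferentiableAt ℂ E z →
      ‖E z‖ = Real.exp (-(8 * t * (|z.re - z₀| * |z.im|))) →
      ‖dbar (fun w => blend χ z₀ f (fun z => q z.re * τ z) w * E w) z‖ ≤
        dbarMajorant k ((K + R) * C) t z₀ z := by
    intro f τ τ₀ E q hq hz hlt hf hfB hfe hτ hτC hτ₀ hE hEa
    set b' : ℝ := (Icc (-L) L).indicator (fun _ => b) z.re with hb'
    have hb'0 : 0 ≤ b' := indicator_nonneg (fun _ _ => hb0) _
    have hdb : ‖dbar (fun z => 1 - (χ z : ℂ)) z‖ ≤ b' := by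
      by_cases hL : z.re ∈ Icc (-L) L
      · rw [hb', indicator_of_mem hL]
        exact (norm_dbar_le _ _).trans (hb z)
      · rw [hG.dbar_cutoff_eq_zero, norm_zero]
        · exact hb'0
        · refine Or.inr (Or.inl ?_)
          refine lt_of_lt_of_le ?_ (Complex.abs_re_le_norm z)
          rw [Set.mem_Icc, ← abs_le] at hL
          exact not_le.1 hL
    obtain ⟨e1, e2⟩ := norm_dbar_blend_le_majorant hχd (hG.norm_one_sub_le z) hdb hb'0 hq hR hK0 hK hr hz
      hf hfB hfe hτ hC0 hτC hτ₀
    have e3 := norm_dbar_mul_le e1 e2 hE hEa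
    rw [dbarMajorant_of_mem (abs_pos.2 him) hlt]
    refine e3.trans (le_of_eq ?_)
    congr 2
    rw [hk, hb']
    simp only [indicator]
    split_ifs <;> ring
  rcases mem_sector_of_notMem_contour hS with h | h | h | h | h | h | h
  · exact absurd h him
  · have h1 := h.1; have h2 := h.2
    have h3 : 0 < z.re - z₀ := h1.trans h2
    refine norm_dbarRtwo_le_lower (isOpen_Omega1.mem_nhds h) hm0 (fun w hw => Rtwo_of_mem1 hw) ?_ i j
    refine main (τ₀ := fun z => (T0 D z₀ ^ 2)⁻¹ *
      (z - z₀) ^ (-2 * Complex.I * (nu D.r z₀ : ℂ)))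
      (isAmplitude_self D.r) (by linarith : z₀ < z.re).ne' ?_ df1 B1 
      (mul_assoc _ _ _) dTi p3 p4 dO.neg ?_
    · rwa [abs_of_pos h1, abs_of_pos h3]
    · rw [norm_neg]; exact norm_osc_of_pos (mul_pos h3 h1)
  · have h2 : |z.re - z₀| < z.im := h
    have : dbarRtwo D χ α γ x t z i j = 0 := by
      rw [dbarRtwo, Matrix.of_apply]
      refine dbar_eq_zero_of_eventually_const (c := (1 : Matrix (Fin 2) (Fin 2) ℂ) i j) ?_
      filter_upwards [isOpen_Omega2.mem_nhds h] with w hw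
      rw [Rtwo_of_abs_lt (lt_of_lt_of_le hw (le_abs_self _))]
    rw [this, norm_zero]; exact hm0
  · have h1 := h.1; have h2 := h.2
    have h3 : z.re - z₀ < 0 := by linarith
    refine norm_dbarRtwo_le_upper (isOpen_Omega3.mem_nhds h) hm0 (fun w hw => Rtwo_of_mem3 hw) ?_ i j
    have key := main (E := fun w => -(osc α γ x t w)⁻¹) (τ₀ := fun z => T0 D z₀ ^ 2 *
      (z - z₀) ^ (2 * Complex.I * (nu D.r z₀ : ℂ)))
      (isAmplitude_div D.r).conj (by linarith : z.re < z₀).ne ?_ df3 B3 ?_ dT p1 p2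
      dOi.neg ?_
    · simpa only [R3, map_div₀, map_add, map_one, map_pow, Complex.conj_ofReal] using key
    · rw [abs_of_pos h1, abs_of_neg h3]; linarith
    · simp only [f3, map_div₀, map_add, map_one, map_pow, Complex.conj_ofReal]; ring
    · rw [norm_neg]; exact norm_osc_inv_of_neg (mul_neg_of_neg_of_pos h3 h1)
  · have h1 := h.1; have h2 := h.2
    have h3 : z.re - z₀ < 0 := by linarith
    refine norm_dbarRtwo_le_lower (isOpen_Omega4.mem_nhds h) hm0 (fun w hw => Rtwo_of_mem4 hw) ?_ i j
    have key := main (E := osc α γ x t) (τ₀ := fun z => (T0 D z₀ ^ 2)⁻¹ *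
      (z - z₀) ^ (-2 * Complex.I * (nu D.r z₀ : ℂ)))
      (isAmplitude_div D.r) (by linarith : z.re < z₀).ne ?_ df4 B4 ?_ dTi p3 p4 dO ?_
    · simpa only [R4] using key
    · rw [abs_of_neg h1, abs_of_neg h3]; linarith
    · simp only [f4]; ring
    · exact norm_osc_of_pos (mul_pos_of_neg_of_neg h3 h1)
  · have h2 : |z.re - z₀| < -z.im := h
    have : dbarRtwo D χ α γ x t z i j = 0 := by
      rw [dbarRtwo, Matrix.of_apply]
      refine dbar_eq_zero_of_eventually_const (c := (1 : Matrix (Fin 2) (Fin 2) ℂ) i j) ?_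
      filter_upwards [isOpen_Omega5.mem_nhds h] with w hw
      rw [Rtwo_of_abs_lt (lt_of_lt_of_le hw (neg_le_abs _))]
    rw [this, norm_zero]; exact hm0
  · have h1 := h.1; have h2 := h.2
    have h3 : 0 < z.re - z₀ := by linarith
    refine norm_dbarRtwo_le_upper (isOpen_Omega6.mem_nhds h) hm0 (fun w hw => Rtwo_of_mem6 hw) ?_ i j
    have key := main (E := fun w => (osc α γ x t w)⁻¹) (τ₀ := fun z => T0 D z₀ ^ 2 *
      (z - z₀) ^ (2 * Complex.I * (nu D.r z₀ : ℂ)))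
      (isAmplitude_self D.r).conj (by linarith : z₀ < z.re).ne' ?_ df6 B6 ?_ dT p1 p2 dOi ?_
    · simpa only [R6] using key
    · rw [abs_of_neg h1, abs_of_pos h3]; linarith
    · simp only [f6]; ring
    · exact norm_osc_inv_of_neg (mul_neg_of_pos_of_neg h3 h1)

end DbarBound

/-! ### Integration along horizontal lines. -/

section Slices

/-- Cauchy–Schwarz by way of `f g ≤ (b / 2a) f² + (a / 2b) g²`, with the weights fitted to the given
bounds for the norms. -/
lemma integral_mul_le_of_sq {f g : ℝ → ℝ} {a b : ℝ} (hf : AEStronglyMeasurable f volume)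
    (hg : AEStronglyMeasurable g volume) (hf0 : ∀ s, 0 ≤ f s) (hg0 : ∀ s, 0 ≤ g s)
    (hf2 : Integrable fun s => f s ^ 2) (hg2 : Integrable fun s => g s ^ 2) (ha : 0 < a) (hb : 0 < b)
    (hfa : ∫ s, f s ^ 2 ≤ a ^ 2) (hgb : ∫ s, g s ^ 2 ≤ b ^ 2) :
    Integrable (fun s => f s * g s) ∧ ∫ s, f s * g s ≤ a * b := by
  have hi : Integrable fun s => b / (2 * a) * f s ^ 2 + a / (2 * b) * g s ^ 2 :=
    (hf2.const_mul _).add (hg2.const_mul _)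
  have hle : ∀ s, f s * g s ≤ b / (2 * a) * f s ^ 2 + a / (2 * b) * g s ^ 2 := fun s => by
    have h1 : b / (2 * a) * f s ^ 2 + a / (2 * b) * g s ^ 2 - f s * g s =
        (b * f s - a * g s) ^ 2 / (2 * a * b) := by
      field_simp; ring
    have h2 : 0 ≤ (b * f s - a * g s) ^ 2 / (2 * a * b) := by positivity
    linarith
  have hm : Integrable fun s => f s * g s := hi.mono' (hf.mul hg) (Eventually.of_forall fun s => by
    rw [Real.norm_of_nonneg (mul_nonneg (hf0 s) (hg0 s))]; exact hle s)
  refine ⟨hm, (integral_mono hm hi hle).trans ?_⟩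
  rw [integral_add (hf2.const_mul _) (hg2.const_mul _), integral_const_mul, integral_const_mul]
  calc _ ≤ b / (2 * a) * a ^ 2 + a / (2 * b) * b ^ 2 := by gcongr
    _ = a * b := by field_simp; ring

lemma integral_sq_add_sq_rpow {p : ℝ} (hp : 1 / 2 < p) (a : ℝ) {b : ℝ} (hb : 0 < b) :
    Integrable (fun s : ℝ => ((s - a) ^ 2 + b ^ 2) ^ (-p)) ∧
      ∫ s : ℝ, ((s - a) ^ 2 + b ^ 2) ^ (-p) = b ^ (1 - 2 * p) * ∫ s : ℝ, (1 + s ^ 2) ^ (-p) := by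
  have h1 : Integrable fun s : ℝ => (1 + s ^ 2) ^ (-p) := by
    have := integrable_rpow_neg_one_add_norm_sq (E := ℝ) (μ := volume) (r := 2 * p)
      (by simp; linarith)
    refine this.congr (Eventually.of_forall fun s => ?_)
    simp only [Real.norm_eq_abs, sq_abs]
    congr 1; ring
  have e : ∀ s : ℝ, (s ^ 2 + b ^ 2) ^ (-p) = b ^ (-(2 * p)) * (1 + (s / b) ^ 2) ^ (-p) := fun s => by
    have : s ^ 2 + b ^ 2 = b ^ 2 * (1 + (s / b) ^ 2) := by field_simp; ring
    rw [this, Real.mul_rpow (by positivity) (by positivity), ← Real.rpow_natCast b 2,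
      ← Real.rpow_mul hb.le]
    congr 2; push_cast; ring
  have h2 : Integrable fun s : ℝ => (s ^ 2 + b ^ 2) ^ (-p) := by
    simp_rw [e]
    exact (h1.comp_div hb.ne').const_mul _
  refine ⟨h2.comp_sub_right a, ?_⟩
  rw [integral_sub_right_eq_self (fun s : ℝ => (s ^ 2 + b ^ 2) ^ (-p)) a]
  simp_rw [e]
  rw [integral_const_mul, Measure.integral_comp_div (fun s : ℝ => (1 + s ^ 2) ^ (-p)) b, abs_of_pos hb,
    smul_eq_mul, ← mul_assoc]
  congr 1
  nth_rewrite 2 [← Real.rpow_one b]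
  rw [← Real.rpow_add hb]
  congr 1; ring

lemma integral_japanese_nonneg (p : ℝ) : 0 ≤ ∫ s : ℝ, (1 + s ^ 2) ^ (-p) :=
  integral_nonneg fun s => by positivity

/-- Gaussian means of a power singularity. -/
lemma integral_gaussian_mul_rpow_le {b : ℝ} (hb0 : 0 ≤ b) (hb : b < 1) {t : ℝ} (ht : 0 < t) (y : ℝ) :
    Integrable (fun v : ℝ => Real.exp (-(4 * t * v ^ 2)) * |v - y| ^ (-b)) ∧
      ∫ v : ℝ, Real.exp (-(4 * t * v ^ 2)) * |v - y| ^ (-b) ≤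
        (2 / (1 - b) + 1) * t ^ ((b - 1) / 2) := by
  -- The singularity is cut off at the Gaussian length `t^(-1/2)`; both parts then scale like `t ^
  -- ((b - 1) / 2)`.
  set ρ : ℝ := t ^ (-(1 / 2) : ℝ) with hρ
  have hρ0 : 0 < ρ := Real.rpow_pos_of_pos ht _
  obtain ⟨k1, k2⟩ := integrable_nearKernel (ρ := ρ) (b := b) hρ0.le hb
  have k1' : Integrable fun v => nearKernel ρ b (v - y) := k1.comp_sub_right y
  have hg : Integrable fun v : ℝ => Real.exp (-(4 * t) * v ^ 2) := integrable_exp_neg_mul_sq (by positivity)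
  have hi : Integrable fun v : ℝ => nearKernel ρ b (v - y) + Real.exp (-(4 * t) * v ^ 2) * ρ ^ (-b) :=
    k1'.add (hg.mul_const _)
  have hle : ∀ v : ℝ, Real.exp (-(4 * t * v ^ 2)) * |v - y| ^ (-b) ≤
      nearKernel ρ b (v - y) + Real.exp (-(4 * t) * v ^ 2) * ρ ^ (-b) := fun v => by
    have h1 := abs_rpow_neg_le_nearKernel hρ0 hb0 (v - y)
    have h2 : Real.exp (-(4 * t * v ^ 2)) ≤ 1 := Real.exp_le_one_iff.2 (by
      have : 0 ≤ 4 * t * v ^ 2 := by positivity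
      linarith)
    rw [← neg_mul] at h2 ⊢
    calc _ ≤ Real.exp (-(4 * t) * v ^ 2) * (nearKernel ρ b (v - y) + ρ ^ (-b)) := by gcongr
      _ = Real.exp (-(4 * t) * v ^ 2) * nearKernel ρ b (v - y) +
          Real.exp (-(4 * t) * v ^ 2) * ρ ^ (-b) := by ring
      _ ≤ _ := by
        have := mul_le_of_le_one_left (nearKernel_nonneg ρ b (v - y)) h2
        linarith
  have hm : Integrable fun v : ℝ => Real.exp (-(4 * t * v ^ 2)) * |v - y| ^ (-b) :=
    hi.mono' (by fun_prop : Measurable _).aestronglyMeasurable (Eventually.of_forall fun v => by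
      rw [Real.norm_of_nonneg (by positivity)]; exact hle v)
  refine ⟨hm, (integral_mono hm hi hle).trans ?_⟩
  rw [integral_add k1' (hg.mul_const _), integral_sub_right_eq_self (nearKernel ρ b) y, k2,
    integral_mul_const, integral_gaussian]
  have e1 : ρ ^ (1 - b) = t ^ ((b - 1) / 2) := by
    rw [hρ, ← Real.rpow_mul ht.le]; congr 1; ring
  have e2 : √(Real.pi / (4 * t)) ≤ ρ := by
    rw [hρ, Real.rpow_neg ht.le, ← Real.sqrt_eq_rpow, ← Real.sqrt_inv]
    refine Real.sqrt_le_sqrt ?_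
    rw [div_le_iff₀ (by positivity)]
    field_simp
    linarith [Real.pi_lt_four]
  have e3 : ρ * ρ ^ (-b) = t ^ ((b - 1) / 2) := by
    rw [← e1, sub_eq_add_neg, Real.rpow_add hρ0, Real.rpow_one]
  have e4 : √(Real.pi / (4 * t)) * ρ ^ (-b) ≤ t ^ ((b - 1) / 2) := by
    rw [← e3]; gcongr
  rw [e1]
  calc _ ≤ 2 * t ^ ((b - 1) / 2) / (1 - b) + t ^ ((b - 1) / 2) := by gcongr
    _ = _ := by ring

/-- The weight that the Cauchy–Schwarz inequality leaves on the horizontal lines. -/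
noncomputable def sliceWeight (t v : ℝ) : ℝ := 1 + t ^ (-(1 / 8) : ℝ) * |v| ^ (-(1 / 4) : ℝ)

lemma one_le_sliceWeight {t : ℝ} (ht : 0 < t) (v : ℝ) : 1 ≤ sliceWeight t v := by
  have : 0 ≤ t ^ (-(1 / 8) : ℝ) * |v| ^ (-(1 / 4) : ℝ) := by positivity
  rw [sliceWeight]; linarith

/-- The weight brings a second singularity, at `v = 0`. The product of both is at most the sum of
two singularities of exponent `b + 1/4 < 1`, and the prefactor restores the power of `t`: `-1/8 + (b
+ 1/4 - 1)/2 = (b - 1)/2`. -/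
lemma exists_integral_sliceWeight_le {b : ℝ} (hb0 : 0 ≤ b) (hb : b < 3 / 4) :
    ∃ A : ℝ, 0 ≤ A ∧ ∀ t y : ℝ, 0 < t →
      Integrable (fun v : ℝ => Real.exp (-(4 * t * v ^ 2)) * sliceWeight t v * |v - y| ^ (-b)) ∧
      ∫ v : ℝ, Real.exp (-(4 * t * v ^ 2)) * sliceWeight t v * |v - y| ^ (-b) ≤
        A * t ^ ((b - 1) / 2) := by
  set c := b + 1 / 4 with hc
  set A₁ := 2 / (1 - b) + 1 with hA₁
  set A₂ := 2 / (1 - c) + 1 with hA₂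
  have h1b : 0 < 1 - b := by linarith
  have h1c : 0 < 1 - c := by linarith
  have hA₁0 : 0 ≤ A₁ := by positivity
  have hA₂0 : 0 ≤ A₂ := by positivity
  refine ⟨A₁ + 2 * A₂, by positivity, fun t y ht => ?_⟩
  obtain ⟨i1, j1⟩ := integral_gaussian_mul_rpow_le hb0 (by linarith) ht y
  obtain ⟨i2, j2⟩ := integral_gaussian_mul_rpow_le (b := c) (by linarith) (by linarith) ht y
  obtain ⟨i3, j3⟩ := integral_gaussian_mul_rpow_le (b := c) (by linarith) (by linarith) ht 0
  simp only [sub_zero] at i3 j3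
  set τ : ℝ := t ^ (-(1 / 8) : ℝ) with hτ
  have hτ0 : 0 < τ := Real.rpow_pos_of_pos ht _
  set g : ℝ → ℝ := fun v => Real.exp (-(4 * t * v ^ 2)) * |v - y| ^ (-b) +
    (τ * (Real.exp (-(4 * t * v ^ 2)) * |v| ^ (-c)) +
      τ * (Real.exp (-(4 * t * v ^ 2)) * |v - y| ^ (-c))) with hg
  have i4 : Integrable fun v : ℝ => τ * (Real.exp (-(4 * t * v ^ 2)) * |v| ^ (-c)) +
      τ * (Real.exp (-(4 * t * v ^ 2)) * |v - y| ^ (-c)) := (i3.const_mul τ).add (i2.const_mul τ)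
  have hi : Integrable g := i1.add i4
  have young : ∀ p q : ℝ, 0 < p → 0 < q → p ^ (-(1 / 4) : ℝ) * q ^ (-b) ≤ p ^ (-c) + q ^ (-c) := by
    intro p q hp hq
    have ec : -c = -(1 / 4) + -b := by rw [hc]; ring
    rcases le_total p q with h | h
    · have : q ^ (-b) ≤ p ^ (-b) := Real.rpow_le_rpow_of_nonpos hp h (by linarith)
      calc _ ≤ p ^ (-(1 / 4) : ℝ) * p ^ (-b) := by gcongr
        _ = p ^ (-c) := by rw [ec, Real.rpow_add hp]
        _ ≤ _ := by have := Real.rpow_nonneg hq.le (-c); linarith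
    · have : p ^ (-(1 / 4) : ℝ) ≤ q ^ (-(1 / 4) : ℝ) :=
        Real.rpow_le_rpow_of_nonpos hq h (by norm_num)
      calc _ ≤ q ^ (-(1 / 4) : ℝ) * q ^ (-b) := by gcongr
        _ = q ^ (-c) := by rw [ec, Real.rpow_add hq]
        _ ≤ _ := by have := Real.rpow_nonneg hp.le (-c); linarith
  have hle : ∀ᵐ v : ℝ, Real.exp (-(4 * t * v ^ 2)) * sliceWeight t v * |v - y| ^ (-b) ≤ g v := by
    filter_upwards [compl_mem_ae_iff.2 (Real.volume_singleton (a := 0)),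
      compl_mem_ae_iff.2 (Real.volume_singleton (a := y))] with v h0 hy
    have h3 := young |v| |v - y| (abs_pos.2 h0) (abs_pos.2 (sub_ne_zero.2 hy))
    have h4 := mul_le_mul_of_nonneg_left h3
      (mul_nonneg hτ0.le (Real.exp_nonneg (-(4 * t * v ^ 2))))
    simp only [sliceWeight, hg, ← hτ]
    linarith
  have hm : Integrable fun v : ℝ =>
      Real.exp (-(4 * t * v ^ 2)) * sliceWeight t v * |v - y| ^ (-b) := by
    refine hi.mono' ?_ ?_
    · unfold sliceWeight
      exact (by fun_prop : Measurable _).aestronglyMeasurable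
    · filter_upwards [hle] with v hv
      have := one_le_sliceWeight ht v
      rwa [Real.norm_of_nonneg (by positivity)]
  refine ⟨hm, (integral_mono_ae hm hi hle).trans ?_⟩
  rw [hg, integral_add i1 i4, integral_add (i3.const_mul τ) (i2.const_mul τ), integral_const_mul,
    integral_const_mul]
  have e : τ * t ^ ((c - 1) / 2) = t ^ ((b - 1) / 2) := by
    rw [hτ, ← Real.rpow_add ht]; congr 1; rw [hc]; ring
  have j2' := mul_le_mul_of_nonneg_left j2 hτ0.le
  have j3' := mul_le_mul_of_nonneg_left j3 hτ0.le
  have e' : τ * ((2 / (1 - c) + 1) * t ^ ((c - 1) / 2)) = A₂ * t ^ ((b - 1) / 2) := by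
    rw [← e]; ring
  rw [e'] at j2' j3'
  linarith

/-- Tonelli's theorem on the horizontal lines. -/
lemma integrable_of_slices {F : ℂ → ℝ} {φ : ℝ → ℝ} (hF : AEStronglyMeasurable F volume)
    (hF0 : ∀ z, 0 ≤ F z) (hφ : Integrable φ)
    (h : ∀ᵐ v : ℝ, Integrable (fun s : ℝ => F ⟨s, v⟩) ∧ ∫ s : ℝ, F ⟨s, v⟩ ≤ φ v) :
    Integrable F ∧ ∫ z, F z ≤ ∫ v, φ v := by
  have hmp := Complex.volume_preserving_equiv_real_prod.symm
  have hemb := Complex.measurableEquivRealProd.symm.measurableEmbedding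
  set G : ℝ × ℝ → ℝ := fun p => F ⟨p.1, p.2⟩ with hG
  have hGm : AEStronglyMeasurable G (volume.prod volume) := hF.comp_measurePreserving hmp
  have hn : ∀ v : ℝ, ∫ s : ℝ, ‖G (s, v)‖ = ∫ s : ℝ, F ⟨s, v⟩ := fun v =>
    integral_congr_ae (Eventually.of_forall fun s => Real.norm_of_nonneg (hF0 _))
  have hGi : Integrable G (volume.prod volume) := by
    refine (integrable_prod_iff' hGm).2 ⟨h.mono fun v hv => hv.1, hφ.mono' ?_ ?_⟩
    · exact hGm.norm.prod_swap.integral_prod_right'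
    · filter_upwards [h] with v hv
      rw [hn, Real.norm_of_nonneg (integral_nonneg fun s => hF0 _)]
      exact hv.2
  refine ⟨(hmp.integrable_comp_emb hemb).1 hGi, ?_⟩
  have e : ∫ z, F z = ∫ p, G p := (hmp.integral_comp hemb F).symm
  rw [e, Measure.volume_eq_prod, integral_prod_symm G hGi]
  exact integral_mono_ae hGi.integral_prod_right hφ (h.mono fun v hv => hv.2)

end Slices

/-! ### Integrals of the majorant. -/

section Majorant

variable {k : ℝ → ℝ} {C : ℝ}

lemma aestronglyMeasurable_dbarMajorant (hk : MemLp k 2) (C t z₀ : ℝ) :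
    AEStronglyMeasurable (dbarMajorant k C t z₀) volume := by
  have hkm : AEStronglyMeasurable (fun z : ℂ => k z.re) volume :=
    hk.1.comp_quasiMeasurePreserving (Measure.quasiMeasurePreserving_fst.comp
      Complex.volume_preserving_equiv_real_prod.quasiMeasurePreserving)
  have h1 : AEStronglyMeasurable (fun z : ℂ => Real.exp (-(8 * t * (|z.re - z₀| * |z.im|)))) volume :=
    (by fun_prop : Continuous _).aestronglyMeasurable
  have h2 : AEStronglyMeasurable (fun z : ℂ => C * |z.re - z₀| ^ (-(1 / 2) : ℝ)) volume :=
    (by fun_prop : Measurable _).aestronglyMeasurable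
  have h3 : MeasurableSet {z : ℂ | 0 < |z.im|} := measurableSet_lt (by fun_prop) (by fun_prop)
  have h4 : MeasurableSet {z : ℂ | |z.im| < |z.re - z₀|} :=
    measurableSet_lt (by fun_prop) (by fun_prop)
  exact (h1.mul (hkm.add h2)).indicator (h3.inter h4)

/-- A quarter power taken from the exponential turns `|u|⁻¹` into `|u|^(-5/4)`, which is integrable
at infinity. -/
lemma exp_neg_four_mul_le {x : ℝ} (hx : 0 < x) : Real.exp (-(4 * x)) ≤ x ^ (-(1 / 4) : ℝ) := by
  rw [← Real.log_le_log_iff (Real.exp_pos _) (Real.rpow_pos_of_pos hx _), Real.log_exp,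
    Real.log_rpow hx]
  have := Real.log_le_sub_one_of_pos hx
  linarith

lemma exp_neg_le_two_div {x : ℝ} (hx : 0 ≤ x) : Real.exp (-x) ≤ 2 * (1 + x ^ 2)⁻¹ := by
  have := Real.quadratic_le_exp_of_nonneg hx
  rw [Real.exp_neg, ← div_eq_mul_inv, inv_eq_one_div, div_le_div_iff₀ (Real.exp_pos _) (by positivity)]
  linarith

/-- For `|v| < |u|` both sides are comparable, and the right side is integrable over the whole line
with the scaling of `integral_sq_add_sq_rpow`. -/
lemma abs_rpow_neg_five_quarter_le {u v : ℝ} (hv : 0 < |v|) (huv : |v| < |u|) :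
    |u| ^ (-(5 / 4) : ℝ) ≤ 2 * (u ^ 2 + |v| ^ 2) ^ (-(5 / 8) : ℝ) := by
  have hu : 0 < |u| := hv.trans huv
  have e1 : |u| ^ (-(5 / 4) : ℝ) = (u ^ 2) ^ (-(5 / 8) : ℝ) := by
    rw [← sq_abs, ← Real.rpow_natCast, ← Real.rpow_mul hu.le]; norm_num
  have h1 : (u ^ 2 + |v| ^ 2) / 2 ≤ u ^ 2 := by
    have : |v| ^ 2 ≤ |u| ^ 2 := by gcongr
    rw [sq_abs u] at this
    linarith
  have h0 : 0 < u ^ 2 + |v| ^ 2 := by positivity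
  have h2 : (2 : ℝ) ^ (5 / 8 : ℝ) ≤ 2 := by
    have := Real.rpow_le_rpow_of_exponent_le (x := 2) (by norm_num) (by norm_num : (5 / 8 : ℝ) ≤ 1)
    simpa using this
  calc |u| ^ (-(5 / 4) : ℝ) = (u ^ 2) ^ (-(5 / 8) : ℝ) := e1
    _ ≤ ((u ^ 2 + |v| ^ 2) / 2) ^ (-(5 / 8) : ℝ) :=
        Real.rpow_le_rpow_of_nonpos (by positivity) h1 (by norm_num)
    _ = (2 : ℝ) ^ (5 / 8 : ℝ) * (u ^ 2 + |v| ^ 2) ^ (-(5 / 8) : ℝ) := by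
        rw [Real.div_rpow h0.le (by norm_num), Real.rpow_neg (by norm_num : (0 : ℝ) ≤ 2), div_inv_eq_mul,
          mul_comm]
    _ ≤ _ := by gcongr

/-- The square-integrability on horizontal lines of the singular part of the majorant. -/
lemma integral_singular_sq_le {t v : ℝ} (ht : 0 < t) (hv : v ≠ 0) (z₀ : ℝ) :
    Integrable (fun s : ℝ => ({s : ℝ | |v| < |s - z₀|}.indicator (fun s =>
      Real.exp (-(2 * t * (|s - z₀| * |v|))) * |s - z₀| ^ (-(1 / 2) : ℝ)) s) ^ 2) ∧
    ∫ s : ℝ, ({s : ℝ | |v| < |s - z₀|}.indicator (fun s =>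
      Real.exp (-(2 * t * (|s - z₀| * |v|))) * |s - z₀| ^ (-(1 / 2) : ℝ)) s) ^ 2 ≤
      2 * (∫ s : ℝ, (1 + s ^ 2) ^ (-(5 / 8) : ℝ)) *
        (t ^ (-(1 / 8) : ℝ) * |v| ^ (-(1 / 4) : ℝ)) ^ 2 := by
  have hv0 : 0 < |v| := abs_pos.2 hv
  set g : ℝ → ℝ := {s : ℝ | |v| < |s - z₀|}.indicator (fun s =>
      Real.exp (-(2 * t * (|s - z₀| * |v|))) * |s - z₀| ^ (-(1 / 2) : ℝ)) with hg
  obtain ⟨i1, j1⟩ := integral_sq_add_sq_rpow (p := 5 / 8) (by norm_num) z₀ hv0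
  have hi := i1.const_mul (2 * (t ^ (-(1 / 4) : ℝ) * |v| ^ (-(1 / 4) : ℝ)))
  have hle : ∀ s, g s ^ 2 ≤ 2 * (t ^ (-(1 / 4) : ℝ) * |v| ^ (-(1 / 4) : ℝ)) *
      ((s - z₀) ^ 2 + |v| ^ 2) ^ (-(5 / 8) : ℝ) := fun s => by
    by_cases hs : |v| < |s - z₀|
    · have hu : 0 < |s - z₀| := hv0.trans hs
      rw [hg, indicator_of_mem (s := {s : ℝ | |v| < |s - z₀|}) hs, mul_pow, ← Real.exp_nat_mul]
      have e1 : (|s - z₀| ^ (-(1 / 2) : ℝ)) ^ 2 = |s - z₀| ^ (-1 : ℝ) := by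
        rw [← Real.rpow_natCast, ← Real.rpow_mul hu.le]; norm_num
      have h1 : Real.exp ((2 : ℕ) * -(2 * t * (|s - z₀| * |v|))) ≤
          t ^ (-(1 / 4) : ℝ) * |v| ^ (-(1 / 4) : ℝ) * |s - z₀| ^ (-(1 / 4) : ℝ) := by
        have := exp_neg_four_mul_le (x := t * |v| * |s - z₀|) (by positivity)
        rw [Real.mul_rpow (by positivity) hu.le, Real.mul_rpow ht.le hv0.le] at this
        refine le_trans (le_of_eq ?_) this
        congr 1; push_cast; ring
      rw [e1]
      calc _ ≤ t ^ (-(1 / 4) : ℝ) * |v| ^ (-(1 / 4) : ℝ) * |s - z₀| ^ (-(1 / 4) : ℝ) *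
            |s - z₀| ^ (-1 : ℝ) := by gcongr
        _ = t ^ (-(1 / 4) : ℝ) * |v| ^ (-(1 / 4) : ℝ) * |s - z₀| ^ (-(5 / 4) : ℝ) := by
            rw [mul_assoc _ (|s - z₀| ^ (-(1 / 4) : ℝ)), ← Real.rpow_add hu]; norm_num
        _ ≤ t ^ (-(1 / 4) : ℝ) * |v| ^ (-(1 / 4) : ℝ) *
            (2 * ((s - z₀) ^ 2 + |v| ^ 2) ^ (-(5 / 8) : ℝ)) := by
            gcongr
            exact abs_rpow_neg_five_quarter_le hv0 hs
        _ = _ := by ring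
    · rw [hg, indicator_of_notMem (s := {s : ℝ | |v| < |s - z₀|}) hs, zero_pow two_ne_zero]
      positivity
  have hgm : Measurable g := Measurable.indicator (by fun_prop)
    (measurableSet_lt (by fun_prop) (by fun_prop))
  have hm : Integrable fun s => g s ^ 2 := hi.mono' (hgm.pow_const 2).aestronglyMeasurable
    (Eventually.of_forall fun s => by rw [Real.norm_of_nonneg (sq_nonneg _)]; exact hle s)
  refine ⟨hm, (integral_mono hm hi hle).trans (le_of_eq ?_)⟩
  rw [integral_const_mul, j1]
  have e1 : (t ^ (-(1 / 8) : ℝ)) ^ 2 = t ^ (-(1 / 4) : ℝ) := by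
    rw [← Real.rpow_natCast, ← Real.rpow_mul ht.le]; norm_num
  have e2 : (|v| ^ (-(1 / 4) : ℝ)) ^ 2 = |v| ^ (-(1 / 4) : ℝ) * |v| ^ (1 - 2 * (5 / 8) : ℝ) := by
    rw [sq]; norm_num
  rw [mul_pow, e1, e2]
  ring

/-- With `u = s - z₀` and `|v| < |u|`, the exponential `exp(-8t|uv|)` is at most `exp(-4tv²)` times
two copies of `exp(-2t|uv|)`. One copy makes the singular part of the majorant square integrable,
the other one goes with the weight `w`; Cauchy–Schwarz on the line does the rest. -/
lemma exists_slice_bound (hk : MemLp k 2) (hk0 : ∀ s, 0 ≤ k s) (hC : 0 ≤ C) :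
    ∃ K : ℝ, 0 < K ∧ ∀ (t z₀ v : ℝ) (w : ℝ → ℝ) (b : ℝ), 0 < t → v ≠ 0 → Measurable w →
      (∀ s, 0 ≤ w s) → 0 < b →
      Integrable (fun s => (Real.exp (-(2 * t * (|s - z₀| * |v|))) * w s) ^ 2) →
      ∫ s, (Real.exp (-(2 * t * (|s - z₀| * |v|))) * w s) ^ 2 ≤ b ^ 2 →
      Integrable (fun s : ℝ => dbarMajorant k C t z₀ ⟨s, v⟩ * w s) ∧
      ∫ s : ℝ, dbarMajorant k C t z₀ ⟨s, v⟩ * w s ≤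
        Real.exp (-(4 * t * v ^ 2)) * (K * sliceWeight t v * b) := by
  have hk2 : Integrable fun s => k s ^ 2 := hk.integrable_sq
  set κ := ∫ s, k s ^ 2 with hκ
  set J := ∫ s : ℝ, (1 + s ^ 2) ^ (-(5 / 8) : ℝ) with hJ
  have hκ0 : 0 ≤ κ := integral_nonneg fun s => sq_nonneg _
  have hJ0 : 0 ≤ J := integral_japanese_nonneg _
  set K := 1 + 2 * κ + 2 * C ^ 2 * (2 * J) with hK
  have hK1 : 1 ≤ K := by
    have : 0 ≤ 2 * C ^ 2 * (2 * J) := by positivity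
    linarith
  refine ⟨K, by linarith, fun t z₀ v w b ht hv hw hw0 hb hBi hBb => ?_⟩
  have hv0 : 0 < |v| := abs_pos.2 hv
  obtain ⟨i1, j1⟩ := integral_singular_sq_le ht hv z₀
  set g : ℝ → ℝ := {s : ℝ | |v| < |s - z₀|}.indicator (fun s =>
      Real.exp (-(2 * t * (|s - z₀| * |v|))) * |s - z₀| ^ (-(1 / 2) : ℝ)) with hg
  set τ : ℝ := t ^ (-(1 / 8) : ℝ) * |v| ^ (-(1 / 4) : ℝ) with hτ
  have hτ0 : 0 ≤ τ := by positivity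
  have hg0 : ∀ s, 0 ≤ g s := indicator_nonneg fun s _ => by positivity
  have hgm : Measurable g := Measurable.indicator (by fun_prop)
    (measurableSet_lt (by fun_prop) (by fun_prop))
  set A : ℝ → ℝ := fun s => k s + C * g s with hA
  have hAm : AEStronglyMeasurable A volume := hk.1.add (hgm.const_mul C).aestronglyMeasurable
  have hA0 : ∀ s, 0 ≤ A s := fun s => add_nonneg (hk0 s) (mul_nonneg hC (hg0 s))
  have hi : Integrable fun s => 2 * k s ^ 2 + 2 * C ^ 2 * g s ^ 2 :=
    (hk2.const_mul 2).add (i1.const_mul _)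
  have hAle : ∀ s, A s ^ 2 ≤ 2 * k s ^ 2 + 2 * C ^ 2 * g s ^ 2 := fun s => by
    simp only [hA]; nlinarith [sq_nonneg (k s - C * g s)]
  have hA2 : Integrable fun s => A s ^ 2 := hi.mono' (hAm.pow 2) (Eventually.of_forall fun s => by
    rw [Real.norm_of_nonneg (sq_nonneg _)]; exact hAle s)
  have hAb : ∫ s, A s ^ 2 ≤ (K * sliceWeight t v) ^ 2 := by
    refine (integral_mono hA2 hi hAle).trans ?_
    rw [integral_add (hk2.const_mul 2) (i1.const_mul _), integral_const_mul, integral_const_mul, ← hκ]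
    have h1 : 2 * C ^ 2 * ∫ s, g s ^ 2 ≤ 2 * C ^ 2 * (2 * J * τ ^ 2) := by gcongr
    have h2 : sliceWeight t v = 1 + τ := rfl
    rw [h2]
    have h3 : 2 * κ + 2 * C ^ 2 * (2 * J * τ ^ 2) ≤ K * (1 + τ ^ 2) := by
      have h4 : 0 ≤ 2 * C ^ 2 * (2 * J) := by positivity
      have h5 : 0 ≤ κ * τ ^ 2 := by positivity
      rw [hK]
      nlinarith [sq_nonneg τ]
    have h6 : K * (1 + τ ^ 2) ≤ (K * (1 + τ)) ^ 2 := by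
      have h7 : (1 + τ ^ 2) ≤ (1 + τ) ^ 2 := by nlinarith
      have h8 : K ≤ K ^ 2 := by nlinarith
      rw [mul_pow K]
      exact mul_le_mul h8 h7 (by positivity) (by positivity)
    linarith
  have hSW := one_le_sliceWeight ht v
  obtain ⟨m1, m2⟩ := integral_mul_le_of_sq hAm
    (by fun_prop : Measurable fun s => Real.exp (-(2 * t * (|s - z₀| * |v|))) * w s).aestronglyMeasurable
    hA0 (fun s => mul_nonneg (Real.exp_nonneg _) (hw0 s)) hA2 hBi (by positivity) hb hAb hBb
  have hle : ∀ s : ℝ, dbarMajorant k C t z₀ ⟨s, v⟩ * w s ≤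
      Real.exp (-(4 * t * v ^ 2)) * (A s * (Real.exp (-(2 * t * (|s - z₀| * |v|))) * w s)) := fun s => by
    by_cases hs : |v| < |s - z₀|
    · rw [dbarMajorant_of_mem (z := ⟨s, v⟩) hv0 hs]
      have hgs : g s = Real.exp (-(2 * t * (|s - z₀| * |v|))) * |s - z₀| ^ (-(1 / 2) : ℝ) :=
        indicator_of_mem (s := {s : ℝ | |v| < |s - z₀|}) hs _
      set e := Real.exp (-(2 * t * (|s - z₀| * |v|))) with he
      have he0 : 0 < e := Real.exp_pos _
      have he1 : e ≤ 1 := Real.exp_le_one_iff.2 (by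
        have : 0 ≤ 2 * t * (|s - z₀| * |v|) := by positivity
        linarith)
      have h8 : Real.exp (-(8 * t * (|s - z₀| * |v|))) ≤ Real.exp (-(4 * t * v ^ 2)) * (e * e) := by
        rw [he, ← Real.exp_add, ← Real.exp_add]
        refine Real.exp_le_exp.2 ?_
        have : v ^ 2 ≤ |s - z₀| * |v| := by
          rw [← sq_abs, sq]; gcongr
        have := mul_le_mul_of_nonneg_left this ht.le
        linarith
      have h9 : e * (k s + C * |s - z₀| ^ (-(1 / 2) : ℝ)) ≤ A s := by
        simp only [hA, hgs]
        have := mul_le_of_le_one_left (hk0 s) he1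
        linarith
      have h10 : 0 ≤ k s + C * |s - z₀| ^ (-(1 / 2) : ℝ) := add_nonneg (hk0 s) (by positivity)
      have hws := hw0 s
      calc _ ≤ Real.exp (-(4 * t * v ^ 2)) * (e * e) *
            (k s + C * |s - z₀| ^ (-(1 / 2) : ℝ)) * w s := by gcongr
        _ = Real.exp (-(4 * t * v ^ 2)) * ((e * (k s + C * |s - z₀| ^ (-(1 / 2) : ℝ))) * (e * w s)) := by
            ring
        _ ≤ _ := by gcongr
    · have : dbarMajorant k C t z₀ ⟨s, v⟩ = 0 :=
        indicator_of_notMem (fun h => hs h.2) _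
      rw [this, zero_mul]
      exact mul_nonneg (Real.exp_nonneg _) (mul_nonneg (hA0 s) (mul_nonneg (Real.exp_nonneg _) (hw0 s)))
  have hsm : AEStronglyMeasurable (fun s : ℝ => dbarMajorant k C t z₀ ⟨s, v⟩) volume := by
    have e : (fun s : ℝ => dbarMajorant k C t z₀ ⟨s, v⟩) =
        {s : ℝ | |v| < |s - z₀|}.indicator fun s => Real.exp (-(8 * t * (|s - z₀| * |v|))) *
          (k s + C * |s - z₀| ^ (-(1 / 2) : ℝ)) := by
      ext s
      simp only [dbarMajorant, indicator, mem_ofPred_eq, hv0, true_and]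
    rw [e]
    have h1 : AEStronglyMeasurable (fun s : ℝ => Real.exp (-(8 * t * (|s - z₀| * |v|)))) volume :=
      (by fun_prop : Continuous _).aestronglyMeasurable
    have h2 : AEStronglyMeasurable (fun s : ℝ => C * |s - z₀| ^ (-(1 / 2) : ℝ)) volume :=
      (by fun_prop : Measurable _).aestronglyMeasurable
    exact (h1.mul (hk.1.add h2)).indicator (measurableSet_lt (by fun_prop) (by fun_prop))
  have hfin : Integrable fun s : ℝ => dbarMajorant k C t z₀ ⟨s, v⟩ * w s := by
    refine (m1.const_mul (Real.exp (-(4 * t * v ^ 2)))).mono' (hsm.mul hw.aestronglyMeasurable)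
      (Eventually.of_forall fun s => ?_)
    rw [Real.norm_of_nonneg (mul_nonneg (dbarMajorant_nonneg hk0 hC _) (hw0 s))]
    exact hle s
  refine ⟨hfin, (integral_mono hfin (m1.const_mul _) hle).trans ?_⟩
  rw [integral_const_mul]
  gcongr

/-- On the line at height `v` the kernel has `L²` norm of order `|v - Im z|^(1/2 - p)`, which needs
`p > 1/2`; the Gaussian integral in `v` then needs `p - 1/2 < 3/4`. The case `p = 1` serves the
contraction, `p = 9/8` the continuity of Cauchy transforms. -/
lemma exists_integral_majorant_kernel_le (hk : MemLp k 2) (hk0 : ∀ s, 0 ≤ k s) (hC : 0 ≤ C) {p : ℝ}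
    (hp1 : 1 / 2 < p) (hp2 : p < 5 / 4) :
    ∃ A : ℝ, 0 ≤ A ∧ ∀ t z₀ : ℝ, 0 < t → ∀ z : ℂ,
      Integrable (fun ζ => dbarMajorant k C t z₀ ζ * ‖z - ζ‖ ^ (-p)) ∧
      ∫ ζ, dbarMajorant k C t z₀ ζ * ‖z - ζ‖ ^ (-p) ≤ A * t ^ ((p - 3 / 2) / 2) := by
  obtain ⟨K, hK, hslice⟩ := exists_slice_bound hk hk0 hC
  obtain ⟨A, hA, hint⟩ := exists_integral_sliceWeight_le (b := p - 1 / 2) (by linarith) (by linarith)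
  set J := ∫ s : ℝ, (1 + s ^ 2) ^ (-p) with hJ
  have hJ0 : 0 ≤ J := integral_japanese_nonneg _
  refine ⟨K * (J + 1) * A, by positivity, fun t z₀ ht z => ?_⟩
  obtain ⟨h1, h2⟩ := hint t z.im ht
  have hφ := h1.const_mul (K * (J + 1))
  obtain ⟨m1, m2⟩ := integrable_of_slices (F := fun ζ => dbarMajorant k C t z₀ ζ * ‖z - ζ‖ ^ (-p))
    ((aestronglyMeasurable_dbarMajorant hk C t z₀).mul
      (by fun_prop : Measurable fun ζ : ℂ => ‖z - ζ‖ ^ (-p)).aestronglyMeasurable)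
    (fun ζ => mul_nonneg (dbarMajorant_nonneg hk0 hC _) (by positivity)) hφ (by
      filter_upwards [compl_mem_ae_iff.2 (Real.volume_singleton (a := 0)),
        compl_mem_ae_iff.2 (Real.volume_singleton (a := z.im))] with v h0 hy
      have hb : 0 < |v - z.im| := abs_pos.2 (sub_ne_zero.2 hy)
      obtain ⟨i1, j1⟩ := integral_sq_add_sq_rpow hp1 z.re hb
      have hwle : ∀ s : ℝ, (Real.exp (-(2 * t * (|s - z₀| * |v|))) * ‖z - ⟨s, v⟩‖ ^ (-p)) ^ 2 ≤
          ((s - z.re) ^ 2 + |v - z.im| ^ 2) ^ (-p) := fun s => by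
        have e1 : (‖z - ⟨s, v⟩‖ ^ (-p)) ^ 2 = ((s - z.re) ^ 2 + |v - z.im| ^ 2) ^ (-p) := by
          rw [← Real.rpow_natCast, ← Real.rpow_mul (norm_nonneg _), mul_comm, Real.rpow_mul (norm_nonneg _),
            Real.rpow_natCast, ← Complex.normSq_eq_norm_sq, Complex.normSq_apply, sq_abs]
          simp only [Complex.sub_re, Complex.sub_im]
          congr 1; ring
        have h3 : Real.exp (-(2 * t * (|s - z₀| * |v|))) ≤ 1 := Real.exp_le_one_iff.2 (by
          have : 0 ≤ 2 * t * (|s - z₀| * |v|) := by positivity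
          linarith)
        rw [mul_pow, e1]
        exact mul_le_of_le_one_left (by positivity) (pow_le_one₀ (Real.exp_nonneg _) h3)
      have hwm : Measurable fun s : ℝ => ‖z - ⟨s, v⟩‖ ^ (-p) := by
        have : Continuous fun s : ℝ => (⟨s, v⟩ : ℂ) := by
          have e : (fun s : ℝ => (⟨s, v⟩ : ℂ)) = fun s : ℝ => (s : ℂ) + v * Complex.I := by
            ext s; apply Complex.ext <;> simp
          rw [e]; fun_prop
        exact (continuous_const.sub this).norm.measurable.pow_const _
      have i2 : Integrable fun s : ℝ =>
          (Real.exp (-(2 * t * (|s - z₀| * |v|))) * ‖z - ⟨s, v⟩‖ ^ (-p)) ^ 2 :=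
        i1.mono' (((by fun_prop : Measurable fun s : ℝ => Real.exp (-(2 * t * (|s - z₀| * |v|)))).mul
          hwm).pow_const 2).aestronglyMeasurable (Eventually.of_forall fun s => by
            rw [Real.norm_of_nonneg (sq_nonneg _)]; exact hwle s)
      obtain ⟨q1, q2⟩ := hslice t z₀ v (fun s => ‖z - ⟨s, v⟩‖ ^ (-p))
        ((J + 1) * |v - z.im| ^ (-(p - 1 / 2))) ht h0 hwm (fun s => by positivity) (by positivity) i2 (by
          refine (integral_mono i2 i1 hwle).trans ?_
          rw [j1, mul_pow, ← Real.rpow_natCast (|v - z.im| ^ (-(p - 1 / 2))), ← Real.rpow_mul hb.le,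
            show -(p - 1 / 2) * ((2 : ℕ) : ℝ) = 1 - 2 * p by push_cast; ring, mul_comm]
          gcongr
          nlinarith)
      refine ⟨q1, q2.trans (le_of_eq ?_)⟩
      ring)
  refine ⟨m1, m2.trans ?_⟩
  rw [integral_const_mul]
  calc _ ≤ K * (J + 1) * (A * t ^ ((p - 1 / 2 - 1) / 2)) := by gcongr
    _ = _ := by rw [show (p - 1 / 2 - 1) / 2 = (p - 3 / 2) / 2 by ring]; ring

/-- Without a kernel the weight is `1`, and the spare exponential has `L²` norm of order
`(t|v|)^(-1/2)`. The Gaussian integral of `|v|^(-1/2)` adds another `t^(-1/4)`; this is the rate of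
the theorem. -/
lemma exists_integral_majorant_le (hk : MemLp k 2) (hk0 : ∀ s, 0 ≤ k s) (hC : 0 ≤ C) :
    ∃ A : ℝ, 0 ≤ A ∧ ∀ t z₀ : ℝ, 0 < t → Integrable (dbarMajorant k C t z₀) ∧
      ∫ ζ, dbarMajorant k C t z₀ ζ ≤ A * t ^ (-(3 / 4) : ℝ) := by
  obtain ⟨K, hK, hslice⟩ := exists_slice_bound hk hk0 hC
  obtain ⟨A, hA, hint⟩ := exists_integral_sliceWeight_le (b := 1 / 2) (by norm_num) (by norm_num)
  set J := ∫ s : ℝ, (1 + s ^ 2) ^ (-1 : ℝ) with hJ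
  have hJ0 : 0 ≤ J := integral_japanese_nonneg _
  refine ⟨K * (2 * J + 1) * A, by positivity, fun t z₀ ht => ?_⟩
  obtain ⟨h1, h2⟩ := hint t 0 ht
  simp only [sub_zero] at h1 h2
  have hφ := h1.const_mul (K * (2 * J + 1) * t ^ (-(1 / 2) : ℝ))
  obtain ⟨m1, m2⟩ := integrable_of_slices (F := dbarMajorant k C t z₀)
    (aestronglyMeasurable_dbarMajorant hk C t z₀) (dbarMajorant_nonneg hk0 hC) hφ (by
      filter_upwards [compl_mem_ae_iff.2 (Real.volume_singleton (a := 0))] with v h0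
      have hv : 0 < |v| := abs_pos.2 h0
      set β := t * |v| with hβ
      have hβ0 : 0 < β := by positivity
      obtain ⟨i1, j1⟩ := integral_sq_add_sq_rpow (p := 1) (by norm_num) z₀ (inv_pos.2 hβ0)
      have i1' := i1.const_mul (2 * (β⁻¹) ^ 2)
      have hle : ∀ s : ℝ, (Real.exp (-(2 * t * (|s - z₀| * |v|))) * 1) ^ 2 ≤
          2 * (β⁻¹) ^ 2 * ((s - z₀) ^ 2 + (β⁻¹) ^ 2) ^ (-1 : ℝ) := fun s => by
        have h3 := exp_neg_le_two_div (x := β * |s - z₀|) (by positivity)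
        have h4 : (Real.exp (-(2 * t * (|s - z₀| * |v|))) * 1) ^ 2 ≤ Real.exp (-(β * |s - z₀|)) := by
          rw [mul_one, ← Real.exp_nat_mul]
          refine Real.exp_le_exp.2 ?_
          have : 0 ≤ β * |s - z₀| := by positivity
          have e : ((2 : ℕ) : ℝ) * -(2 * t * (|s - z₀| * |v|)) = -(4 * (β * |s - z₀|)) := by
            rw [hβ]; push_cast; ring
          rw [e]; linarith
        refine h4.trans (h3.trans (le_of_eq ?_))
        rw [mul_pow, sq_abs, Real.rpow_neg_one]
        field_simp
        ring
      have i2 : Integrable fun s : ℝ => (Real.exp (-(2 * t * (|s - z₀| * |v|))) * 1) ^ 2 :=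
        i1'.mono' (by fun_prop : Continuous _).aestronglyMeasurable (Eventually.of_forall fun s => by
            rw [Real.norm_of_nonneg (sq_nonneg _)]; exact hle s)
      obtain ⟨q1, q2⟩ := hslice t z₀ v (fun s => 1) ((2 * J + 1) * β ^ (-(1 / 2) : ℝ)) ht h0
        measurable_const (fun s => zero_le_one) (by positivity) i2 (by
          refine (integral_mono i2 i1' hle).trans ?_
          rw [integral_const_mul, j1, mul_pow, ← Real.rpow_natCast (β ^ (-(1 / 2) : ℝ)),
            ← Real.rpow_mul hβ0.le]
          have e : (β⁻¹) ^ 2 * (β⁻¹) ^ (1 - 2 * 1 : ℝ) = β ^ (-(1 / 2) * ((2 : ℕ) : ℝ) : ℝ) := by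
            norm_num [Real.rpow_neg_one]
            field_simp
          calc _ = 2 * J * ((β⁻¹) ^ 2 * (β⁻¹) ^ (1 - 2 * 1 : ℝ)) := by ring
            _ ≤ _ := by
              rw [e]
              gcongr
              nlinarith)
      simp only [mul_one] at q1 q2
      refine ⟨q1, q2.trans (le_of_eq ?_)⟩
      rw [hβ, Real.mul_rpow ht.le hv.le]
      ring)
  refine ⟨m1, m2.trans ?_⟩
  rw [integral_const_mul]
  calc _ ≤ K * (2 * J + 1) * t ^ (-(1 / 2) : ℝ) * (A * t ^ ((1 / 2 - 1) / 2 : ℝ)) := by gcongr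
    _ = K * (2 * J + 1) * A * (t ^ (-(1 / 2) : ℝ) * t ^ ((1 / 2 - 1) / 2 : ℝ)) := by ring
    _ = _ := by rw [← Real.rpow_add ht]; norm_num

end Majorant

/-! ### The ∂̄-problem with a small coefficient. -/

section FixedPoint

/-- Coefficients of `∂̄M = MW` for which the solid Cauchy transform is a contraction. -/
structure IsSmallCoefficient (W : ℂ → Matrix (Fin 2) (Fin 2) ℂ) (h : ℂ → ℝ) (B z₀ : ℝ) : Prop where
  aestronglyMeasurable : ∀ i j, AEStronglyMeasurable (fun z => W z i j) volume
  norm_le : ∀ᵐ z, ∀ i j, ‖W z i j‖ ≤ h z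
  integrable : Integrable h
  integrable_inv : ∀ z, Integrable fun ζ => h ζ * ‖z - ζ‖⁻¹
  integral_inv_le : ∀ z, ∫ ζ, h ζ * ‖z - ζ‖⁻¹ ≤ 1 / 4
  integrable_kernel : ∀ z, Integrable fun ζ => h ζ * ‖z - ζ‖ ^ (-(9 / 8) : ℝ)
  integral_kernel_le : ∀ z, ∫ ζ, h ζ * ‖z - ζ‖ ^ (-(9 / 8) : ℝ) ≤ B
  eq_zero : ∀ z, |z.re - z₀| ≤ |z.im| → h z = 0

variable {W : ℂ → Matrix (Fin 2) (Fin 2) ℂ} {h : ℂ → ℝ} {B z₀ : ℝ}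

lemma aestronglyMeasurable_mul_entry {F G : ℂ → Matrix (Fin 2) (Fin 2) ℂ}
    (hF : ∀ i j, AEStronglyMeasurable (fun z => F z i j) volume)
    (hG : ∀ i j, AEStronglyMeasurable (fun z => G z i j) volume) (i j : Fin 2) :
    AEStronglyMeasurable (fun z => (F z * G z) i j) volume := by
  simp only [Matrix.mul_apply, Fin.sum_univ_two]
  exact ((hF i 0).mul (hG 0 j)).add ((hF i 1).mul (hG 1 j))

namespace IsSmallCoefficient

lemma norm_mul_le (hW : IsSmallCoefficient W h B z₀) {F : ℂ → Matrix (Fin 2) (Fin 2) ℂ} {b : ℝ}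
    (hFb : ∀ z i j, ‖F z i j‖ ≤ b) : ∀ᵐ z, ∀ i j, ‖(F z * W z) i j‖ ≤ 2 * b * h z := by
  filter_upwards [hW.norm_le] with z hz i j
  exact norm_mul_entry_le (hFb z) hz i j

/-- The product of two `2 × 2` matrices costs a factor `2`. With the `1/4` in the definition of
smallness, the Cauchy transform of `F W` is at most half the bound of `F`. -/
lemma hasKatoBound (hW : IsSmallCoefficient W h B z₀) {F : ℂ → Matrix (Fin 2) (Fin 2) ℂ} {b : ℝ}
    (hF : ∀ i j, Continuous fun z => F z i j) (hFb : ∀ z i j, ‖F z i j‖ ≤ b) (i j : Fin 2) :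
    HasKatoBound (fun z => (F z * W z) i j) (2 * b * B) ∧
      (∀ z, ‖solidCauchy (fun z => (F z * W z) i j) z‖ ≤ b / 2) ∧
      ∫ z, ‖(F z * W z) i j‖ ≤ 2 * b * ∫ z, h z := by
  have hb0 : 0 ≤ b := (norm_nonneg _).trans (hFb 0 0 0)
  have hm := aestronglyMeasurable_mul_entry (fun i j => (hF i j).aestronglyMeasurable)
    hW.aestronglyMeasurable i j
  have hle : ∀ᵐ z, ‖(F z * W z) i j‖ ≤ 2 * b * h z := (hW.norm_mul_le hFb).mono fun z hz => hz i j
  have weight : ∀ (w : ℂ → ℝ), (∀ ζ, 0 ≤ w ζ) → Measurable w → Integrable (fun ζ => h ζ * w ζ) →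
      Integrable (fun ζ => ‖(F ζ * W ζ) i j‖ * w ζ) ∧
        ∫ ζ, ‖(F ζ * W ζ) i j‖ * w ζ ≤ 2 * b * ∫ ζ, h ζ * w ζ := by
    intro w hw0 hwm hwi
    have hle' : ∀ᵐ ζ, ‖(F ζ * W ζ) i j‖ * w ζ ≤ 2 * b * (h ζ * w ζ) := by
      filter_upwards [hle] with ζ hζ
      rw [← mul_assoc]
      exact mul_le_mul_of_nonneg_right hζ (hw0 ζ)
    have hi : Integrable fun ζ => ‖(F ζ * W ζ) i j‖ * w ζ := by
      refine (hwi.const_mul (2 * b)).mono' (hm.norm.mul hwm.aestronglyMeasurable) ?_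
      filter_upwards [hle'] with ζ hζ
      rwa [Real.norm_of_nonneg (mul_nonneg (norm_nonneg _) (hw0 ζ))]
    refine ⟨hi, (integral_mono_ae hi (hwi.const_mul _) hle').trans (le_of_eq ?_)⟩
    exact integral_const_mul _ _
  have hint : Integrable fun z => (F z * W z) i j := (hW.integrable.const_mul (2 * b)).mono' hm hle
  refine ⟨⟨hint, fun z => ?_, fun z => ?_⟩, fun z => ?_, ?_⟩
  · exact (weight _ (fun ζ => by positivity) (by fun_prop) (hW.integrable_kernel z)).1
  · refine (weight _ (fun ζ => by positivity) (by fun_prop) (hW.integrable_kernel z)).2.trans ?_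
    exact mul_le_mul_of_nonneg_left (hW.integral_kernel_le z) (by positivity)
  · refine norm_solidCauchy_le _ z
      ((weight _ (fun ζ => by positivity) (by fun_prop) (hW.integrable_inv z)).2.trans ?_)
    have := mul_le_mul_of_nonneg_left (hW.integral_inv_le z) (by positivity : 0 ≤ 2 * b)
    linarith
  · have := (weight (fun _ => 1) (fun ζ => zero_le_one) measurable_const (by simpa using hW.integrable)).2
    simpa using this

/-- Bounded continuous matrix functions. -/
abbrev _root_.CGNLS.BoundedMatrix := BoundedContinuousFunction ℂ (Fin 2 → Fin 2 → ℂ)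

lemma _root_.CGNLS.BoundedMatrix.norm_entry_le (F : BoundedMatrix) (z : ℂ) (i j : Fin 2) :
    ‖F z i j‖ ≤ ‖F‖ :=
  (norm_le_pi_norm (F z i) j).trans ((norm_le_pi_norm (F z) i).trans (F.norm_coe_le_norm z))

lemma _root_.CGNLS.BoundedMatrix.continuous_entry (F : BoundedMatrix) (i j : Fin 2) :
    Continuous fun z => F z i j :=
  (continuous_apply_apply i j).comp F.continuous

/-- The integral operator whose fixed points solve the `∂̄`-problem. -/
noncomputable def picard (hW : IsSmallCoefficient W h B z₀) (F : BoundedMatrix) : BoundedMatrix :=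
  BoundedContinuousFunction.ofNormedAddCommGroup
    (fun z i j => (1 : Matrix (Fin 2) (Fin 2) ℂ) i j +
      solidCauchy (fun ζ => (Matrix.of (F ζ) * W ζ) i j) z)
    (continuous_pi fun i => continuous_pi fun j => continuous_const.add
      (hW.hasKatoBound (F := fun z => Matrix.of (F z)) F.continuous_entry F.norm_entry_le
        i j).1.continuous_solidCauchy)
    (1 + ‖F‖ / 2) (fun z => by
      have h0 : 0 ≤ 1 + ‖F‖ / 2 := by positivity
      refine (pi_norm_le_iff_of_nonneg h0).2 fun i => (pi_norm_le_iff_of_nonneg h0).2 fun j => ?_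
      refine (norm_add_le _ _).trans (add_le_add ?_ ?_)
      · fin_cases i <;> fin_cases j <;> simp
      · exact (hW.hasKatoBound (F := fun z => Matrix.of (F z)) F.continuous_entry F.norm_entry_le
          i j).2.1 z)

lemma picard_apply (hW : IsSmallCoefficient W h B z₀) (F : BoundedMatrix) (z : ℂ) (i j : Fin 2) :
    hW.picard F z i j = (1 : Matrix (Fin 2) (Fin 2) ℂ) i j +
      solidCauchy (fun ζ => (Matrix.of (F ζ) * W ζ) i j) z := rfl

lemma norm_picard_le (hW : IsSmallCoefficient W h B z₀) (F : BoundedMatrix) :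
    ‖hW.picard F‖ ≤ 1 + ‖F‖ / 2 :=
  BoundedContinuousFunction.norm_ofNormedAddCommGroup_le _ (by positivity) _

/-- By linearity the difference of two images is the Cauchy transform of `(F - G) W`, to which the
half bound of `hasKatoBound` applies with `b = dist F G`. -/
lemma contracting (hW : IsSmallCoefficient W h B z₀) : ContractingWith (1 / 2) hW.picard := by
  refine ⟨by norm_num, LipschitzWith.of_dist_le_mul fun F G => ?_⟩
  have hFG : 0 ≤ dist F G := dist_nonneg
  rw [BoundedContinuousFunction.dist_le (by positivity)]
  intro z
  refine (dist_pi_le_iff (by positivity)).2 fun i => (dist_pi_le_iff (by positivity)).2 fun j => ?_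
  have hb : ∀ z i j, ‖(Matrix.of (F z) - Matrix.of (G z)) i j‖ ≤ dist F G := fun z i j => by
    rw [dist_eq_norm]
    exact (F - G).norm_entry_le z i j
  have h1 := (hW.hasKatoBound (F := fun z => Matrix.of (F z)) F.continuous_entry F.norm_entry_le i j).1
  have h2 := (hW.hasKatoBound (F := fun z => Matrix.of (G z)) G.continuous_entry G.norm_entry_le i j).1
  obtain ⟨-, h3, -⟩ := hW.hasKatoBound (F := fun z => Matrix.of (F z) - Matrix.of (G z))
    (fun i j => (F.continuous_entry i j).sub (G.continuous_entry i j)) hb i j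
  have e : solidCauchy (fun ζ => (Matrix.of (F ζ) * W ζ) i j) z -
      solidCauchy (fun ζ => (Matrix.of (G ζ) * W ζ) i j) z =
      solidCauchy (fun ζ => ((Matrix.of (F ζ) - Matrix.of (G ζ)) * W ζ) i j) z := by
    rw [solidCauchy, solidCauchy, solidCauchy, ← mul_sub,
      ← integral_sub (h1.integrable_div z) (h2.integrable_div z)]
    congr 2 with ζ
    rw [sub_mul, Matrix.sub_apply, sub_div]
  rw [dist_eq_norm, picard_apply, picard_apply, add_sub_add_left_eq_sub, e]
  refine (h3 z).trans (le_of_eq ?_)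
  rw [NNReal.coe_div, NNReal.coe_one, NNReal.coe_ofNat]
  ring

end IsSmallCoefficient

lemma integral_dbar_eq_zero {φ : ℂ → ℂ} (hφ : ContDiff ℝ 1 φ) (hc : HasCompactSupport φ) :
    ∫ z, dbar φ z = 0 :=
  integral_dbar_eq_zero_of_contour (z₀ := 0) hφ.continuous hc
    (fun z _ => hφ.differentiable one_ne_zero z)
    ((continuous_dbar hφ).integrable_of_hasCompactSupport (hasCompactSupport_dbar hc))

lemma exists_bound_of_tendsto_cocompact {f : ℂ → ℂ} (hf : Continuous f) {c : ℂ}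
    (h : Tendsto f (cocompact ℂ) (𝓝 c)) : ∃ b : ℝ, ∀ z, ‖f z‖ ≤ b := by
  have h1 : ∀ᶠ z in cocompact ℂ, ‖f z‖ < ‖c‖ + 1 := h.norm.eventually_lt_const (by linarith)
  obtain ⟨K, hK, hKs⟩ := mem_cocompact.1 h1
  obtain ⟨b, hb⟩ := hK.exists_bound_of_continuousOn hf.continuousOn
  refine ⟨max b (‖c‖ + 1), fun z => ?_⟩
  by_cases hz : z ∈ K
  · exact (hb z hz).trans (le_max_left _ _)
  · exact (le_of_lt (hKs hz)).trans (le_max_right _ _)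

namespace IsSmallCoefficient

/-- A fixed point of the integral operator solves the `∂̄`-problem. -/
lemma isPureDbarSolution (hW : IsSmallCoefficient W h B z₀) {F : BoundedMatrix}
    (hF : hW.picard F = F) : IsPureDbarSolution W fun z => Matrix.of (F z) := by
  have hK := fun i j => (hW.hasKatoBound (F := fun z => Matrix.of (F z)) F.continuous_entry
    F.norm_entry_le i j).1
  have hFe : ∀ z i j, F z i j = (1 : Matrix (Fin 2) (Fin 2) ℂ) i j +
      solidCauchy (fun ζ => (Matrix.of (F ζ) * W ζ) i j) z := fun z i j => by
    conv_lhs => rw [← hF]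
    rfl
  refine ⟨F.continuous, ?_, fun i j => (hK i j).integrable.locallyIntegrable, fun φ hφ hc i j => ?_⟩
  · refine tendsto_matrix_iff.2 fun i j => ?_
    simp only [Matrix.of_apply, hFe]
    simpa using (hK i j).tendsto_solidCauchy.const_add ((1 : Matrix (Fin 2) (Fin 2) ℂ) i j)
  · have hφ1 : ContDiff ℝ 1 φ := hφ.of_le (by exact_mod_cast le_top)
    have hd : Continuous (dbar φ) := continuous_dbar hφ1
    have hdc : HasCompactSupport (dbar φ) := hasCompactSupport_dbar hc
    have i1 : Integrable fun z => (1 : Matrix (Fin 2) (Fin 2) ℂ) i j * dbar φ z :=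
      (hd.integrable_of_hasCompactSupport hdc).const_mul _
    have i2 : Integrable fun z => solidCauchy (fun ζ => (Matrix.of (F ζ) * W ζ) i j) z * dbar φ z :=
      ((hK i j).continuous_solidCauchy.mul hd).integrable_of_hasCompactSupport hdc.mul_left
    rw [← (hK i j).weak_dbar hφ1 hc]
    simp only [Matrix.of_apply, hFe, add_mul]
    rw [integral_add i1 i2, integral_const_mul, integral_dbar_eq_zero hφ1 hc, mul_zero, zero_add]

/-- Solutions of the `∂̄`-problem are fixed points of the integral operator. -/
lemma exists_fixedPoint_of_solution (hW : IsSmallCoefficient W h B z₀)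
    {M : ℂ → Matrix (Fin 2) (Fin 2) ℂ} (hM : IsPureDbarSolution W M) :
    ∃ F : BoundedMatrix, hW.picard F = F ∧ ∀ z, Matrix.of (F z) = M z := by
  have hMc : ∀ i j, Continuous fun z => M z i j := fun i j =>
    (continuous_apply_apply i j).comp hM.continuous
  have hMt := tendsto_matrix_iff.1 hM.tendsto_one
  -- Solutions are not assumed bounded; continuity and the limit at infinity make them so.
  have hbd : ∃ b : ℝ, ∀ z i j, ‖M z i j‖ ≤ b := by
    choose b hb using fun i j => exists_bound_of_tendsto_cocompact (hMc i j) (hMt i j)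
    refine ⟨∑ i, ∑ j, |b i j|, fun z i j => (hb i j z).trans ((le_abs_self _).trans ?_)⟩
    exact (Finset.single_le_sum (f := fun j => |b i j|) (fun _ _ => abs_nonneg _)
      (Finset.mem_univ j)).trans (Finset.single_le_sum (f := fun i => ∑ j, |b i j|)
        (fun _ _ => Finset.sum_nonneg fun _ _ => abs_nonneg _) (Finset.mem_univ i))
  obtain ⟨b, hb⟩ := hbd
  have hb0 : 0 ≤ b := (norm_nonneg _).trans (hb 0 0 0)
  set F : BoundedMatrix := BoundedContinuousFunction.ofNormedAddCommGroup (fun z i j => M z i j)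
    (continuous_pi fun i => continuous_pi fun j => hMc i j) b (fun z =>
      (pi_norm_le_iff_of_nonneg hb0).2 fun i => (pi_norm_le_iff_of_nonneg hb0).2 fun j => hb z i j)
    with hF
  have hFM : ∀ z, Matrix.of (F z) = M z := fun z => rfl
  refine ⟨F, ?_, hFM⟩
  ext z i j
  rw [picard_apply]
  simp only [hFM]
  have hK := (hW.hasKatoBound hMc hb i j).1
  set S := solidCauchy fun ζ => (M ζ * W ζ) i j with hS
  have hSc : Continuous S := hK.continuous_solidCauchy
  -- `M - S` has no weak ∂̄-derivative left, so it is entire by Weyl's lemma; its limit at infinity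
  -- makes it constant.
  have hweak : DifferentiableOn ℂ (fun z => M z i j - S z) univ := by
    refine differentiableOn_of_weak_dbar_eq_zero isOpen_univ ((hMc i j).sub hSc).continuousOn
      fun φ hφ hc _ => ?_
    have hφ1 : ContDiff ℝ 1 φ := hφ.of_le (by exact_mod_cast le_top)
    have hd : Continuous (dbar φ) := continuous_dbar hφ1
    have hdc : HasCompactSupport (dbar φ) := hasCompactSupport_dbar hc
    have i1 : Integrable fun z => M z i j * dbar φ z :=
      ((hMc i j).mul hd).integrable_of_hasCompactSupport hdc.mul_left
    have i2 : Integrable fun z => S z * dbar φ z :=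
      (hSc.mul hd).integrable_of_hasCompactSupport hdc.mul_left
    simp only [sub_mul]
    rw [integral_sub i1 i2, hM.weak_dbar φ hφ hc i j,
      hK.weak_dbar hφ1 hc, sub_self]
  have hlim : Tendsto (fun z => M z i j - S z) (cocompact ℂ)
      (𝓝 ((1 : Matrix (Fin 2) (Fin 2) ℂ) i j)) := by
    simpa using (hMt i j).sub hK.tendsto_solidCauchy
  have h3 := (differentiableOn_univ.1 hweak).apply_eq_of_tendsto_cocompact z hlim
  have h4 : F z i j = M z i j := rfl
  rw [h4]
  linear_combination -h3

/-- Points of the imaginary axis are far from the sectors that carry the coefficient. -/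
lemma _root_.CGNLS.abs_le_four_mul_norm_sub {y z₀ : ℝ} {ζ : ℂ} (hζ : |ζ.im| < |ζ.re - z₀|)
    (hy : 2 * |z₀| ≤ |y|) : |y| ≤ 4 * ‖(y : ℂ) * Complex.I - ζ‖ := by
  -- Otherwise `|Re ζ| < |y|/4` and `|Im ζ| > 3|y|/4`, whereas `|Im ζ| < |Re ζ| + |z₀| < 3|y|/4`.
  by_contra hcon
  have h1 := Complex.abs_re_le_norm ((y : ℂ) * Complex.I - ζ)
  have h2 := Complex.abs_im_le_norm ((y : ℂ) * Complex.I - ζ)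
  simp only [Complex.sub_re, Complex.sub_im, Complex.re_ofReal_mul, Complex.im_ofReal_mul, Complex.I_re,
    Complex.I_im, mul_zero, mul_one, zero_sub, abs_neg] at h1 h2
  have h3 := abs_sub_abs_le_abs_sub y ζ.im
  have h4 := abs_sub ζ.re z₀
  linarith

/-- On the support of `F` one has `|y| / |iy - ζ| ≤ 4` as soon as `|y| ≥ 2|z₀|`, so `4 * ‖F‖`
dominates the integrands, which tend to `F ζ`. -/
lemma tendsto_mul_solidCauchy {F : ℂ → ℂ} (hF : Integrable F)
    (hF0 : ∀ᵐ ζ : ℂ, |ζ.re - z₀| ≤ |ζ.im| → F ζ = 0) :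
    Tendsto (fun y : ℝ => (y * Complex.I) * solidCauchy F (y * Complex.I)) (cocompact ℝ)
      (𝓝 (1 / (Real.pi : ℂ) * ∫ ζ, F ζ)) := by
  have : (cocompact ℝ).IsCountablyGenerated := by
    rw [← Metric.cobounded_eq_cocompact, ← comap_norm_atTop]; infer_instance
  have e : (fun y : ℝ => (y * Complex.I) * solidCauchy F (y * Complex.I)) = fun y : ℝ =>
      1 / (Real.pi : ℂ) * ∫ ζ, (y * Complex.I) * (F ζ / (y * Complex.I - ζ)) := by
    ext y
    rw [solidCauchy, integral_const_mul]; ring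
  rw [e]
  refine Tendsto.const_mul _ ?_
  have hnorm : Tendsto (fun y : ℝ => |y|) (cocompact ℝ) atTop := tendsto_norm_cocompact_atTop
  refine tendsto_integral_filter_of_dominated_convergence (fun ζ => 4 * ‖F ζ‖) ?_ ?_
    (hF.norm.const_mul 4) ?_
  · refine Eventually.of_forall fun y => ?_
    simp only [div_eq_mul_inv]
    exact (hF.1.mul (by fun_prop : Measurable fun ζ : ℂ =>
      ((y : ℂ) * Complex.I - ζ)⁻¹).aestronglyMeasurable).const_mul _
  · filter_upwards [hnorm.eventually_ge_atTop (2 * |z₀|)] with y hy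
    filter_upwards [hF0] with ζ hζ
    by_cases hs : |ζ.im| < |ζ.re - z₀|
    · have h1 := abs_le_four_mul_norm_sub hs hy
      rw [norm_mul, norm_div, norm_mul, Complex.norm_real, Complex.norm_I, mul_one, Real.norm_eq_abs]
      rcases (norm_nonneg ((y : ℂ) * Complex.I - ζ)).eq_or_lt with h0 | h0
      · rw [← h0, div_zero, mul_zero]; positivity
      · rw [mul_div_assoc', div_le_iff₀ h0]
        calc _ ≤ 4 * ‖(y : ℂ) * Complex.I - ζ‖ * ‖F ζ‖ := by gcongr
          _ = _ := by ring
    · rw [hζ (not_lt.1 hs), zero_div, mul_zero, norm_zero, mul_zero]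
  · refine Eventually.of_forall fun ζ => ?_
    have h1 : Tendsto (fun y : ℝ => (y : ℂ) * Complex.I) (cocompact ℝ) (cocompact ℂ) := by
      rw [← Metric.cobounded_eq_cocompact (α := ℂ), ← tendsto_norm_atTop_iff_cobounded]
      simpa using hnorm
    have h2 : Tendsto (fun w : ℂ => w / (w - ζ)) (cocompact ℂ) (𝓝 1) := by
      have h3 : Tendsto (fun w : ℂ => 1 + ζ * (w - ζ)⁻¹) (cocompact ℂ) (𝓝 (1 + ζ * 0)) := by
        refine Tendsto.const_add _ (Tendsto.const_mul _ ?_)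
        have h4 : Tendsto (fun w : ℂ => w - ζ) (cocompact ℂ) (cocompact ℂ) :=
          (Homeomorph.subRight ζ).isClosedEmbedding.tendsto_cocompact
        exact (tendsto_inv₀_cobounded (α := ℂ)).comp (by rwa [Metric.cobounded_eq_cocompact])
      rw [mul_zero, add_zero] at h3
      refine h3.congr' ?_
      filter_upwards [(isCompact_singleton (x := ζ)).compl_mem_cocompact] with w hw
      have : w - ζ ≠ 0 := sub_ne_zero.2 hw
      field_simp
      ring
    have h5 := (h2.comp h1).const_mul (F ζ)
    rw [mul_one] at h5
    refine h5.congr fun y => ?_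
    simp only [Function.comp_apply]
    ring

/-- The `∂̄`-problem with a small coefficient. -/
theorem exists_solution (hW : IsSmallCoefficient W h B z₀) :
    ∃ M : ℂ → Matrix (Fin 2) (Fin 2) ℂ, IsPureDbarSolution W M ∧
      (∀ M', IsPureDbarSolution W M' → M' = M) ∧
      (∀ i j, Integrable fun z => (M z * W z) i j) ∧
      (∀ i j, Tendsto (fun y : ℝ => (y * Complex.I) * (M (y * Complex.I) - 1) i j) (cocompact ℝ)
        (𝓝 (coeffOne W M i j))) ∧
      ∀ i j, ‖coeffOne W M i j‖ ≤ 4 * ∫ z, h z := by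
  set F := hW.contracting.fixedPoint with hFdef
  have hF : hW.picard F = F := hW.contracting.fixedPoint_isFixedPt
  -- At the fixed point `‖F‖ ≤ 1 + ‖F‖ / 2`. The constant `4` in the last estimate is this `2` times
  -- the `2` of the matrix product; the factor `1/π` is dropped.
  have hF2 : ‖F‖ ≤ 2 := by
    have := hW.norm_picard_le F
    rw [hF] at this
    linarith
  have hK := fun i j => hW.hasKatoBound (F := fun z => Matrix.of (F z)) F.continuous_entry
    (fun z i j => (F.norm_entry_le z i j).trans hF2) i j
  refine ⟨fun z => Matrix.of (F z), hW.isPureDbarSolution hF, fun M' hM' => ?_,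
    fun i j => (hK i j).1.integrable, fun i j => ?_, fun i j => ?_⟩
  · obtain ⟨G, hG, hGM⟩ := hW.exists_fixedPoint_of_solution hM'
    have : G = F := hW.contracting.fixedPoint_unique hG
    ext1 z
    rw [← hGM, this]
  · have h0 : ∀ᵐ ζ : ℂ, |ζ.re - z₀| ≤ |ζ.im| → (Matrix.of (F ζ) * W ζ) i j = 0 := by
      filter_upwards [hW.norm_mul_le (F := fun z => Matrix.of (F z)) F.norm_entry_le] with ζ hζ hs
      have := hζ i j
      rw [hW.eq_zero ζ hs, mul_zero] at this
      exact norm_le_zero_iff.1 this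
    refine (tendsto_mul_solidCauchy (hK i j).1.integrable h0).congr fun y => ?_
    have e : F ((y : ℂ) * Complex.I) i j = (1 : Matrix (Fin 2) (Fin 2) ℂ) i j +
        solidCauchy (fun ζ => (Matrix.of (F ζ) * W ζ) i j) (y * Complex.I) := by
      conv_lhs => rw [← hF]
      rfl
    have e' : (Matrix.of (F ((y : ℂ) * Complex.I)) - 1 : Matrix (Fin 2) (Fin 2) ℂ) i j =
        solidCauchy (fun ζ => (Matrix.of (F ζ) * W ζ) i j) (y * Complex.I) := by
      rw [Matrix.sub_apply, Matrix.of_apply, e, add_sub_cancel_left]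
    exact congrArg _ e'.symm
  · rw [coeffOne, Matrix.of_apply, norm_mul, norm_div, norm_one, Complex.norm_real,
      Real.norm_of_nonneg Real.pi_pos.le]
    have h1 : ‖∫ z, (Matrix.of (F z) * W z) i j‖ ≤ 4 * ∫ z, h z := by
      refine (norm_integral_le_integral_norm _).trans ((hK i j).2.2.trans (le_of_eq ?_))
      ring
    refine (mul_le_of_le_one_left (norm_nonneg _) ?_).trans h1
    rw [div_le_one Real.pi_pos]
    linarith [Real.pi_gt_three]

end IsSmallCoefficient

end FixedPoint

/-! ### The coefficient W⁽³⁾. -/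

section Coefficient

variable {D : ScatteringData} {χ : ℂ → ℝ} {α γ x t d L : ℝ}
  {M : ℂ → Matrix (Fin 2) (Fin 2) ℂ}

lemma ae_notMem_contour_union (D : ScatteringData) (z₀ : ℝ) :
    ∀ᵐ z : ℂ, z ∈ (contour z₀ ∪ D.discrete)ᶜ :=
  measure_eq_zero_iff_ae_notMem.1
    (measure_union_null (volume_contour z₀) ((discrete_finite D).measure_zero _))

lemma measurable_dbar (f : ℂ → ℂ) : Measurable (dbar f) := by
  unfold dbar
  have h1 := measurable_fderiv_apply_const ℝ f 1
  have h2 := measurable_fderiv_apply_const ℝ f Complex.I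
  fun_prop

/-- The adjugate formula also holds for singular matrices, since both inverses are then zero by
convention; no invertibility is needed. -/
lemma aemeasurable_inv_entry {F : ℂ → Matrix (Fin 2) (Fin 2) ℂ}
    (hF : ∀ i j, AEMeasurable (fun z => F z i j) volume) (i j : Fin 2) :
    AEMeasurable (fun z => (F z)⁻¹ i j) volume := by
  have hdet : AEMeasurable (fun z => (F z 0 0 * F z 1 1 - F z 0 1 * F z 1 0)⁻¹) volume :=
    (((hF 0 0).mul (hF 1 1)).sub ((hF 0 1).mul (hF 1 0))).inv
  have h : ∀ z, (F z)⁻¹ = (F z 0 0 * F z 1 1 - F z 0 1 * F z 1 0)⁻¹ •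
      !![F z 1 1, -F z 0 1; -F z 1 0, F z 0 0] := fun z => by
    rw [Matrix.inv_def, Ring.inverse_eq_inv', Matrix.det_fin_two, Matrix.adjugate_fin_two]
  simp only [h, Matrix.smul_apply, smul_eq_mul]
  refine hdet.mul ?_
  fin_cases i <;> fin_cases j
  · exact hF 1 1
  · exact (hF 0 1).neg
  · exact (hF 1 0).neg
  · exact hF 0 0

lemma IsModelSolution.aestronglyMeasurable (hM : IsModelSolution D χ α γ x t M) (i j : Fin 2) :
    AEStronglyMeasurable (fun z => M z i j) volume := by
  have hO := isOpen_compl_contour_union D (phasePoint α x t)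
  have h := (hM.analytic i j).continuousOn.aestronglyMeasurable (μ := volume) hO.measurableSet
  rwa [Measure.restrict_eq_self_of_ae_mem (ae_notMem_contour_union D _)] at h

lemma IsModelSolution.aestronglyMeasurable_Wthree (hM : IsModelSolution D χ α γ x t M) (i j : Fin 2) :
    AEStronglyMeasurable (fun z => Wthree D χ α γ x t M z i j) volume := by
  refine aestronglyMeasurable_mul_entry (fun i j => aestronglyMeasurable_mul_entry
    hM.aestronglyMeasurable (fun i j => (measurable_dbar _).aestronglyMeasurable) i j) (fun i j => ?_) i j
  exact (aemeasurable_inv_entry (fun i j => (hM.aestronglyMeasurable i j).aemeasurable)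
    i j).aestronglyMeasurable

/-- The coefficient of the pure `∂̄`-problem is bounded by the majorant of `∂̄R⁽²⁾`. -/
lemma CutoffGeometry.norm_Wthree_le (hG : CutoffGeometry D χ d L) {C : ℝ} {h : ℂ → ℝ}
    (h0 : ∀ z, 0 ≤ h z)
    (hM : ∀ z ∈ offPoles D (phasePoint α x t) d,
      (∀ i j, ‖M z i j‖ ≤ C) ∧ ∀ i j, ‖(M z)⁻¹ i j‖ ≤ C)
    (hR : ∀ᵐ z, ∀ i j, ‖dbarRtwo D χ α γ x t z i j‖ ≤ h z) :
    ∀ᵐ z, ∀ i j, ‖Wthree D χ α γ x t M z i j‖ ≤ 4 * C ^ 2 * h z := by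
  filter_upwards [hR, ae_notMem_contour_union D (phasePoint α x t)] with z hz hzS i j
  by_cases hnear : ∃ w ∈ D.discrete, dist z w < d
  · obtain ⟨w, hw, hzw⟩ := hnear
    have hR0 : dbarRtwo D χ α γ x t z = 0 := by
      ext i j; exact hG.dbarRtwo_eq_zero hw hzw i j
    rw [Wthree, hR0, Matrix.mul_zero, Matrix.zero_mul, Matrix.zero_apply, norm_zero]
    exact mul_nonneg (by positivity) (h0 z)
  · push Not at hnear
    obtain ⟨h1, h2⟩ := hM z ⟨fun h => hzS (Or.inl h), hnear⟩
    refine (norm_mul_entry_le (norm_mul_entry_le h1 hz) h2 i j).trans (le_of_eq ?_)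
    ring

lemma dbarMajorant_eq_zero {k : ℝ → ℝ} {C z₀ : ℝ} {z : ℂ} (h : |z.re - z₀| ≤ |z.im|) :
    dbarMajorant k C t z₀ z = 0 :=
  indicator_of_notMem (fun h' => absurd h'.2 (not_lt.2 h)) _

/-- For large times the pure `∂̄`-problem has a small coefficient. -/
theorem IsCutoff.exists_isSmallCoefficient (hχ : IsCutoff D χ) :
    ∃ c t₀ : ℝ, 0 < t₀ ∧ ∀ α γ t x : ℝ, t₀ ≤ t → ∀ M, IsModelSolution D χ α γ x t M →
      ∃ (h : ℂ → ℝ) (B : ℝ), IsSmallCoefficient (Wthree D χ α γ x t M) h B (phasePoint α x t) ∧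
        ∫ z, h z ≤ c * t ^ (-(3 / 4) : ℝ) := by
  obtain ⟨C, t₁, d, L, hG, hC0, ht₁, hC⟩ := exists_uniform_bound hχ
  obtain ⟨k, C', hC'0, hk0, hk, hR⟩ := hG.exists_dbarRtwo_bound
  obtain ⟨A₀, hA₀0, hA₀⟩ := exists_integral_majorant_le hk hk0 hC'0
  obtain ⟨A₁, hA₁0, hA₁⟩ := exists_integral_majorant_kernel_le hk hk0 hC'0 (p := 1) (by norm_num)
    (by norm_num)
  obtain ⟨A₂, hA₂0, hA₂⟩ := exists_integral_majorant_kernel_le hk hk0 hC'0 (p := 9 / 8) (by norm_num)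
    (by norm_num)
  set m := 4 * C ^ 2 with hm
  have hm0 : 0 ≤ m := by positivity
  -- The contraction condition is the case `p = 1`, whose bound decays like `t^(-1/4)`; together
  -- with `t₁` it determines how large `t` must be.
  have hlim : Tendsto (fun t : ℝ => m * (A₁ * t ^ (-(1 / 4) : ℝ))) atTop (𝓝 0) := by
    have := ((tendsto_rpow_neg_atTop (by norm_num : (0 : ℝ) < 1 / 4)).const_mul A₁).const_mul m
    simpa using this
  obtain ⟨t₂, ht₂⟩ := eventually_atTop.1 (hlim.eventually_le_const (by norm_num : (0 : ℝ) < 1 / 4))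
  refine ⟨m * A₀, max t₁ t₂, lt_max_of_lt_left ht₁, fun α γ t x ht M hM => ?_⟩
  have htpos : 0 < t := ht₁.trans_le ((le_max_left _ _).trans ht)
  set z₀ := phasePoint α x t with hz₀
  set h : ℂ → ℝ := dbarMajorant k C' t z₀ with hh
  have h0 : ∀ z, 0 ≤ h z := dbarMajorant_nonneg hk0 hC'0
  obtain ⟨i0, j0⟩ := hA₀ t z₀ htpos
  have i1 := fun z => (hA₁ t z₀ htpos z).1
  have j1 := fun z => (hA₁ t z₀ htpos z).2
  simp only [Real.rpow_neg_one] at i1 j1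
  refine ⟨fun z => m * h z, m * (A₂ * t ^ ((9 / 8 - 3 / 2) / 2 : ℝ)),
    ⟨hM.aestronglyMeasurable_Wthree, hG.norm_Wthree_le h0
      (hC α γ t x ((le_max_left _ _).trans ht) M hM) (hR α γ x t),
      i0.const_mul m, fun z => ?_, fun z => ?_, fun z => ?_, fun z => ?_, fun z hz => ?_⟩, ?_⟩
  · simpa only [mul_assoc] using (i1 z).const_mul m
  · simp only [mul_assoc]
    rw [integral_const_mul]
    refine (mul_le_mul_of_nonneg_left (j1 z) hm0).trans ?_
    have := ht₂ t ((le_max_right _ _).trans ht)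
    rwa [show ((1 : ℝ) - 3 / 2) / 2 = -(1 / 4) by norm_num]
  · simpa only [mul_assoc] using (hA₂ t z₀ htpos z).1.const_mul m
  · simp only [mul_assoc]
    rw [integral_const_mul]
    exact mul_le_mul_of_nonneg_left (hA₂ t z₀ htpos z).2 hm0
  · rw [hh, dbarMajorant_eq_zero hz, mul_zero]
  · rw [integral_const_mul, mul_assoc m]
    exact mul_le_mul_of_nonneg_left j0 hm0

end Coefficient

end CGNLS

/-! ### Conclusion. -/

theorem mainTheorem4 (D : CGNLS.ScatteringData) (χ : ℂ → ℝ) (hχ : CGNLS.IsCutoff D χ)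
    (α γ : ℝ) :
    ∃ c t₀ : ℝ, 0 < t₀ ∧ ∀ t : ℝ, t₀ ≤ t → ∀ x : ℝ,
      ∀ Mrhp : ℂ → Matrix (Fin 2) (Fin 2) ℂ, CGNLS.IsModelSolution D χ α γ x t Mrhp →
        ∃ M3 : ℂ → Matrix (Fin 2) (Fin 2) ℂ,
          CGNLS.IsPureDbarSolution (CGNLS.Wthree D χ α γ x t Mrhp) M3 ∧
          (∀ M' : ℂ → Matrix (Fin 2) (Fin 2) ℂ,
            CGNLS.IsPureDbarSolution (CGNLS.Wthree D χ α γ x t Mrhp) M' → M' = M3) ∧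
          (∀ i j, MeasureTheory.Integrable
            (fun z => (M3 z * CGNLS.Wthree D χ α γ x t Mrhp z) i j) MeasureTheory.volume) ∧
          (∀ i j, Filter.Tendsto
            (fun y : ℝ => (y * Complex.I) * (M3 (y * Complex.I) - 1) i j) (Filter.cocompact ℝ)
            (nhds (CGNLS.coeffOne (CGNLS.Wthree D χ α γ x t Mrhp) M3 i j))) ∧
          ∀ i j, ‖CGNLS.coeffOne (CGNLS.Wthree D χ α γ x t Mrhp) M3 i j‖
            ≤ c * t ^ (-(3 / 4) : ℝ) := by
  obtain ⟨c, t₀, ht₀, h⟩ := hχ.exists_isSmallCoefficient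
  refine ⟨4 * c, t₀, ht₀, fun t ht x M hM => ?_⟩
  obtain ⟨g, B, hW, hg⟩ := h α γ t x ht M hM
  obtain ⟨M3, h1, h2, h3, h4, h5⟩ := hW.exists_solution
  refine ⟨M3, h1, h2, h3, h4, fun i j => (h5 i j).trans ?_⟩
  rw [mul_assoc]
  exact mul_le_mul_of_nonneg_left hg (by norm_num)
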